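/- **Setting.** A *problem on trees* has as inputs rooted trees $T$ with $n$ vertices, each vertex carrying at most $\mathrm{polylog}(n)$ words of $O(\log n)$ bits; it specifies which strings are solutions for $T$. A *binary extension* of $T$ is a binary tree $T^b$ obtained from $T$ by adding auxiliary vertices (without data) so that the ancestor relation among the vertices of $T$ is preserved (and reflected). A *dynamic program* $\mathcal D$ computes the dynamic data $\mathcal D(v)$ of each vertex $v$ of a binary tree from the data of $v$ and the dynamic data of its children. It is *binary adapted* to a problem $P$ if for every input $T$ of $P$ and every binary extension $T^b$ of $T$ the dynamic data of the root of $T^b$ is a solution for $T$. $P$ is $(\mathrm{polylog})$*-expressible* if it has a binary adapted dynamic program $\mathcal D$ and deterministic word-RAM algorithms $\mathcal C$ (compressor) and $\mathcal M$ (merger), such that for some constant $k\ge 2$, for all binary extensions $T^b$ of inputs of $P$ (with $N$ vertices) the following holds. (1) All dynamic data have $\mathrm{polylog}(N)$ words of $O(\log N)$ bits. (2) Let $X$ be a connected part of $T^b$ with root $v$, in which at most $k$ leaves $u_1,\dots,u_j$ are *unknown* (everything below $u_i$ is cut off, and $\mathcal D(u_i)$ is not known), while all other vertices come with all their children. From $X$,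 $\mathcal C$ computes partial data $\mathcal C(X)$ of $\mathrm{polylog}(N)$ words of $O(\log N)$ bits in time polynomial in $|X|$ and $\log N$, and from $\mathcal C(X),\mathcal D(u_1),\dots,\mathcal D(u_j)$, $\mathcal M$ computes $\mathcal D(v)$ in time $\mathrm{polylog}(N)$. (3) If $Y$ is another such part, whose root is an unknown leaf of $X$, and $X\cup Y$ also has at most $k$ unknown leaves, then $\mathcal M$ computes $\mathcal C(X\cup Y)$ from $\mathcal C(X)$, $\mathcal C(Y)$ and the position of that leaf, in time $\mathrm{polylog}(N)$. (The algorithms have to work for every word length that is at least a suitable constant times $\log N$.) **Model (MPC).** $M$ machines, each a randomized word RAM with words of $O(\log n)$ bits, work in synchronous rounds. In a round every machine runs the program on its memory (which includes the words it received), and then the machines exchange messages. All machines run the same program, and know $n$, $M$ and their own index. Initially the vertices of $T$ (each with its index, the index of its parent, and its data) are placed arbitrarily on the machines, $\tilde O(n/M)$ vertices on each. As usual, $M\le\tilde O(n/M)$ is assumed: a machine has enough memory to store the names of all machines. ($\tilde O$ hides factors polylogarithmic in $n$.) **Theorem.** Let $P$ be a $(\mathrm{polylog})$-expressible problem, let $c\in\mathbb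 N$, and fix the constants hidden in the two $\tilde O(n/M)$ bounds of the model. There is a randomized MPC algorithm that, for every number $M$ of machines and every input tree $T$ of $P$ with $n$ vertices as above, leaves a solution for $T$ on the first machine after $O(\log n+1)$ rounds, and such that with probability at least $1-n^{-c}$, in every round, every machine uses space (memory, messages sent and messages received included) at most $\tilde O(n/M)$ words and runs for a time that is at most linear in the size of its input in this round (the content of its memory at the start of the round, with the received messages). The algorithm and all hidden constants depend only on $P$, on $c$ and on the fixed constants, not on $n$, $M$, $T$ or the placement of the vertices. -/

import Mathlib

open MeasureTheory
open scoped ENNReal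

noncomputable section

namespace MPC

/-! ## Rooted trees with data at the vertices, and binary extensions -/

/-- A rooted tree with vertices `0, …, n - 1`. Every vertex stores its parent (the root stores
itself) and a list of words of data. -/
structure DataTree (n : ℕ) where
  root : Fin n
  parent : Fin n → Fin n
  parent_root : parent root = root
  reaches_root : ∀ v, ∃ k, parent^[k] v = root
  data : Fin n → List ℕ

/-- `u` is an ancestor of `v` (every vertex is an ancestor of itself). -/
def DataTree.IsAncestor {n : ℕ} (T : DataTree n) (u v : Fin n) : Prop :=
  ∃ k, T.parent^[k] v = u

/-- Binary trees; `nil` stands for an absent child. An original vertex has data `some d`, an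
auxiliary vertex has data `none`. -/
inductive BTree : Type
  | nil : BTree
  | node (d : Option (List ℕ)) (l r : BTree) : BTree

namespace BTree

/-- The number of vertices. -/
def size : BTree → ℕ
  | nil => 0
  | node _ l r => l.size + r.size + 1

/-- A vertex is addressed by the left/right turns on the way to it from the root;
`label t p = none` if there is no vertex with address `p`, and `some d` if it has data `d`. -/
def label : BTree → List Bool → Option (Option (List ℕ))
  | nil, _ => none
  | node d _ _, [] => some d
  | node _ l _, false :: p => l.label p
  | node _ _ r, true :: p => r.label p

/-- `IsSubtree s t`: `s` consists of a vertex of `t` with all its descendants (or is empty). -/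
inductive IsSubtree : BTree → BTree → Prop
  | refl (t : BTree) : IsSubtree t t
  | left {s l : BTree} (d : Option (List ℕ)) (r : BTree) :
      IsSubtree s l → IsSubtree s (node d l r)
  | right {s r : BTree} (d : Option (List ℕ)) (l : BTree) :
      IsSubtree s r → IsSubtree s (node d l r)

end BTree

/-- `B` is a binary extension of `T`: it is obtained by adding auxiliary vertices (without data)
in such a way that the ancestor relation between the vertices of `T` is kept. A vertex of `B` is
an ancestor of another one iff its address is a prefix of the address of the other one. -/
def IsBinaryExtension {n : ℕ} (T : DataTree n) (B : BTree) : Prop :=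
  ∃ φ : Fin n → List Bool,
    Function.Injective φ ∧
    (∀ v, B.label (φ v) = some (some (T.data v))) ∧
    (∀ p, p ∉ Set.range φ → B.label p = none ∨ B.label p = some none) ∧
    ∀ u v, φ u <+: φ v ↔ T.IsAncestor u v

/-- Connected parts of a binary tree. `hole d` is an unknown leaf of the part: a vertex with
data `d`, with all its descendants in the whole tree cut off, whose dynamic data is unknown. -/
inductive Part : Type
  | nil : Part
  | hole (d : Option (List ℕ)) : Part
  | node (d : Option (List ℕ)) (l r : Part) : Part

namespace Part

/-- The number of vertices, including the unknown leaves. -/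
def size : Part → ℕ
  | nil => 0
  | hole _ => 1
  | node _ l r => l.size + r.size + 1

/-- The number of unknown leaves. They are numbered from the left to the right, from `0`. -/
def holes : Part → ℕ
  | nil => 0
  | hole _ => 1
  | node _ l r => l.holes + r.holes

/-- The part is nonempty and its root is not an unknown leaf. -/
def IsNode : Part → Prop
  | node _ _ _ => True
  | _ => False

/-- The union of `X` and of a part `Y` whose root is the unknown leaf number `i` of `X`. -/
def plug : Part → ℕ → Part → Part
  | nil, _, _ => nil
  | hole _, _, Y => Y
  | node d l r, i, Y =>
      if i < l.holes then node d (l.plug i Y) r else node d l (r.plug (i - l.holes) Y)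

/-- `Fills X hs S`: the part `X` occurs in the binary tree `S` at its root, and `hs` lists the
subtrees of `S` that hang at the unknown leaves of `X`, from the left to the right. -/
inductive Fills : Part → List BTree → BTree → Prop
  | nil : Fills Part.nil [] BTree.nil
  | hole (d : Option (List ℕ)) (l r : BTree) :
      Fills (Part.hole d) [BTree.node d l r] (BTree.node d l r)
  | node (d : Option (List ℕ)) {X Y : Part} {hs ks : List BTree} {l r : BTree} :
      Fills X hs l → Fills Y ks r → Fills (Part.node d X Y) (hs ++ ks) (BTree.node d l r)

/-- A vertex label as a string of words. -/
def encodeData : Option (List ℕ) → List ℕ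
  | none => [0]
  | some x => 1 :: x.length :: x

/-- A part as a string of words, in preorder. -/
def encode : Part → List ℕ
  | nil => [0]
  | hole d => 1 :: encodeData d
  | node d l r => 2 :: (encodeData d ++ l.encode ++ r.encode)

end Part

/-! ## Word RAM with unit cost -/

/-- The arithmetic operations on words. -/
inductive Op : Type
  | add | sub | mul | div | mod | lt | eq

/-- Their values (before reduction to a word). -/
def Op.eval : Op → ℕ → ℕ → ℕ
  | add, x, y => x + y
  | sub, x, y => x - y
  | mul, x, y => x * y
  | div, x, y => x / y
  | mod, x, y => x % y
  | lt, x, y => if x < y then 1 else 0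
  | eq, x, y => if x = y then 1 else 0

/-- The memory of a machine: registers that hold one word each, growing arrays of words, the
random words that are still to be read, and the messages `(recipient, word)` written in the
present round. -/
structure Mem where
  reg : ℕ → ℕ
  arr : ℕ → List ℕ
  tape : ℕ → ℕ
  out : List (ℕ × ℕ)

/-- The number of words in memory, for a program with registers and arrays `0, …, K - 1`. -/
def Mem.size (K : ℕ) (σ : Mem) : ℕ :=
  K + ∑ a ∈ Finset.range K, (σ.arr a).length + 2 * σ.out.length

/-- The instructions. Array positions, recipients and operands are read from registers. -/
inductive Instr : Type
  | const (r c : ℕ)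
  | arith (o : Op) (r x y : ℕ)
  | length (r a : ℕ)
  | get (r a i : ℕ)
  | set (a i r : ℕ)
  | push (a r : ℕ)
  | pop (a : ℕ)
  | clear (a : ℕ)
  | rand (r : ℕ)
  | send (d r : ℕ)

namespace Instr

/-- The effect of an instruction on a machine whose words are the numbers below `W`. -/
def run (W : ℕ) : Instr → Mem → Mem
  | const r c, σ => { σ with reg := Function.update σ.reg r (c % W) }
  | arith o r x y, σ =>
      { σ with reg := Function.update σ.reg r (o.eval (σ.reg x) (σ.reg y) % W) }
  | length r a, σ => { σ with reg := Function.update σ.reg r ((σ.arr a).length % W) }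
  | get r a i, σ => { σ with reg := Function.update σ.reg r ((σ.arr a).getD (σ.reg i) 0) }
  | set a i r, σ =>
      { σ with arr := Function.update σ.arr a ((σ.arr a).set (σ.reg i) (σ.reg r)) }
  | push a r, σ => { σ with arr := Function.update σ.arr a (σ.arr a ++ [σ.reg r]) }
  | pop a, σ => { σ with arr := Function.update σ.arr a (σ.arr a).dropLast }
  | clear a, σ => { σ with arr := Function.update σ.arr a [] }
  | rand r, σ =>
      { σ with reg := Function.update σ.reg r (σ.tape 0), tape := fun i => σ.tape (i + 1) }
  | send d r, σ => { σ with out := σ.out ++ [(σ.reg d, σ.reg r)] }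

/-- A number above all register and array numbers of the instruction. -/
def bound : Instr → ℕ
  | const r _ => r + 1
  | arith _ r x y => max r (max x y) + 1
  | length r a => max r a + 1
  | get r a i => max r (max a i) + 1
  | set a i r => max r (max a i) + 1
  | push a r => max r a + 1
  | pop a => a + 1
  | clear a => a + 1
  | rand r => r + 1
  | send d r => max d r + 1

/-- The instruction neither reads random words nor sends messages. -/
def IsSequential : Instr → Prop
  | rand _ => False
  | send _ _ => False
  | _ => True

end Instr

/-- Programs: instructions, composition, branching and loops (a register is true if it is not
`0`). -/
inductive Prog : Type
  | instr (i : Instr)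
  | comp (p q : Prog)
  | branch (r : ℕ) (p q : Prog)
  | loop (r : ℕ) (p : Prog)

namespace Prog

/-- A number above all register and array numbers of the program. -/
def bound : Prog → ℕ
  | instr i => i.bound
  | comp p q => max p.bound q.bound
  | branch r p q => max (r + 1) (max p.bound q.bound)
  | loop r p => max (r + 1) p.bound

/-- The program is an ordinary deterministic sequential program. -/
def IsSequential : Prog → Prop
  | instr i => i.IsSequential
  | comp p q => p.IsSequential ∧ q.IsSequential
  | branch _ p q => p.IsSequential ∧ q.IsSequential
  | loop _ p => p.IsSequential

end Prog

/-- `Exec W K p σ σ' t s`: on words below `W`, the program `p` started with memory `σ` stops with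
memory `σ'` after `t` steps, and the largest size of the memory on the way is `s`. -/
inductive Exec (W K : ℕ) : Prog → Mem → Mem → ℕ → ℕ → Prop
  | instr (i : Instr) (σ : Mem) :
      Exec W K (.instr i) σ (i.run W σ) 1 (max (σ.size K) ((i.run W σ).size K))
  | comp {p q : Prog} {σ σ₁ σ₂ : Mem} {t t' s s' : ℕ} :
      Exec W K p σ σ₁ t s → Exec W K q σ₁ σ₂ t' s' →
      Exec W K (.comp p q) σ σ₂ (t + t') (max s s')
  | branch_true {r : ℕ} {p : Prog} (q : Prog) {σ σ' : Mem} {t s : ℕ} :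
      σ.reg r ≠ 0 → Exec W K p σ σ' t s → Exec W K (.branch r p q) σ σ' (t + 1) s
  | branch_false {r : ℕ} (p : Prog) {q : Prog} {σ σ' : Mem} {t s : ℕ} :
      σ.reg r = 0 → Exec W K q σ σ' t s → Exec W K (.branch r p q) σ σ' (t + 1) s
  | loop_stop {r : ℕ} (p : Prog) {σ : Mem} :
      σ.reg r = 0 → Exec W K (.loop r p) σ σ 1 (σ.size K)
  | loop_step {r : ℕ} {p : Prog} {σ σ₁ σ₂ : Mem} {t t' s s' : ℕ} :
      σ.reg r ≠ 0 → Exec W K p σ σ₁ t s → Exec W K (.loop r p) σ₁ σ₂ t' s' →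
      Exec W K (.loop r p) σ σ₂ (t + t' + 1) (max s s')

/-- `p` computes, on words below `W` and in at most `t` steps, the string `y` from the strings
`xs`, which are given in the arrays `0, 1, …`; the result is left in the array `0`. -/
def Prog.Computes (p : Prog) (W : ℕ) (xs : List (List ℕ)) (y : List ℕ) (t : ℕ) : Prop :=
  ∃ (σ : Mem) (t' s : ℕ),
    Exec W p.bound p
      { reg := fun _ => 0, arr := fun a => xs.getD a [], tape := fun _ => 0, out := [] }
      σ t' s ∧
    σ.arr 0 = y ∧ t' ≤ t

/-! ## Problems on trees and expressibility -/

/-- Logarithm of an input size; it is at least `1`. -/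
def lg (n : ℕ) : ℕ := Nat.log 2 n + 1

/-- The string `x` consists of at most `ℓ` words of `b` bits each. -/
def Fits (ℓ b : ℕ) (x : List ℕ) : Prop := x.length ≤ ℓ ∧ ∀ a ∈ x, a < 2 ^ b

/-- A problem on trees: which trees are inputs, and which strings are solutions for an input.
Every vertex of an input with `n` vertices has data of size polylogarithmic in `n`. -/
structure TreeProblem where
  IsInput : {n : ℕ} → DataTree n → Prop
  IsSolution : {n : ℕ} → DataTree n → List ℕ → Prop
  data_bound : ∃ A : ℕ, ∀ (n : ℕ) (T : DataTree n), IsInput T →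
    ∀ v, Fits (A * lg n ^ A) (A * lg n) (T.data v)

/-- A dynamic program on binary trees: the dynamic data of a vertex is computed from its data and
from the dynamic data of its (at most two) children. -/
structure DynProg where
  step : Option (List ℕ) → Option (List ℕ) → Option (List ℕ) → List ℕ

/-- The dynamic data of the root of a binary tree (`none` for the empty tree). -/
def DynProg.value? (D : DynProg) : BTree → Option (List ℕ)
  | .nil => none
  | .node d l r => some (D.step d (D.value? l) (D.value? r))

/-- The dynamic data of the root of a nonempty binary tree. -/
def DynProg.value (D : DynProg) (S : BTree) : List ℕ := (D.value? S).getD []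

/-- `D` is a binary adapted dynamic program for `P`: on any binary extension of any input, the
result (the dynamic data of the root) is a solution. -/
def DynProg.IsBinaryAdapted (D : DynProg) (P : TreeProblem) : Prop :=
  ∀ (n : ℕ) (T : DataTree n) (B : BTree), P.IsInput T → IsBinaryExtension T B →
    P.IsSolution T (D.value B)

/-- The problem `P` is `f`-expressible. Here `A` is the constant in the bounds, `k ≥ 2` is the
constant number of unknown leaves, `C` is the compression (computed by the program `pC`), and the
program `pM` is the merger. The first array given to the merger tells which of its two tasks it
has to do: `[0]` to evaluate, and `[1, i]` to join two parts at the unknown leaf `i` of the upper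
one. The programs have to work for every sufficiently large word length `w`. The compressor has
to read the whole part, and is therefore allowed a time polynomial in the size of the part,
too. -/
def IsExpressible (f : ℕ → ℕ) (P : TreeProblem) : Prop :=
  ∃ (D : DynProg) (C : Part → List ℕ) (pC pM : Prog) (A k : ℕ),
    2 ≤ k ∧ pC.IsSequential ∧ pM.IsSequential ∧ D.IsBinaryAdapted P ∧
    ∀ (n : ℕ) (T : DataTree n) (B : BTree), P.IsInput T → IsBinaryExtension T B →
      (∀ S : BTree, S.IsSubtree B → S ≠ .nil →
        Fits (A * f S.size * lg B.size ^ A) (A * lg B.size) (D.value S)) ∧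
      (∀ (S : BTree) (X : Part) (hs : List BTree),
        S.IsSubtree B → X.IsNode → X.holes ≤ k → X.Fills hs S →
          Fits (A * f X.size * lg B.size ^ A) (A * lg B.size) (C X) ∧
          ∀ w : ℕ, A * lg B.size ≤ w →
            pC.Computes (2 ^ w) [X.encode] (C X)
              (A * (X.size * f X.size * lg B.size) ^ A) ∧
            pM.Computes (2 ^ w) ([0] :: C X :: hs.map D.value) (D.value S)
              (A * (f X.size * lg B.size) ^ A)) ∧
      (∀ (S U : BTree) (X Y : Part) (hs ks : List BTree) (i : ℕ),
        S.IsSubtree B → X.IsNode → X.Fills hs S → hs[i]? = some U → Y.IsNode → Y.Fills ks U →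
        X.holes ≤ k → Y.holes ≤ k → (X.plug i Y).holes ≤ k →
          ∀ w : ℕ, A * lg B.size ≤ w →
            pM.Computes (2 ^ w) [[1, i], C X, C Y] (C (X.plug i Y))
              (A * (f (X.plug i Y).size * lg B.size) ^ A))

/-- `P` is `f`-expressible for some polylogarithmic function `f`. -/
def IsPolylogExpressible (P : TreeProblem) : Prop :=
  ∃ a : ℕ, IsExpressible (fun x => lg x ^ a) P

/-! ## Massively parallel computation -/

/-- The input of machine `j` when the vertices are placed on the machines by `loc`: for each
vertex its index, the index of its parent, and its data. -/
def localInput {n m : ℕ} (T : DataTree n) (loc : Fin n → Fin m) (j : Fin m) : List ℕ :=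
  ((List.finRange n).filter fun v => loc v = j).flatMap fun v : Fin n =>
    (v : ℕ) :: (T.parent v : ℕ) :: (T.data v).length :: T.data v

/-- The random words of the machines: `ω (j, i)` is the `i`-th random word of machine `j`. -/
abbrev Coins (m W : ℕ) : Type := Fin m × ℕ → Fin W

/-- The random words are independent and uniformly distributed. -/
def coinMeasure (m W : ℕ) [NeZero W] : Measure (Coins m W) :=
  Measure.infinitePi fun _ => (PMF.uniformOfFintype (Fin W)).toMeasure

/-- The initial memories. The local input is in the array `0`, and the registers `0`, `1`, `2`
hold the index of the machine, the number of machines and the number of vertices. -/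
def initial {n m W : ℕ} (T : DataTree n) (loc : Fin n → Fin m) (ω : Coins m W) (j : Fin m) :
    Mem where
  reg r := if r = 0 then (j : ℕ) else if r = 1 then m else if r = 2 then n else 0
  arr a := if a = 0 then localInput T loc j else []
  tape i := (ω (j, i) : ℕ)
  out := []

/-- The memory of machine `j` after the communication that follows the local computations: the
received words are in the array `0`, in the order of the senders; the rest of the memory is
kept. -/
def deliver {m : ℕ} (c : Fin m → Mem) (j : Fin m) : Mem :=
  { c j with
    arr := Function.update (c j).arr 0
      ((List.finRange m).flatMap fun i =>
        ((c i).out.filter fun x => x.1 = (j : ℕ)).map Prod.snd)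
    out := [] }

/-- One round of the algorithm `p`, from the memories `c` to the memories `c'`: every machine runs
`p` on its memory, and then the messages are delivered. `t j` is the running time of machine `j`,
and `s j` is its space: the largest size of its memory, also after the communication. -/
def IsRound {m : ℕ} (W : ℕ) (p : Prog) (c c' : Fin m → Mem) (t s : Fin m → ℕ) : Prop :=
  ∃ (mid : Fin m → Mem) (s' : Fin m → ℕ),
    (∀ j, Exec W p.bound p (c j) (mid j) (t j) (s' j)) ∧
    c' = deliver mid ∧
    ∀ j, s j = max (s' j) ((c' j).size p.bound)

/-- A computation: the memories before each round (and after the last one), and the running times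
and the space in each round. -/
structure Trace (m : ℕ) where
  mem : ℕ → Fin m → Mem
  time : ℕ → Fin m → ℕ
  space : ℕ → Fin m → ℕ

/-- `τ` is the computation of `p` in `R` rounds with the random words `ω`. -/
def Trace.IsRun {n m W : ℕ} (τ : Trace m) (p : Prog) (T : DataTree n) (loc : Fin n → Fin m)
    (ω : Coins m W) (R : ℕ) : Prop :=
  τ.mem 0 = initial T loc ω ∧
  ∀ r < R, IsRound W p (τ.mem r) (τ.mem (r + 1)) (τ.time r) (τ.space r)

end MPC

end

open MeasureTheory
open scoped ENNReal

set_option linter.constructorNameAsVariable false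

noncomputable section

namespace MPC

open Finset (range mem_range sum_range_succ)
open Function (update update_of_ne update_apply iterate_succ_apply' update_self)
open List (mem_singleton mem_cons not_mem_nil mem_append getD_eq_getElem getD_eq_getElem?_getD
  map_cons length_nil length_append mem_flatMap flatMap_cons take_of_length_le mem_of_getElem
  mem_of_getElem? sum_cons mem_map length_cons append_nil take_add_one length_map getD_cons_succ
  flatMap_nil countP_append append_assoc)

open Instr (run)

/-! ## Sequential programs: running time, memory and relocation -/

lemma sum_length_update (K a : ℕ) (g : ℕ → List ℕ) (l : List ℕ) (d : ℕ)
    (h : l.length ≤ (g a).length + d) :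
    ∑ b ∈ range K, (update g a l b).length ≤ ∑ b ∈ range K, (g b).length + d := by
  by_cases ha : a ∈ range K
  · rw [← Finset.add_sum_erase _ _ ha, ← Finset.add_sum_erase _ (fun b => (g b).length) ha]
    have : ∑ x ∈ (range K).erase a, (update g a l x).length
        = ∑ x ∈ (range K).erase a, (g x).length :=
      Finset.sum_congr rfl fun x hx => by rw [update_of_ne (Finset.ne_of_mem_erase hx)]
    rw [this]; simp only [update_self]; omega
  · have : ∑ b ∈ range K, (update g a l b).length = ∑ b ∈ range K, (g b).length :=
      Finset.sum_congr rfl fun x hx => by rw [update_of_ne (by rintro rfl; exact ha hx)]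
    omega

lemma Instr.size_run_le (W K : ℕ) (i : Instr) (σ : Mem) : (i.run W σ).size K ≤ σ.size K + 2 := by
  cases i <;> simp only [run, Mem.size]
  case const | arith | length | get | rand => omega
  case set a i r =>
    have := sum_length_update K a σ.arr ((σ.arr a).set (σ.reg i) (σ.reg r)) 0 (by simp); omega
  case push a r => have := sum_length_update K a σ.arr (σ.arr a ++ [σ.reg r]) 1 (by simp); omega
  case pop a => have := sum_length_update K a σ.arr (σ.arr a).dropLast 0 (by simp); omega
  case clear a => have := sum_length_update K a σ.arr [] 0 (by simp); omega
  case send d r => simp only [length_append, List.length_singleton]; omega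

lemma Exec.size_le {W K : ℕ} {p : Prog} {σ σ' : Mem} {t s : ℕ} (h : Exec W K p σ σ' t s) :
    s ≤ σ.size K + 2 * t ∧ σ'.size K ≤ σ.size K + 2 * t := by
  induction h with
  | instr i σ => have := i.size_run_le W K σ; omega
  | comp _ _ ih1 ih2 => omega
  | branch_true _ _ _ ih => omega
  | branch_false _ _ _ ih => omega
  | loop_stop => omega
  | loop_step _ _ _ ih1 ih2 => omega

def Instr.shift (R A : ℕ) : Instr → Instr
  | const r c => const (R + r) c
  | arith o r x y => arith o (R + r) (R + x) (R + y)
  | length r a => length (R + r) (A + a)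
  | get r a i => get (R + r) (A + a) (R + i)
  | set a i r => set (A + a) (R + i) (R + r)
  | push a r => push (A + a) (R + r)
  | pop a => pop (A + a)
  | clear a => clear (A + a)
  | rand r => rand (R + r)
  | send d r => send (R + d) (R + r)

def Prog.shift (R A : ℕ) : Prog → Prog
  | instr i => instr (i.shift R A)
  | comp p q => comp (p.shift R A) (q.shift R A)
  | branch r p q => branch (R + r) (p.shift R A) (q.shift R A)
  | loop r p => loop (R + r) (p.shift R A)

def Relocated (R A N : ℕ) (σ τ : Mem) : Prop :=
  (∀ r < N, τ.reg (R + r) = σ.reg r) ∧ ∀ a < N, τ.arr (A + a) = σ.arr a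

def AgreeBelow (R A : ℕ) (τ τ' : Mem) : Prop :=
  (∀ r < R, τ'.reg r = τ.reg r) ∧ (∀ a < A, τ'.arr a = τ.arr a) ∧ τ'.out = τ.out

lemma AgreeBelow.trans {R A : ℕ} {τ τ' τ'' : Mem} (h : AgreeBelow R A τ τ')
    (h' : AgreeBelow R A τ' τ'') : AgreeBelow R A τ τ'' :=
  ⟨fun r hr => (h'.1 r hr).trans (h.1 r hr), fun r hr => (h'.2.1 r hr).trans (h.2.1 r hr),
    h'.2.2.trans h.2.2⟩

lemma Instr.run_shift (W R A N : ℕ) (i : Instr) (hi : i.bound ≤ N) (hs : i.IsSequential)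
    (σ τ : Mem) (h : Relocated R A N σ τ) :
    Relocated R A N (i.run W σ) ((i.shift R A).run W τ) ∧
      AgreeBelow R A τ ((i.shift R A).run W τ) := by
  obtain ⟨h1, h2⟩ := h
  have upd : ∀ {α : Type} (f g : ℕ → α) (B r : ℕ) (v : α), (∀ x < N, g (B + x) = f x) →
      ∀ x < N, update g (B + r) v (B + x) = update f r v x := by
    intro α f g B r v hfg x hx; by_cases hxr : x = r
    · subst hxr; simp
    · rw [update_of_ne hxr, update_of_ne (by omega), hfg x hx]
  have low : ∀ {α : Type} (g : ℕ → α) (B r : ℕ) (v : α), ∀ x < B, update g (B + r) v x = g x := by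
    intro α g B r v x hx; rw [update_of_ne (by omega)]
  cases i <;> simp only [Instr.bound, Instr.IsSequential] at hi hs
  case const r c => exact ⟨⟨upd _ _ _ _ _ h1, h2⟩, low _ _ _ _, fun _ _ => rfl, rfl⟩
  case arith o r x y =>
    simp only [run, Instr.shift]; rw [h1 x (by omega), h1 y (by omega)]
    exact ⟨⟨upd _ _ _ _ _ h1, h2⟩, low _ _ _ _, fun _ _ => rfl, rfl⟩
  case length r a =>
    simp only [run, Instr.shift]; rw [h2 a (by omega)]
    exact ⟨⟨upd _ _ _ _ _ h1, h2⟩, low _ _ _ _, fun _ _ => rfl, rfl⟩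
  case get r a i =>
    simp only [run, Instr.shift]; rw [h2 a (by omega), h1 i (by omega)]
    exact ⟨⟨upd _ _ _ _ _ h1, h2⟩, low _ _ _ _, fun _ _ => rfl, rfl⟩
  case set a i r =>
    simp only [run, Instr.shift]; rw [h2 a (by omega), h1 i (by omega), h1 r (by omega)]
    exact ⟨⟨h1, upd _ _ _ _ _ h2⟩, fun _ _ => rfl, low _ _ _ _, rfl⟩
  case push a r =>
    simp only [run, Instr.shift]; rw [h2 a (by omega), h1 r (by omega)]
    exact ⟨⟨h1, upd _ _ _ _ _ h2⟩, fun _ _ => rfl, low _ _ _ _, rfl⟩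
  case pop a =>
    simp only [run, Instr.shift]; rw [h2 a (by omega)]
    exact ⟨⟨h1, upd _ _ _ _ _ h2⟩, fun _ _ => rfl, low _ _ _ _, rfl⟩
  case clear a => exact ⟨⟨h1, upd _ _ _ _ _ h2⟩, fun _ _ => rfl, low _ _ _ _, rfl⟩

lemma Exec.shift {W K R A N : ℕ} {p : Prog} {σ σ' : Mem} {t s : ℕ} (h : Exec W K p σ σ' t s)
    (hb : p.bound ≤ N) (hs : p.IsSequential) {τ : Mem} (hτ : Relocated R A N σ τ) :
    ∃ τ', (∀ K', ∃ s', Exec W K' (p.shift R A) τ τ' t s') ∧ Relocated R A N σ' τ' ∧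
      AgreeBelow R A τ τ' := by
  induction h generalizing τ with
  | instr i σ =>
    have := i.run_shift W R A N hb hs σ τ hτ; exact ⟨_, fun K' => ⟨_, .instr _ _⟩, this⟩
  | comp _ _ ih1 ih2 =>
    simp only [Prog.bound, Prog.IsSequential] at hb hs
    obtain ⟨τ1, e1, r1, a1⟩ := ih1 (by omega) hs.1 hτ
    obtain ⟨τ2, e2, r2, a2⟩ := ih2 (by omega) hs.2 r1
    refine ⟨τ2, fun K' => ?_, r2, a1.trans a2⟩; obtain ⟨s1, e1⟩ := e1 K'; obtain ⟨s2, e2⟩ := e2 K'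
    exact ⟨_, .comp e1 e2⟩
  | branch_true q hr _ ih =>
    simp only [Prog.bound, Prog.IsSequential] at hb hs
    obtain ⟨τ1, e1, r1, a1⟩ := ih (by omega) hs.1 hτ
    refine ⟨τ1, fun K' => ?_, r1, a1⟩; obtain ⟨s1, e1⟩ := e1 K'
    exact ⟨_, .branch_true _ (by rwa [hτ.1 _ (by omega)]) e1⟩
  | branch_false q hr _ ih =>
    simp only [Prog.bound, Prog.IsSequential] at hb hs
    obtain ⟨τ1, e1, r1, a1⟩ := ih (by omega) hs.2 hτ
    refine ⟨τ1, fun K' => ?_, r1, a1⟩; obtain ⟨s1, e1⟩ := e1 K'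
    exact ⟨_, .branch_false _ (by rwa [hτ.1 _ (by omega)]) e1⟩
  | loop_stop p hr =>
    simp only [Prog.bound] at hb
    exact ⟨τ, fun K' => ⟨_, Exec.loop_stop _ (by rwa [hτ.1 _ (by omega)])⟩, hτ,
      fun _ _ => rfl, fun _ _ => rfl, rfl⟩
  | loop_step hr _ _ ih1 ih2 =>
    have hb' := hb; simp only [Prog.bound] at hb; obtain ⟨τ1, e1, r1, a1⟩ := ih1 (by omega) hs hτ
    obtain ⟨τ2, e2, r2, a2⟩ := ih2 hb' hs r1; refine ⟨τ2, fun K' => ?_, r2, a1.trans a2⟩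
    obtain ⟨s1, e1⟩ := e1 K'; obtain ⟨s2, e2⟩ := e2 K'
    exact ⟨_, .loop_step (by rwa [hτ.1 _ (by omega)]) e1 e2⟩

/-! ## Total correctness with running times -/

@[ext] structure St where
  reg : ℕ → ℕ
  arr : ℕ → List ℕ
  out : List (ℕ × ℕ)

namespace St

def setR (st : St) (r v : ℕ) : St := { st with reg := update st.reg r v }
def setA (st : St) (a : ℕ) (l : List ℕ) : St := { st with arr := update st.arr a l }
def addOut (st : St) (l : List (ℕ × ℕ)) : St := { st with out := st.out ++ l }

variable (st : St) (r v a x : ℕ) (l : List ℕ) (o : List (ℕ × ℕ))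

@[simp] lemma setR_reg : (st.setR r v).reg x = if x = r then v else st.reg x := by
  simp [setR, update_apply]
@[simp] lemma setR_arr : (st.setR r v).arr = st.arr := rfl
@[simp] lemma setR_out : (st.setR r v).out = st.out := rfl
@[simp] lemma setA_arr : (st.setA a l).arr x = if x = a then l else st.arr x := by
  simp [setA, update_apply]
@[simp] lemma setA_reg : (st.setA a l).reg = st.reg := rfl
@[simp] lemma setA_out : (st.setA a l).out = st.out := rfl
@[simp] lemma addOut_reg : (st.addOut o).reg = st.reg := rfl
@[simp] lemma addOut_arr : (st.addOut o).arr = st.arr := rfl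
@[simp] lemma addOut_out : (st.addOut o).out = st.out ++ o := rfl

end St

/-- The registers below `U`, the arrays and the messages of `σ` are those of `st`. -/
def Sim (U : ℕ) (st : St) (σ : Mem) : Prop :=
  (∀ r < U, σ.reg r = st.reg r) ∧ σ.arr = st.arr ∧ σ.out = st.out

/-- Started with a memory that looks like `st`, the program `p` stops after at most `T` steps with
a memory that looks like a state with property `Q`. Registers from `U` on are not looked at. -/
def Tri (W U : ℕ) (p : Prog) (st : St) (T : ℕ) (Q : St → Prop) : Prop :=
  ∀ σ, Sim U st σ → ∃ σ' t st', t ≤ T ∧ (∀ K, ∃ s, Exec W K p σ σ' t s) ∧ Sim U st' σ' ∧ Q st'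

section Tri
variable {W U : ℕ} {st : St} {Q Q' : St → Prop} {T T' : ℕ} {p q : Prog}

lemma Tri.mono (h : Tri W U p st T Q) (hT : T ≤ T') (hQ : ∀ s, Q s → Q' s) :
    Tri W U p st T' Q' := fun σ hσ =>
  let ⟨σ', t, st', h1, h2, h3, h4⟩ := h σ hσ
  ⟨σ', t, st', h1.trans hT, h2, h3, hQ _ h4⟩

lemma Tri.le (h : Tri W U p st T Q) (hT : T ≤ T') : Tri W U p st T' Q := h.mono hT fun _ h => h

lemma Tri.comp (h : Tri W U p st T fun s => Tri W U q s T' Q) :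
    Tri W U (.comp p q) st (T + T') Q := by
  intro σ hσ; obtain ⟨σ1, t1, st1, h1, e1, s1, q1⟩ := h σ hσ
  obtain ⟨σ2, t2, st2, h2, e2, s2, q2⟩ := q1 σ1 s1
  refine ⟨σ2, t1 + t2, st2, by omega, fun K => ?_, s2, q2⟩
  obtain ⟨_, e1⟩ := e1 K; obtain ⟨_, e2⟩ := e2 K; exact ⟨_, .comp e1 e2⟩

lemma Tri.hide {V : ℕ} (hUV : U ≤ V)
    (h : ∀ ρ : ℕ → ℕ, (∀ r < U, ρ r = st.reg r) → Tri W V p { st with reg := ρ } T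
      fun s => ∃ s', (∀ r < U, s'.reg r = s.reg r) ∧ s'.arr = s.arr ∧ s'.out = s.out ∧ Q s') :
    Tri W U p st T Q := by
  intro σ hσ; obtain ⟨σ', t, st1, h1, h2, h3, s', h4, h5, h6, h7⟩ :=
    h σ.reg hσ.1 σ ⟨fun _ _ => rfl, hσ.2.1, hσ.2.2⟩
  exact ⟨σ', t, s', h1, h2, ⟨fun r hr => (h3.1 r (by omega)).trans (h4 r hr).symm,
    h3.2.1.trans h5.symm, h3.2.2.trans h6.symm⟩, h7⟩

end Tri

/-! ## Expressions -/

lemma Op.eval_lt_le_one (x y : ℕ) : Op.lt.eval x y ≤ 1 := by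
  unfold Op.eval; by_cases h : x < y <;> simp [h]

lemma Op.eval_eq_le_one (x y : ℕ) : Op.eq.eval x y ≤ 1 := by
  unfold Op.eval; by_cases h : x = y <;> simp [h]

inductive Expr : Type
  | c (k : ℕ)
  | r (i : ℕ)
  | op (o : Op) (a b : Expr)
  | len (a : ℕ)
  | get (a : ℕ) (e : Expr)

abbrev tmp : ℕ := 64

abbrev vis : ℕ := 32

namespace Expr

def eval (st : St) : Expr → ℕ
  | c k => k
  | r i => st.reg i
  | op o a b => o.eval (a.eval st) (b.eval st)
  | len a => (st.arr a).length
  | get a e => (st.arr a).getD (e.eval st) 0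

def ok (W : ℕ) (st : St) : Expr → Prop
  | c k => k < W
  | r i => st.reg i < W
  | op o a b => a.ok W st ∧ b.ok W st ∧ o.eval (a.eval st) (b.eval st) < W
  | len a => (st.arr a).length < W
  | get _ e => e.ok W st

def wf (U : ℕ) : Expr → Prop
  | c _ => True
  | r i => i < U
  | op _ a b => a.wf U ∧ b.wf U
  | len _ => True
  | get _ e => e.wf U

def comp (d : ℕ) : Expr → Prog
  | c k => .instr (.const (tmp + d) k)
  | r i => .comp (.instr (.const (tmp + d) 0)) (.instr (.arith .add (tmp + d) i (tmp + d)))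
  | op o a b => .comp (a.comp d) (.comp (b.comp (d + 1))
      (.instr (.arith o (tmp + d) (tmp + d) (tmp + (d + 1)))))
  | len a => .instr (.length (tmp + d) a)
  | get a e => .comp (e.comp d) (.instr (.get (tmp + d) a (tmp + d)))

def cost : Expr → ℕ
  | c _ => 1
  | r _ => 2
  | op _ a b => a.cost + b.cost + 1
  | len _ => 1
  | get _ e => e.cost + 1

lemma exec_comp {W U : ℕ} (hU : U ≤ tmp) {st : St} (e : Expr) (hwf : e.wf U)
    (hok : e.ok W st) (d : ℕ) {σ : Mem} (hσ : Sim U st σ) :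
    ∃ σ', (∀ K, ∃ s, Exec W K (e.comp d) σ σ' e.cost s) ∧ σ'.reg (tmp + d) = e.eval st ∧
      (∀ r < tmp + d, σ'.reg r = σ.reg r) ∧ σ'.arr = σ.arr ∧ σ'.out = σ.out := by
  have upd : ∀ (g : ℕ → ℕ) (r v : ℕ), ∀ x < r, update g r v x = g x := by
    intro g r v x hx; rw [update_of_ne (by omega)]
  induction e generalizing d σ with
  | c k =>
    refine ⟨_, fun K => ⟨_, .instr _ _⟩, ?_, upd _ _ _, rfl, rfl⟩
    simp [run, eval, Nat.mod_eq_of_lt hok]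
  | r i =>
    simp only [ok, wf] at hok hwf
    refine ⟨_, fun K => ⟨_, .comp (.instr _ _) (.instr _ _)⟩, ?_, ?_, rfl, rfl⟩
    · have : i ≠ tmp + d := by omega
      simp [run, eval, Op.eval, update_of_ne this, hσ.1 i hwf, Nat.mod_eq_of_lt hok]
    · intro r hr; simp only [run]; rw [upd _ _ _ _ hr, upd _ _ _ _ hr]
  | op o a b iha ihb =>
    obtain ⟨σ1, e1, v1, l1, a1, o1⟩ := iha hwf.1 hok.1 d hσ; have hσ1 : Sim U st σ1 :=
      ⟨fun r hr => (l1 r (by omega)).trans (hσ.1 r hr), a1.trans hσ.2.1, o1.trans hσ.2.2⟩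
    obtain ⟨σ2, e2, v2, l2, a2, o2⟩ := ihb hwf.2 hok.2.1 (d + 1) hσ1
    refine ⟨run W (.arith o (tmp + d) (tmp + d) (tmp + (d + 1))) σ2, fun K => ?_, ?_, ?_,
      a2.trans a1, o2.trans o1⟩
    · obtain ⟨_, e1⟩ := e1 K; obtain ⟨_, e2⟩ := e2 K; rw [cost, Nat.add_assoc]
      exact ⟨_, .comp e1 (.comp e2 (.instr _ _))⟩
    · simp only [run, update_self, eval]; rw [l2 _ (by omega), v1, v2, Nat.mod_eq_of_lt hok.2.2]
    · intro r hr; simp only [run]; rw [upd _ _ _ _ hr, l2 r (by omega), l1 r hr]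
  | len a =>
    refine ⟨_, fun K => ⟨_, .instr _ _⟩, ?_, upd _ _ _, rfl, rfl⟩; simp only [ok] at hok
    simp [run, eval, hσ.2.1, Nat.mod_eq_of_lt hok]
  | get a e ih =>
    obtain ⟨σ1, e1, v1, l1, a1, o1⟩ := ih hwf hok d hσ
    refine ⟨run W (.get (tmp + d) a (tmp + d)) σ1, fun K => ?_, ?_, ?_, a1, o1⟩
    · obtain ⟨_, e1⟩ := e1 K; exact ⟨_, .comp e1 (.instr _ _)⟩
    · simp only [run, update_self, eval]; rw [v1, a1, hσ.2.1]
    · intro r hr; simp only [run]; rw [upd _ _ _ _ hr, l1 r hr]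

end Expr

open Expr (eval ok cost wf)
open St (setR_reg setA_arr setR_arr addOut_reg setA_reg)

/-! ## Statements -/

section Statements
variable {W U : ℕ} {st : St} {Q : St → Prop} {T : ℕ}

def skip : Prog := .instr (.const tmp 0)

def assign (i : ℕ) (e : Expr) : Prog :=
  .comp (e.comp 0) (.comp (.instr (.const (tmp + 1) 0)) (.instr (.arith .add i tmp (tmp + 1))))

def pushE (a : ℕ) (e : Expr) : Prog := .comp (e.comp 0) (.instr (.push a tmp))

def setE (a : ℕ) (e f : Expr) : Prog :=
  .comp (e.comp 0) (.comp (f.comp 1) (.instr (.set a tmp (tmp + 1))))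

def sendE (e f : Expr) : Prog := .comp (e.comp 0) (.comp (f.comp 1) (.instr (.send tmp (tmp + 1))))

def clearA (a : ℕ) : Prog := .instr (.clear a)

def ifE (e : Expr) (p q : Prog) : Prog := .comp (e.comp 0) (.branch tmp p q)

def forE (i : ℕ) (e : Expr) (body : Prog) : Prog :=
  .comp (assign i (.c 0)) (.comp ((Expr.op .lt (.r i) e).comp 0)
    (.loop tmp (.comp body (.comp (assign i (.op .add (.r i) (.c 1)))
      ((Expr.op .lt (.r i) e).comp 0)))))

lemma Tri.skip (h : Q st) (hU : U ≤ tmp := by decide) : Tri W U skip st 1 Q := fun σ hσ =>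
  ⟨_, 1, st, le_rfl, fun _ => ⟨_, .instr _ _⟩, ⟨fun r hr => by
    simp only [run]; rw [update_of_ne (by omega), hσ.1 r hr], hσ.2.1, hσ.2.2⟩, h⟩

lemma Tri.assign {i : ℕ} {e : Expr} (hok : e.ok W st) (hlt : e.eval st < W)
    (h : Q (st.setR i (e.eval st))) (hwf : e.wf U := by simp [wf, vis, tmp])
    (hU : U ≤ tmp := by decide) :
    Tri W U (assign i e) st (e.cost + 2) Q := by
  intro σ hσ; obtain ⟨σ1, e1, v1, l1, a1, o1⟩ := e.exec_comp hU hwf hok 0 hσ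
  refine ⟨run W (.arith .add i tmp (tmp + 1)) (run W (.const (tmp + 1) 0) σ1), _, _, le_rfl, fun K => ?_, ?_, h⟩
  · obtain ⟨_, e1⟩ := e1 K; exact ⟨_, .comp e1 (.comp (.instr _ _) (.instr _ _))⟩
  · refine ⟨fun r hr => ?_, a1.trans hσ.2.1, o1.trans hσ.2.2⟩
    simp only [run, Op.eval, St.setR, update_apply]; by_cases hri : r = i
    · simp only [hri, if_true]; rw [if_neg (by simp), Nat.zero_mod, Nat.add_zero]
      simp only [Nat.add_zero] at v1; rw [v1, Nat.mod_eq_of_lt hlt]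
    · rw [if_neg hri, if_neg hri, if_neg (by omega), l1 r (by omega), hσ.1 r hr]

lemma Tri.assignC {i k : ℕ} (hk : k < W) (h : Q (st.setR i k)) (hU : U ≤ tmp := by decide) :
    Tri W U (MPC.assign i (.c k)) st 3 Q :=
  assign (e := .c k) hk hk h trivial hU

lemma Tri.pushE {a : ℕ} {e : Expr} (hok : e.ok W st) (h : Q (st.setA a (st.arr a ++ [e.eval st])))
    (hwf : e.wf U := by simp [wf, vis, tmp]) (hU : U ≤ tmp := by decide) :
    Tri W U (pushE a e) st (e.cost + 1) Q := by
  intro σ hσ; obtain ⟨σ1, e1, v1, l1, a1, o1⟩ := e.exec_comp hU hwf hok 0 hσ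
  refine ⟨run W (.push a tmp) σ1, _, _, le_rfl, fun K => ?_, ?_, h⟩
  · obtain ⟨_, e1⟩ := e1 K; exact ⟨_, .comp e1 (.instr _ _)⟩
  · refine ⟨fun r hr => ?_, ?_, o1.trans hσ.2.2⟩
    · simp only [run, St.setA]; rw [l1 r (by omega), hσ.1 r hr]
    · simp only [Nat.add_zero] at v1; simp only [run, St.setA, a1, hσ.2.1, v1]

lemma Tri.setE {a : ℕ} {e f : Expr} (hok : e.ok W st) (hok' : f.ok W st)
    (h : Q (st.setA a ((st.arr a).set (e.eval st) (f.eval st))))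
    (hwf : e.wf U := by simp [wf, vis, tmp])
    (hwf' : f.wf U := by simp [wf, vis, tmp]) (hU : U ≤ tmp := by decide) :
    Tri W U (setE a e f) st (e.cost + f.cost + 1) Q := by
  intro σ hσ; obtain ⟨σ1, e1, v1, l1, a1, o1⟩ := e.exec_comp hU hwf hok 0 hσ
  have hσ1 : Sim U st σ1 :=
    ⟨fun r hr => (l1 r (by omega)).trans (hσ.1 r hr), a1.trans hσ.2.1, o1.trans hσ.2.2⟩
  obtain ⟨σ2, e2, v2, l2, a2, o2⟩ := f.exec_comp hU hwf' hok' 1 hσ1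
  refine ⟨run W (.set a tmp (tmp + 1)) σ2, _, _, le_rfl, fun K => ?_, ?_, h⟩
  · obtain ⟨_, e1⟩ := e1 K; obtain ⟨_, e2⟩ := e2 K; rw [Nat.add_assoc]
    exact ⟨_, .comp e1 (.comp e2 (.instr _ _))⟩
  · refine ⟨fun r hr => ?_, ?_, o2.trans (o1.trans hσ.2.2)⟩
    · simp only [run, St.setA]; rw [l2 r (by omega), l1 r (by omega), hσ.1 r hr]
    · simp only [Nat.add_zero] at v1; have := l2 tmp (by omega)
      simp only [run, St.setA, a2, a1, hσ.2.1, v2, this, v1]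

lemma Tri.sendE {e f : Expr} (hok : e.ok W st) (hok' : f.ok W st)
    (h : Q (st.addOut [(e.eval st, f.eval st)]))
    (hwf : e.wf U := by simp [wf, vis, tmp])
    (hwf' : f.wf U := by simp [wf, vis, tmp]) (hU : U ≤ tmp := by decide) :
    Tri W U (sendE e f) st (e.cost + f.cost + 1) Q := by
  intro σ hσ; obtain ⟨σ1, e1, v1, l1, a1, o1⟩ := e.exec_comp hU hwf hok 0 hσ
  have hσ1 : Sim U st σ1 :=
    ⟨fun r hr => (l1 r (by omega)).trans (hσ.1 r hr), a1.trans hσ.2.1, o1.trans hσ.2.2⟩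
  obtain ⟨σ2, e2, v2, l2, a2, o2⟩ := f.exec_comp hU hwf' hok' 1 hσ1
  refine ⟨run W (.send tmp (tmp + 1)) σ2, _, _, le_rfl, fun K => ?_, ?_, h⟩
  · obtain ⟨_, e1⟩ := e1 K; obtain ⟨_, e2⟩ := e2 K; rw [Nat.add_assoc]
    exact ⟨_, .comp e1 (.comp e2 (.instr _ _))⟩
  · refine ⟨fun r hr => ?_, a2.trans (a1.trans hσ.2.1), ?_⟩
    · simp only [run, St.addOut]; rw [l2 r (by omega), l1 r (by omega), hσ.1 r hr]
    · simp only [Nat.add_zero] at v1; have := l2 tmp (by omega)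
      simp only [run, St.addOut, o2, o1, hσ.2.2, v2, this, v1]

lemma Tri.clearA {a : ℕ} (h : Q (st.setA a [])) : Tri W U (clearA a) st 1 Q := fun σ hσ =>
  ⟨run W (.clear a) σ, 1, st.setA a [], le_rfl, fun _ => ⟨_, .instr _ _⟩,
    ⟨fun r hr => hσ.1 r hr, by simp only [run, St.setA, hσ.2.1], hσ.2.2⟩, h⟩

lemma Tri.ifE {e : Expr} {p q : Prog} (hok : e.ok W st)
    (h1 : e.eval st ≠ 0 → Tri W U p st T Q) (h2 : e.eval st = 0 → Tri W U q st T Q)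
    (hwf : e.wf U := by simp [wf, vis, tmp]) (hU : U ≤ tmp := by decide) :
    Tri W U (ifE e p q) st (e.cost + 1 + T) Q := by
  intro σ hσ; obtain ⟨σ1, e1, v1, l1, a1, o1⟩ := e.exec_comp hU hwf hok 0 hσ
  have hσ1 : Sim U st σ1 :=
    ⟨fun r hr => (l1 r (by omega)).trans (hσ.1 r hr), a1.trans hσ.2.1, o1.trans hσ.2.2⟩
  simp only [Nat.add_zero] at v1; by_cases h : e.eval st = 0
  · obtain ⟨σ2, t, st2, ht, e2, s2, q2⟩ := h2 h σ1 hσ1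
    refine ⟨σ2, e.cost + (t + 1), st2, by omega, fun K => ?_, s2, q2⟩
    obtain ⟨_, e1⟩ := e1 K; obtain ⟨_, e2⟩ := e2 K
    exact ⟨_, .comp e1 (.branch_false _ (by rw [v1, h]) e2)⟩
  · obtain ⟨σ2, t, st2, ht, e2, s2, q2⟩ := h1 h σ1 hσ1
    refine ⟨σ2, e.cost + (t + 1), st2, by omega, fun K => ?_, s2, q2⟩
    obtain ⟨_, e1⟩ := e1 K; obtain ⟨_, e2⟩ := e2 K
    exact ⟨_, .comp e1 (.branch_true _ (by rwa [v1]) e2)⟩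

lemma Tri.forE (hU : U ≤ tmp) {i N : ℕ} {e : Expr} {body : Prog} (I : ℕ → St → Prop)
    (hi : i < U) (he : e.wf U) (hN : N + 1 < W)
    (h0 : I 0 (st.setR i 0))
    (hev : ∀ k ≤ N, ∀ s, I k s → s.reg i = k → e.ok W s ∧ e.eval s = N)
    (hb : ∀ k < N, ∀ s, I k s → s.reg i = k →
      Tri W U body s T fun s' => s'.reg i = k ∧ I (k + 1) (s'.setR i (k + 1)))
    (hQ : ∀ s, I N s → s.reg i = N → Q s) :
    Tri W U (forE i e body) st ((N + 1) * (T + e.cost + 12)) Q := by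
  have hone : 1 < W := by omega
  have hcost : (Expr.op .lt (.r i) e).cost = e.cost + 3 := by simp only [cost]; omega
  have hwf : (Expr.op .lt (.r i) e).wf U := ⟨hi, he⟩
  have key : ∀ (b k : ℕ), b + k = N → ∀ s σ, I k s → s.reg i = k → Sim U s σ →
      σ.reg tmp = (if k < N then 1 else 0) →
      ∃ σ' t st', t ≤ b * (T + e.cost + 10) + 1 ∧
        (∀ K, ∃ s, Exec W K (.loop tmp (.comp body (.comp (MPC.assign i (.op .add (.r i) (.c 1)))
          ((Expr.op .lt (.r i) e).comp 0)))) σ σ' t s) ∧ Sim U st' σ' ∧ Q st' := by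
    intro b
    induction b with
    | zero =>
      intro k hk s σ hI hr hs ht; obtain rfl : k = N := by omega
      exact ⟨σ, 1, s, by omega, fun K => ⟨_, Exec.loop_stop _ (by simpa using ht)⟩, hs, hQ s hI hr⟩
    | succ b ih =>
      intro k hk s σ hI hr hs ht; rw [if_pos (by omega)] at ht
      obtain ⟨σ1, t1, s1, ht1, e1, hs1, hr1, hI1⟩ := hb k (by omega) s hI hr σ hs
      have hasg : Tri W U (MPC.assign i (.op .add (.r i) (.c 1))) s1 6
          fun s' => s' = s1.setR i (k + 1) := by
        have hev : (Expr.op .add (.r i) (.c 1)).eval s1 = k + 1 := by simp [eval, Op.eval, hr1]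
        refine Tri.mono (Tri.assign (Q := fun s' => s' = s1.setR i (k + 1)) ?_ ?_ (by rw [hev])
          (hU := hU) (hwf := ⟨hi, trivial⟩)) (by simp [cost]) fun _ h => h
        · refine ⟨?_, ?_, ?_⟩
          · simp only [ok, hr1]; omega
          · simp only [ok]; omega
          · simp only [eval, Op.eval, hr1]; omega
        · rw [hev]; omega
      obtain ⟨σ2, t2, s2, ht2, e2, hs2, rfl⟩ := hasg σ1 hs1
      obtain ⟨hok, hval⟩ := hev (k + 1) (by omega) _ hI1 (by simp)
      have hreg : (s1.setR i (k + 1)).reg i = k + 1 := by simp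
      obtain ⟨σ3, e3, v3, l3, a3, o3⟩ := (Expr.op .lt (.r i) e).exec_comp hU hwf (W := W)
        ⟨by simp only [ok, hreg]; omega, hok, lt_of_le_of_lt (Op.eval_lt_le_one _ _) hone⟩ 0 hs2
      have hs3 : Sim U (s1.setR i (k + 1)) σ3 :=
        ⟨fun r hr => (l3 r (by omega)).trans (hs2.1 r hr), a3.trans hs2.2.1, o3.trans hs2.2.2⟩
      obtain ⟨σ4, t4, s4, ht4, e4, hs4, q4⟩ := ih (k + 1) (by omega) _ σ3 hI1 (by simp) hs3 (by
        have : σ3.reg tmp = _ := v3; rw [this]; simp only [eval, Op.eval, hreg, hval])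
      refine ⟨σ4, t1 + (t2 + (Expr.op .lt (.r i) e).cost) + t4 + 1, s4, ?_, fun K => ?_, hs4, q4⟩
      · rw [hcost, Nat.succ_mul]; omega
      · obtain ⟨_, e1⟩ := e1 K; obtain ⟨_, e2⟩ := e2 K; obtain ⟨_, e3⟩ := e3 K
        obtain ⟨_, e4⟩ := e4 K; exact ⟨_, .loop_step (by rw [ht]; simp) (.comp e1 (.comp e2 e3)) e4⟩
  intro σ hσ
  obtain ⟨σ1, t1, s1, ht1, e1, hs1, rfl⟩ := Tri.assignC (Q := fun s => s = st.setR i 0) (k := 0)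
    (W := W) (by omega) rfl hU σ hσ; obtain ⟨hok, hval⟩ := hev 0 (by omega) _ h0 (by simp)
  obtain ⟨σ2, e2, v2, l2, a2, o2⟩ := (Expr.op .lt (.r i) e).exec_comp hU hwf (W := W)
    (st := st.setR i 0)
    ⟨by simp only [ok, setR_reg, if_true]; omega, hok, lt_of_le_of_lt (Op.eval_lt_le_one _ _) hone⟩ 0 hs1
  have hs2 : Sim U (st.setR i 0) σ2 :=
    ⟨fun r hr => (l2 r (by omega)).trans (hs1.1 r hr), a2.trans hs1.2.1, o2.trans hs1.2.2⟩
  obtain ⟨σ3, t3, s3, ht3, e3, hs3, q3⟩ := key N 0 (by omega) _ σ2 h0 (by simp) hs2 (by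
    have : σ2.reg tmp = _ := v2; rw [this]; simp only [eval, Op.eval, hval, setR_reg, if_true])
  refine ⟨σ3, t1 + ((Expr.op .lt (.r i) e).cost + t3), s3, ?_, fun K => ?_, hs3, q3⟩
  · rw [hcost]; nlinarith
  · obtain ⟨_, e1⟩ := e1 K; obtain ⟨_, e2⟩ := e2 K; obtain ⟨_, e3⟩ := e3 K
    exact ⟨_, .comp e1 (.comp e2 e3)⟩

end Statements

open Expr (eval ok cost wf)
open St (setR_reg setA_arr setR_arr addOut_reg setA_reg)
open Tri (comp le)

/-! ## Copying, messages and calls -/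

abbrev nf : ℕ := 22
abbrev aQ : ℕ := 4
abbrev aP : ℕ := 5
abbrev aF : ℕ := 6
abbrev aC : ℕ := 28

section Macros
variable {W : ℕ} {st : St} {Q : St → Prop} {T : ℕ}

section
variable {U : ℕ} {q : Prog}

lemma Tri.comp_then {T' : ℕ} {p : Prog} (hT : T' ≤ T)
    (h : Tri W U p st T' fun s => Tri W U q s (T - T') Q) : Tri W U (.comp p q) st T Q :=
  (comp h).le (by omega)

lemma Tri.assign_then (hU : U ≤ tmp) {i v : ℕ} {e : Expr} (hwf : e.wf U) (hok : e.ok W st)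
    (hv : e.eval st = v) (hlt : v < W) (hT : e.cost + 2 ≤ T)
    (h : Tri W U q (st.setR i v) (T - (e.cost + 2)) Q) :
    Tri W U (.comp (MPC.assign i e) q) st T Q :=
  Tri.comp_then hT (assign hok (hv ▸ hlt) (by rw [hv]; exact h) (hU := hU) (hwf := hwf))

lemma Tri.sendE_then (hU : U ≤ tmp) {v w : ℕ} {e f : Expr} (hwf : e.wf U) (hok : e.ok W st)
    (hwf' : f.wf U) (hok' : f.ok W st) (hv : e.eval st = v) (hw : f.eval st = w)
    (hT : e.cost + f.cost + 1 ≤ T)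
    (h : Tri W U q (st.addOut [(v, w)]) (T - (e.cost + f.cost + 1)) Q) :
    Tri W U (.comp (MPC.sendE e f) q) st T Q :=
  Tri.comp_then hT (Tri.sendE hok hok' (by rw [hv, hw]; exact h) (hU := hU) (hwf := hwf) (hwf' := hwf'))

lemma Tri.clearA_then {a : ℕ} (hT : 1 ≤ T) (h : Tri W U q (st.setA a []) (T - 1) Q) :
    Tri W U (.comp (MPC.clearA a) q) st T Q :=
  Tri.comp_then hT (Tri.clearA h)

end

def copyA (b a : ℕ) : Prog := forE 40 (.len a) (pushE b (.get a (.r 40)))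

lemma Tri.copyA {a b : ℕ} (hab : a ≠ b) (hW : (st.arr a).length + 1 < W)
    (h : Q (st.setA b (st.arr b ++ st.arr a))) :
    Tri W vis (MPC.copyA b a) st (((st.arr a).length + 1) * 17) Q := by
  refine Tri.hide (V := tmp) (by decide) fun ρ hρ => ?_
  refine Tri.forE (T := 4) (N := (st.arr a).length) le_rfl
    (fun k s => s.arr = update st.arr b (st.arr b ++ (st.arr a).take k) ∧ s.out = st.out ∧
      ∀ r < vis, s.reg r = st.reg r) (by decide) trivial hW ?_ ?_ ?_ ?_
  · refine ⟨by simp, rfl, fun r hr => ?_⟩; rw [setR_reg, if_neg (by unfold vis at hr; omega)]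
    exact hρ r hr
  · rintro k hk s ⟨hs, -, -⟩ -; simp [ok, eval, hs, update_of_ne hab]; omega
  · rintro k hk s ⟨hs, ho, hr⟩ hi
    refine Tri.pushE (by simp only [ok]; omega) ⟨hi, ?_, ho, fun r hr' => ?_⟩
    · simp only [setR_arr, St.setA, hs, update_self, Function.update_idem, eval,
        update_of_ne hab, hi]
      rw [append_assoc, take_add_one, getD_eq_getElem?_getD, List.getElem?_eq_getElem hk]; simp
    · rw [setR_reg, if_neg (by unfold vis at hr'; omega)]; exact hr r hr'
  · rintro s ⟨hs, ho, hr⟩ -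
    exact ⟨st.setA b (st.arr b ++ st.arr a), fun r h => (hr r h).symm, by simp [hs, St.setA],
      ho.symm, h⟩

inductive PSeg : Type
  | e (x : Expr)
  | a (x : ℕ)

def PSeg.val (st : St) : PSeg → List ℕ
  | e x => [x.eval st]
  | a x => st.arr x

def Expr.avoid (b : ℕ) : Expr → Prop
  | c _ => True
  | r _ => True
  | op _ x y => x.avoid b ∧ y.avoid b
  | len a => a ≠ b
  | get a e => a ≠ b ∧ e.avoid b

lemma Expr.eval_setA {b : ℕ} {l : List ℕ} {e : Expr} (h : e.avoid b) :
    e.eval (st.setA b l) = e.eval st := by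
  induction e with
  | c | r => rfl
  | op o x y ihx ihy => simp only [eval, ihx h.1, ihy h.2]
  | len a => simp only [eval, setA_arr, if_neg h]
  | get a e ih => simp only [eval, setA_arr, if_neg h.1, ih h.2]

lemma Expr.ok_setA {b : ℕ} {l : List ℕ} {e : Expr} (h : e.avoid b) (hok : e.ok W st) :
    e.ok W (st.setA b l) := by
  induction e with
  | c | r => exact hok
  | op o x y ihx ihy =>
    refine ⟨ihx h.1 hok.1, ihy h.2 hok.2.1, ?_⟩; rw [eval_setA h.1, eval_setA h.2]; exact hok.2.2
  | len a => simpa only [ok, setA_arr, if_neg h] using hok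
  | get a e ih => exact ih h.2 hok

def PSeg.ok (W lam : ℕ) (b : ℕ) (st : St) : PSeg → Prop
  | e x => x.wf vis ∧ x.ok W st ∧ x.avoid b
  | a x => x ≠ b ∧ (st.arr x).length ≤ lam

def payloadA (b : ℕ) : List PSeg → Prog
  | [] => skip
  | .e x :: l => .comp (pushE b x) (payloadA b l)
  | .a x :: l => .comp (copyA b x) (payloadA b l)

lemma St.setA_setA (st : St) (a : ℕ) (l l' : List ℕ) : (st.setA a l).setA a l' = st.setA a l' := by
  simp [St.setA, Function.update_idem]

lemma St.setA_self (st : St) (a : ℕ) : st.setA a (st.arr a) = st := by simp [St.setA]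

lemma PSeg.val_setA {b lam : ℕ} {l : List ℕ} {s : PSeg} (h : s.ok W lam b st) :
    s.val (st.setA b l) = s.val st := by
  cases s with
  | e x => simp only [val, Expr.eval_setA h.2.2]
  | a x => simp only [val, setA_arr, if_neg h.1]

lemma PSeg.ok_setA {b lam : ℕ} {l : List ℕ} {s : PSeg} (h : s.ok W lam b st) :
    s.ok W lam b (st.setA b l) := by
  cases s with
  | e x => exact ⟨h.1, Expr.ok_setA h.2.2 h.2.1, h.2.2⟩
  | a x => exact ⟨h.1, by simpa only [setA_arr, if_neg h.1] using h.2⟩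

def PSeg.cost : PSeg → ℕ
  | e x => x.cost + 1
  | a _ => 17

lemma Tri.payloadA {lam b : ℕ} (hW : lam + 1 < W) (l : List PSeg) (hl : ∀ s ∈ l, s.ok W lam b st)
    (h : Q (st.setA b (st.arr b ++ l.flatMap (PSeg.val st)))) :
    Tri W vis (MPC.payloadA b l) st (((l.map PSeg.cost).sum + 1) * (lam + 1)) Q := by
  induction l generalizing st with
  | nil => refine Tri.mono (skip (Q := Q) ?_) (by simp) fun _ h => h; simpa [St.setA_self] using h
  | cons s l ih =>
    have hs := hl s (by simp)
    have hl' : ∀ s ∈ l, s.ok W lam b st := fun s' hs' => hl s' (by simp [hs'])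
    have hval : ∀ l', List.flatMap (PSeg.val (st.setA b l')) l = l.flatMap (PSeg.val st) :=
      fun l' => List.flatMap_congr fun s hs' => PSeg.val_setA (hl' s hs')
    have main : Q ((st.setA b (st.arr b ++ s.val st)).setA b
        ((st.setA b (st.arr b ++ s.val st)).arr b ++
          l.flatMap (PSeg.val (st.setA b (st.arr b ++ s.val st))))) := by
      rw [hval, St.setA_setA, setA_arr, if_pos rfl, append_assoc]; simpa using h
    have rest := ih (fun s hs' => PSeg.ok_setA (hl' s hs')) main
    cases s with
    | e x =>
      refine Tri.mono (comp (Tri.pushE hs.2.1 rest (hwf := hs.1))) ?_ fun _ h => h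
      simp only [map_cons, sum_cons, PSeg.cost]; nlinarith
    | a x =>
      have h2 := hs.2; refine Tri.mono (comp (Tri.copyA hs.1 (by omega) rest)) ?_ fun _ h => h
      simp only [map_cons, sum_cons, PSeg.cost]; nlinarith

def addr (q lam y f : ℕ) : ℕ := (y % q * nf + f) * lam

def emitMsgs (q lam : ℕ) (e : ℕ × ℕ × List ℕ) : List (ℕ × ℕ × ℕ) :=
  (e.1 / q, addr q lam e.1 e.2.1, e.2.2.length) :: (List.range e.2.2.length).map fun o =>
    (e.1 / q, addr q lam e.1 e.2.1 + 1 + o, e.2.2.getD o 0)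

def enc2 (l : List (ℕ × ℕ × ℕ)) : List (ℕ × ℕ) := l.flatMap fun x => [(x.1, x.2.1), (x.1, x.2.2)]

@[simp] lemma enc2_nil : enc2 [] = [] := rfl
@[simp] lemma enc2_append (l l' : List (ℕ × ℕ × ℕ)) : enc2 (l ++ l') = enc2 l ++ enc2 l' := by
  simp [enc2]
@[simp] lemma enc2_cons (x : ℕ × ℕ × ℕ) (l : List (ℕ × ℕ × ℕ)) :
    enc2 (x :: l) = (x.1, x.2.1) :: (x.1, x.2.2) :: enc2 l := rfl

/-- Send the string in the array `aP` to the field `f` of node `y`. Register `6` holds the number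
of nodes of a machine, and register `7` the size of a field. -/
def emitP (y : Expr) (f : ℕ) : Prog := .comp (assign 41 (.op .div y (.r 6)))
    (.comp (MPC.assign 42 (.op .mul (.op .add (.op .mul (.op .mod y (.r 6)) (.c nf)) (.c f)) (.r 7)))
      (.comp (MPC.sendE (.r 41) (.r 42)) (.comp (MPC.sendE (.r 41) (.len aP))
        (forE 40 (.len aP) (.comp (sendE (.r 41) (.op .add (.op .add (.r 42) (.c 1)) (.r 40)))
          (sendE (.r 41) (.get aP (.r 40))))))))

structure Fit (W q lam : ℕ) : Prop where
  q_pos : 0 < q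
  lam_pos : 0 < lam
  lt : q * nf * lam + q + lam + nf + 2 < W

lemma Expr.eval_congr {U : ℕ} {s : St} (hr : ∀ r < U, s.reg r = st.reg r)
    (ha : s.arr = st.arr) {e : Expr} (h : e.wf U) : e.eval s = e.eval st := by
  induction e with
  | c => rfl
  | len => simp only [eval, ha]
  | r i => exact hr i h
  | op o x y ihx ihy => simp only [eval, ihx h.1, ihy h.2]
  | get a e ih => simp only [eval, ih h, ha]

lemma Expr.ok_congr {U : ℕ} {s : St} (hr : ∀ r < U, s.reg r = st.reg r)
    (ha : s.arr = st.arr) {e : Expr} (h : e.wf U) (hok : e.ok W st) : e.ok W s := by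
  induction e with
  | c => exact hok
  | len => simpa only [ok, ha] using hok
  | r i => simpa only [ok, hr i h] using hok
  | op o x y ihx ihy =>
    refine ⟨ihx h.1 hok.1, ihy h.2 hok.2.1, ?_⟩; rw [eval_congr hr ha h.1, eval_congr hr ha h.2]
    exact hok.2.2
  | get a e ih => exact ih h hok

lemma Expr.wf_mono {U V : ℕ} (hUV : U ≤ V) {e : Expr} (h : e.wf U) : e.wf V := by
  induction e with
  | c | len => trivial
  | r i => exact lt_of_lt_of_le h hUV
  | op o x y ihx ihy => exact ⟨ihx h.1, ihy h.2⟩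
  | get a e ih => exact ih h

lemma addr_lt {q lam y f : ℕ} (hq : 0 < q) (hf : f < nf) : addr q lam y f + lam ≤ q * nf * lam := by
  have h1 : y % q < q := Nat.mod_lt _ hq; have h2 : y % q * nf + f + 1 ≤ q * nf := by nlinarith
  calc addr q lam y f + lam = (y % q * nf + f + 1) * lam := by unfold addr; ring
    _ ≤ _ := Nat.mul_le_mul_right _ h2

lemma Tri.emitP {q lam f : ℕ} (hfit : Fit W q lam) {y : Expr} (hf : f < nf)
    (h6 : st.reg 6 = q) (h7 : st.reg 7 = lam) (hy : y.wf vis) (hyo : y.ok W st)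
    (hyW : y.eval st < W) (hlen : (st.arr aP).length < lam)
    (h : Q (st.addOut (enc2 (emitMsgs q lam (y.eval st, f, st.arr aP))))) :
    Tri W vis (MPC.emitP y f) st ((2 * y.cost + 100) * (lam + 1)) Q := by
  have hlt := hfit.lt; have hq := hfit.q_pos; have ha := addr_lt (lam := lam) (y := y.eval st) hq hf
  have hm : y.eval st % q < q := Nat.mod_lt _ hq
  have hm1 : y.eval st % q * nf + f + 1 ≤ q * nf := by nlinarith
  have hm2 : q * nf ≤ q * nf * lam := Nat.le_mul_of_pos_right _ hfit.lam_pos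
  have hd : y.eval st / q ≤ y.eval st := Nat.div_le_self _ _
  have hyt : y.wf tmp := Expr.wf_mono (by decide) hy
  refine Tri.hide (V := tmp) (by decide) fun ρ hρ => ?_
  set s0 : St := { st with reg := ρ } with hs0; have hr0 : ∀ r < vis, s0.reg r = st.reg r := hρ
  have ev0 : y.eval s0 = y.eval st := Expr.eval_congr hr0 rfl hy
  have eo0 : y.ok W s0 := Expr.ok_congr hr0 rfl hy hyo
  have h60 : s0.reg 6 = q := (hr0 6 (by decide)).trans h6
  have h70 : s0.reg 7 = lam := (hr0 7 (by decide)).trans h7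
  set s1 := s0.setR 41 (y.eval st / q) with hs1
  have hr1 : ∀ r < vis, s1.reg r = st.reg r := fun r hr => by
    rw [hs1, setR_reg, if_neg (by unfold vis at hr; omega), hr0 r hr]
  have ev1 : y.eval s1 = y.eval st := Expr.eval_congr hr1 rfl hy
  have eo1 : y.ok W s1 := Expr.ok_congr hr1 rfl hy hyo
  have h61 : s1.reg 6 = q := (hr1 6 (by decide)).trans h6
  have h71 : s1.reg 7 = lam := (hr1 7 (by decide)).trans h7
  have hA : (y.eval st % q * nf + f) * lam = addr q lam (y.eval st) f := rfl
  have hm3 : y.eval st % q * nf + f ≤ q * nf := by omega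
  have hT : (y.cost + 5) + (y.cost + 14) + 10 + ((st.arr aP).length + 1) * (16 + 1 + 12)
      ≤ (2 * y.cost + 100) * (lam + 1) := by nlinarith
  have hc2 : (Expr.op .mul (.op .add (.op .mul (.op .mod y (.r 6)) (.c nf)) (.c f)) (.r 7)).cost
      = y.cost + 10 := by simp only [cost]
  have hc1 : (Expr.op .div y (.r 6)).cost = y.cost + 3 := by simp only [cost]
  generalize (2 * y.cost + 100) * (lam + 1) = Tb at hT ⊢; unfold MPC.emitP
  refine Tri.assign_then le_rfl ⟨hyt, show 6 < tmp by decide⟩ ⟨eo0, ?_, ?_⟩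
    (v := y.eval st / q) ?_ (by omega) (by omega) ?_
  · simp only [ok, h60]; omega
  · simp only [eval, Op.eval, h60, ev0]; omega
  · simp only [eval, Op.eval, h60, ev0]
  refine Tri.assign_then le_rfl (v := addr q lam (y.eval st) f)
    ⟨⟨⟨⟨hyt, show 6 < tmp by decide⟩, trivial⟩, trivial⟩, show 7 < tmp by decide⟩ ?_ ?_
    (by omega) (by omega) ?_
  · refine ⟨⟨⟨⟨eo1, ?_, ?_⟩, ?_, ?_⟩, ?_, ?_⟩, ?_, ?_⟩ <;>
      simp only [eval, Op.eval, ← hs1, h61, h71, ev1, ok] <;> omega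
  · simp only [eval, Op.eval, ← hs1, h61, h71, ev1, addr]
  refine Tri.sendE_then le_rfl (v := y.eval st / q) (w := addr q lam (y.eval st) f)
    (show 41 < tmp by decide) (by simp [ok]; omega) (show 42 < tmp by decide)
    (by simp [ok]; omega) (by simp [eval]) (by simp [eval])
    (by simp only [cost]; omega) ?_
  refine Tri.sendE_then le_rfl (v := y.eval st / q) (w := (st.arr aP).length)
    (show 41 < tmp by decide) (by simp [ok]; omega) trivial
    (by simp [ok, hs0]; omega) (by simp [eval]) (by simp [eval, hs0])
    (by simp only [cost]; omega) ?_; refine le (Tri.forE (N := (st.arr aP).length) (T := 16) le_rfl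
      (fun k s => s.arr = st.arr ∧ s.reg 41 = y.eval st / q ∧
        s.reg 42 = addr q lam (y.eval st) f ∧ (∀ r < vis, s.reg r = st.reg r) ∧
        s.out = st.out ++ ((y.eval st / q, addr q lam (y.eval st) f) ::
          (y.eval st / q, (st.arr aP).length) :: enc2 ((List.range k).map fun o =>
            (y.eval st / q, addr q lam (y.eval st) f + 1 + o, (st.arr aP).getD o 0))))
      (by decide) trivial (by omega) ?_ ?_ ?_ ?_)
      (by simp only [cost]; omega)
  · refine ⟨rfl, by simp, by simp, fun r hr => ?_, by simp [hs0]⟩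
    unfold vis at hr; simp only [setR_reg, addOut_reg]
    rw [if_neg (by omega), if_neg (by omega), if_neg (by omega)]; exact hr0 r hr
  · rintro k hk s ⟨h1, h2, h3, h4, h5⟩ h6; simp only [ok, eval, h1, and_true]; omega
  · rintro k hk s ⟨h1, h2, h3, h4, h5⟩ h6; refine (Tri.sendE_then le_rfl (v := y.eval st / q)
      (w := addr q lam (y.eval st) f + 1 + k) (show 41 < tmp by decide) ?_ ?_ ?_ ?_ ?_
      (by simp [cost]) ((Tri.sendE (e := .r 41) (f := .get aP (.r 40)) ?_ ?_ ?_
        (hwf := (show 41 < tmp by decide)) (hwf' := (show 40 < tmp by decide))).le (by simp [cost])))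
    · simp only [ok, h2]; omega
    · simp [wf, tmp]
    · simp only [ok, eval, Op.eval, h3, h6]; omega
    · simp [eval, h2]
    · simp [eval, Op.eval, h3, h6]
    · simp only [ok, addOut_reg, h2]; omega
    · simp only [ok, addOut_reg, h6]; omega
    · refine ⟨by simp [h6], by simp [h1], by simp [h2], by simp [h3], fun r hr => ?_, ?_⟩
      · simp only [setR_reg, addOut_reg]; rw [if_neg (by unfold vis at hr; omega), h4 r hr]
      · simp [h5, List.range_succ, eval, h1, h2, h6]
  · rintro s ⟨h1, h2, h3, h4, h5⟩ h6
    exact ⟨st.addOut (enc2 (emitMsgs q lam (y.eval st, f, st.arr aP))),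
      fun r hr => (h4 r hr).symm, h1.symm, by rw [h5]; rfl, h⟩

def loadField (i : Expr) (f a : ℕ) : Prog :=
  .comp (assign 43 (.op .mul (.op .add (.op .mul i (.c nf)) (.c f)) (.r 7)))
    (.comp (MPC.clearA a) (forE 40 (.get aQ (.r 43))
      (pushE a (.get aQ (.op .add (.op .add (.r 43) (.c 1)) (.r 40))))))

def StoredAt (l : List ℕ) (b : ℕ) (s : List ℕ) : Prop :=
  l.getD b 0 = s.length ∧ ∀ o < s.length, l.getD (b + 1 + o) 0 = s.getD o 0

lemma Tri.loadField {q lam f i a : ℕ} (hfit : Fit W q lam) {ie : Expr} (hf : f < nf)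
    (h7 : st.reg 7 = lam) (hy : ie.wf vis) (hyo : ie.ok W st) (hi : ie.eval st = i) (hiq : i < q)
    (ha : a ≠ aQ) {s : List ℕ} (hs : s.length < lam)
    (hst : StoredAt (st.arr aQ) ((i * nf + f) * lam) s) (h : Q (st.setA a s)) :
    Tri W vis (MPC.loadField ie f a) st ((ie.cost + 100) * (lam + 1)) Q := by
  have hlt := hfit.lt; have hm1 : i * nf + f + 1 ≤ q * nf := by nlinarith
  have hm2 : q * nf ≤ q * nf * lam := Nat.le_mul_of_pos_right _ hfit.lam_pos
  have hb : (i * nf + f) * lam + lam ≤ q * nf * lam := by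
    calc (i * nf + f) * lam + lam = (i * nf + f + 1) * lam := by ring
      _ ≤ _ := Nat.mul_le_mul_right _ hm1
  refine Tri.hide (V := tmp) (by decide) fun ρ hρ => ?_
  set s0 : St := { st with reg := ρ } with hs0; have hr0 : ∀ r < vis, s0.reg r = st.reg r := hρ
  have ev0 : ie.eval s0 = i := (Expr.eval_congr hr0 rfl hy).trans hi
  have eo0 : ie.ok W s0 := Expr.ok_congr hr0 rfl hy hyo
  have h70 : s0.reg 7 = lam := (hr0 7 (by decide)).trans h7; set b := (i * nf + f) * lam with hbdef
  have hT : (ie.cost + 10) + 1 + (s.length + 1) * (9 + 3 + 12)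
      ≤ (ie.cost + 100) * (lam + 1) := by nlinarith
  have hc2 : (Expr.op .mul (.op .add (.op .mul ie (.c nf)) (.c f)) (.r 7)).cost
      = ie.cost + 7 := by simp only [cost]
  generalize (ie.cost + 100) * (lam + 1) = Tb at hT ⊢; unfold MPC.loadField
  refine Tri.assign_then le_rfl (v := b)
    ⟨⟨⟨Expr.wf_mono (by decide) hy, trivial⟩, trivial⟩, show 7 < tmp by decide⟩ ?_ ?_
    (by omega) (by omega) ?_
  · refine ⟨⟨⟨eo0, ?_, ?_⟩, ?_, ?_⟩, ?_, ?_⟩ <;> simp only [eval, Op.eval, h70, ev0, ok] <;> omega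
  · simp only [eval, Op.eval, h70, ev0, hbdef]
  refine Tri.clearA_then (by omega) ?_; refine le (Tri.forE (N := s.length) (T := 9) le_rfl
      (fun k s' => s'.arr = update st.arr a (s.take k) ∧ s'.reg 43 = b ∧
        (∀ r < vis, s'.reg r = st.reg r) ∧ s'.out = st.out)
      (by decide) (show 43 < tmp by decide) (by omega) ?_ ?_ ?_ ?_)
      (by simp only [cost]; omega)
  · refine ⟨by simp [St.setA, St.setR, hs0], by simp, fun r hr => ?_, by simp [hs0]⟩
    unfold vis at hr; simp only [setR_reg, setA_reg]; rw [if_neg (by omega), if_neg (by omega)]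
    exact hr0 r hr
  · rintro k hk s' ⟨h1, h2, h3, h4⟩ h5
    simp only [ok, eval, h1, h2, update_of_ne ha.symm, hst.1, and_true]; omega
  · rintro k hk s' ⟨h1, h2, h3, h4⟩ h5; refine le (Tri.pushE ?_ ?_) ?_
    · simp only [ok, eval, Op.eval, h2, h5]; omega
    · refine ⟨by simp [h5], ?_, by simp [h2], fun r hr => ?_, by simp [h4]⟩
      · simp only [setR_arr, St.setA, h1, update_self, Function.update_idem,
          eval, update_of_ne ha.symm, h5, Op.eval, h2]
        rw [hst.2 k hk, take_add_one, getD_eq_getElem?_getD, List.getElem?_eq_getElem hk]; simp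
      · simp only [setR_reg, setA_reg]; rw [if_neg (by unfold vis at hr; omega), h3 r hr]
    · simp [cost]
  · rintro s' ⟨h1, h2, h3, h4⟩ h5
    exact ⟨st.setA a s, fun r hr => (h3 r hr).symm, by simp [h1, St.setA], h4.symm, h⟩

def zeroRegs : ℕ → Prog
  | 0 => skip
  | N + 1 => .comp (zeroRegs N) (.instr (.const (tmp + N) 0))

def clearFrom (k : ℕ) : ℕ → Prog
  | 0 => skip
  | N + 1 => .comp (clearFrom k N) (if k ≤ N then clearA (aC + N) else skip)

def callP (p : Prog) (k : ℕ) : Prog :=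
  .comp (clearFrom k (p.bound + 1)) (.comp (zeroRegs (p.bound + 1)) (p.shift tmp aC))

lemma exec_zeroRegs (N : ℕ) (σ : Mem) : ∃ σ', (∀ K, ∃ s, Exec W K (zeroRegs N) σ σ' (N + 1) s) ∧
    (∀ r < N, σ'.reg (tmp + r) = 0) ∧ (∀ r < tmp, σ'.reg r = σ.reg r) ∧ σ'.arr = σ.arr ∧
    σ'.out = σ.out := by
  induction N with
  | zero =>
    refine ⟨_, fun _ => ⟨_, .instr _ _⟩, by simp, fun r hr => ?_, rfl, rfl⟩
    simp only [run]; rw [update_of_ne (by omega)]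
  | succ N ih =>
    obtain ⟨σ1, e1, z1, l1, a1, o1⟩ := ih
    refine ⟨run W (.const (tmp + N) 0) σ1, fun K => ?_, fun r hr => ?_, fun r hr => ?_, a1, o1⟩
    · obtain ⟨_, e1⟩ := e1 K; exact ⟨_, .comp e1 (.instr _ _)⟩
    · simp only [run, update_apply]; split_ifs with h
      · simp
      · exact z1 r (by omega)
    · simp only [run]; rw [update_of_ne (by omega), l1 r hr]

lemma exec_clearFrom (k N : ℕ) (σ : Mem) :
    ∃ σ', (∀ K, ∃ s, Exec W K (clearFrom k N) σ σ' (N + 1) s) ∧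
    (∀ a < N, k ≤ a → σ'.arr (aC + a) = []) ∧ (∀ a < aC + k, σ'.arr a = σ.arr a) ∧
    (∀ r < tmp, σ'.reg r = σ.reg r) ∧ σ'.out = σ.out := by
  induction N with
  | zero =>
    refine ⟨_, fun _ => ⟨_, .instr _ _⟩, by simp, fun a _ => rfl, fun r hr => ?_, rfl⟩
    simp only [run]; rw [update_of_ne (by omega)]
  | succ N ih =>
    obtain ⟨σ1, e1, z1, a1, r1, o1⟩ := ih; unfold clearFrom; by_cases hk : k ≤ N
    · simp only [if_pos hk]
      refine ⟨run W (.clear (aC + N)) σ1, fun K => ?_, fun a ha hka => ?_, fun a ha => ?_, r1, o1⟩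
      · obtain ⟨_, e1⟩ := e1 K; exact ⟨_, .comp e1 (.instr _ _)⟩
      · simp only [run, update_apply]; split_ifs with h
        · rfl
        · exact z1 a (by omega) hka
      · simp only [run]; rw [update_of_ne (by omega), a1 a ha]
    · simp only [if_neg hk]
      refine ⟨run W (.const tmp 0) σ1, fun K => ?_, fun a ha hka => ?_, fun a ha => ?_,
        fun r hr => ?_, o1⟩
      · obtain ⟨_, e1⟩ := e1 K; exact ⟨_, .comp e1 (.instr _ _)⟩
      · omega
      · exact a1 a ha
      · simp only [run]; rw [update_of_ne (by omega), r1 r hr]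

lemma Tri.callP {p : Prog} (hseq : p.IsSequential) {xs : List (List ℕ)} {y : List ℕ} {t : ℕ}
    (hp : p.Computes W xs y t) (hin : ∀ a < xs.length, st.arr (aC + a) = xs.getD a [])
    (h : ∀ A : ℕ → List ℕ, (∀ a < aC, A a = st.arr a) → A aC = y → Q { st with arr := A }) :
    Tri W tmp (MPC.callP p xs.length) st (2 * p.bound + 4 + t) Q := by
  intro σ hσ; obtain ⟨σ0, t0, s0, e0, hy, ht⟩ := hp
  obtain ⟨σ1, e1, z1, a1, r1, o1⟩ := exec_clearFrom (W := W) xs.length (p.bound + 1) σ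
  obtain ⟨σ2, e2, z2, r2, a2, o2⟩ := exec_zeroRegs (W := W) (p.bound + 1) σ1
  obtain ⟨σ3, e3, ⟨h3r, h3a⟩, l3⟩ := e0.shift (N := p.bound + 1) (R := tmp) (A := aC) (τ := σ2)
    (by omega) hseq ⟨fun r hr => z2 r hr, fun a ha => by
      rw [a2]; by_cases hx : a < xs.length
      · rw [a1 _ (by omega), hσ.2.1, hin a hx]
      · rw [z1 a ha (by omega)]; exact (List.getD_eq_default _ _ (by omega)).symm⟩
  refine ⟨σ3, (p.bound + 1 + 1) + ((p.bound + 1 + 1) + t0), { st with arr := σ3.arr }, by omega,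
    fun K => ?_, ⟨fun r hr => ?_, rfl, ?_⟩, h _ (fun a ha => ?_) ?_⟩
  · obtain ⟨_, e1⟩ := e1 K; obtain ⟨_, e2⟩ := e2 K; obtain ⟨_, e3⟩ := e3 K
    exact ⟨_, .comp e1 (.comp e2 e3)⟩
  · rw [l3.1 r hr, r2 r hr, r1 r hr, hσ.1 r hr]
  · rw [l3.2.2, o2, o1, hσ.2.2]
  · rw [l3.2.1 a ha, a2, a1 a (by omega), hσ.2.1]
  · have := h3a 0 (by omega); rw [Nat.add_zero] at this; rw [this, hy]

end Macros

/-! ## Programs for the nodes of a virtual network -/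

inductive NE : Type
  | n | pw | x | pre | tot
  | c (k : ℕ)
  | op (o : Op) (a b : NE)
  | len (f : ℕ)
  | get (f j : ℕ)

/-- What a node knows: the number of vertices, a power of two, its index, the sum of the values of
the nodes before it and of all nodes, and its fields. -/
structure Env where
  n : ℕ
  pw : ℕ
  x : ℕ
  pre : ℕ
  tot : ℕ
  fld : ℕ → List ℕ

def isPtr (f : ℕ) : Bool := !(f == 1 || f == 14 || f == 16 || f == 18 || f == 21 || f == 22)

namespace NE

def eval (E : Env) : NE → ℕ
  | n => E.n
  | pw => E.pw
  | x => E.x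
  | pre => E.pre
  | tot => E.tot
  | c k => k
  | op o a b => o.eval (a.eval E) (b.eval E)
  | len f => (E.fld f).length
  | get f j => (E.fld f).getD j 0

def toExpr : NE → Expr
  | n => .r 2
  | pw => .r 8
  | x => .r 10
  | pre => .r 11
  | tot => .r 12
  | c k => .c k
  | op o a b => .op o a.toExpr b.toExpr
  | len f => .len (aF + f)
  | get f j => .get (aF + f) (.c j)

def size : NE → ℕ
  | op _ a b => a.size + b.size
  | _ => 1

def check (F : ℕ) : NE → Bool
  | c k => Nat.ble k 16
  | op _ a b => a.check F && b.check F
  | len f => Nat.blt f F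
  | get f j => Nat.blt f F && (isPtr f && Nat.ble j 16)
  | _ => true

def good (F : ℕ) (e : NE) : Bool := e.check F && Nat.ble e.size 24

end NE

structure Env.Bounded (B lam : ℕ) (E : Env) : Prop where
  n_le : E.n ≤ B
  pw_le : E.pw ≤ B
  x_le : E.x ≤ B
  pre_le : E.pre ≤ B
  tot_le : E.tot ≤ B
  len : ∀ f < 23, (E.fld f).length < lam
  ptr : ∀ f < 23, isPtr f = true → ∀ w ∈ E.fld f, w ≤ B

structure Big (W B lam : ℕ) : Prop where
  le : 16 ≤ B
  lam : lam ≤ B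
  lt : B ^ 24 < W

structure NodeSt (F q lam : ℕ) (E : Env) (st : St) : Prop where
  n : st.reg 2 = E.n
  q : st.reg 6 = q
  lam : st.reg 7 = lam
  pw : st.reg 8 = E.pw
  x : st.reg 10 = E.x
  pre : st.reg 11 = E.pre
  tot : st.reg 12 = E.tot
  fld : ∀ f < F, st.arr (aF + f) = E.fld f

section
variable {W B lam q F : ℕ} {E : Env} {st : St} {Q : St → Prop} {T : ℕ}

lemma le_mul_succ (lam a : ℕ) : a ≤ a * (lam + 1) := Nat.le_mul_of_pos_right _ (by omega)

lemma Big.succ_lt (h : Big W B lam) : B * B < W := by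
  have h1 := h.le; have : B ^ 2 ≤ B ^ 24 := Nat.pow_le_pow_right (by omega) (by norm_num)
  have := h.lt; nlinarith

lemma Big.lam_lt (h : Big W B lam) : lam + 1 < W := by
  have := h.succ_lt; have := h.le; have := h.lam; nlinarith

namespace NE

lemma one_le_size (e : NE) : 1 ≤ e.size := by induction e <;> simp only [size] <;> omega

lemma eval_le (hB : Big W B lam) (hE : E.Bounded B lam) (hF : F ≤ 23) {e : NE}
    (h : e.check F = true) : e.eval E ≤ B ^ e.size := by
  have hB1 := hB.le
  induction e with
  | n => simpa [size, eval] using hE.n_le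
  | pw => simpa [size, eval] using hE.pw_le
  | x => simpa [size, eval] using hE.x_le
  | pre => simpa [size, eval] using hE.pre_le
  | tot => simpa [size, eval] using hE.tot_le
  | c k => have := Nat.le_of_ble_eq_true h; simp only [size, eval, pow_one]; omega
  | len f =>
    have h1 := hE.len f (by have := Nat.blt_eq.mp h; omega)
    have := hB.lam; simp only [size, eval, pow_one]; omega
  | get f j =>
    simp only [check, Bool.and_eq_true] at h
    have h1 := hE.ptr f (by have := Nat.blt_eq.mp h.1; omega) h.2.1
    simp only [size, eval, pow_one, getD_eq_getElem?_getD]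
    cases hx : (E.fld f)[j]? with
    | none => simp
    | some w => exact h1 w (mem_of_getElem? hx)
  | op o a b iha ihb =>
    simp only [check, Bool.and_eq_true] at h; have ha := iha h.1; have hb := ihb h.2
    have ga : B ≤ B ^ a.size := Nat.le_self_pow (by have := a.one_le_size; omega) B
    have gb : B ≤ B ^ b.size := Nat.le_self_pow (by have := b.one_le_size; omega) B
    simp only [size, eval, pow_add]
    have hmul : a.eval E * b.eval E ≤ B ^ a.size * B ^ b.size := Nat.mul_le_mul ha hb
    have h1 : B ^ a.size ≤ B ^ a.size * B ^ b.size := Nat.le_mul_of_pos_right _ (by omega)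
    have h2 : B ^ a.size + B ^ b.size ≤ B ^ a.size * B ^ b.size := by nlinarith
    cases o <;> simp only [Op.eval]
    · omega
    · omega
    · exact hmul
    · exact (Nat.div_le_self _ _).trans (by omega)
    · exact (Nat.mod_le _ _).trans (by omega)
    · split_ifs <;> omega
    · split_ifs <;> omega

lemma toExpr_eval (hS : NodeSt F q lam E st) {e : NE} (h : e.check F = true) :
    e.toExpr.eval st = e.eval E := by
  induction e with
  | n => exact hS.n
  | pw => exact hS.pw
  | x => exact hS.x
  | pre => exact hS.pre
  | tot => exact hS.tot
  | c k => rfl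
  | len f => simp only [toExpr, Expr.eval, eval, hS.fld f (Nat.blt_eq.mp h)]
  | get f j =>
    simp only [check, Bool.and_eq_true] at h
    simp only [toExpr, Expr.eval, eval, hS.fld f (Nat.blt_eq.mp h.1)]
  | op o a b iha ihb =>
    simp only [check, Bool.and_eq_true] at h; simp only [toExpr, Expr.eval, eval, iha h.1, ihb h.2]

lemma toExpr_ok (hB : Big W B lam) (hE : E.Bounded B lam) (hF : F ≤ 23)
    (hS : NodeSt F q lam E st) {e : NE} (h : e.check F = true) (hs : e.size ≤ 24) :
    e.toExpr.ok W st := by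
  have hB1 := hB.le
  have hlt : ∀ e : NE, e.check F = true → e.size ≤ 24 → e.eval E < W := fun e h hs =>
    ((eval_le hB hE hF h).trans (Nat.pow_le_pow_right (by omega) hs)).trans_lt hB.lt
  induction e with
  | n | pw | x | pre | tot => have := hlt _ h hs; rw [← toExpr_eval hS h] at this; exact this
  | c k => exact hlt _ h hs
  | len f => have := hlt _ h hs; rw [← toExpr_eval hS h] at this; exact this
  | get f j =>
    simp only [check, Bool.and_eq_true] at h; have := Nat.le_of_ble_eq_true h.2.2
    have := hB.succ_lt; simp only [toExpr, ok]
    have : B ≤ B * B := Nat.le_mul_of_pos_right _ (by omega); omega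
  | op o a b iha ihb =>
    have h0 := h; simp only [check, Bool.and_eq_true] at h; have h1 := a.one_le_size
    have h2 := b.one_le_size; have hs' := hs; simp only [size] at hs
    refine ⟨iha h.1 (by omega), ihb h.2 (by omega), ?_⟩
    have := hlt _ h0 hs'; rw [← toExpr_eval hS h0] at this; exact this

lemma toExpr_wf (e : NE) : e.toExpr.wf vis := by
  induction e with
  | op o a b iha ihb => exact ⟨iha, ihb⟩
  | c | len | get => trivial
  | n | pw | x | pre | tot => simp [toExpr, wf, vis]

lemma toExpr_avoid {b : ℕ} (hb : b < aF ∨ aF + F ≤ b) {e : NE} (h : e.check F = true) :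
    e.toExpr.avoid b := by
  induction e with
  | op o a b iha ihb => simp only [check, Bool.and_eq_true] at h; exact ⟨iha h.1, ihb h.2⟩
  | len f => have := Nat.blt_eq.mp h; simp only [toExpr, Expr.avoid]; omega
  | get f j =>
    simp only [check, Bool.and_eq_true] at h; have := Nat.blt_eq.mp h.1; refine ⟨?_, trivial⟩; omega
  | n | pw | x | pre | tot | c => trivial

lemma check_of_good {e : NE} (h : e.good F = true) : e.check F = true := by
  simp only [good, Bool.and_eq_true] at h; exact h.1

lemma size_of_good {e : NE} (h : e.good F = true) : e.size ≤ 24 := by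
  simp only [good, Bool.and_eq_true] at h; exact Nat.le_of_ble_eq_true h.2

lemma toExpr_lt (hB : Big W B lam) (hE : E.Bounded B lam) (hF : F ≤ 23) {e : NE}
    (h : e.good F = true) : e.eval E < W :=
  ((eval_le hB hE hF (NE.check_of_good h)).trans
    (Nat.pow_le_pow_right (by have := hB.le; omega) (NE.size_of_good h))).trans_lt hB.lt

end NE

inductive Seg : Type
  | e (x : NE)
  | a (f : ℕ)

namespace Seg
def val (E : Env) : Seg → List ℕ
  | e x => [x.eval E]
  | a f => E.fld f
def toP : Seg → PSeg
  | e x => .e x.toExpr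
  | a f => .a (aF + f)
def good (F : ℕ) : Seg → Bool
  | e x => x.good F
  | a f => Nat.blt f F

lemma toP_val (hS : NodeSt F q lam E st) {s : Seg} (h : s.good F = true) :
    s.toP.val st = s.val E := by
  cases s with
  | e x => simp only [toP, PSeg.val, val, NE.toExpr_eval hS (NE.check_of_good h)]
  | a f => simp only [toP, PSeg.val, val, hS.fld f (Nat.blt_eq.mp h)]

lemma toP_ok {b : ℕ} (hB : Big W B lam) (hE : E.Bounded B lam) (hF : F ≤ 23)
    (hS : NodeSt F q lam E st) (hb : b < aF ∨ aF + F ≤ b) {s : Seg} (h : s.good F = true) :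
    s.toP.ok W lam b st := by
  cases s with
  | e x => exact ⟨x.toExpr_wf, x.toExpr_ok hB hE hF hS (NE.check_of_good h) (NE.size_of_good h), x.toExpr_avoid hb (NE.check_of_good h)⟩
  | a f =>
    have h1 := Nat.blt_eq.mp h; refine ⟨by omega, ?_⟩
    rw [hS.fld f h1]; exact (hE.len f (by omega)).le
end Seg

def segs (E : Env) (l : List Seg) : List ℕ := l.flatMap (Seg.val E)

lemma Tri.segs {b : ℕ} (hB : Big W B lam) (hE : E.Bounded B lam) (hF : F ≤ 23)
    (hS : NodeSt F q lam E st) (hb : b < aF ∨ aF + F ≤ b) (l : List Seg)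
    (hl : l.all (Seg.good F) = true) (h : Q (st.setA b (MPC.segs E l))) :
    Tri W vis (.comp (MPC.clearA b) (MPC.payloadA b (l.map Seg.toP))) st
      (1 + ((((l.map Seg.toP).map PSeg.cost).sum + 1) * (lam + 1))) Q := by
  rw [List.all_eq_true] at hl; have hS' : NodeSt F q lam E (st.setA b []) :=
    ⟨hS.n, hS.q, hS.lam, hS.pw, hS.x, hS.pre, hS.tot, fun f hf => by
      rw [setA_arr, if_neg (by omega), hS.fld f hf]⟩
  refine comp (Tri.clearA (Tri.payloadA hB.lam_lt _ ?_ ?_))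
  · intro s hs; obtain ⟨s', hs', rfl⟩ := mem_map.mp hs; exact Seg.toP_ok hB hE hF hS' hb (hl s' hs')
  · have : (l.map Seg.toP).flatMap (PSeg.val (st.setA b [])) = MPC.segs E l := by
      unfold MPC.segs; rw [List.flatMap_map]
      exact List.flatMap_congr fun s hs => by exact Seg.toP_val hS' (hl s hs)
    rw [St.setA_setA, setA_arr, if_pos rfl, List.nil_append, this]; exact h

def fires (E : Env) (gs : List NE) : Prop := ∀ g ∈ gs, g.eval E ≠ 0

instance (E : Env) (gs : List NE) : Decidable (fires E gs) :=
  inferInstanceAs (Decidable (∀ g ∈ gs, g.eval E ≠ 0))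

@[simp] lemma fires_nil (E : Env) : fires E [] ↔ True := by simp [fires]
@[simp] lemma fires_cons (E : Env) (g : NE) (gs : List NE) :
    fires E (g :: gs) ↔ g.eval E ≠ 0 ∧ fires E gs := by simp [fires]

def guardP : List NE → Prog → Prog
  | [], p => p
  | g :: gs, p => ifE g.toExpr (guardP gs p) skip

lemma Tri.guardP (hB : Big W B lam) (hE : E.Bounded B lam) (hF : F ≤ 23)
    (hS : NodeSt F q lam E st) (gs : List NE) (hg : gs.all (NE.good F) = true) {p : Prog}
    (h1 : fires E gs → Tri W vis p st T Q) (h2 : ¬ fires E gs → Q st) :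
    Tri W vis (MPC.guardP gs p) st ((gs.map fun g => g.toExpr.cost + 1).sum + 1 + T) Q := by
  induction gs with
  | nil => exact (h1 (by simp)).le (by simp)
  | cons g gs ih =>
    simp only [List.all_cons, Bool.and_eq_true] at hg
    have e1 := NE.toExpr_eval hS (NE.check_of_good hg.1)
    refine (Tri.ifE (hwf := g.toExpr_wf) (T := (gs.map fun g => g.toExpr.cost + 1).sum + 1 + T)
      (NE.toExpr_ok hB hE hF hS (NE.check_of_good hg.1) (NE.size_of_good hg.1)) (fun h => ?_)
      fun h => ?_).le (by simp only [map_cons, sum_cons]; omega)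
    · rw [e1] at h; exact ih hg.2 (fun hf => h1 (by simp [h, hf])) fun hf => h2 (by simp [hf])
    · rw [e1] at h; exact (skip (h2 (by simp [h]))).le (by omega)

structure Rule where
  guards : List NE
  target : NE
  field : ℕ
  payload : List Seg

namespace Rule

def emit (E : Env) (r : Rule) : List (ℕ × ℕ × List ℕ) :=
  if fires E r.guards then [(r.target.eval E, r.field, segs E r.payload)] else []

def good (r : Rule) : Bool :=
  r.guards.all (NE.good 23) && (r.target.good 23 && (Nat.ble 1 r.field && (Nat.blt r.field nf &&
    r.payload.all (Seg.good 23))))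

def prog (r : Rule) : Prog :=
  guardP r.guards (.comp (.comp (clearA aP) (payloadA aP (r.payload.map Seg.toP)))
    (emitP r.target.toExpr r.field))

def cost (r : Rule) : ℕ := (r.guards.map fun g => g.toExpr.cost + 1).sum + 1 +
    (1 + (((r.payload.map Seg.toP).map PSeg.cost).sum + 1)) + (2 * r.target.toExpr.cost + 100)

end Rule

def Keep (N : ℕ) (st st' : St) : Prop :=
  (∀ r < vis, st'.reg r = st.reg r) ∧ ∀ a < N, a ≠ aP → st'.arr a = st.arr a

lemma Keep.refl (N : ℕ) (st : St) : Keep N st st := ⟨fun _ _ => rfl, fun _ _ _ => rfl⟩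

lemma Keep.trans {N : ℕ} {st st' st'' : St} (h : Keep N st st') (h' : Keep N st' st'') :
    Keep N st st'' :=
  ⟨fun r hr => (h'.1 r hr).trans (h.1 r hr), fun a ha h1 => (h'.2 a ha h1).trans (h.2 a ha h1)⟩

lemma NodeSt.keep {N : ℕ} {st' : St} (hS : NodeSt F q lam E st) (h : Keep N st st')
    (hN : aF + F ≤ N) : NodeSt F q lam E st' :=
  ⟨(h.1 2 (by decide)).trans hS.n, (h.1 6 (by decide)).trans hS.q, (h.1 7 (by decide)).trans hS.lam,
    (h.1 8 (by decide)).trans hS.pw, (h.1 10 (by decide)).trans hS.x,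
    (h.1 11 (by decide)).trans hS.pre, (h.1 12 (by decide)).trans hS.tot,
    fun f hf => (h.2 _ (by omega) (by unfold aF aP; omega)).trans (hS.fld f hf)⟩

lemma Tri.rule (hfit : Fit W q lam) (hB : Big W B lam) (hE : E.Bounded B lam)
    (hS : NodeSt 23 q lam E st) {r : Rule} (hr : r.good = true)
    (hlen : fires E r.guards → (MPC.segs E r.payload).length < lam)
    (h : ∀ st', Keep 29 st st' →
      st'.out = st.out ++ enc2 ((r.emit E).flatMap (emitMsgs q lam)) → Q st') :
    Tri W vis r.prog st (r.cost * (lam + 1)) Q := by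
  have ht := le_mul_succ lam (r.guards.map fun g => g.toExpr.cost + 1).sum
  simp only [Rule.good, Bool.and_eq_true] at hr; obtain ⟨h1, h2, h3, h4, h5⟩ := hr
  refine (Tri.guardP (T := 1 + ((((r.payload.map Seg.toP).map PSeg.cost).sum + 1) * (lam + 1)) +
    (2 * r.target.toExpr.cost + 100) * (lam + 1)) hB hE le_rfl hS _ h1 (fun hf => ?_)
      fun hf => ?_).le ?_
  · refine comp (Tri.segs hB hE le_rfl hS (Or.inl (show aP < aF by decide)) _ h5 ?_)
    have e1 : r.target.toExpr.eval (st.setA aP (MPC.segs E r.payload)) = r.target.eval E := by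
      rw [Expr.eval_setA (NE.toExpr_avoid (Or.inl (show aP < aF by decide)) (NE.check_of_good h2)),
        NE.toExpr_eval hS (NE.check_of_good h2)]
    refine Tri.emitP hfit (Nat.blt_eq.mp h4) hS.q hS.lam r.target.toExpr_wf
      (Expr.ok_setA (NE.toExpr_avoid (Or.inl (show aP < aF by decide)) (NE.check_of_good h2))
        (NE.toExpr_ok hB hE le_rfl hS (NE.check_of_good h2) (NE.size_of_good h2))) ?_ ?_ ?_
    · rw [e1]; exact NE.toExpr_lt hB hE le_rfl h2
    · simpa using hlen hf
    · refine h _ ⟨fun _ _ => rfl, fun a _ ha => by simp [ha]⟩ ?_; rw [e1]; simp [Rule.emit, hf]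
  · exact h _ (Keep.refl _ _) (by simp [Rule.emit, hf])
  · simp only [Rule.cost]; nlinarith

structure Call where
  guards : List NE
  prog : Prog
  ins : List (List Seg)

/-- The program of a node: a call (if its guards hold), the rules for the emissions, and the value
that is added up over all nodes. -/
structure NodeProg where
  call : Call
  rules : List Rule
  cv : NE

def loadIns : ℕ → List (List Seg) → Prog
  | _, [] => skip
  | a, l :: ls => .comp (.comp (clearA (aC + a)) (payloadA (aC + a) (l.map Seg.toP)))
      (loadIns (a + 1) ls)

def loadInsCost (l : List (List Seg)) : ℕ :=
  (l.map fun l => 1 + (((l.map Seg.toP).map PSeg.cost).sum + 1)).sum + 1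

lemma Tri.loadIns (hB : Big W B lam) (hE : E.Bounded B lam)
    (hS : NodeSt 22 q lam E st) (k : ℕ) (ls : List (List Seg))
    (hl : ls.all (fun l => l.all (Seg.good 22)) = true)
    (h : ∀ st', Keep (aC + k) st st' → st'.out = st.out →
      (∀ a < ls.length, st'.arr (aC + (k + a)) = (ls.map (MPC.segs E)).getD a []) → Q st') :
    Tri W vis (MPC.loadIns k ls) st (loadInsCost ls * (lam + 1)) Q := by
  induction ls generalizing k st with
  | nil => exact (skip (h _ (Keep.refl _ _) rfl (by simp))).le (by simp [loadInsCost])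
  | cons l ls ih =>
    simp only [List.all_cons, Bool.and_eq_true] at hl
    refine (comp (Tri.segs hB hE (by omega) hS (b := aC + k) (Or.inr (by unfold aF aC; omega)) l hl.1
      (ih (?_ : NodeSt 22 q lam E (st.setA (aC + k) (MPC.segs E l))) (k + 1) hl.2 ?_))).le ?_
    · refine hS.keep (N := aC + k) ⟨fun _ _ => rfl, fun a ha _ => ?_⟩ (by unfold aF aC; omega)
      rw [setA_arr, if_neg (by omega)]
    · intro st' hk ho hv; refine h st' ⟨hk.1, fun a ha h1 => ?_⟩ ho fun a ha => ?_
      · rw [hk.2 a (by omega) h1, setA_arr, if_neg (by omega)]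
      · cases a with
        | zero => have := hk.2 (aC + k) (by omega) (by unfold aC aP; omega); simpa using this
        | succ a =>
          have := hv a (by simpa using ha); rw [show k + (a + 1) = k + 1 + a by omega, this]; simp
    · simp only [loadInsCost, map_cons, sum_cons]; nlinarith

namespace Call

def good (c : Call) : Bool := c.guards.all (NE.good 22) && c.ins.all (fun l => l.all (Seg.good 22))

def code (c : Call) : Prog :=
  .comp (clearA aC) (guardP c.guards (.comp (loadIns 0 c.ins) (callP c.prog c.ins.length)))

def Result (W t : ℕ) (E : Env) (c : Call) (R : List ℕ) : Prop :=
  (fires E c.guards → c.prog.Computes W (c.ins.map (segs E)) R t) ∧ (¬ fires E c.guards → R = [])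

def cost (c : Call) : ℕ :=
  1 + (c.guards.map fun g => g.toExpr.cost + 1).sum + 1 + loadInsCost c.ins + 2 * c.prog.bound + 4

end Call

lemma Tri.callP_vis {p : Prog} (hseq : p.IsSequential) {xs : List (List ℕ)} {y : List ℕ} {t : ℕ}
    (hp : p.Computes W xs y t) (hin : ∀ a < xs.length, st.arr (aC + a) = xs.getD a [])
    (h : ∀ A : ℕ → List ℕ, (∀ a < aC, A a = st.arr a) → A aC = y → Q { st with arr := A }) :
    Tri W vis (MPC.callP p xs.length) st (2 * p.bound + 4 + t) Q := by
  refine Tri.hide (V := tmp) (by decide) fun ρ hρ => ?_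
  refine Tri.callP hseq hp hin fun A h1 h2 => ?_
  exact ⟨{ st with arr := A }, fun r hr => (hρ r hr).symm, rfl, rfl, h A h1 h2⟩

lemma Tri.call (hB : Big W B lam) (hE : E.Bounded B lam)
    (hS : NodeSt 22 q lam E st) {c : Call} (hc : c.good = true) (hseq : c.prog.IsSequential)
    {R : List ℕ} {t : ℕ} (hR : c.Result W t E R)
    (h : ∀ st', Keep aC st st' → st'.out = st.out → st'.arr aC = R → Q st') :
    Tri W vis c.code st (c.cost * (lam + 1) + t) Q := by
  have ht := le_mul_succ lam (c.guards.map fun g => g.toExpr.cost + 1).sum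
  have ht' := le_mul_succ lam c.prog.bound; simp only [Call.good, Bool.and_eq_true] at hc
  have hK : Keep aC st (st.setA aC []) :=
    ⟨fun _ _ => rfl, fun a ha _ => by rw [setA_arr, if_neg (by omega)]⟩
  have hS' := hS.keep hK (by decide); refine (comp (Tri.clearA (Tri.guardP
    (T := loadInsCost c.ins * (lam + 1) + (2 * c.prog.bound + 4 + t)) hB hE (by omega) hS' _ hc.1
    (fun hf => ?_) fun hf => ?_))).le ?_
  · refine comp (Tri.loadIns hB hE hS' 0 _ hc.2 fun st1 hk ho hv => ?_)
    have := Tri.callP_vis (W := W) (st := st1) (Q := Q) hseq (hR.1 hf) (fun a ha => by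
      have := hv a (by simpa using ha)
      rwa [Nat.zero_add] at this) (fun A h1 h2 => h _ (hK.trans ⟨hk.1, fun a ha hh => ?_⟩) ho h2)
    · simpa using this
    · rw [← hk.2 a (by omega) hh]; exact h1 a ha
  · exact h _ hK rfl (by simpa using (hR.2 hf).symm)
  · simp only [Call.cost]; nlinarith

def Env.withR (E : Env) (R : List ℕ) : Env :=
  { E with fld := fun f => if f = 22 then R else E.fld f }

def rulesP : List Rule → Prog
  | [] => skip
  | r :: rs => .comp r.prog (rulesP rs)

lemma Tri.rules (hfit : Fit W q lam) (hB : Big W B lam) (hE : E.Bounded B lam)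
    (hS : NodeSt 23 q lam E st) (rs : List Rule) (hr : rs.all Rule.good = true)
    (hlen : ∀ r ∈ rs, fires E r.guards → (MPC.segs E r.payload).length < lam)
    (h : ∀ st', Keep 29 st st' →
      st'.out = st.out ++ enc2 ((rs.flatMap (Rule.emit E)).flatMap (emitMsgs q lam)) → Q st') :
    Tri W vis (rulesP rs) st (((rs.map Rule.cost).sum + 1) * (lam + 1)) Q := by
  induction rs generalizing st with
  | nil => exact (skip (h _ (Keep.refl _ _) (by simp))).le (by simp)
  | cons r rs ih =>
    simp only [List.all_cons, Bool.and_eq_true] at hr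
    refine (comp (Tri.rule hfit hB hE hS hr.1 (hlen r (by simp)) fun st1 hk ho =>
      ih (hS.keep hk (by decide)) hr.2 (fun r' h' => hlen r' (by simp [h'])) fun st2 hk2 ho2 =>
        h st2 (hk.trans hk2) ?_)).le ?_
    · rw [ho2, ho]; simp
    · simp only [map_cons, sum_cons]; nlinarith

namespace NodeProg

def good (p : NodeProg) : Bool := p.call.good && (p.rules.all Rule.good && p.cv.good 23)

def emits (E : Env) (p : NodeProg) : List (ℕ × ℕ × List ℕ) :=
  p.rules.flatMap (Rule.emit E) ++ [(E.x, 0, [p.cv.eval E])]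

def code (p : NodeProg) : Prog :=
  .comp p.call.code (.comp (rulesP p.rules) (.comp (assign 14 p.cv.toExpr) (.comp
    (.comp (clearA aP) (payloadA aP [.e (.r 14)])) (emitP (.r 10) 0))))

def cost (p : NodeProg) : ℕ := p.call.cost + (p.rules.map Rule.cost).sum + p.cv.toExpr.cost + 200

end NodeProg

lemma Env.Bounded.withR (hE : E.Bounded B lam) {R : List ℕ} (hR : R.length < lam) :
    (E.withR R).Bounded B lam := by
  refine ⟨hE.n_le, hE.pw_le, hE.x_le, hE.pre_le, hE.tot_le, fun f hf => ?_, fun f hf hp => ?_⟩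
  · simp only [Env.withR]; split_ifs
    · exact hR
    · exact hE.len f hf
  · simp only [Env.withR]; split_ifs with h
    · subst h; simp [isPtr] at hp
    · exact hE.ptr f hf hp

lemma Tri.node (hfit : Fit W q lam) (hB : Big W B lam) (hE : E.Bounded B lam)
    (hS : NodeSt 22 q lam E st) {p : NodeProg} (hp : p.good = true)
    (hseq : p.call.prog.IsSequential) {R : List ℕ} {t : ℕ} (hR : p.call.Result W t E R)
    (hRl : R.length < lam) (hlam : 1 < lam)
    (hlen : ∀ r ∈ p.rules, fires (E.withR R) r.guards →
      (MPC.segs (E.withR R) r.payload).length < lam)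
    (h : ∀ st', (∀ r < vis, r ≠ 14 → st'.reg r = st.reg r) →
      st'.reg 14 = p.cv.eval (E.withR R) → (∀ a < aC, a ≠ aP → st'.arr a = st.arr a) →
      st'.out = st.out ++ enc2 ((p.emits (E.withR R)).flatMap (emitMsgs q lam)) → Q st') :
    Tri W vis p.code st (p.cost * (lam + 1) + t) Q := by
  simp only [NodeProg.good, Bool.and_eq_true] at hp; obtain ⟨h1, h2, h3⟩ := hp
  have hE' := hE.withR hRl; refine (comp (Tri.call hB hE hS h1 hseq hR fun s1 k1 o1 v1 => comp
    (T := ((p.rules.map Rule.cost).sum + 1) * (lam + 1))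
    (T' := p.cv.toExpr.cost + 2 + ((1 + 4) * (lam + 1) + 1 + 104 * (lam + 1))) ?_)).le ?_
  · have hS1 : NodeSt 23 q lam (E.withR R) s1 := by
      have := hS.keep k1 (by decide)
      refine ⟨this.n, this.q, this.lam, this.pw, this.x, this.pre, this.tot, fun f hf => ?_⟩
      simp only [Env.withR]; split_ifs with h
      · subst h; exact v1
      · exact this.fld f (by omega)
    refine Tri.rules hfit hB hE' hS1 _ h2 hlen fun s2 k2 o2 => ?_
    have hS2 := hS1.keep k2 (by decide)
    have ev := NE.toExpr_eval hS2 (NE.check_of_good h3); have elt := NE.toExpr_lt hB hE' le_rfl h3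
    refine comp (assign
      (NE.toExpr_ok hB hE' le_rfl hS2 (NE.check_of_good h3) (NE.size_of_good h3)) (by rwa [ev]) ?_
      (hwf := p.cv.toExpr_wf)); rw [ev]; refine comp (T := (1 + 4) * (lam + 1) + 1) ?_
    refine le (T := 1 + (([PSeg.e (.r 14)].map PSeg.cost).sum + 1) * (lam + 1))
      (comp (Tri.clearA (Tri.payloadA (lam := lam) hB.lam_lt [.e (.r 14)] ?_ ?_))) (by
        simp only [map_cons, List.map_nil, sum_cons, List.sum_nil, PSeg.cost, cost]; omega)
    · intro s hs; simp only [mem_singleton] at hs; subst hs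
      exact ⟨by simp [wf, vis], by simpa [ok] using elt, trivial⟩
    · have hx := hS2.x; refine (Tri.emitP hfit (by decide) ?_ ?_ (by simp [wf, vis]) ?_ ?_ ?_ ?_).le
        (T := (2 * (Expr.r 10).cost + 100) * (lam + 1)) (by simp [cost])
      · simpa using hS2.q
      · simpa using hS2.lam
      · have := hE'.x_le; have := hB.succ_lt; have := hB.le; simp [ok, hx]; nlinarith
      · have := hE'.x_le; have := hB.succ_lt; have := hB.le; simp [eval, hx]; nlinarith
      · simpa [PSeg.val] using hlam
      · refine h _ ?_ ?_ ?_ ?_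
        · intro r hr hr14; simp only [addOut_reg, setA_reg, setR_reg, if_neg hr14]
          rw [k2.1 r hr, k1.1 r hr]
        · simp
        · intro a ha haP; simp only [St.addOut_arr, setA_arr, if_neg haP, setR_arr]
          rw [k2.2 a (by unfold aC at ha; omega) haP, k1.2 a ha haP]
        · simp [o2, o1, NodeProg.emits, eval, PSeg.val, hx]
  · simp only [NodeProg.cost]; nlinarith

end

open NodeProg (emits)

abbrev Fields := ℕ → ℕ → List ℕ

/-! ## One round of one machine of a virtual network -/

def hd (l : List ℕ) : ℕ := l.getD 0 0

def Chg (rs as : List ℕ) (st st' : St) : Prop :=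
  (∀ r < vis, r ∉ rs → st'.reg r = st.reg r) ∧ ∀ a < 5, a ∉ as → st'.arr a = st.arr a

lemma Chg.refl (rs as : List ℕ) (st : St) : Chg rs as st st := ⟨fun _ _ _ => rfl, fun _ _ _ => rfl⟩

lemma Chg.reg {rs as : List ℕ} {s s' : St} (h : Chg rs as s s') {r v : ℕ} (e : s.reg r = v)
    (hr : r < vis := by decide) (hn : r ∉ rs := by decide) : s'.reg r = v := (h.1 r hr hn).trans e

lemma Chg.arr {rs as : List ℕ} {s s' : St} (h : Chg rs as s s') {a : ℕ} {l : List ℕ}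
    (e : s.arr a = l) (ha : a < 5 := by decide) (hn : a ∉ as := by decide) : s'.arr a = l :=
  (h.2 a ha hn).trans e

lemma Chg.trans {rs as rs' as' : List ℕ} {s s' s'' : St} (h : Chg rs as s s')
    (h' : Chg rs' as' s' s'') : Chg (rs ++ rs') (as ++ as') s s'' :=
  ⟨fun r hr hn => by
    simp only [mem_append, not_or] at hn; exact (h'.1 r hr hn.2).trans (h.1 r hr hn.1),
  fun r hr hn => by
    simp only [mem_append, not_or] at hn; exact (h'.2 r hr hn.2).trans (h.2 r hr hn.1)⟩

lemma Chg.mono {rs as rs' as' : List ℕ} {s s' : St} (h : Chg rs as s s')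
    (h1 : rs ⊆ rs') (h2 : as ⊆ as') : Chg rs' as' s s' :=
  ⟨fun r hr hn => h.1 r hr fun hh => hn (h1 hh), fun r hr hn => h.2 r hr fun hh => hn (h2 hh)⟩

def pairs (M : List (ℕ × ℕ)) : List ℕ := M.flatMap fun p => [p.1, p.2]

lemma length_pairs (M : List (ℕ × ℕ)) : (pairs M).length = 2 * M.length := by
  induction M with
  | nil => rfl
  | cons p M ih => simp only [pairs, flatMap_cons, length_append] at *; simp [ih]; omega

lemma getD_pairs (M : List (ℕ × ℕ)) (i : ℕ) (hi : i < M.length) :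
    (pairs M).getD (2 * i) 0 = M[i].1 ∧ (pairs M).getD (2 * i + 1) 0 = M[i].2 := by
  induction M generalizing i with
  | nil => simp at hi
  | cons p M ih =>
    cases i with
    | zero => simp [pairs]
    | succ i =>
      have := ih i (by simpa using hi); simp only [pairs, flatMap_cons] at this ⊢
      rw [show 2 * (i + 1) + 1 = (2 * i + 1) + 1 + 1 by omega,
        show 2 * (i + 1) = 2 * i + 1 + 1 by omega]; simpa using this

def writes (l : List ℕ) (M : List (ℕ × ℕ)) : List ℕ := M.foldl (fun l p => l.set p.1 p.2) l

lemma length_writes (l : List ℕ) (M : List (ℕ × ℕ)) : (writes l M).length = l.length := by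
  unfold writes
  induction M generalizing l with
  | nil => rfl
  | cons p M ih => simp only [List.foldl_cons, ih]; simp

/-- `M` describes the memory with the words `f 0, …, f (N - 1)`: the words that are not `0` are
listed in `M`, and all pairs in `M` are correct. -/
def Describes (N : ℕ) (f : ℕ → ℕ) (M : List (ℕ × ℕ)) : Prop :=
  (∀ p ∈ M, p.2 = f p.1) ∧ ∀ a < N, f a ≠ 0 → (a, f a) ∈ M

lemma writes_eq {N : ℕ} {f : ℕ → ℕ} {M : List (ℕ × ℕ)} (h : Describes N f M) :
    writes (List.replicate N 0) M = (List.range N).map f := by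
  have key : ∀ (M : List (ℕ × ℕ)) (l : List ℕ) (a : ℕ), (∀ p ∈ M, p.2 = f p.1) → a < l.length →
      (writes l M).getD a 0 = if a ∈ M.map Prod.fst then f a else l.getD a 0 := by
    intro M
    induction M with
    | nil => intro l a _ _; simp [writes]
    | cons p M ih =>
      intro l a hM ha; have h1 : writes l (p :: M) = writes (l.set p.1 p.2) M := rfl
      rw [h1, ih _ a (fun p hp => hM p (by simp [hp])) (by simpa using ha)]
      by_cases hpa : a ∈ M.map Prod.fst
      · rw [if_pos hpa, if_pos (by simp only [map_cons, mem_cons]; exact Or.inr hpa)]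
      · rw [if_neg hpa]; by_cases hp : a = p.1
        · rw [if_pos (by simp [hp]), hp, ← hM p (by simp)]
          subst hp; simp [getD_eq_getElem?_getD, ha]
        · rw [if_neg (by simp only [map_cons, mem_cons, not_or]; exact ⟨hp, hpa⟩)]
          simp only [getD_eq_getElem?_getD]; rw [List.getElem?_set_ne (Ne.symm hp)]
  refine List.ext_getElem (by simp [length_writes]) fun a h1 h2 => ?_
  have haN : a < N := by simpa using h2
  have := key M (List.replicate N 0) a h.1 (by simpa using haN)
  rw [getD_eq_getElem _ _ h1] at this; rw [this]
  simp only [List.getElem_map, List.getElem_range]; split_ifs with hm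
  · rfl
  · have h0 : f a = 0 := by by_contra h0; exact hm (mem_map.mpr ⟨_, h.2 a haN h0, rfl⟩)
    rw [h0]; simp [getD_eq_getElem?_getD, haN]

lemma getD_map_range (N a : ℕ) (f : ℕ → ℕ) (h : a < N) : ((List.range N).map f).getD a 0 = f a := by
  rw [getD_eq_getElem _ _ (by simpa using h)]; simp

def cnt (q : ℕ) (Γ : Fields) (k : ℕ) : ℕ := ∑ i ∈ range q, hd (Γ (k * q + i) 0)

def memOf (q lam : ℕ) (Γ : Fields) (j a : ℕ) : ℕ := if a < q * nf * lam then
    if a % lam = 0 then (Γ (j * q + a / lam / nf) (a / lam % nf)).length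
    else (Γ (j * q + a / lam / nf) (a / lam % nf)).getD (a % lam - 1) 0
  else cnt q Γ (a - q * nf * lam)

lemma memOf_addr {q lam i f o : ℕ} (Γ : Fields) (j : ℕ) (hi : i < q) (hf : f < nf)
    (ho : o < lam) : memOf q lam Γ j ((i * nf + f) * lam + o) =
      if o = 0 then (Γ (j * q + i) f).length else (Γ (j * q + i) f).getD (o - 1) 0 := by
  have h1 : i * nf + f + 1 ≤ q * nf := by nlinarith
  have h2 : (i * nf + f + 1) * lam ≤ q * nf * lam := Nat.mul_le_mul_right _ h1
  have hlt : (i * nf + f) * lam + o < q * nf * lam := by nlinarith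
  have hd1 : ((i * nf + f) * lam + o) / lam = i * nf + f := by
    rw [mul_comm, Nat.mul_add_div (by omega), Nat.div_eq_of_lt ho, Nat.add_zero]
  have hm1 : ((i * nf + f) * lam + o) % lam = o := by
    rw [mul_comm, Nat.mul_add_mod, Nat.mod_eq_of_lt ho]
  have hd2 : (i * nf + f) / nf = i := by
    rw [mul_comm, Nat.mul_add_div (by decide), Nat.div_eq_of_lt hf, Nat.add_zero]
  have hm2 : (i * nf + f) % nf = f := by rw [mul_comm, Nat.mul_add_mod, Nat.mod_eq_of_lt hf]
  unfold memOf; rw [if_pos hlt, hd1, hm1, hd2, hm2]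

lemma storedAt_memOf {q lam m i f : ℕ} (Γ : Fields) (j : ℕ) (hi : i < q) (hf : f < nf)
    (hl : (Γ (j * q + i) f).length < lam) :
    StoredAt ((List.range (q * nf * lam + m)).map (memOf q lam Γ j)) ((i * nf + f) * lam)
      (Γ (j * q + i) f) := by
  have h1 : i * nf + f + 1 ≤ q * nf := by nlinarith
  have h2 : (i * nf + f + 1) * lam ≤ q * nf * lam := Nat.mul_le_mul_right _ h1
  have h3 : (i * nf + f) * lam + lam ≤ q * nf * lam := by nlinarith
  constructor
  · rw [getD_map_range _ _ _ (by omega : (i * nf + f) * lam < q * nf * lam + m)]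
    have := memOf_addr (lam := lam) Γ j hi hf (o := 0) (by omega); simpa using this
  · intro o ho; rw [getD_map_range _ _ _ (by omega : (i * nf + f) * lam + 1 + o < q * nf * lam + m),
      show (i * nf + f) * lam + 1 + o =
      (i * nf + f) * lam + (o + 1) by omega, memOf_addr Γ j hi hf (o := o + 1) (by omega)]; simp

structure Sizes (W B m q lam : ℕ) : Prop where
  fit : Fit W q lam
  big : Big W B lam
  one_lt : 1 < lam
  m_pos : 0 < m
  le : q * nf * lam + m + m * q ≤ B

section
variable {W B m n q lam : ℕ} {st : St} {Q : St → Prop} {T : ℕ}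

lemma Sizes.lt (h : Sizes W B m q lam) : 16 * B + 16 ≤ W := by
  have h1 := h.big.le; have h2 := h.big.lt
  have : B ^ 3 ≤ B ^ 24 := Nat.pow_le_pow_right (by omega) (by norm_num)
  have : 16 * 16 * B ≤ B ^ 3 := by
    have : B ^ 3 = B * B * B := by ring
    rw [this]; exact Nat.mul_le_mul (Nat.mul_le_mul h1 h1) le_rfl
  omega

def fillQ : Prog := .comp (clearA aQ) (.comp
    (forE 9 (.op .add (.op .mul (.op .mul (.r 6) (.c nf)) (.r 7)) (.r 1)) (pushE aQ (.c 0)))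
    (forE 9 (.op .div (.len 0) (.c 2)) (setE aQ (.get 0 (.op .mul (.c 2) (.r 9)))
      (.get 0 (.op .add (.op .mul (.c 2) (.r 9)) (.c 1))))))

lemma Tri.fillQ (hs : Sizes W B m q lam) (h1 : st.reg 1 = m) (h6 : st.reg 6 = q)
    (h7 : st.reg 7 = lam) {M : List (ℕ × ℕ)} (hM : st.arr 0 = pairs M)
    (hMW : 2 * M.length + 4 ≤ W) {f : ℕ → ℕ} (hf : Describes (q * nf * lam + m) f M)
    (h : ∀ st', Chg [9] [aQ] st st' → st'.out = st.out →
      st'.arr aQ = (List.range (q * nf * lam + m)).map f → Q st') :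
    Tri W vis MPC.fillQ st ((q * nf * lam + m + M.length + 2) * 40) Q := by
  have hW := hs.lt; have hle := hs.le
  have hq : q ≤ B := by have : q ≤ m * q := Nat.le_mul_of_pos_left _ hs.m_pos; omega
  have hlam := hs.big.lam; have hB := hs.big.le; set N := q * nf * lam + m with hN
  have hqn : q * nf ≤ q * nf * lam := Nat.le_mul_of_pos_right _ hs.fit.lam_pos; unfold MPC.fillQ
  refine le (comp (Tri.clearA (comp (T' := (M.length + 1) * (13 + 3 + 12))
    (Tri.forE (N := N) (T := 2) (by decide)
    (fun k s => Chg [9] [aQ] st s ∧ s.out = st.out ∧ s.arr aQ = List.replicate k 0)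
    (by decide) ⟨⟨⟨by simp [wf, vis], trivial⟩, by simp [wf, vis]⟩, by simp [wf, vis]⟩
    (by omega) ?_ ?_ ?_ ?_)))) ?_
  · refine ⟨⟨fun r hr hn => ?_, fun a ha hn => ?_⟩, rfl, by simp⟩
    · simp only [mem_singleton] at hn; simp [hn]
    · simp only [mem_singleton] at hn; simp [hn]
  · rintro k hk s ⟨⟨hc, -⟩, -, -⟩ hr; have e1 := (hc 1 (by decide) (by decide)).trans h1
    have e6 := (hc 6 (by decide) (by decide)).trans h6
    have e7 := (hc 7 (by decide) (by decide)).trans h7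
    simp only [ok, eval, Op.eval, e1, e6, e7]; have : nf = 22 := rfl
    refine ⟨⟨⟨⟨by omega, by omega, by omega⟩, by omega, by omega⟩, by omega, by omega⟩, rfl⟩
  · rintro k hk s ⟨hc, ho, hv⟩ hr
    refine Tri.pushE (by simp only [ok]; omega) ⟨by simpa using hr, ?_, ?_, ?_⟩
    · refine ⟨fun r hr' hn => ?_, fun a ha hn => ?_⟩
      · rw [← hc.1 r hr' hn]; simp only [mem_singleton] at hn; simp [hn]
      · rw [← hc.2 a ha hn]; simp only [mem_singleton] at hn; simp [hn]
    · simpa using ho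
    · simp [hv, eval, List.replicate_succ']
  · rintro s ⟨hc, ho, hv⟩ hr; have e0 := hc.arr hM
    refine Tri.forE (N := M.length) (T := 13) (by decide)
      (fun k s => Chg [9] [aQ] st s ∧ s.out = st.out ∧
        s.arr aQ = writes (List.replicate N 0) (M.take k))
      (by decide) ⟨trivial, trivial⟩ (by omega) ?_ ?_ ?_ ?_
    · refine ⟨⟨fun r hr' hn => ?_, fun a ha hn => ?_⟩, ho, by simpa [writes] using hv⟩
      · rw [← hc.1 r hr' hn]; simp only [mem_singleton] at hn; simp [hn]
      · rw [← hc.2 a ha hn]; simp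
    · rintro k hk s' ⟨hc', -, -⟩ hr'; have e0 := hc'.arr hM
      simp only [ok, eval, Op.eval, e0, length_pairs]
      refine ⟨⟨by omega, by omega, by omega⟩, by omega⟩
    · rintro k hk s' ⟨hc', ho', hv'⟩ hr'; have e0 := hc'.arr hM
      refine le (Tri.setE ?_ ?_ ?_) (by simp [cost])
      · simp only [ok, eval, Op.eval, hr']; refine ⟨by omega, by omega, by omega⟩
      · simp only [ok, eval, Op.eval, hr']
        refine ⟨⟨by omega, by omega, by omega⟩, by omega, by omega⟩
      · obtain ⟨g1, g2⟩ := getD_pairs M k hk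
        refine ⟨by simpa using hr', ⟨fun r hr'' hn => ?_, fun a ha hn => ?_⟩, by simpa using ho', ?_⟩
        · rw [← hc'.1 r hr'' hn]; simp only [mem_singleton] at hn; simp [hn]
        · rw [← hc'.2 a ha hn]; simp only [mem_singleton] at hn; simp [hn]
        · simp only [setR_arr, setA_arr, if_pos, eval, Op.eval, hr', e0, g1, g2, hv']
          rw [take_add_one, List.getElem?_eq_getElem hk]
          simp only [writes, List.foldl_append, Option.toList, List.foldl_cons, List.foldl_nil]
    · rintro s' ⟨hc', ho', hv'⟩ hr'; refine h s' hc' ho' ?_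
      rw [hv', List.take_length, writes_eq hf]
  · simp only [cost]; nlinarith

lemma Chg.setR {rs as : List ℕ} {s s' : St} (h : Chg rs as s s') {r : ℕ} (v : ℕ) (hr : r ∈ rs) :
    Chg rs as s (s'.setR r v) :=
  ⟨fun r' hr' hn => by rw [setR_reg, if_neg (by rintro rfl; exact hn hr)]; exact h.1 r' hr' hn, h.2⟩

def sumQ (d : ℕ) (e : Expr) : Prog := .comp (assign d (.c 0)) (forE 9 e (assign d (.op .add (.r d)
    (.get aQ (.op .add (.op .mul (.op .mul (.r 6) (.c nf)) (.r 7)) (.r 9))))))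

lemma Tri.sumQ (hs : Sizes W B m q lam) (h6 : st.reg 6 = q)
    (h7 : st.reg 7 = lam) {d i N : ℕ} (hi : i < vis) (hd : d < vis) (hd9 : d ≠ 9) (hd6 : d ≠ 6)
    (hd7 : d ≠ 7) (hdi : d ≠ i) (hi9 : i ≠ 9) (hN : st.reg i = N) (hNm : N ≤ m) {f : ℕ → ℕ}
    (hQ : st.arr aQ = (List.range (q * nf * lam + m)).map f)
    (hf : ∑ k ∈ range N, f (q * nf * lam + k) ≤ B)
    (h : ∀ st', Chg [9, d] [] st st' → st'.out = st.out →
      st'.reg d = ∑ k ∈ range N, f (q * nf * lam + k) → Q st') :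
    Tri W vis (MPC.sumQ d (.r i)) st ((N + 1) * 40) Q := by
  have hW := hs.lt; have hle := hs.le; have hB := hs.big.le; have hlam := hs.big.lam
  have hq : q ≤ B := by have : q ≤ m * q := Nat.le_mul_of_pos_left _ hs.m_pos; omega
  have hqn : q * nf ≤ q * nf * lam := Nat.le_mul_of_pos_right _ hs.fit.lam_pos
  have hnf : nf = 22 := rfl
  have hmono : ∀ k ≤ N, ∑ k ∈ range k, f (q * nf * lam + k) ≤ B := fun k hk =>
    (Finset.sum_le_sum_of_subset (Finset.range_mono hk)).trans hf; unfold MPC.sumQ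
  refine le (comp (assign (by simp only [ok]; omega)
    (by simp only [eval]; omega) (Tri.forE (N := N) (T := 17) (by decide)
      (fun k s => Chg [9, d] [] st s ∧ s.out = st.out ∧
        s.reg d = ∑ k ∈ range k, f (q * nf * lam + k)) (by decide) hi
      (by omega) ?_ ?_ ?_ ?_))) ?_
  · exact ⟨((Chg.refl _ _ _).setR _ (by simp)).setR _ (by simp), rfl, by simp [hd9, eval]⟩
  · rintro k hk s ⟨hc, -, -⟩ hr; have := hc.1 i hi (by simp [hi9, Ne.symm hdi])
    simp only [ok, eval, this, hN]; exact ⟨by omega, trivial⟩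
  · rintro k hk s ⟨hc, ho, hv⟩ hr; have e6 := (hc.1 6 (by decide) (by simp [Ne.symm hd6])).trans h6
    have e7 := (hc.1 7 (by decide) (by simp [Ne.symm hd7])).trans h7
    have eQ := (hc.2 aQ (by decide) (by simp)).trans hQ
    have hval : ∑ k ∈ range k, f (q * nf * lam + k) + f (q * nf * lam + k)
        = ∑ k ∈ range (k + 1), f (q * nf * lam + k) := (sum_range_succ _ _).symm
    have h1 := hmono (k + 1) (by omega); have h2 := hmono k (by omega)
    refine le (assign ?_ ?_ ?_ (hwf := ⟨hd, by simp [wf, vis]⟩)) (by simp [cost])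
    · simp only [ok, eval, Op.eval, e6, e7, hr, hv, eQ]; rw [getD_map_range _ _ _ (by omega), hval]
      refine ⟨by omega, ⟨⟨⟨by omega, by omega, by omega⟩, by omega, by omega⟩, by omega, by omega⟩,
        by omega⟩
    · simp only [eval, Op.eval, e6, e7, hr, hv, eQ]; rw [getD_map_range _ _ _ (by omega), hval]
      omega
    · refine ⟨by simp [hr, Ne.symm hd9], (hc.setR _ (by simp)).setR _ (by simp), ho, ?_⟩
      simp only [eval, Op.eval, e6, e7, hr, hv, eQ]; rw [getD_map_range _ _ _ (by omega), hval]
      simp [hd9]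
  · rintro s ⟨hc, ho, hv⟩ hr; exact h s hc ho hv
  · simp only [cost]; nlinarith

def loadAll : ℕ → Prog
  | 0 => skip
  | K + 1 => .comp (loadAll K) (loadField (.r 9) K (aF + K))

lemma Tri.loadAll (hs : Sizes W B m q lam) (h7 : st.reg 7 = lam) {i j : ℕ} (h9 : st.reg 9 = i)
    (hi : i < q) {Γ : Fields} (hΓ : ∀ f, (Γ (j * q + i) f).length < lam)
    (hQ : st.arr aQ = (List.range (q * nf * lam + m)).map (memOf q lam Γ j)) (K : ℕ) (hK : K ≤ nf)
    (h : ∀ st', Chg [] [] st st' → st'.out = st.out →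
      (∀ f < K, st'.arr (aF + f) = Γ (j * q + i) f) → Q st') :
    Tri W vis (MPC.loadAll K) st ((K + 1) * 110 * (lam + 1)) Q := by
  have hlt := hs.fit.lt
  induction K generalizing Q with
  | zero => exact (skip (h st (Chg.refl _ _ _) rfl (by simp))).le (by omega)
  | succ K ih =>
    refine le (comp (ih (by omega) fun s hc ho hv => Tri.loadField (q := q) (i := i)
      (s := Γ (j * q + i) K) hs.fit (f := K) (by omega) ((hc.1 7 (by decide) (by simp)).trans h7)
      (by simp [wf, vis]) ?_ ((hc.1 9 (by decide) (by simp)).trans h9) hi (by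
        unfold aF aQ; omega) (hΓ K) ?_ (h _ ?_ ho ?_))) ?_
    · have := (hc.1 9 (by decide) (by simp)).trans h9; simp only [ok, this]; omega
    · rw [(hc.2 aQ (by decide) (by simp)).trans hQ]; exact storedAt_memOf Γ j hi (by omega) (hΓ K)
    · exact ⟨hc.1, fun a ha hn => by
        rw [setA_arr, if_neg (by unfold aF; omega)]; exact hc.2 a ha hn⟩
    · intro f hf; rw [setA_arr]; split_ifs with hh
      · obtain rfl : f = K := by omega
        rfl
      · exact hv f (by omega)
    · simp only [cost]; nlinarith

def nodeEnv (n pw N : ℕ) (Γ : Fields) (x : ℕ) : Env where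
  n := n
  pw := pw
  x := x
  pre := ∑ y ∈ range x, hd (Γ y 0)
  tot := ∑ y ∈ range N, hd (Γ y 0)
  fld := Γ x

notation:max "envOf" n:max pw:max N:max Γ:max R:max x:max => Env.withR (nodeEnv n pw N Γ x) (R x)

structure GOK (B lam : ℕ) (Γ : Fields) : Prop where
  len : ∀ x f, (Γ x f).length < lam
  ptr : ∀ x f, isPtr f = true → ∀ w ∈ Γ x f, w ≤ B
  hd : ∀ x, hd (Γ x 0) ≤ 1

def sent (n pw m q lam : ℕ) (p : NodeProg) (Γ : Fields) (R : ℕ → List ℕ) (j : ℕ) :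
    List (ℕ × ℕ × ℕ) :=
  ((List.range q).flatMap fun i =>
    (p.emits (envOf n pw (m * q) Γ R (j * q + i))).flatMap (emitMsgs q lam)) ++
  (List.range m).map fun k => (k, q * nf * lam + j, ∑ i ∈ range q,
    p.cv.eval (envOf n pw (m * q) Γ R (j * q + i)))

/-- In one round of the network, in which the nodes run `p`, the fields `Γ` become `Γ'`. -/
structure VStep (W lam n pw N : ℕ) (p : NodeProg) (Γ Γ' : Fields) (R : ℕ → List ℕ) :
    Prop where
  call : ∀ x < N, p.call.Result W lam (nodeEnv n pw N Γ x) (R x)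
  res_len : ∀ x < N, (R x).length < lam
  inj : ∀ r ∈ p.rules, ∀ x < N, ∀ y < N,
    fires (envOf n pw N Γ R x) r.guards →
    fires (envOf n pw N Γ R y) r.guards →
    r.target.eval (envOf n pw N Γ R x) =
      r.target.eval (envOf n pw N Γ R y) → x = y
  sound : ∀ x < N, ∀ e ∈ p.emits (envOf n pw N Γ R x),
    e.1 < N ∧ Γ' e.1 e.2.1 = e.2.2
  complete : ∀ y < N, ∀ f < nf, Γ' y f ≠ [] →
    ∃ x < N, (y, f, Γ' y f) ∈ p.emits (envOf n pw N Γ R x)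

lemma sum_blocks (g : ℕ → ℕ) (q k : ℕ) :
    ∑ i ∈ range k, ∑ o ∈ range q, g (i * q + o) = ∑ x ∈ range (k * q), g x := by
  induction k with
  | zero => simp
  | succ k ih => rw [sum_range_succ, ih, Nat.succ_mul, Finset.sum_range_add]

lemma sum_le_card (g : ℕ → ℕ) (h : ∀ x, g x ≤ 1) (k : ℕ) : ∑ x ∈ range k, g x ≤ k := by
  simpa using Finset.sum_le_card_nsmul (range k) g 1 fun x _ => h x

lemma memOf_cnt (Γ : Fields) (j k : ℕ) : memOf q lam Γ j (q * nf * lam + k) = cnt q Γ k := by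
  unfold memOf; rw [if_neg (by omega), Nat.add_sub_cancel_left]

lemma nodeEnv_bounded {pw x : ℕ} {Γ : Fields} (hs : Sizes W B m q lam) (hn : n ≤ B)
    (hpw : pw ≤ B) (hx : x < m * q) (hΓ : GOK B lam Γ) :
    (nodeEnv n pw (m * q) Γ x).Bounded B lam := by
  have := hs.le; exact ⟨hn, hpw, by simp only [nodeEnv]; omega,
    (sum_le_card _ hΓ.hd _).trans (by omega), (sum_le_card _ hΓ.hd _).trans (by omega),
    fun f _ => hΓ.len x f, fun f _ hf => hΓ.ptr x f hf⟩

def nodeBody (p : NodeProg) : Prog :=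
  .comp (assign 10 (.op .add (.op .mul (.r 0) (.r 6)) (.r 9))) (.comp (loadAll nf) (.comp p.code
    (.comp (assign 13 (.op .add (.r 13) (.r 14))) (assign 11 (.op .add (.r 11) (.get aF (.c 0)))))))

lemma Tri.nodeBody {pw j i : ℕ} {p : NodeProg} {Γ Γ' : Fields} {R : ℕ → List ℕ}
    (hs : Sizes W B m q lam) (hn : n ≤ B) (hpw : pw ≤ B)
    (hp : p.good = true) (hseq : p.call.prog.IsSequential)
    (hv : VStep W lam n pw (m * q) p Γ Γ' R) (hΓ : GOK B lam Γ) (hΓ' : GOK B lam Γ') (hj : j < m)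
    (hi : i < q) (h0 : st.reg 0 = j) (h2 : st.reg 2 = n) (h6 : st.reg 6 = q) (h7 : st.reg 7 = lam)
    (h8 : st.reg 8 = pw) (h9 : st.reg 9 = i)
    (h11 : st.reg 11 = ∑ y ∈ range (j * q + i), hd (Γ y 0))
    (h12 : st.reg 12 = ∑ y ∈ range (m * q), hd (Γ y 0))
    (h13 : st.reg 13 ≤ q)
    (hQ : st.arr aQ = (List.range (q * nf * lam + m)).map (memOf q lam Γ j))
    (h : ∀ st', Chg [10, 11, 13, 14] [] st st' →
      st'.reg 13 = st.reg 13 + p.cv.eval (envOf n pw (m * q) Γ R (j * q + i)) →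
      st'.reg 11 = ∑ y ∈ range (j * q + i + 1), hd (Γ y 0) →
      st'.out = st.out ++ enc2 ((p.emits (envOf n pw (m * q) Γ R (j * q + i))).flatMap (emitMsgs q lam)) → Q st') :
    Tri W vis (MPC.nodeBody p) st ((p.cost + 3000) * (lam + 1)) Q := by
  have hW := hs.lt; have hle := hs.le; have hxN : j * q + i < m * q := by nlinarith
  have hjq : j * q ≤ m * q := Nat.mul_le_mul_right _ hj.le
  have hq : q ≤ B := by have : q ≤ m * q := Nat.le_mul_of_pos_left _ hs.m_pos; omega
  set x := j * q + i with hx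
  have hcv := (hv.sound x hxN (x, 0, [p.cv.eval (envOf n pw (m * q) Γ R x)])
    (by simp [emits, Env.withR, nodeEnv])).2
  have hcv1 : p.cv.eval (envOf n pw (m * q) Γ R x) ≤ 1 := by
    have := hΓ'.hd x; rw [show Γ' x 0 = _ from hcv] at this; simpa [hd] using this
  have hsum : ∑ y ∈ range (x + 1), hd (Γ y 0) ≤ x + 1 := sum_le_card _ hΓ.hd _; unfold MPC.nodeBody
  refine le (comp (assign (by
      simp only [ok, eval, Op.eval, h0, h6, h9]
      refine ⟨⟨by omega, by omega, by omega⟩, by omega, by omega⟩) (by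
      simp only [eval, Op.eval, h0, h6, h9]; omega)
    (comp (Tri.loadAll hs (i := i) (j := j) (by simp [h7]) (by simp [h9]) hi (hΓ.len x)
      (by simpa using hQ) nf le_rfl fun s1 c1 o1 v1 =>
      comp (T' := ((Expr.op .add (.r 13) (.r 14)).cost + 2) +
        ((Expr.op .add (.r 11) (.get aF (.c 0))).cost + 2)) (Tri.node (R := R x) (q := q) hs.fit hs.big
        (nodeEnv_bounded (x := x) hs hn hpw hxN hΓ)
        ?_ hp hseq (hv.call x hxN) (hv.res_len x hxN) hs.one_lt ?_ fun s2 c2 v14 a2 o2 =>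
          comp (assign ?_ ?_ (assign ?_ ?_ (h _ ?_ ?_ ?_ ?_)))))))) ?_
  · have g : ∀ r < vis, s1.reg r = if r = 10 then x else st.reg r := fun r hr => by
      rw [c1.1 r hr (by simp), setR_reg]; simp only [eval, Op.eval, h0, h6, h9, hx]
    constructor
    · rw [g 2 (by decide)]; simpa [nodeEnv] using h2
    · rw [g 6 (by decide)]; simpa using h6
    · rw [g 7 (by decide)]; simpa using h7
    · rw [g 8 (by decide)]; simpa [nodeEnv] using h8
    · rw [g 10 (by decide)]; simp [nodeEnv]
    · rw [g 11 (by decide)]; simpa [nodeEnv] using h11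
    · rw [g 12 (by decide)]; simpa [nodeEnv] using h12
    · exact v1
  · intro r hr hf; have hem : (r.target.eval (envOf n pw (m * q) Γ R x), r.field,
        MPC.segs (envOf n pw (m * q) Γ R x) r.payload) ∈ p.emits (envOf n pw (m * q) Γ R x) := by
      simp only [emits, mem_append, mem_flatMap]; exact Or.inl ⟨r, hr, by simp [Rule.emit, hf]⟩
    have := (hv.sound x hxN _ hem).2; simp only at this; rw [← this]; exact hΓ'.len _ _
  · have g13 : s2.reg 13 = st.reg 13 := by
      rw [c2 13 (by decide) (by decide), c1.1 13 (by decide) (by simp)]; simp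
    simp only [ok, eval, Op.eval, g13, v14]; exact ⟨by omega, by omega, by omega⟩
  · have g13 : s2.reg 13 = st.reg 13 := by
      rw [c2 13 (by decide) (by decide), c1.1 13 (by decide) (by simp)]; simp
    simp only [eval, Op.eval, g13, v14]; omega
  · have g11 : s2.reg 11 = ∑ y ∈ range x, hd (Γ y 0) := by
      rw [c2 11 (by decide) (by decide), c1.1 11 (by decide) (by simp)]; simpa using h11
    have gF : (s2.arr aF).getD 0 0 = hd (Γ x 0) := by
      rw [a2 aF (by decide) (by decide)]; rw [show s1.arr aF = Γ x 0 from v1 0 (by decide)]; rfl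
    have e : ∑ y ∈ range x, hd (Γ y 0) + hd (Γ x 0) = ∑ y ∈ range (x + 1), hd (Γ y 0) :=
      (sum_range_succ _ _).symm
    simp only [ok, eval, Op.eval, setR_reg, setR_arr, gF]; rw [if_neg (by decide), g11, e]
    refine ⟨by omega, by omega, by omega⟩
  · have g11 : s2.reg 11 = ∑ y ∈ range x, hd (Γ y 0) := by
      rw [c2 11 (by decide) (by decide), c1.1 11 (by decide) (by simp)]; simpa using h11
    have gF : (s2.arr aF).getD 0 0 = hd (Γ x 0) := by
      rw [a2 aF (by decide) (by decide)]; rw [show s1.arr aF = Γ x 0 from v1 0 (by decide)]; rfl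
    have e : ∑ y ∈ range x, hd (Γ y 0) + hd (Γ x 0) = ∑ y ∈ range (x + 1), hd (Γ y 0) :=
      (sum_range_succ _ _).symm
    simp only [eval, Op.eval, setR_reg, setR_arr, gF]; rw [if_neg (by decide), g11, e]; omega
  · refine ⟨fun r hr hn => ?_, fun a ha _ => ?_⟩
    · simp only [mem_cons, not_mem_nil, or_false, not_or] at hn
      rw [setR_reg, if_neg hn.2.1, setR_reg, if_neg hn.2.2.1, c2 r hr hn.2.2.2,
        c1.1 r hr (by simp), setR_reg, if_neg hn.1]
    · simp only [setR_arr]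
      rw [a2 a (by unfold aC; omega) (by unfold aP; omega), c1.2 a ha (by simp)]; simp
  · have g13 : s2.reg 13 = st.reg 13 := by
      rw [c2 13 (by decide) (by decide), c1.1 13 (by decide) (by simp)]; simp
    rw [setR_reg, if_neg (by decide), setR_reg, if_pos rfl]; simp only [eval, Op.eval, g13, v14]
  · have g11 : s2.reg 11 = ∑ y ∈ range x, hd (Γ y 0) := by
      rw [c2 11 (by decide) (by decide), c1.1 11 (by decide) (by simp)]; simpa using h11
    have gF : (s2.arr aF).getD 0 0 = hd (Γ x 0) := by
      rw [a2 aF (by decide) (by decide)]; rw [show s1.arr aF = Γ x 0 from v1 0 (by decide)]; rfl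
    rw [setR_reg, if_pos rfl]; simp only [eval, Op.eval, setR_reg, setR_arr, gF]
    rw [if_neg (by decide), g11, sum_range_succ]
  · simp only [St.setR_out, o2, o1]
  · simp only [cost]; rw [Nat.add_mul p.cost]; generalize p.cost * (lam + 1) = z
    have : (nf + 1) * 110 * (lam + 1) = 2530 * (lam + 1) := rfl; omega

end

section
variable {W B m n q lam : ℕ} {st : St} {Q : St → Prop} {T : ℕ}

def bcast : Prog := forE 9 (.r 1) (.comp
    (sendE (.r 9) (.op .add (.op .mul (.op .mul (.r 6) (.c nf)) (.r 7)) (.r 0)))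
    (sendE (.r 9) (.r 13)))

lemma Tri.bcast (hs : Sizes W B m q lam) {j v : ℕ} (hj : j < m) (h0 : st.reg 0 = j)
    (h1 : st.reg 1 = m) (h6 : st.reg 6 = q) (h7 : st.reg 7 = lam) (h13 : st.reg 13 = v) (hv : v < W)
    (h : ∀ st', Chg [9] [] st st' →
      st'.out = st.out ++ enc2 ((List.range m).map fun k => (k, q * nf * lam + j, v)) → Q st') :
    Tri W vis MPC.bcast st ((m + 1) * 40) Q := by
  have hW := hs.lt; have hle := hs.le; have hB := hs.big.le; have hlam := hs.big.lam
  have hq : q ≤ B := by have : q ≤ m * q := Nat.le_mul_of_pos_left _ hs.m_pos; omega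
  have hqn : q * nf ≤ q * nf * lam := Nat.le_mul_of_pos_right _ hs.fit.lam_pos
  have hnf : nf = 22 := rfl; unfold MPC.bcast
  refine le (Tri.forE (N := m) (T := 18) (by decide) (fun k s => Chg [9] [] st s ∧
      s.out = st.out ++ enc2 ((List.range k).map fun k => (k, q * nf * lam + j, v)))
    (by decide) (by simp [wf, vis]) (by omega) ?_ ?_ ?_ ?_) ?_
  · exact ⟨(Chg.refl _ _ _).setR _ (by simp), by simp⟩
  · rintro k hk s ⟨hc, -⟩ hr; have := hc.reg h1
    simp only [ok, eval, this]; exact ⟨by omega, trivial⟩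
  · rintro k hk s ⟨hc, ho⟩ hr; have e0 := hc.reg h0; have e6 := hc.reg h6; have e7 := hc.reg h7
    have e13 := hc.reg h13; refine le (comp (Tri.sendE ?_ ?_ (Tri.sendE ?_ ?_ ?_))) ?_
    · simp only [ok, hr]; omega
    · simp only [ok, eval, Op.eval, e0, e6, e7]
      refine ⟨⟨⟨by omega, by omega, by omega⟩, by omega, by omega⟩, by omega, by omega⟩
    · simp only [ok, addOut_reg, hr]; omega
    · simp only [ok, addOut_reg, e13]; omega
    · refine ⟨by simp [hr], ⟨fun r hr' hn => ?_, fun a ha hn => ?_⟩, ?_⟩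
      · rw [← hc.1 r hr' hn]; simp only [mem_singleton] at hn; simp [hn]
      · rw [← hc.2 a ha hn]; simp
      · simp only [St.setR_out, St.addOut_out, ho, eval, Op.eval, e0, e6, e7, hr,
          addOut_reg, e13, List.range_succ]; simp
    · simp [cost]
  · rintro s ⟨hc, ho⟩ hr; exact h s hc ho
  · simp only [cost]; nlinarith

def mainStep (p : NodeProg) : Prog :=
  .comp fillQ (.comp (sumQ 11 (.r 0)) (.comp (sumQ 12 (.r 1)) (.comp (assign 13 (.c 0))
    (.comp (forE 9 (.r 6) (nodeBody p)) bcast))))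

lemma mainStep_time_le {c j M : ℕ} (hj : j < m) :
    (q * nf * lam + m + M + 2) * 40 + ((j + 1) * 40 + ((m + 1) * 40 + (3 +
      ((q + 1) * ((c + 3000) * (lam + 1) + 2 + 12) + (m + 1) * 40)))) ≤
    (c + 4000) * ((q + 1) * (lam + 1) + m + M + 1) := by
  have e2 : (q + 1) * ((c + 3000) * (lam + 1) + 2 + 12) =
      c * ((q + 1) * (lam + 1)) + 3000 * ((q + 1) * (lam + 1)) + 14 * (q + 1) := by ring
  have e3 : (c + 4000) * ((q + 1) * (lam + 1) + m + M + 1) =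
      c * ((q + 1) * (lam + 1)) + 4000 * ((q + 1) * (lam + 1)) +
        (c * (m + M + 1) + 4000 * (m + M + 1)) := by ring
  have e4 : (q + 1) * (lam + 1) = q * lam + q + lam + 1 := by ring
  have e5 : q * nf * lam = 22 * (q * lam) := by have : nf = 22 := rfl; rw [this]; ring
  rw [e2, e3, e5]; generalize c * ((q + 1) * (lam + 1)) = z; generalize c * (m + M + 1) = z'
  rw [e4]; omega

lemma Tri.mainStep {pw j : ℕ} {p : NodeProg} {Γ Γ' : Fields} {R : ℕ → List ℕ}
    (hs : Sizes W B m q lam) (hn : n ≤ B) (hpw : pw ≤ B)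
    (hp : p.good = true) (hseq : p.call.prog.IsSequential)
    (hv : VStep W lam n pw (m * q) p Γ Γ' R) (hΓ : GOK B lam Γ) (hΓ' : GOK B lam Γ') (hj : j < m)
    (h0 : st.reg 0 = j) (h1 : st.reg 1 = m) (h2 : st.reg 2 = n) (h6 : st.reg 6 = q)
    (h7 : st.reg 7 = lam) (h8 : st.reg 8 = pw) {M : List (ℕ × ℕ)} (hM : st.arr 0 = pairs M)
    (hMW : 2 * M.length + 4 ≤ W) (hf : Describes (q * nf * lam + m) (memOf q lam Γ j) M)
    {c Tb : ℕ} (hpc : p.cost + 3000 ≤ c) (hT : (q * nf * lam + m + M.length + 2) * 40 + ((j + 1) * 40 +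
      ((m + 1) * 40 + (3 + ((q + 1) * (c * (lam + 1) + 2 + 12) + (m + 1) * 40)))) ≤ Tb)
    (h : ∀ st', Chg [9, 10, 11, 12, 13, 14] [aQ] st st' →
      st'.out = st.out ++ enc2 (sent n pw m q lam p Γ R j) → Q st') :
    Tri W vis (MPC.mainStep p) st Tb Q := by
  refine le ?_ hT; clear hT; have hW := hs.lt; have hle := hs.le; have hB := hs.big.le
  have hq : q ≤ B := by have : q ≤ m * q := Nat.le_mul_of_pos_left _ hs.m_pos; omega
  have hsum : ∀ k, ∑ i ∈ range k, memOf q lam Γ j (q * nf * lam + i)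
      = ∑ y ∈ range (k * q), hd (Γ y 0) := fun k => by
    simp only [memOf_cnt, cnt]; exact sum_blocks (fun x => hd (Γ x 0)) q k
  have hsumB : ∀ k ≤ m, ∑ i ∈ range k, memOf q lam Γ j (q * nf * lam + i) ≤ B := fun k hk => by
    rw [hsum]; refine (sum_le_card _ hΓ.hd _).trans ?_
    have : k * q ≤ m * q := Nat.mul_le_mul_right _ hk; omega
  have hcv : ∀ i < q, p.cv.eval (envOf n pw (m * q) Γ R (j * q + i)) ≤ 1 := by
    intro i hi; have hx : j * q + i < m * q := by nlinarith
    have := hv.sound _ hx (j * q + i, 0, [p.cv.eval (envOf n pw (m * q) Γ R (j * q + i))])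
      (by simp [emits, Env.withR, nodeEnv])
    have h' := hΓ'.hd (j * q + i); rw [show Γ' (j * q + i) 0 = _ from this.2] at h'
    simpa [hd] using h'
  have hcvs : ∀ k ≤ q, ∑ i ∈ range k,
      p.cv.eval (envOf n pw (m * q) Γ R (j * q + i)) ≤ k := fun k hk => by
    simpa using Finset.sum_le_card_nsmul (range k)
      (fun i => p.cv.eval (envOf n pw (m * q) Γ R (j * q + i))) 1
      fun x hx => hcv x (by have := mem_range.mp hx; omega)
  unfold MPC.mainStep; refine comp (Tri.fillQ hs h1 h6 h7 hM hMW hf fun s1 c1 o1 v1 => ?_)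
  refine comp (Tri.sumQ hs (i := 0) (d := 11) (N := j) (c1.reg h6)
      (c1.reg h7) (by decide) (by decide)
      (by decide) (by decide) (by decide) (by decide) (by decide)
      (c1.reg h0) hj.le v1 (hsumB j hj.le)
      fun s2 c2 o2 v2 => ?_); have c12 := c1.trans c2
  refine comp (Tri.sumQ hs (i := 1) (d := 12) (N := m) (c12.reg h6)
      (c12.reg h7) (by decide) (by decide)
      (by decide) (by decide) (by decide) (by decide) (by decide)
      (c12.reg h1) le_rfl
      (c2.arr v1) (hsumB m le_rfl)
      fun s3 c3 o3 v3 => ?_); refine comp (le (assign (e := .c 0) (by simp only [ok]; omega)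
    (by simp only [eval]; omega) ?_) (by simp [cost])); simp only [eval]
  have c4 : Chg [9, 10, 11, 12, 13, 14] [aQ] st (s3.setR 13 0) :=
    ((c12.trans c3).mono (by simp) (by simp)).setR _ (by simp)
  have v4 : (s3.setR 13 0).arr aQ = (List.range (q * nf * lam + m)).map (memOf q lam Γ j) :=
    (c2.trans c3).arr v1; have r11 : (s3.setR 13 0).reg 11 = ∑ y ∈ range (j * q), hd (Γ y 0) := by
    rw [setR_reg, if_neg (by decide), c3.1 11 (by decide) (by decide), v2, hsum]
  have r12 : (s3.setR 13 0).reg 12 = ∑ y ∈ range (m * q), hd (Γ y 0) := by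
    rw [setR_reg, if_neg (by decide), v3, hsum]
  have r13 : (s3.setR 13 0).reg 13 = 0 := by simp
  have o4 : (s3.setR 13 0).out = st.out := o3.trans (o2.trans o1)
  generalize s3.setR 13 0 = s4 at c4 v4 r11 r12 r13 o4 ⊢; refine comp ?_
  refine Tri.forE (N := q) (T := c * (lam + 1)) (by decide) (fun k s => Chg [9, 10, 11, 12, 13, 14] [aQ] st s ∧
    s.arr aQ = (List.range (q * nf * lam + m)).map (memOf q lam Γ j) ∧
    s.reg 11 = ∑ y ∈ range (j * q + k), hd (Γ y 0) ∧
    s.reg 12 = ∑ y ∈ range (m * q), hd (Γ y 0) ∧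
    s.reg 13 = ∑ i ∈ range k, p.cv.eval (envOf n pw (m * q) Γ R (j * q + i)) ∧
    s.out = st.out ++ enc2 ((List.range k).flatMap fun i =>
      (p.emits (envOf n pw (m * q) Γ R (j * q + i))).flatMap
        (emitMsgs q lam))) (by decide) (by simp [wf, vis]) (by omega) ?_ ?_ ?_ ?_
  · exact ⟨c4.setR _ (by simp), v4, by simpa using r11, by simpa using r12, by simpa using r13,
      by simpa using o4⟩
  · rintro k hk s ⟨hc, -⟩ hr; have := hc.reg h6
    simp only [ok, eval, this]; exact ⟨by omega, trivial⟩
  · rintro k hk s ⟨hc, hQ, g11, g12, g13, ho⟩ hr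
    refine le (T := (p.cost + 3000) * (lam + 1)) (Tri.nodeBody hs hn hpw hp hseq hv hΓ hΓ' hj hk
      (hc.reg h0) (hc.reg h2)
      (hc.reg h6) (hc.reg h7)
      (hc.reg h8) hr g11 g12 ?_ hQ fun s' c' a13 a11 o' => ?_)
      (Nat.mul_le_mul_right _ hpc)
    · rw [g13]; exact (hcvs k hk.le).trans hk.le
    · refine ⟨c'.reg hr, ((hc.trans c').mono (by simp) (by simp)).setR _ (by simp),
        (c'.2 aQ (by decide) (by simp)).trans hQ, ?_, ?_, ?_, ?_⟩
      · rw [setR_reg, if_neg (by decide), a11]; rfl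
      · rw [setR_reg, if_neg (by decide), c'.1 12 (by decide) (by decide), g12]
      · rw [setR_reg, if_neg (by decide), a13, g13, sum_range_succ]
      · simp only [St.setR_out, o', ho, List.range_succ]; simp
  · rintro s ⟨hc, hQ, g11, g12, g13, ho⟩ hr
    refine (Tri.bcast hs hj (hc.reg h0) (hc.reg h1) (hc.reg h6)
      (hc.reg h7) g13 ?_ fun s' c' o' => ?_)
    · have := hcvs q le_rfl; omega
    · refine h s' ((hc.trans c').mono (by simp) (by simp)) ?_; rw [o', ho]; simp [sent]

/-! ## Delivery of the messages -/

lemma filter_enc2 (l : List (ℕ × ℕ × ℕ)) (j : ℕ) : ((enc2 l).filter fun x => x.1 = j).map Prod.snd =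
      pairs ((l.filter fun x => x.1 = j).map Prod.snd) := by
  induction l with
  | nil => rfl
  | cons x l ih =>
    simp only [enc2_cons, List.filter_cons]; by_cases hx : x.1 = j
    · simp only [hx, decide_true, if_true, map_cons]; rw [ih]; simp [pairs]
    · simp only [hx, decide_false]; simpa using ih

/-- The pairs `(address, word)` that machine `j` receives when machine `i` sends `S i`. -/
def inbox (m : ℕ) (S : ℕ → List (ℕ × ℕ × ℕ)) (j : ℕ) : List (ℕ × ℕ) :=
  (List.range m).flatMap fun i => ((S i).filter fun x => x.1 = j).map Prod.snd

lemma mem_inbox {S : ℕ → List (ℕ × ℕ × ℕ)} {j : ℕ} {p : ℕ × ℕ} :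
    p ∈ inbox m S j ↔ ∃ i < m, (j, p) ∈ S i := by
  simp only [inbox, mem_flatMap, List.mem_range, mem_map, List.mem_filter, decide_eq_true_eq]
  constructor
  · rintro ⟨i, hi, ⟨x, y⟩, ⟨h1, rfl⟩, rfl⟩; exact ⟨i, hi, h1⟩
  · rintro ⟨i, hi, h⟩; exact ⟨i, hi, (j, p), ⟨h, rfl⟩, rfl⟩

lemma pairs_flatMap {α : Type} (l : List α) (f : α → List (ℕ × ℕ)) :
    pairs (l.flatMap f) = l.flatMap fun x => pairs (f x) := by
  simp [pairs, List.flatMap_assoc]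

lemma deliver_arr_zero {m : ℕ} (c : Fin m → Mem) (S : ℕ → List (ℕ × ℕ × ℕ))
    (h : ∀ i : Fin m, (c i).out = enc2 (S i)) (j : Fin m) :
    (deliver c j).arr 0 = pairs (inbox m S j) := by
  simp only [deliver, update_self, inbox, pairs_flatMap]
  have e : (List.range m) = (List.finRange m).map Fin.val := by simp
  rw [e, List.flatMap_map]; refine List.flatMap_congr fun i _ => ?_; rw [h i, filter_enc2]

lemma mem_emitMsgs {e : ℕ × ℕ × List ℕ} {x : ℕ × ℕ × ℕ} :
    x ∈ emitMsgs q lam e ↔ x = (e.1 / q, addr q lam e.1 e.2.1, e.2.2.length) ∨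
      ∃ o < e.2.2.length, x = (e.1 / q, addr q lam e.1 e.2.1 + 1 + o, e.2.2.getD o 0) := by
  simp only [emitMsgs, mem_cons, mem_map, List.mem_range, eq_comm]

lemma mem_sent {pw : ℕ} {p : NodeProg} {Γ : Fields} {R : ℕ → List ℕ} {j : ℕ}
    {x : ℕ × ℕ × ℕ} : x ∈ sent n pw m q lam p Γ R j ↔
      (∃ i < q, ∃ e ∈ p.emits (envOf n pw (m * q) Γ R (j * q + i)), x ∈ emitMsgs q lam e) ∨
      ∃ k < m, x = (k, q * nf * lam + j, ∑ i ∈ range q,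
        p.cv.eval (envOf n pw (m * q) Γ R (j * q + i))) := by
  simp only [sent, mem_append, mem_flatMap, mem_map, List.mem_range, eq_comm]

lemma NodeProg.field_lt {p : NodeProg} (hp : p.good = true) {E : Env} {e : ℕ × ℕ × List ℕ}
    (he : e ∈ p.emits E) : e.2.1 < nf := by
  simp only [NodeProg.good, Bool.and_eq_true] at hp
  simp only [emits, mem_append, mem_flatMap, mem_singleton] at he; rcases he with ⟨r, hr, he⟩ | rfl
  · have := List.all_eq_true.mp hp.2.1 r hr; simp only [Rule.good, Bool.and_eq_true] at this
    unfold Rule.emit at he; split_ifs at he with hf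
    · simp only [mem_singleton] at he; rw [he]; exact Nat.blt_eq.mp this.2.2.2.1
    · simp at he
  · exact (by decide : 0 < 22)

lemma describes_inbox {Γ : Fields} (hq : 0 < q) (S : ℕ → List (ℕ × ℕ × ℕ))
    (hsound : ∀ i < m, ∀ x ∈ S i, (∃ e : ℕ × ℕ × List ℕ, e.1 < m * q ∧ e.2.1 < nf ∧
      e.2.2.length < lam ∧ Γ e.1 e.2.1 = e.2.2 ∧ x ∈ emitMsgs q lam e) ∨
      ∃ k, x = (k, q * nf * lam + i, cnt q Γ i))
    (hcomplete : ∀ y < m * q, ∀ f < nf, Γ y f ≠ [] →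
      ∃ i < m, ∀ x ∈ emitMsgs q lam (y, f, Γ y f), x ∈ S i)
    (hcnt : ∀ i < m, cnt q Γ i ≠ 0 → ∀ k < m, (k, q * nf * lam + i, cnt q Γ i) ∈ S i)
    {j : ℕ} (hj : j < m) :
    Describes (q * nf * lam + m) (memOf q lam Γ j) (inbox m S j) := by
  constructor
  · intro x hx; obtain ⟨i, hi, hx⟩ := mem_inbox.mp hx
    rcases hsound i hi _ hx with ⟨e, -, hf, hl, hs, hx⟩ | ⟨k, hx⟩
    · have hmod := Nat.mod_lt e.1 hq; have hdm : e.1 / q * q + e.1 % q = e.1 := Nat.div_add_mod' _ _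
      rcases mem_emitMsgs.mp hx with hx | ⟨o, ho, hx⟩
      · obtain ⟨h1, h2⟩ := Prod.mk.inj hx; subst h2
        have := memOf_addr (lam := lam) Γ j hmod hf (o := 0) (by omega)
        rw [h1, hdm, hs] at this; simp only [Nat.add_zero, if_true] at this; simp only [addr]
        rw [← h1] at this; rw [this]
      · obtain ⟨h1, h2⟩ := Prod.mk.inj hx; subst h2
        have := memOf_addr (lam := lam) Γ j hmod hf (o := o + 1) (by omega)
        rw [h1, hdm, hs] at this
        simp only [Nat.add_one_ne_zero, if_false, Nat.add_sub_cancel] at this; simp only [addr]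
        rw [← h1] at this
        rw [show (e.1 % q * nf + e.2.1) * lam + 1 + o = (e.1 % q * nf + e.2.1) * lam + (o + 1) by
          omega, this]
    · obtain ⟨h1, h2⟩ := Prod.mk.inj hx; subst h2; simp only; rw [memOf_cnt]
  · intro a ha h0; refine mem_inbox.mpr ?_; by_cases hlt : a < q * nf * lam
    · have hlam : 0 < lam := by
        by_contra hc; have : lam = 0 := by omega
        subst this; simp at hlt
      set i := a / lam / nf with hi; set f := a / lam % nf with hf; set o := a % lam with ho
      have hfl : f < nf := Nat.mod_lt _ (by decide); have hol : o < lam := Nat.mod_lt _ hlam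
      have hiq : i < q := by
        rw [hi, Nat.div_div_eq_div_mul]; refine Nat.div_lt_of_lt_mul ?_
        calc a < q * nf * lam := hlt
          _ = _ := by ring
      have haeq : (i * nf + f) * lam + o = a := by
        rw [hi, hf, ho, Nat.div_add_mod', Nat.div_add_mod']
      have hval := memOf_addr Γ j hiq hfl hol; rw [haeq] at hval
      have hyN : j * q + i < m * q := by nlinarith
      have hne : Γ (j * q + i) f ≠ [] := by intro hnil; rw [hval, hnil] at h0; simp at h0
      obtain ⟨x, hx, hem⟩ := hcomplete (j * q + i) hyN f hfl hne; refine ⟨x, hx, hem _ ?_⟩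
      have e1 : (j * q + i) / q = j := by
        rw [mul_comm, Nat.mul_add_div hq, Nat.div_eq_of_lt hiq, Nat.add_zero]
      have e2 : addr q lam (j * q + i) f = (i * nf + f) * lam := by
        unfold addr; rw [mul_comm j, Nat.mul_add_mod, Nat.mod_eq_of_lt hiq]
      refine mem_emitMsgs.mpr ?_; simp only [e1, e2, hval]; by_cases ho0 : o = 0
      · left; rw [if_pos ho0, ← haeq, ho0]; rfl
      · right; rw [if_neg ho0] at hval ⊢; refine ⟨o - 1, ?_, ?_⟩
        · by_contra hc; rw [hval, List.getD_eq_default _ _ (by omega)] at h0; exact h0 rfl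
        · rw [show (i * nf + f) * lam + 1 + (o - 1) = a by omega]
    · obtain ⟨k, rfl⟩ : ∃ k, a = q * nf * lam + k := ⟨a - q * nf * lam, by omega⟩
      have hk : k < m := by omega
      rw [memOf_cnt] at h0 ⊢; exact ⟨k, hk, hcnt k hk h0 j hj⟩

lemma VStep.describes {pw : ℕ} {p : NodeProg} {Γ Γ' : Fields} {R : ℕ → List ℕ}
    (hq : 0 < q) (hp : p.good = true)
    (hv : VStep W lam n pw (m * q) p Γ Γ' R) (hΓ' : GOK B lam Γ') {j : ℕ} (hj : j < m) :
    Describes (q * nf * lam + m) (memOf q lam Γ' j) (inbox m (sent n pw m q lam p Γ R) j) := by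
  have hcnt : ∀ i < m, ∑ o ∈ range q,
      p.cv.eval (envOf n pw (m * q) Γ R (i * q + o)) = cnt q Γ' i := by
    intro i hi; refine Finset.sum_congr rfl fun o ho => ?_; have ho := mem_range.mp ho
    have := (hv.sound (i * q + o) (by nlinarith) (i * q + o, 0,
      [p.cv.eval (envOf n pw (m * q) Γ R (i * q + o))])
      (by simp [emits, Env.withR, nodeEnv])).2; rw [show Γ' (i * q + o) 0 = _ from this]; simp [hd]
  refine describes_inbox hq _ (fun i hi x hx => ?_) (fun y hy f hf hne => ?_)
    (fun i hi _ k hk => ?_) hj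
  · rcases mem_sent.mp hx with ⟨o, ho, e, he, hx⟩ | ⟨k, hk, hx⟩
    · have hs := (hv.sound _ (by nlinarith) e he); have hl := hΓ'.len e.1 e.2.1; rw [hs.2] at hl
      exact Or.inl ⟨e, hs.1, NodeProg.field_lt hp he, hl, hs.2, hx⟩
    · rw [hcnt i hi] at hx; exact Or.inr ⟨k, hx⟩
  · obtain ⟨x, hx, hem⟩ := hv.complete y hy f hf hne
    have hxm : x / q < m := Nat.div_lt_of_lt_mul (by rwa [mul_comm] at hx)
    have hdm : x / q * q + x % q = x := Nat.div_add_mod' _ _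
    exact ⟨x / q, hxm, fun z hz => mem_sent.mpr (Or.inl ⟨x % q, Nat.mod_lt _ hq, _,
      by rw [hdm]; exact hem, hz⟩)⟩
  · rw [← hcnt i hi]; exact mem_sent.mpr (Or.inr ⟨k, hk, rfl⟩)

/-! ## The number of messages -/

lemma countP_emitMsgs (j : ℕ) (e : ℕ × ℕ × List ℕ) (hl : e.2.2.length < lam) :
    (emitMsgs q lam e).countP (fun x => x.1 = j) ≤ if e.1 / q = j then lam else 0 := by
  split_ifs with h
  · refine List.countP_le_length.trans ?_; simp [emitMsgs]; omega
  · refine le_of_eq (List.countP_eq_zero.mpr fun x hx => ?_)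
    rcases mem_emitMsgs.mp hx with rfl | ⟨o, -, rfl⟩ <;> simpa using h

lemma sum_countP_le {N j : ℕ} (hq : 0 < q) (g : ℕ → List (ℕ × ℕ × List ℕ))
    (h1 : ∀ x < N, (g x).length ≤ 1)
    (h2 : ∀ x < N, ∀ y < N, ∀ e ∈ g x, ∀ e' ∈ g y, e.1 = e'.1 → x = y)
    (h3 : ∀ x < N, ∀ e ∈ g x, e.2.2.length < lam) :
    ∑ x ∈ range N, ((g x).flatMap (emitMsgs q lam)).countP (fun x => x.1 = j) ≤ q * lam := by
  have hle : ∀ x ∈ range N, ((g x).flatMap (emitMsgs q lam)).countP (fun x => x.1 = j) ≤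
      if (∃ e ∈ g x, e.1 / q = j) then lam else 0 := by
    intro x hx; have hx := mem_range.mp hx; have hl := h1 x hx; rcases hg : g x with _ | ⟨e, l⟩
    · simp
    · rw [hg] at hl; obtain rfl : l = [] := List.eq_nil_of_length_eq_zero (by simpa using hl)
      have := countP_emitMsgs (q := q) j e (h3 x hx e (by simp [hg])); simpa using this
  refine (Finset.sum_le_sum hle).trans ?_; rw [← Finset.sum_filter, Finset.sum_const, smul_eq_mul]
  refine Nat.mul_le_mul_right _ ?_
  let F : ℕ → ℕ := fun x => ((g x).headD (0, 0, [])).1 % q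
  have key : ∀ x ∈ (range N).filter (fun x => ∃ e ∈ g x, e.1 / q = j),
      ∃ e ∈ g x, e.1 / q = j ∧ F x = e.1 % q := by
    intro x hx; simp only [Finset.mem_filter, mem_range] at hx; obtain ⟨hx, e, he, hj⟩ := hx
    refine ⟨e, he, hj, ?_⟩; have hl := h1 x hx; rcases hg : g x with _ | ⟨e', l⟩
    · simp [hg] at he
    · rw [hg] at hl he; obtain rfl : l = [] := List.eq_nil_of_length_eq_zero (by simpa using hl)
      simp only [mem_singleton] at he; simp [F, hg, he]
  calc _ ≤ (range q).card := by
        refine Finset.card_le_card_of_injOn F (fun x hx => ?_) fun x hx y hy hxy => ?_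
        · obtain ⟨e, -, -, h⟩ := key x hx; rw [h]
          exact Finset.mem_coe.mpr (mem_range.mpr (Nat.mod_lt _ hq))
        · obtain ⟨e, he, hj, h⟩ := key x hx; obtain ⟨e', he', hj', h'⟩ := key y hy
          have hx' := mem_range.mp (Finset.mem_filter.mp (Finset.mem_coe.mp hx)).1
          have hy' := mem_range.mp (Finset.mem_filter.mp (Finset.mem_coe.mp hy)).1
          refine h2 x hx' y hy' e he e' he' ?_; rw [h, h'] at hxy
          rw [← Nat.div_add_mod' e.1 q, ← Nat.div_add_mod' e'.1 q, hj, hj', hxy]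
    _ = q := Finset.card_range q

lemma length_flatMap_range {α : Type} (f : ℕ → List α) (k : ℕ) :
    ((List.range k).flatMap f).length = ∑ i ∈ range k, (f i).length := by
  induction k with
  | zero => rfl
  | succ k ih => simp [List.range_succ, sum_range_succ, ih]

lemma countP_flatMap_range {α : Type} (P : α → Bool) (f : ℕ → List α) (k : ℕ) :
    ((List.range k).flatMap f).countP P = ∑ i ∈ range k, (f i).countP P := by
  induction k with
  | zero => rfl
  | succ k ih => simp [List.range_succ, sum_range_succ, ih]

lemma countP_range_le (k j : ℕ) : (List.range k).countP (fun i => i = j) ≤ 1 := by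
  refine le_trans (le_of_eq ?_) (List.nodup_iff_count_le_one.mp (List.nodup_range (n := k)) j)
  rw [List.count_eq_countP]; refine List.countP_congr fun i _ => ?_; simp

lemma VStep.length_inbox {pw : ℕ} {p : NodeProg} {Γ Γ' : Fields} {R : ℕ → List ℕ}
    (hq : 0 < q) (hv : VStep W lam n pw (m * q) p Γ Γ' R) (hΓ' : GOK B lam Γ') (j : ℕ) :
    (inbox m (sent n pw m q lam p Γ R) j).length ≤ m + (p.rules.length + 1) * (q * lam) := by
  set E : ℕ → Env := fun x => envOf n pw (m * q) Γ R x with hE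
  have hsl : ∀ x < m * q, ∀ e ∈ p.emits (E x), e.2.2.length < lam := fun x hx e he => by
    rw [← (hv.sound x hx e he).2]; exact hΓ'.len _ _
  have hrule : ∀ r ∈ p.rules, ∑ x ∈ range (m * q),
      ((r.emit (E x)).flatMap (emitMsgs q lam)).countP (fun x => x.1 = j) ≤ q * lam := by
    intro r hr
    have hmem : ∀ x e, e ∈ r.emit (E x) → fires (E x) r.guards ∧ e.1 = r.target.eval (E x) := by
      intro x e he; unfold Rule.emit at he; split_ifs at he with hf
      · simp only [mem_singleton] at he; exact ⟨hf, by rw [he]⟩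
      · simp at he
    refine sum_countP_le hq _ (fun x _ => ?_) (fun x hx y hy e he e' he' hee => ?_)
      fun x hx e he => hsl x hx e ?_
    · unfold Rule.emit; split_ifs <;> simp
    · obtain ⟨h1, h2⟩ := hmem x e he; obtain ⟨h1', h2'⟩ := hmem y e' he'
      exact hv.inj r hr x hx y hy h1 h1' (by rw [← hE] at *; rw [← h2, ← h2', hee])
    · simp only [emits, mem_append, mem_flatMap]; exact Or.inl ⟨r, hr, he⟩
  have hrules : ∀ rs ⊆ p.rules, ∑ x ∈ range (m * q),
      ((rs.flatMap fun r => r.emit (E x)).flatMap (emitMsgs q lam)).countP (fun x => x.1 = j)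
        ≤ rs.length * (q * lam) := by
    intro rs
    induction rs with
    | nil => intro _; simp
    | cons r rs ih =>
      intro hrs; have h1 := hrule r (hrs (by simp)); have h2 := ih fun r' h' => hrs (by simp [h'])
      simp only [flatMap_cons, List.flatMap_append, countP_append,
        Finset.sum_add_distrib, length_cons]; nlinarith
  have hself : ∑ x ∈ range (m * q),
      (([(x, 0, [p.cv.eval (E x)])] : List (ℕ × ℕ × List ℕ)).flatMap (emitMsgs q lam)).countP
        (fun x => x.1 = j) ≤ q * lam := by
    refine sum_countP_le hq _ (fun x _ => by simp) (fun x hx y hy e he e' he' hee => ?_)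
      fun x hx e he => hsl x hx e ?_
    · simp only [mem_singleton] at he he'; rw [he, he'] at hee; exact hee
    · simp only [mem_singleton] at he; rw [he]; simp [emits, hE, Env.withR, nodeEnv]
  have hD : ∀ x, ((p.emits (E x)).flatMap (emitMsgs q lam)).countP (fun x => x.1 = j) =
      ((p.rules.flatMap fun r => r.emit (E x)).flatMap (emitMsgs q lam)).countP (fun x => x.1 = j) +
      (([(x, 0, [p.cv.eval (E x)])] : List (ℕ × ℕ × List ℕ)).flatMap (emitMsgs q lam)).countP
        (fun x => x.1 = j) := fun x => by
    rw [← countP_append, ← List.flatMap_append]; rfl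
  have hlen : (inbox m (sent n pw m q lam p Γ R) j).length ≤ ∑ i ∈ range m, (∑ o ∈ range q,
        ((p.emits (E (i * q + o))).flatMap (emitMsgs q lam)).countP (fun x => x.1 = j) + 1) := by
    unfold inbox; rw [length_flatMap_range]; refine Finset.sum_le_sum fun i hi => ?_
    rw [length_map, ← List.countP_eq_length_filter, sent, countP_append, countP_flatMap_range]
    refine Nat.add_le_add le_rfl ?_; rw [List.countP_map]; exact countP_range_le m j
  refine hlen.trans ?_; rw [Finset.sum_add_distrib, sum_blocks (fun x => ((p.emits (E x)).flatMap
    (emitMsgs q lam)).countP (fun x => x.1 = j)) q m, Finset.sum_congr rfl fun x _ => hD x,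
    Finset.sum_add_distrib]; have := hrules p.rules (by simp)
  simp only [Finset.sum_const, Finset.card_range, smul_eq_mul]; nlinarith

end

/-! ## Reading the input -/

def encIn (V : List (ℕ × ℕ × List ℕ)) : List ℕ :=
  V.flatMap fun v => v.1 :: v.2.1 :: v.2.2.length :: v.2.2

def upper (n v p : ℕ) : ℕ := if p = v then n else p

def inputMsgs (n q lam : ℕ) (V : List (ℕ × ℕ × List ℕ)) : List (ℕ × ℕ × ℕ) :=
  V.flatMap fun v => emitMsgs q lam (v.1, 1, v.2.2) ++
    emitMsgs q lam (v.1, 2, [upper n v.1 v.2.1 + 1, v.1])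

def parseBody : Prog :=
  .comp (assign 18 (.get 2 (.r 17))) (.comp (assign 19 (.get 2 (.op .add (.r 17) (.c 1))))
  (.comp (assign 20 (.get 2 (.op .add (.r 17) (.c 2)))) (.comp (clearA aP)
  (.comp (forE 21 (.r 20) (pushE aP (.get 2 (.op .add (.op .add (.r 17) (.c 3)) (.r 21)))))
  (.comp (emitP (.r 18) 1) (.comp (clearA aP)
  (.comp (pushE aP (.op .add (.op .add (.op .mul (.op .eq (.r 19) (.r 18)) (.r 2))
    (.op .mul (.op .sub (.c 1) (.op .eq (.r 19) (.r 18))) (.r 19))) (.c 1)))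
  (.comp (pushE aP (.r 18)) (.comp (emitP (.r 18) 2)
    (assign 17 (.op .add (.op .add (.r 17) (.c 3)) (.r 20))))))))))))

def parse : Prog :=
  .comp (assign 17 (.c 0)) (forE 16 (.len 2) (ifE (.op .lt (.r 17) (.len 2)) parseBody skip))

section
variable {W B m n q lam : ℕ} {st : St} {Q : St → Prop} {T : ℕ}

lemma upper_eq (v p : ℕ) : Op.eval .add (Op.eval .add (Op.eval .mul (Op.eval .eq p v) n)
    (Op.eval .mul (Op.eval .sub 1 (Op.eval .eq p v)) p)) 1 = upper n v p + 1 := by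
  unfold upper; by_cases h : p = v <;> simp [Op.eval, h]

lemma Tri.parseBody (hs : Sizes W B m q lam) (hn : n + 1 ≤ B) (h2 : st.reg 2 = n)
    (h6 : st.reg 6 = q) (h7 : st.reg 7 = lam) {i v p : ℕ} {d : List ℕ} (h17 : st.reg 17 = i)
    (hi : i + 3 + d.length ≤ B) (hv : v < n) (hp : p < n) (hd : d.length < lam) (hlam : 2 < lam)
    (g0 : (st.arr 2).getD i 0 = v) (g1 : (st.arr 2).getD (i + 1) 0 = p)
    (g2 : (st.arr 2).getD (i + 2) 0 = d.length)
    (g3 : ∀ o < d.length, (st.arr 2).getD (i + 3 + o) 0 = d.getD o 0)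
    (h : ∀ st', Chg [17, 18, 19, 20, 21] [] st st' → st'.reg 17 = i + 3 + d.length →
      st'.out = st.out ++ enc2 (inputMsgs n q lam [(v, p, d)]) → Q st') :
    Tri W vis MPC.parseBody st (300 * (lam + 1)) Q := by
  have hW := hs.lt; have hle := hs.le; have hB := hs.big.le; have hdl : d.length ≤ B := by omega
  refine le (T := 5 + (7 + (7 + (1 + ((d.length + 1) * (9 + 2 + 12) + (104 * (lam + 1) +
    (1 + (25 + (3 + (104 * (lam + 1) + 11)))))))))) ?_ (by omega); unfold MPC.parseBody
  set s1 := st.setR 18 v with hs1; set s2 := s1.setR 19 p with hs2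
  set s3 := s2.setR 20 d.length with hs3; refine comp (le (assign ?_ ?_ ?_) (by simp [cost]))
  · simp only [ok, h17]; omega
  · simp only [eval, h17, g0]; omega
  simp only [eval, h17, g0, ← hs1]; have k1 : s1.reg 17 = i := by simp [hs1, h17]
  have a1 : s1.arr = st.arr := rfl; refine comp (le (assign ?_ ?_ ?_) (by simp [cost]))
  · simp only [ok, eval, Op.eval, k1]; exact ⟨by omega, by omega, by omega⟩
  · simp only [eval, Op.eval, k1, a1, g1]; omega
  simp only [eval, Op.eval, k1, a1, g1, ← hs2]; have k2 : s2.reg 17 = i := by simp [hs2, hs1, h17]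
  have a2 : s2.arr = st.arr := rfl; refine comp (le (assign ?_ ?_ ?_) (by simp [cost]))
  · simp only [ok, eval, Op.eval, k2]; exact ⟨by omega, by omega, by omega⟩
  · simp only [eval, Op.eval, k2, a2, g2]; omega
  simp only [eval, Op.eval, k2, a2, g2, ← hs3]
  have k3 : s3.reg 17 = i := by simp [hs3, hs2, hs1, h17]
  have a3 : s3.arr = st.arr := rfl; have c3 : Chg [17, 18, 19, 20, 21] [] st s3 :=
    (((Chg.refl _ _ _).setR _ (by simp)).setR _ (by simp)).setR _ (by simp)
  have r18 : s3.reg 18 = v := by simp [hs3, hs2, hs1]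
  have r19 : s3.reg 19 = p := by simp [hs3, hs2]
  have r20 : s3.reg 20 = d.length := by simp [hs3]
  have o3 : s3.out = st.out := rfl
  clear_value s3
  clear hs3; refine comp (Tri.clearA ?_); refine comp (Tri.forE (N := d.length) (by decide)
    (fun k s => Chg [21] [] s3 s ∧ s.out = st.out ∧ s.arr aP = d.take k) (by decide)
    (by simp [wf, vis]) (by omega) ?_ ?_ ?_ ?_)
  · refine ⟨⟨fun r hr hn => ?_, fun a ha hn => ?_⟩, o3, by simp⟩
    · simp only [mem_singleton] at hn; simp [hn]
    · rw [setR_arr, setA_arr, if_neg (by unfold aP; omega)]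
  · rintro k hk s ⟨hc, -, -⟩ hr; have := hc.reg r20
    simp only [ok, eval, this]; exact ⟨by omega, trivial⟩
  · rintro k hk s ⟨hc, ho, hv⟩ hr; have e17 := hc.reg k3; have e2 := hc.2 2 (by decide) (by simp)
    refine le (Tri.pushE ?_ ?_) (by simp [cost])
    · simp only [ok, eval, Op.eval, e17, hr]
      exact ⟨⟨by omega, by omega, by omega⟩, by omega, by omega⟩
    · refine ⟨by simpa using hr, ⟨fun r hr' hn => ?_, fun a ha hn => ?_⟩, ho, ?_⟩
      · rw [← hc.1 r hr' hn]; simp only [mem_singleton] at hn; simp [hn]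
      · rw [← hc.2 a ha hn, setR_arr, setA_arr, if_neg (by unfold aP; omega)]
      · simp only [setR_arr, setA_arr, if_pos, eval, Op.eval, e17, hr, e2, a3, hv]
        rw [g3 k hk, take_add_one, getD_eq_getElem?_getD, List.getElem?_eq_getElem hk]; simp
  rintro s4 ⟨c4, o4, v4⟩ -; rw [List.take_length] at v4; have c34 := c3.trans c4
  have u2 : s4.reg 2 = n := c34.reg h2; have u6 : s4.reg 6 = q := c34.reg h6
  have u7 : s4.reg 7 = lam := c34.reg h7; have u17 : s4.reg 17 = i := c4.reg k3
  have u18 : s4.reg 18 = v := c4.reg r18; have u19 : s4.reg 19 = p := c4.reg r19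
  have u20 : s4.reg 20 = d.length := c4.reg r20
  refine comp (Tri.emitP hs.fit (y := .r 18) (by decide) u6 u7 (by simp [wf, vis]) (by
    simp only [ok, u18]; omega) (by simp only [eval, u18]; omega) (by rw [v4]; exact hd) ?_)
  simp only [eval, u18, v4]; refine comp (Tri.clearA ?_)
  refine comp (le (Tri.pushE ?_ ?_) (by simp [cost]))
  · have hnn : n * 1 ≤ B := by omega
    simp only [ok, eval, setA_reg, addOut_reg, u2, u18, u19]; by_cases hpv : p = v
    · simp only [Op.eval, hpv, if_true]
      refine ⟨⟨⟨⟨?_, ?_, ?_⟩, ?_, ?_⟩, ⟨⟨?_, ⟨?_, ?_, ?_⟩, ?_⟩, ?_, ?_⟩, ?_⟩, ?_, ?_⟩ <;> omega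
    · simp only [Op.eval, hpv, if_false]
      refine ⟨⟨⟨⟨?_, ?_, ?_⟩, ?_, ?_⟩, ⟨⟨?_, ⟨?_, ?_, ?_⟩, ?_⟩, ?_, ?_⟩, ?_⟩, ?_, ?_⟩ <;> omega
  simp only [eval, setA_reg, addOut_reg, u2, u18, u19, upper_eq]
  refine comp (le (Tri.pushE ?_ ?_) (by simp [cost]))
  · simp only [ok, setA_reg, addOut_reg, u18]; omega
  simp only [eval, setA_reg, addOut_reg, u18, setA_arr, if_true, St.setA_setA,
    List.nil_append, List.cons_append]
  refine comp (Tri.emitP hs.fit (y := .r 18) (by decide) (by simpa using u6) (by simpa using u7)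
    (by simp [wf, vis]) (by
    simp only [ok, setA_reg, addOut_reg, u18]; omega) (by
    simp only [eval, setA_reg, addOut_reg, u18]; omega) (by simpa using hlam) ?_)
  simp only [eval, setA_reg, addOut_reg, u18, setA_arr, if_true]
  refine le (assign ?_ ?_ ?_) (by simp [cost])
  · simp only [ok, eval, Op.eval, setA_reg, addOut_reg, u17, u20]
    exact ⟨⟨by omega, by omega, by omega⟩, by omega, by omega⟩
  · simp only [eval, Op.eval, setA_reg, addOut_reg, u17, u20]; omega
  simp only [eval, Op.eval, setA_reg, addOut_reg, u17, u20]
  refine h _ ⟨fun r hr hn => ?_, fun a ha hn => ?_⟩ (by simp) ?_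
  · have hn' : r ≠ 17 := by rintro rfl; simp at hn
    have hn'' : r ∉ [21] := fun hh => hn (by simp only [mem_singleton] at hh; simp [hh])
    simp only [setR_reg, if_neg hn', addOut_reg, setA_reg]; rw [c4.1 r hr hn'', c3.1 r hr hn]
  · simp only [setR_arr, St.addOut_arr, setA_arr]
    rw [if_neg (by unfold aP; omega), c4.2 a ha (by simp), c3.2 a ha (by simp)]
  · simp [o4, inputMsgs]

lemma encIn_append (V V' : List (ℕ × ℕ × List ℕ)) : encIn (V ++ V') = encIn V ++ encIn V' :=
  List.flatMap_append

lemma inputMsgs_append (V V' : List (ℕ × ℕ × List ℕ)) :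
    inputMsgs n q lam (V ++ V') = inputMsgs n q lam V ++ inputMsgs n q lam V' :=
  List.flatMap_append

lemma encIn_split (V : List (ℕ × ℕ × List ℕ)) (k : ℕ) (hk : k < V.length) :
    encIn V = encIn (V.take k) ++ (V[k].1 :: V[k].2.1 :: V[k].2.2.length :: V[k].2.2 ++
      encIn (V.drop (k + 1))) := by
  conv_lhs => rw [← List.take_append_drop k V, List.drop_eq_getElem_cons hk, encIn_append]
  rfl

lemma length_le_encIn (V : List (ℕ × ℕ × List ℕ)) : V.length ≤ (encIn V).length := by
  induction V with
  | nil => simp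
  | cons v V ih => simp only [encIn, flatMap_cons, length_append, length_cons] at ih ⊢; omega

lemma getD_append_add (l l' : List ℕ) (o : ℕ) : (l ++ l').getD (l.length + o) 0 = l'.getD o 0 := by
  rw [getD_eq_getElem?_getD, getD_eq_getElem?_getD,
    List.getElem?_append_right (by omega), Nat.add_sub_cancel_left]

lemma Tri.parse (hs : Sizes W B m q lam) (hn : n + 1 ≤ B) (h2 : st.reg 2 = n)
    (h6 : st.reg 6 = q) (h7 : st.reg 7 = lam) (hlam : 2 < lam) {V : List (ℕ × ℕ × List ℕ)}
    (hV : st.arr 2 = encIn V) (hVB : (encIn V).length ≤ B)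
    (hin : ∀ v ∈ V, v.1 < n ∧ v.2.1 < n ∧ v.2.2.length < lam)
    (h : ∀ st', Chg [16, 17, 18, 19, 20, 21] [] st st' →
      st'.out = st.out ++ enc2 (inputMsgs n q lam V) → Q st') :
    Tri W vis MPC.parse st (400 * (((encIn V).length + 1) * (lam + 1))) Q := by
  have hW := hs.lt; have hle := hs.le; have hB := hs.big.le
  refine le (T := 3 + ((encIn V).length + 1) * ((5 + (300 * (lam + 1))) + 1 + 12)) ?_ ?_
  · unfold MPC.parse; refine comp (le (assign (by simp only [ok]; omega)
      (by simp only [eval]; omega) ?_) (by simp [cost])); simp only [eval]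
    refine Tri.forE (N := (encIn V).length) (by decide) (fun k s =>
      Chg [16, 17, 18, 19, 20, 21] [] st s ∧ s.reg 17 = (encIn (V.take k)).length ∧
      s.out = st.out ++ enc2 (inputMsgs n q lam (V.take k))) (by decide) (by simp [wf])
      (by omega) ?_ ?_ ?_ ?_
    · exact ⟨((Chg.refl _ _ _).setR _ (by simp)).setR _ (by simp), by simp [encIn],
        by simp [inputMsgs]⟩
    · rintro k hk s ⟨hc, -, -⟩ hr; have := (hc.2 2 (by decide) (by simp)).trans hV
      simp only [ok, eval, this]; exact ⟨by omega, trivial⟩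
    · rintro k hk s ⟨hc, h17, ho⟩ hr; have e2 := (hc.2 2 (by decide) (by simp)).trans hV
      have hpre : (encIn (V.take k)).length ≤ (encIn V).length := by
        have : encIn V = encIn (V.take k) ++ encIn (V.drop k) := by
          rw [← encIn_append, List.take_append_drop]
        rw [this, length_append]; omega
      refine Tri.ifE ?_ (fun hlt => ?_) fun hlt => ?_
      · refine ⟨by simp only [ok, h17]; omega, by simp only [ok, e2]; omega, ?_⟩
        exact lt_of_le_of_lt (Op.eval_lt_le_one _ _) (by omega)
      · have hkV : k < V.length := by
          by_contra hc'; rw [take_of_length_le (by omega)] at h17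
          simp [eval, Op.eval, h17, e2] at hlt
        have hsp := encIn_split V k hkV; have hlen := congrArg List.length hsp
        simp only [length_append, length_cons] at hlen
        have ht : V.take (k + 1) = V.take k ++ [V[k]] := by
          rw [take_add_one, List.getElem?_eq_getElem hkV]; rfl
        obtain ⟨hv1, hv2, hv3⟩ := hin V[k] (List.getElem_mem hkV)
        refine Tri.parseBody (v := V[k].1) (p := V[k].2.1) (d := V[k].2.2) hs hn
          (hc.reg h2) (hc.reg h6)
          (hc.reg h7) h17 (by omega) hv1 hv2 hv3 hlam ?_ ?_ ?_ ?_
          fun s' c' k17 o' => ?_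
        · rw [e2, hsp]
          have := getD_append_add (encIn (V.take k)) (V[k].1 :: V[k].2.1 :: V[k].2.2.length ::
            V[k].2.2 ++ encIn (V.drop (k + 1))) 0; simp at this ⊢
        · rw [e2, hsp, getD_append_add]; simp
        · rw [e2, hsp, getD_append_add]; simp
        · intro o ho
          rw [e2, hsp, Nat.add_assoc, getD_append_add, show 3 + o = o + 1 + 1 + 1 by omega]
          simp only [List.cons_append, getD_cons_succ]
          rw [getD_eq_getElem?_getD, List.getElem?_append_left ho, getD_eq_getElem?_getD]
        · refine ⟨c'.reg hr, ((hc.trans c').mono (by simp) (by simp)).setR _ (by simp), ?_, ?_⟩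
          · rw [setR_reg, if_neg (by decide), k17, ht, encIn_append, length_append]
            simp only [encIn, flatMap_cons, flatMap_nil, append_nil, length_cons]; omega
          · rw [St.setR_out, o', ho, ht, inputMsgs_append, enc2_append, append_assoc]
      · have hkV : ¬ k < V.length := by
          intro hkV; have hsp := congrArg List.length (encIn_split V k hkV)
          simp only [length_append, length_cons] at hsp
          simp only [eval, Op.eval, h17, e2] at hlt; rw [if_pos (by omega)] at hlt; omega
        refine le (skip ⟨hr, hc.setR _ (by simp), ?_, ?_⟩) (by omega)
        · rw [setR_reg, if_neg (by decide), h17, take_of_length_le (by omega),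
            take_of_length_le (by omega)]
        · rw [St.setR_out, ho, take_of_length_le (by omega), take_of_length_le (by omega)]
    · rintro s ⟨hc, h17, ho⟩ hr; refine h s hc ?_; rw [ho, take_of_length_le (length_le_encIn V)]
  · generalize (encIn V).length = a
    have : (a + 1) * (5 + 300 * (lam + 1) + 1 + 12) = 300 * ((a + 1) * (lam + 1)) + 18 * (a + 1) := by
      ring
    have h1 : a + 1 ≤ (a + 1) * (lam + 1) := le_mul_succ lam (a + 1); rw [this]; omega

end

/-! ## Control -/

section
variable {W U : ℕ} {st : St} {Q : St → Prop} {T : ℕ}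

def selP (r : ℕ) (f : ℕ → Prog) : ℕ → Prog
  | 0 => f 0
  | k + 1 => ifE (.op .eq (.r r) (.c (k + 1))) (f (k + 1)) (selP r f k)

lemma Tri.selP {r v : ℕ} {f : ℕ → Prog} (hr : r < vis) (hv : st.reg r = v) {k : ℕ} (hk : v ≤ k)
    (hkW : k + 1 < W) (h : Tri W vis (f v) st T Q) : Tri W vis (MPC.selP r f k) st (5 * k + T) Q := by
  induction k with
  | zero =>
    obtain rfl : v = 0 := by omega
    exact h.le (by omega)
  | succ k ih =>
    unfold MPC.selP
    refine le (T := 4 + 1 + (5 * k + T)) (Tri.ifE (hwf := ⟨hr, trivial⟩) ?_ (fun hh => ?_)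
      fun hh => ?_) (by omega)
    · refine ⟨by simp only [ok]; omega, by simp only [ok]; omega, ?_⟩
      exact lt_of_le_of_lt (Op.eval_eq_le_one _ _) (by omega)
    · have : v = k + 1 := by by_contra hc; simp [eval, Op.eval, hv, hc] at hh
      subst this; exact h.le (by omega)
    · have : v ≠ k + 1 := by intro hc; simp [eval, Op.eval, hv, hc] at hh
      exact ih (by omega) (by omega)

def chainP (d : ℕ) : List (ℕ × ℕ × Expr) → Prog
  | [] => assign 16 (.c d)
  | x :: l => ifE (.op .lt (.r 4) (.op .add (.op .mul (.c x.1) (.r 3)) (.c x.2.1)))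
      (assign 16 x.2.2) (chainP d l)

def chainVal (d : ℕ) (st : St) : List (ℕ × ℕ × Expr) → ℕ
  | [] => d
  | x :: l => if st.reg 4 < x.1 * st.reg 3 + x.2.1 then x.2.2.eval st else chainVal d st l

lemma Tri.chain {d : ℕ} (hd : d + 1 < W) (h4 : st.reg 4 < W) (h3 : st.reg 3 < W)
    (l : List (ℕ × ℕ × Expr))
    (hl : ∀ x ∈ l, x.1 * st.reg 3 + x.2.1 < W ∧ x.1 < W ∧ x.2.2.wf vis ∧ x.2.2.ok W st ∧
      x.2.2.eval st < W)
    (h : Q (st.setR 16 (chainVal d st l))) :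
    Tri W vis (chainP d l) st ((l.map fun x => x.2.2.cost + 12).sum + 3) Q := by
  induction l with
  | nil => exact (Tri.assignC (k := d) (by omega) h).le (by simp)
  | cons x l ih =>
    obtain ⟨h1, h2, h5, h6, h7⟩ := hl x (by simp); unfold chainP
    refine le (T := 9 + 1 + (x.2.2.cost + 2 + ((l.map fun x => x.2.2.cost + 12).sum + 3)))
      (le (T := (Expr.op .lt (.r 4) (.op .add (.op .mul (.c x.1) (.r 3)) (.c x.2.1))).cost + 1 +
        (x.2.2.cost + 2 + ((l.map fun x => x.2.2.cost + 12).sum + 3)))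
        (Tri.ifE ?_ (fun hh => ?_) fun hh => ?_)
        (by simp [cost]))
      (by simp only [map_cons, sum_cons]; omega)
    · simp only [ok, eval]; simp only [Op.eval] at *
      refine ⟨h4, ⟨⟨h2, h3, by omega⟩, by omega, h1⟩, ?_⟩
      exact lt_of_le_of_lt (Op.eval_lt_le_one _ _) (by omega)
    · refine le (Tri.assign h6 h7 ?_ (hwf := h5)) (by omega)
      have : st.reg 4 < x.1 * st.reg 3 + x.2.1 := by by_contra hc; simp [eval, Op.eval, hc] at hh
      simpa [chainVal, this] using h
    · have : ¬ st.reg 4 < x.1 * st.reg 3 + x.2.1 := by intro hc; simp [eval, Op.eval, hc] at hh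
      refine le (ih (fun y hy => hl y (by simp [hy])) ?_) (by omega); simpa [chainVal, this] using h

def powE : ℕ → Expr
  | 0 => .c 1
  | g + 1 => .op .mul (powE g) (.r 3)

lemma powE_spec {L : ℕ} (hL : 0 < L) (h3 : st.reg 3 = L) (g : ℕ) (hW : L ^ g < W) (hLW : L < W) :
    (powE g).eval st = L ^ g ∧ (powE g).ok W st ∧ (powE g).wf vis ∧ (powE g).cost = 3 * g + 1 := by
  induction g with
  | zero => exact ⟨rfl, hW, trivial, rfl⟩
  | succ g ih =>
    have h1 : L ^ g ≤ L ^ (g + 1) := Nat.pow_le_pow_right hL (by omega)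
    obtain ⟨a, b, c, d⟩ := ih (by omega); have e : (powE (g + 1)).eval st = L ^ (g + 1) := by
      simp only [powE, eval, Op.eval, a, h3, pow_succ]
    refine ⟨e, ⟨b, by simp only [ok, h3]; exact hLW, ?_⟩, ⟨c, by simp [wf, vis]⟩, ?_⟩
    · rw [a]; simp only [eval, Op.eval, h3, ← pow_succ]; exact hW
    · simp only [powE, cost, d]; omega

end

def ncode (L u : ℕ) : ℕ :=
  if u < 2 * L + 2 then u % 2 else if u < 2 * L + 3 then 2 else if u < 2 * L + 4 then 3
  else if u < 2 * L + 5 then 4 else if u < 3 * L + 7 then 5 else if u < 3 * L + 8 then 6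
  else if u < 9 * L + 14 then 7 + (u - (3 * L + 8)) % 6 else 13

def pwAt (L u : ℕ) : ℕ := 2 ^ min (u / 2) (L + 1)

lemma ncode_le (L u : ℕ) : ncode L u ≤ 13 := by
  unfold ncode; have := Nat.mod_lt (u - (3 * L + 8)) (show 0 < 6 by decide); split_ifs <;> omega

lemma pwAt_succ (L u : ℕ) : pwAt L (u + 1) = pwAt L u * (1 + if ncode L u = 1 then 1 else 0) := by
  have key : (if ncode L u = 1 then 1 else 0) = if u < 2 * L + 2 ∧ u % 2 = 1 then 1 else 0 := by
    unfold ncode; split_ifs <;> omega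
  rw [key]; unfold pwAt; split_ifs with h
  · rw [show min ((u + 1) / 2) (L + 1) = min (u / 2) (L + 1) + 1 by omega, pow_succ]
  · rw [show min ((u + 1) / 2) (L + 1) = min (u / 2) (L + 1) by omega]; omega

def codeList : List (ℕ × ℕ × Expr) :=
  [(2, 2, .op .mod (.r 4) (.c 2)), (2, 3, .c 2), (2, 4, .c 3), (2, 5, .c 4), (3, 7, .c 5),
    (3, 8, .c 6), (9, 14, .op .add (.c 7) (.op .mod
      (.op .sub (.r 4) (.op .add (.op .mul (.c 3) (.r 3)) (.c 8))) (.c 6)))]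

lemma chainVal_codeList (st : St) : chainVal 13 st codeList = ncode (st.reg 3) (st.reg 4) := rfl

def targetE (g : ℕ) : Expr := .op .mul (.op .add (.op .div (.r 2) (.r 1)) (.c 1)) (powE g)

/-- The program of a machine in the different stages; the stage is in register `5`. -/
def stageP (progs : ℕ → NodeProg) (g a : ℕ) : ℕ → Prog
  | 0 => .comp (copyA 2 0) (.comp (pushE 3 (.c 0)) (.comp (assign 5 (.c 1)) (assign 15 (.r 2))))
  | 1 => .comp (assign 3 (.op .add (.r 3) (.c 1))) (.comp (assign 15 (.op .div (.r 15) (.c 2)))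
      (assign 5 (.op .add (.c 1) (.op .eq (.r 15) (.c 0)))))
  | 2 => .comp (ifE (.op .lt (.len 3) (targetE g)) (.comp (copyA 4 3) (copyA 3 4)) skip)
      (.comp (assign 4 (.op .add (.r 4) (.c 1)))
        (assign 5 (.op .add (.c 2) (.op .eq (.r 4) (.op .mul (.c g) (.r 3))))))
  | 3 => .comp (assign 6 (.op .add (.op .div (.op .add (.op .mul (.c 2) (.r 2)) (.c 2)) (.r 1)) (.c 1)))
      (.comp (assign 7 (.op .mul (.c a) (powE a))) (.comp (assign 8 (.c 1))
      (.comp (assign 4 (.c 0)) (.comp (assign 5 (.c 4)) parse))))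
  | 4 => .comp (chainP 13 codeList) (.comp (selP 16 (fun k => mainStep (progs k)) 13)
      (.comp (assign 8 (.op .mul (.r 8) (.op .add (.c 1) (.op .eq (.r 16) (.c 1)))))
      (.comp (assign 4 (.op .add (.r 4) (.c 1)))
        (assign 5 (.op .add (.c 4) (.op .eq (.r 4) (.op .add (.op .mul (.c 9) (.r 3)) (.c 15))))))))
  | 5 => .comp fillQ (.comp (assign 9 (.c 0)) (.comp (loadField (.r 9) 21 1) (assign 5 (.c 6))))
  | _ => skip

def coreP (progs : ℕ → NodeProg) (g a : ℕ) : Prog := selP 5 (stageP progs g a) 6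

structure Setup where
  n : ℕ
  m : ℕ
  q : ℕ
  lam : ℕ
  L : ℕ
  Z : ℕ
  g : ℕ
  a : ℕ
  c0 : ℕ
  W : ℕ
  B : ℕ
  V : ℕ → List (ℕ × ℕ × List ℕ)
  progs : ℕ → NodeProg
  Γ : ℕ → ℕ → ℕ → List ℕ
  R : ℕ → ℕ → List ℕ

namespace Setup

def msgs (S : Setup) : ℕ → ℕ → List (ℕ × ℕ × ℕ)
  | 0, j => inputMsgs S.n S.q S.lam (S.V j)
  | u + 1, j => sent S.n (pwAt S.L u) S.m S.q S.lam (S.progs (ncode S.L u)) (S.Γ u) (S.R u) j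

structure Ok (S : Setup) : Prop where
  sizes : Sizes S.W S.B S.m S.q S.lam
  two_lt : 2 < S.lam
  n_pos : 0 < S.n
  L_eq : S.L = lg S.n
  q_eq : S.q = (2 * S.n + 2) / S.m + 1
  lam_eq : S.lam = S.a * S.L ^ S.a
  Z_eq : S.Z = (S.n / S.m + 1) * S.L ^ S.g
  g_pos : 0 < S.g
  Z_pow : S.Z ≤ 2 ^ (S.g * S.L - 1)
  Z_le : 2 * S.Z ≤ S.B
  n_le : 2 * S.n + 3 ≤ S.B
  a_le : S.a ≤ S.B
  gL_le : S.g * S.L ≤ S.B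
  L_le : 9 * S.L + 15 ≤ S.B
  in_le : ∀ j < S.m, (encIn (S.V j)).length ≤ S.B
  pw_le : 2 ^ (S.L + 1) ≤ S.B
  c0_le : 2 * (S.c0 * S.Z) + 4 ≤ S.W
  good : ∀ k ≤ 13, (S.progs k).good = true
  seq : ∀ k ≤ 13, (S.progs k).call.prog.IsSequential
  vstep : ∀ u < 9 * S.L + 15, VStep S.W S.lam S.n (pwAt S.L u) (S.m * S.q)
    (S.progs (ncode S.L u)) (S.Γ u) (S.Γ (u + 1)) (S.R u)
  gok : ∀ u ≤ 9 * S.L + 15, GOK S.B S.lam (S.Γ u)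
  input : ∀ j < S.m, ∀ v ∈ S.V j, v.1 < S.n ∧ v.2.1 < S.n ∧ v.2.2.length < S.lam
  start : ∀ j < S.m,
    Describes (S.q * nf * S.lam + S.m) (memOf S.q S.lam (S.Γ 0) j) (inbox S.m (S.msgs 0) j)
  start_len : ∀ j < S.m, (inbox S.m (S.msgs 0) j).length ≤ S.c0 * S.Z
  load : ∀ k ≤ 13, S.m + ((S.progs k).rules.length + 1) * (S.q * S.lam) ≤ S.c0 * S.Z
  z1 : (S.q + 1) * (S.lam + 1) + S.m ≤ S.c0 * S.Z
  z2 : ∀ j < S.m, ((encIn (S.V j)).length + 1) * (S.lam + 1) ≤ S.c0 * S.Z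

end Setup

inductive Stage : Type
  | copy | lg (i : ℕ) | pad (t : ℕ) | init | net (u : ℕ) | output | idle

def Setup.next (S : Setup) : Stage → Stage
  | .copy => .lg 0
  | .lg i => if i + 1 < S.L then .lg (i + 1) else .pad 0
  | .pad t => if t + 1 < S.g * S.L then .pad (t + 1) else .init
  | .init => .net 0
  | .net u => if u + 1 < 9 * S.L + 15 then .net (u + 1) else .output
  | .output => .idle
  | .idle => .idle

def Setup.out (S : Setup) : Stage → ℕ → List (ℕ × ℕ × ℕ)
  | .init => S.msgs 0
  | .net u => S.msgs (u + 1)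
  | _ => fun _ => []

structure Setup.Inv (S : Setup) (s : Stage) (j : ℕ) (st : St) : Prop where
  r0 : st.reg 0 = j
  r1 : st.reg 1 = S.m
  r2 : st.reg 2 = S.n
  stage : match s with
    | .copy => st.reg 5 = 0 ∧ st.reg 3 = 0 ∧ st.reg 4 = 0 ∧ st.arr 0 = encIn (S.V j) ∧
        st.arr 1 = [] ∧ st.arr 2 = [] ∧ st.arr 3 = []
    | .lg i => i < S.L ∧ st.reg 5 = 1 ∧ st.reg 3 = i ∧ st.reg 4 = 0 ∧ st.reg 15 = S.n / 2 ^ i ∧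
        st.arr 0 = [] ∧ st.arr 1 = [] ∧ st.arr 2 = encIn (S.V j) ∧ (st.arr 3).length = 1
    | .pad t => t < S.g * S.L ∧ st.reg 5 = 2 ∧ st.reg 3 = S.L ∧ st.reg 4 = t ∧ st.arr 0 = [] ∧
        st.arr 1 = [] ∧ st.arr 2 = encIn (S.V j) ∧ min S.Z (2 ^ t) ≤ (st.arr 3).length ∧
        (st.arr 3).length ≤ 2 * S.Z
    | .init => st.reg 5 = 3 ∧ st.reg 3 = S.L ∧ st.arr 0 = [] ∧ st.arr 1 = [] ∧
        st.arr 2 = encIn (S.V j) ∧ S.Z ≤ (st.arr 3).length ∧ (st.arr 3).length ≤ 2 * S.Z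
    | .net u => u < 9 * S.L + 15 ∧ st.reg 5 = 4 ∧ st.reg 3 = S.L ∧ st.reg 4 = u ∧
        st.reg 6 = S.q ∧ st.reg 7 = S.lam ∧ st.reg 8 = pwAt S.L u ∧
        st.arr 0 = pairs (inbox S.m (S.msgs u) j) ∧ st.arr 1 = [] ∧ st.arr 2 = encIn (S.V j) ∧
        S.Z ≤ (st.arr 3).length ∧ (st.arr 3).length ≤ 2 * S.Z
    | .output => st.reg 5 = 5 ∧ st.reg 6 = S.q ∧ st.reg 7 = S.lam ∧
        st.arr 0 = pairs (inbox S.m (S.msgs (9 * S.L + 15)) j) ∧ st.arr 1 = [] ∧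
        st.arr 2 = encIn (S.V j) ∧ S.Z ≤ (st.arr 3).length ∧ (st.arr 3).length ≤ 2 * S.Z
    | .idle => st.reg 5 = 6 ∧ st.arr 0 = [] ∧ st.arr 1 = S.Γ (9 * S.L + 15) (j * S.q) 21 ∧
        st.arr 2 = encIn (S.V j) ∧ (st.arr 3).length ≤ 2 * S.Z

def Setup.Post (S : Setup) (s : Stage) (j : ℕ) (st : St) : Prop := st.out = enc2 (S.out s j) ∧
    S.Inv (S.next s) j { st with arr := update st.arr 0 (pairs (inbox S.m (S.out s) j)) }

def timeC (progs : ℕ → NodeProg) (c0 g a : ℕ) : ℕ :=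
  ((∑ k ∈ range 14, (progs k).cost) + 10000) * (c0 + 1) * 3 + 10 * g + 10 * a

lemma inbox_nil (m j : ℕ) : inbox m (fun _ => []) j = [] := by simp [inbox]

namespace Setup
variable {S : Setup} (h : S.Ok) {j : ℕ} (hj : j < S.m) {st : St}
include h

lemma Ok.W_big : 16 * S.B + 16 ≤ S.W := h.sizes.lt

lemma Ok.L_pos : 0 < S.L := by rw [h.L_eq]; unfold MPC.lg; omega

lemma Ok.describes {u : ℕ} (hu : u ≤ 9 * S.L + 15) (hj : j < S.m) :
    Describes (S.q * nf * S.lam + S.m) (memOf S.q S.lam (S.Γ u) j) (inbox S.m (S.msgs u) j) := by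
  cases u with
  | zero => exact h.start j hj
  | succ u =>
    exact VStep.describes (Γ := S.Γ u) h.sizes.fit.q_pos (h.good _ (ncode_le _ _))
      (h.vstep u (by omega)) (h.gok (u + 1) hu) (j := j) hj

lemma Ok.inbox_len {u : ℕ} (hu : u ≤ 9 * S.L + 15) (hj : j < S.m) :
    (inbox S.m (S.msgs u) j).length ≤ S.c0 * S.Z := by
  cases u with
  | zero => exact h.start_len j hj
  | succ u =>
    exact ((h.vstep u (by omega)).length_inbox h.sizes.fit.q_pos (h.gok _ hu) j).trans
      (h.load _ (ncode_le _ _))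

lemma Ok.Z_pos : 1 ≤ S.Z := by rw [h.Z_eq]; exact Nat.mul_pos (Nat.succ_pos _) (pow_pos h.L_pos _)

lemma Ok.targetE (h1 : st.reg 1 = S.m) (h2 : st.reg 2 = S.n) (h3 : st.reg 3 = S.L) :
    (targetE S.g).eval st = S.Z ∧ (targetE S.g).ok S.W st ∧ (targetE S.g).wf vis ∧
      (targetE S.g).cost = 3 * S.g + 9 := by
  have hW := h.W_big; have hZ := h.Z_le; have hn := h.n_le; have hL := h.L_le; have hm := h.sizes.le
  have hLg : S.L ^ S.g ≤ S.Z := by rw [h.Z_eq]; exact Nat.le_mul_of_pos_left _ (Nat.succ_pos _)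
  obtain ⟨p1, p2, p3, p4⟩ := powE_spec (W := S.W) h.L_pos h3 S.g (by omega) (by omega)
  have hdiv : S.n / S.m ≤ S.n := Nat.div_le_self _ _; have e : (MPC.targetE S.g).eval st = S.Z := by
    simp only [MPC.targetE, eval, Op.eval, p1, h1, h2, h.Z_eq]
  refine ⟨e, ?_, ?_, by simp [MPC.targetE, cost, p4]; omega⟩
  · refine ⟨?_, p2, ?_⟩
    · simp only [ok, eval, Op.eval, h1, h2]; omega
    · have : Op.mul.eval ((Expr.op .add (.op .div (.r 2) (.r 1)) (.c 1)).eval st) ((powE S.g).eval st)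
          = S.Z := e; rw [this]; omega
  · simp [MPC.targetE, wf, vis, p3]

include hj

lemma Ok.copy (hI : S.Inv .copy j st) (ho : st.out = []) :
    Tri S.W vis (stageP S.progs S.g S.a 0) st (17 * ((st.arr 0).length + 1) + 20) (S.Post .copy j) := by
  obtain ⟨h0, h1, h2, h5, h3, h4, a0, a1, a2, a3⟩ := hI; have hW := h.W_big; have hi := h.in_le j hj
  have hn := h.n_le; have hn2 : S.n / 2 ^ 0 = S.n := by simp
  unfold stageP
  refine le (T := ((st.arr 0).length + 1) * 17 + (2 + (3 + 4))) (comp (Tri.copyA (by decide) (by rw [a0]; omega) ?_)) (by omega)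
  refine comp (Tri.pushE (by simp [ok]; omega) ?_); refine comp (Tri.assignC (by omega) ?_)
  refine Tri.assign (by simp [ok]; omega) (by simp [eval]; omega) ?_
  refine ⟨by simpa [Setup.out, enc2] using ho, ?_⟩
  refine ⟨by simpa using h0, by simpa using h1, by simpa using h2, ?_⟩
  rw [show S.next .copy = .lg 0 from rfl]
  simp [h.L_pos, h3, h4, h2, a0, a1, a2, a3, eval, Setup.out, inbox_nil, pairs]

lemma Ok.logStep {i : ℕ} (hI : S.Inv (.lg i) j st) (ho : st.out = []) :
    Tri S.W vis (stageP S.progs S.g S.a 1) st 30 (S.Post (.lg i) j) := by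
  obtain ⟨h0, h1, h2, hi, h5, h3, h4, h15, a0, a1, a2, a3⟩ := hI; have hW := h.W_big
  have hn := h.n_le; have hL := h.L_le; have hL' := h.L_eq
  have hdiv : S.n / 2 ^ i ≤ S.n := Nat.div_le_self _ _
  have hdd : S.n / 2 ^ i / 2 = S.n / 2 ^ (i + 1) := by rw [Nat.div_div_eq_div_mul, pow_succ]
  have hz : S.n / 2 ^ (i + 1) = 0 ↔ S.L ≤ i + 1 := by
    rw [Nat.div_eq_zero_iff, ← Nat.log_lt_iff_lt_pow (by decide) h.n_pos.ne', hL', MPC.lg]; simp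
  have hdiv2 : S.n / 2 ^ (i + 1) ≤ S.n := Nat.div_le_self _ _; unfold stageP
  refine le (T := 6 + (6 + 8)) ?_ (by omega)
  refine comp (Tri.assign (by simp only [ok, eval, Op.eval]; omega)
    (by simp only [eval, Op.eval]; omega) ?_); refine comp (Tri.assign ?_ ?_ ?_)
  · simp only [ok, eval, Op.eval, setR_reg]
    simp only [h15, hdd, show (15 : ℕ) ≠ 3 by decide, if_false]; omega
  · simp only [eval, Op.eval, setR_reg]; simp only [h15, hdd, show (15 : ℕ) ≠ 3 by decide, if_false]
    omega
  have e15 : (Expr.op .div (.r 15) (.c 2)).eval (st.setR 3 ((Expr.op Op.add (Expr.r 3) (Expr.c 1)).eval st))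
      = S.n / 2 ^ (i + 1) := by simp [eval, Op.eval, h15, hdd]
  have e3 : (Expr.op Op.add (Expr.r 3) (Expr.c 1)).eval st = i + 1 := by simp [eval, Op.eval, h3]
  rw [e15, e3]; refine Tri.assign ?_ ?_ ?_
  · simp only [ok, eval, Op.eval, setR_reg, if_true]; split_ifs <;> omega
  · simp only [eval, Op.eval, setR_reg, if_true]; split_ifs <;> omega
  refine ⟨by simpa [Setup.out, enc2] using ho, ?_⟩
  refine ⟨by simpa using h0, by simpa using h1, by simpa using h2, ?_⟩; by_cases hlt : i + 1 < S.L
  · have : S.n / 2 ^ (i + 1) ≠ 0 := by rw [Ne, hz]; omega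
    rw [show S.next (.lg i) = .lg (i + 1) from if_pos hlt]
    simp [hlt, h4, a1, a2, a3, eval, Op.eval, Setup.out, inbox_nil,
      pairs, this, - Nat.div_eq_zero_iff]
  · have h0' : S.n / 2 ^ (i + 1) = 0 := by rw [hz]; omega
    have hi1 : i + 1 = S.L := by omega
    have hZ : 1 ≤ S.Z := by rw [h.Z_eq]; exact Nat.mul_pos (Nat.succ_pos _) (pow_pos h.L_pos _)
    have := Nat.mul_pos h.g_pos h.L_pos; rw [show S.next (.lg i) = .pad 0 from if_neg hlt]
    simp [hi1, h4, a1, a2, a3, eval, Op.eval, Setup.out, inbox_nil,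
      pairs, this, - Nat.div_eq_zero_iff]; rw [hi1] at h0'; exact ⟨by rw [if_pos h0'], by omega⟩

lemma Ok.padStep {t : ℕ} (hI : S.Inv (.pad t) j st) (ho : st.out = []) (ha4 : st.arr 4 = []) :
    Tri S.W vis (stageP S.progs S.g S.a 2) st (3 * S.g + 60 + 34 * ((st.arr 3).length + 1))
      (S.Post (.pad t) j) := by
  obtain ⟨h0, h1, h2, ht, h5, h3, h4, a0, a1, a2, a3, a3'⟩ := hI; have hW := h.W_big
  have hn := h.n_le; have hZ := h.Z_le; have hL := h.L_le; have hgL := h.gL_le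
  have hg : S.g ≤ S.B := le_trans (Nat.le_mul_of_pos_right _ h.L_pos) hgL
  obtain ⟨e1, e2, e3, e4⟩ := h.targetE h1 h2 h3
  have hcost : (Expr.op .lt (.len 3) (MPC.targetE S.g)).cost = 3 * S.g + 11 := by
    simp only [cost, e4]; omega
  unfold stageP
  have key : ∀ s : St, s.reg = st.reg → (∀ a < 3, s.arr a = st.arr a) → s.out = st.out →
      (s.arr 3).length ≤ 2 * S.Z → min S.Z (2 ^ (t + 1)) ≤ (s.arr 3).length →
      Tri S.W vis (.comp (MPC.assign 4 (.op .add (.r 4) (.c 1)))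
        (MPC.assign 5 (.op .add (.c 2) (.op .eq (.r 4) (.op .mul (.c S.g) (.r 3)))))) s
        (6 + 11) (S.Post (.pad t) j) := by
    intro s hr ha hso hl hl'; refine comp (Tri.assign (by simp only [ok, eval, Op.eval, hr]; omega)
      (by simp only [eval, Op.eval, hr]; omega) ?_); refine Tri.assign ?_ ?_ ?_
    · simp only [ok, eval, Op.eval, setR_reg, hr]; simp only [h4, h3]
      simp only [show (3 : ℕ) ≠ 4 by decide, if_true, if_false]; split_ifs <;> omega
    · simp only [eval, Op.eval, setR_reg, hr]; split_ifs <;> omega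
    have e5 : (Expr.op Op.add (Expr.r 4) (Expr.c 1)).eval s = t + 1 := by
      simp [eval, Op.eval, hr, h4]
    rw [e5]; refine ⟨by simpa [Setup.out, enc2, hso] using ho, ?_⟩
    refine ⟨by simpa [hr] using h0, by simpa [hr] using h1, by simpa [hr] using h2, ?_⟩
    have b0 := ha 0 (by decide); have b1 := ha 1 (by decide); have b2 := ha 2 (by decide)
    by_cases hlt : t + 1 < S.g * S.L
    · have hne : t + 1 ≠ S.g * S.L := by omega
      rw [show S.next (.pad t) = .pad (t + 1) from if_pos hlt]
      simp only [setR_reg, setR_arr, hr, eval, Op.eval]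
      simp [hlt, h3, a1, a2, b1, b2, Setup.out, inbox_nil, pairs, hne, hl]; simpa using hl'
    · have hne : t + 1 = S.g * S.L := by omega
      rw [show S.next (.pad t) = .init from if_neg hlt]; have hzz : S.Z ≤ (s.arr 3).length := by
        refine le_trans (le_min le_rfl ?_) hl'
        exact h.Z_pow.trans (Nat.pow_le_pow_right (by decide) (by omega))
      simp only [setR_reg, setR_arr, hr, eval, Op.eval]
      simp [h3, a1, a2, b1, b2, Setup.out, inbox_nil, pairs, hne, hl, hzz]
  refine le (T := (Expr.op .lt (.len 3) (MPC.targetE S.g)).cost + 1 +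
    (((st.arr 3).length + 1) * 17 + ((st.arr 3).length + 1) * 17 + 1) + (6 + 11)) (comp
    (Tri.ifE (hwf := by simp [wf, e3]) ?_ (fun hh => ?_) fun hh => ?_)) (by rw [hcost]; omega)
  · refine ⟨by simp only [ok]; omega, e2, ?_⟩
    exact lt_of_le_of_lt (Op.eval_lt_le_one _ _) (by omega)
  · have hlt : (st.arr 3).length < S.Z := by by_contra hc; simp [eval, Op.eval, e1, hc] at hh
    refine le (T := ((st.arr 3).length + 1) * 17 + ((st.arr 3).length + 1) * 17) ?_ (by omega)
    refine comp (Tri.copyA (by decide) (by omega) ?_); rw [ha4, List.nil_append]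
    refine le (T := (((st.setA 4 (st.arr 3)).arr 4).length + 1) * 17)
      (Tri.copyA (by decide) (by simp; omega) ?_) (by simp)
    refine key _ rfl (fun a ha => by simp [show a ≠ 3 by omega, show a ≠ 4 by omega]) rfl
      (by simp; omega) ?_
    simp only [setA_arr, if_true, if_neg (show (3 : ℕ) ≠ 4 by decide), length_append, pow_succ]
    omega
  · have hlt : ¬ (st.arr 3).length < S.Z := by intro hc; simp [eval, Op.eval, e1, hc] at hh
    refine le (T := 1) (Tri.skip (key _ rfl (fun a ha => rfl) rfl a3' ?_)) (by omega)
    exact (min_le_left _ _).trans (by omega)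

lemma Ok.initStep (hI : S.Inv .init j st) (ho : st.out = []) :
    Tri S.W vis (stageP S.progs S.g S.a 3) st (3 * S.a + 60 + 400 * (S.c0 * S.Z))
      (S.Post .init j) := by
  obtain ⟨h0, h1, h2, h5, h3, a0, a1, a2, a3, a3'⟩ := hI; have hW := h.W_big; have hn := h.n_le
  have hL := h.L_le; have hlam := h.sizes.big.lam; have hlam2 := h.two_lt; have hm := h.sizes.le
  have hLa : S.L ^ S.a ≤ S.lam := by
    rw [h.lam_eq]; refine Nat.le_mul_of_pos_left _ (Nat.pos_of_ne_zero fun ha => ?_)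
    rw [h.lam_eq, ha] at hlam2; omega
  have hq : S.q ≤ S.B := by have : S.q ≤ S.m * S.q := Nat.le_mul_of_pos_left _ h.sizes.m_pos; omega
  have hdiv : (2 * S.n + 2) / S.m ≤ 2 * S.n + 2 := Nat.div_le_self _ _; have haB := h.a_le
  unfold stageP
  refine le (T := 13 + (3 * S.a + 5 + (3 + (3 + (3 + 400 * (((encIn (S.V j)).length + 1) * (S.lam + 1)))))))
    ?_ (by have := h.z2 j hj; omega)
  refine comp (Tri.assign (by simp only [ok, eval, Op.eval, h1, h2]; omega)
    (by simp only [eval, Op.eval, h1, h2]; omega) ?_)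
  have e1 : (Expr.op Op.add (.op .div (.op .add (.op .mul (.c 2) (.r 2)) (.c 2)) (.r 1)) (.c 1)).eval st
      = S.q := by simp only [eval, Op.eval, h1, h2, h.q_eq]
  rw [e1]; obtain ⟨p1, p2, p3, p4⟩ := powE_spec (W := S.W) (st := st.setR 6 S.q) h.L_pos
    (by simp [h3]) S.a (by omega) (by omega)
  have e2 : (Expr.op Op.mul (.c S.a) (powE S.a)).eval (st.setR 6 S.q) = S.lam := by
    simp only [eval, Op.eval, p1, h.lam_eq]
  refine comp (le (Tri.assign ?_ ?_ ?_ ⟨trivial, p3⟩) (by simp [cost, p4]; omega))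
  · refine ⟨by simp only [ok]; omega, p2, ?_⟩
    have : Op.mul.eval (eval (st.setR 6 S.q) (.c S.a)) (eval (st.setR 6 S.q) (powE S.a))
      = S.lam := e2; rw [this]; omega
  · rw [e2]; omega
  rw [e2]; refine comp (Tri.assignC (by omega) ?_); refine comp (Tri.assignC (by omega) ?_)
  refine comp (Tri.assignC (by omega) ?_)
  refine Tri.parse h.sizes (n := S.n) (V := S.V j) (by omega) (by simpa using h2) (by simp) (by simp) hlam2
    (by simpa using a2) (h.in_le j hj) (h.input j hj) fun s c o => ?_
  have cr : ∀ r < 16, s.reg r = _ := fun r hr => c.1 r (by unfold vis; omega) (by simp; omega)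
  have ca : ∀ a < 5, s.arr a = _ := fun a ha => c.2 a ha (by simp)
  refine ⟨by rw [o]; simp [ho]; rfl, ?_⟩
  refine ⟨by simp [cr, h0], by simp [cr, h1], by simp [cr, h2], ?_⟩
  rw [show S.next .init = .net 0 from rfl]; simp [cr, ca, h3, a1, a2, a3, a3', pwAt, Setup.out]

lemma Ok.netStep {u : ℕ} (hI : S.Inv (.net u) j st) (ho : st.out = []) :
    Tri S.W vis (stageP S.progs S.g S.a 4) st
      (400 + ((S.progs (ncode S.L u)).cost + 4000) * (2 * (S.c0 * S.Z) + 1)) (S.Post (.net u) j) := by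
  obtain ⟨h0, h1, h2, hu, h5, h3, h4, h6, h7, h8, a0, a1, a2, a3, a3'⟩ := hI; have hW := h.W_big
  have hn := h.n_le; have hL := h.L_le; have hm := h.sizes.le
  have hpw : ∀ u, pwAt S.L u ≤ S.B := fun u =>
    (Nat.pow_le_pow_right (by decide) (min_le_right _ _)).trans h.pw_le
  have hM := h.inbox_len hu.le hj; have hc0 := h.c0_le
  have hcode : ncode S.L u ≤ 13 := ncode_le _ _
  have hmod := Nat.mod_lt (st.reg 4 - (3 * st.reg 3 + 8)) (show 0 < 6 by decide); unfold stageP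
  refine le (T := 200 + (65 + ((S.progs (ncode S.L u)).cost + 4000) *
    ((S.q + 1) * (S.lam + 1) + S.m + (inbox S.m (S.msgs u) j).length + 1) + (11 + (6 + 20)))) ?_ ?_
  swap
  · have := Nat.mul_le_mul_left ((S.progs (ncode S.L u)).cost + 4000)
      (show (S.q + 1) * (S.lam + 1) + S.m + (inbox S.m (S.msgs u) j).length + 1 ≤
        2 * (S.c0 * S.Z) + 1 by have := h.z1; omega)
    refine le_trans ?_ (Nat.add_le_add_left this 400)
    generalize ((S.progs (ncode S.L u)).cost + 4000) *
      ((S.q + 1) * (S.lam + 1) + S.m + (inbox S.m (S.msgs u) j).length + 1) = y; clear * -; omega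
  refine comp (le (Tri.chain (by omega) (by omega) (by omega) codeList ?_ ?_) (by decide))
  · simp only [codeList, mem_cons, not_mem_nil, or_false]
    rintro x (rfl | rfl | rfl | rfl | rfl | rfl | rfl) <;>
      refine ⟨by simp only; omega, by simp only; omega, by simp [wf, vis], ?_⟩ <;>
      simp only [ok, eval, Op.eval] <;> omega
  rw [chainVal_codeList, h3, h4]
  refine comp (le (Tri.selP (v := ncode S.L u) (by decide) (by simp) hcode (by omega)
    (T := ((S.progs (ncode S.L u)).cost + 4000) *
      ((S.q + 1) * (S.lam + 1) + S.m + (inbox S.m (S.msgs u) j).length + 1)) ?_) (by omega))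
  refine Tri.mainStep h.sizes (n := S.n) (by omega) (hpw u) (h.good _ hcode) (h.seq _ hcode) (h.vstep u hu)
    (h.gok u hu.le) (h.gok (u + 1) hu) hj (by simp [h0]) (by simp [h1]) (by simp [h2]) (by simp [h6])
    (by simp [h7]) (by simp [h8]) (M := inbox S.m (S.msgs u) j) (by simp [a0]) (by omega)
    (h.describes hu.le hj) le_rfl (mainStep_time_le hj) fun s c o => ?_
  have cr : ∀ r < 9, s.reg r = st.reg r := fun r hr =>
    (c.1 r (by unfold vis; omega) (by simp; omega)).trans (by simp; omega)
  have c16 : s.reg 16 = ncode S.L u := c.reg (by simp)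
  have ca : ∀ a < 4, s.arr a = st.arr a := fun a ha => c.2 a (by omega) (by simp [aQ]; omega)
  have e8 : (Expr.op .mul (.r 8) (.op .add (.c 1) (.op .eq (.r 16) (.c 1)))).eval s = pwAt S.L (u + 1) := by
    simp only [eval, Op.eval, cr 8 (by decide), h8, c16, pwAt_succ]
  have hp1 := hpw u; have hp2 := hpw (u + 1); refine comp (Tri.assign ?_ (by rw [e8]; omega) ?_)
  · refine ⟨by simp only [ok, cr 8 (by decide)]; omega, ?_, ?_⟩
    · simp only [ok, eval, Op.eval, c16]; split_ifs <;> omega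
    · have := e8; simp only [eval] at this ⊢; rw [this]; omega
  rw [e8]; refine comp (Tri.assign ?_ ?_ ?_)
  · simp [ok, eval, Op.eval, cr 4]; omega
  · simp [eval, Op.eval, cr 4]; omega
  have e4 : (Expr.op Op.add (Expr.r 4) (Expr.c 1)).eval (s.setR 8 (pwAt S.L (u + 1))) = u + 1 := by
    simp [eval, Op.eval, cr 4, h4]
  rw [e4]; refine le (Tri.assign ?_ ?_ ?_) (by decide)
  · simp [ok, eval, Op.eval, cr 3, h3]; split_ifs <;> omega
  · simp [eval, Op.eval, cr 3, h3]; split_ifs <;> omega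
  refine ⟨by simp [o, ho]; rfl, ?_⟩
  refine ⟨by simp [cr, h0], by simp [cr, h1], by simp [cr, h2], ?_⟩
  by_cases hlt : u + 1 < 9 * S.L + 15
  · have hne : u + 1 ≠ 9 * S.L + 15 := by omega
    rw [show S.next (.net u) = .net (u + 1) from if_pos hlt]
    simp [cr, ca, h3, h6, h7, a1, a2, a3, a3', eval, Op.eval, Setup.out, hlt]; omega
  · have hne : u + 1 = 9 * S.L + 15 := by omega
    rw [show S.next (.net u) = .output from if_neg hlt]
    simp [cr, ca, h3, h6, h7, a1, a2, a3, a3', eval, Op.eval, Setup.out, hne]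

lemma Ok.outStep (hI : S.Inv .output j st) (ho : st.out = []) :
    Tri S.W vis (stageP S.progs S.g S.a 5) st
      (200 + 5000 * (2 * (S.c0 * S.Z) + 1)) (S.Post .output j) := by
  obtain ⟨h0, h1, h2, h5, h6, h7, a0, a1, a2, a3, a3'⟩ := hI; have hW := h.W_big
  have hM := h.inbox_len le_rfl hj; have hc0 := h.c0_le; have hq := h.sizes.fit.q_pos; unfold stageP
  refine le (T := (S.q * nf * S.lam + S.m + (inbox S.m (S.msgs (9 * S.L + 15)) j).length + 2) * 40 +
    (3 + (102 * (S.lam + 1) + 3))) ?_ ?_; swap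
  · have h1 := h.z1; have h2 : S.q * nf * S.lam + (S.lam + 1) ≤ 22 * ((S.q + 1) * (S.lam + 1)) := by
      simp only [nf]; nlinarith
    omega
  refine comp (Tri.fillQ h.sizes h1 h6 h7 a0 (by omega) (h.describes le_rfl hj) fun s c o v => ?_)
  have cr : ∀ r < 9, s.reg r = st.reg r := fun r hr => c.1 r (by unfold vis; omega) (by simp; omega)
  have ca : ∀ a < 4, s.arr a = st.arr a := fun a ha => c.2 a (by omega) (by simp [aQ]; omega)
  refine comp (Tri.assignC (by omega) ?_)
  refine comp (le (Tri.loadField (i := 0) (s := S.Γ (9 * S.L + 15) (j * S.q) 21) h.sizes.fit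
    (by decide) (by simp [cr, h7]) (by simp [wf, vis]) (by simp [ok]; omega)
    (by simp [eval]) hq (by decide) ((h.gok _ le_rfl).len _ _) ?_ ?_) (by simp [cost]))
  · have := storedAt_memOf (m := S.m) (S.Γ (9 * S.L + 15)) j hq (show 21 < nf by decide) ((h.gok _ le_rfl).len _ _)
    simp only [setR_arr]; rw [v]; simpa using this
  refine Tri.assignC (by omega) ?_; refine ⟨by simpa [o, Setup.out, enc2] using ho, ?_⟩
  refine ⟨by simp [cr, h0], by simp [cr, h1], by simp [cr, h2], ?_⟩
  rw [show S.next .output = .idle from rfl]; simp [ca, a2, a3', Setup.out, inbox_nil, pairs]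

lemma Ok.step (s : Stage) (hI : S.Inv s j st) (ho : st.out = []) (ha4 : st.arr 4 = []) :
    Tri S.W vis (coreP S.progs S.g S.a) st
      (timeC S.progs S.c0 S.g S.a * (1 + (st.arr 0).length + (st.arr 3).length)) (S.Post s j) := by
  have hW := h.W_big; have hB := h.sizes.big.le
  have run : ∀ k ≤ 6, st.reg 5 = k → ∀ T, Tri S.W vis (stageP S.progs S.g S.a k) st T (S.Post s j) →
      30 + T ≤ timeC S.progs S.c0 S.g S.a * (1 + (st.arr 0).length + (st.arr 3).length) →
      Tri S.W vis (coreP S.progs S.g S.a) st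
        (timeC S.progs S.c0 S.g S.a * (1 + (st.arr 0).length + (st.arr 3).length)) (S.Post s j) :=
    fun k hk h5 T hT hle => (Tri.selP (by decide) h5 hk (by omega) hT).le (by omega)
  generalize hx : 1 + (st.arr 0).length + (st.arr 3).length = x at run ⊢
  have t1 : 30000 * x + 10 * S.g * x + 10 * S.a * x ≤ timeC S.progs S.c0 S.g S.a * x := by
    rw [← add_mul, ← add_mul]; refine Nat.mul_le_mul_right _ ?_; unfold timeC
    have := Nat.mul_le_mul (show 10000 ≤ ∑ k ∈ range 14, (S.progs k).cost + 10000 by omega)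
      (show 1 ≤ S.c0 + 1 by omega); omega
  have t2 : ∀ k ≤ 13, S.Z ≤ (st.arr 3).length →
      400 + ((S.progs k).cost + 5000) * (2 * (S.c0 * S.Z) + 1) + 3 * S.a + 30 ≤ timeC S.progs S.c0 S.g S.a * x := by
    intro k hk hz; have hk' : (S.progs k).cost ≤ ∑ k ∈ range 14, (S.progs k).cost :=
      Finset.single_le_sum (f := fun k => (S.progs k).cost) (fun _ _ => Nat.zero_le _)
        (mem_range.mpr (by omega))
    unfold timeC; generalize ∑ k ∈ range 14, (S.progs k).cost = A at hk' ⊢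
    have h1 : 2 * (S.c0 * S.Z) + 1 ≤ 2 * (S.c0 + 1) * x := by
      have : S.c0 * S.Z ≤ S.c0 * x := Nat.mul_le_mul_left _ (by omega); nlinarith
    have h2 := Nat.mul_le_mul (show (S.progs k).cost + 5000 ≤ A + 5000 by omega) h1
    have h3 : (A + 5000) * (2 * (S.c0 + 1) * x) + 5000 * ((S.c0 + 1) * x) + 10 * S.g * x + 10 * S.a * x
        ≤ ((A + 10000) * (S.c0 + 1) * 3 + 10 * S.g + 10 * S.a) * x := by
      nlinarith [Nat.zero_le (A * ((S.c0 + 1) * x))]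
    have hx1 : 1 ≤ x := by omega
    have h4 : x ≤ (S.c0 + 1) * x := Nat.le_mul_of_pos_left _ (by omega)
    have h5 : S.a ≤ S.a * x := Nat.le_mul_of_pos_right _ (by omega)
    have h6 : 10 * S.a * x = 10 * (S.a * x) := by ring
    omega
  have hg : S.g ≤ S.g * x := Nat.le_mul_of_pos_right _ (by omega)
  have ar : ∀ c y : ℕ, 30 + (3 * S.a + 60 + 400 * y) ≤
      400 + (c + 5000) * (2 * y + 1) + 3 * S.a + 30 := fun c y => by
    nlinarith [Nat.zero_le (c * (2 * y + 1))]
  have ar' : ∀ c y : ℕ, 30 + (400 + (c + 4000) * (2 * y + 1)) ≤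
      400 + (c + 5000) * (2 * y + 1) + 3 * S.a + 30 := fun c y => by nlinarith
  have ar'' : ∀ c y : ℕ, 230 + 5000 * (2 * y + 1) ≤
      400 + (c + 5000) * (2 * y + 1) + 3 * S.a + 30 := fun c y => by
    nlinarith [Nat.zero_le (c * (2 * y + 1))]
  have hg' : 10 * S.g * x = 10 * (S.g * x) := by ring
  cases s with
  | copy => exact run 0 (by decide) hI.stage.1 _ (h.copy hj hI ho) (by omega)
  | lg i => exact run 1 (by decide) hI.stage.2.1 _ (h.logStep hj hI ho) (by omega)
  | pad t => exact run 2 (by decide) hI.stage.2.1 _ (h.padStep hj hI ho ha4) (by omega)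
  | init =>
    refine run 3 (by decide) hI.stage.1 _ (h.initStep hj hI ho) ?_
    exact (ar _ _).trans (t2 0 (by decide) hI.stage.2.2.2.2.2.1)
  | net u =>
    refine run 4 (by decide) hI.stage.2.1 _ (h.netStep hj hI ho) ?_
    refine le_trans ?_ (t2 (ncode S.L u) (ncode_le _ _) hI.stage.2.2.2.2.2.2.2.2.2.2.1)
    exact ar' _ _
  | output =>
    refine run 5 (by decide) hI.stage.1 _ (h.outStep hj hI ho) ?_
    refine le_trans ?_ (t2 0 (by decide) hI.stage.2.2.2.2.2.2.1)
    refine le_trans ?_ (ar'' (S.progs 0).cost _); omega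
  | idle =>
    obtain ⟨h0, h1, h2, h5, a0, a1, a2, a3⟩ := hI
    refine run 6 (by decide) h5 1 (Tri.skip ?_) (by omega)
    refine ⟨by simpa [Setup.out, enc2] using ho, h0, h1, h2, ?_⟩
    rw [show S.next .idle = .idle from rfl]; simp [h5, a1, a2, a3, Setup.out, inbox_nil, pairs]

end Setup

/-! ## Computations -/

def clearUp : ℕ → Prog
  | 0 => .instr (.clear 4)
  | N + 1 => .comp (clearUp N) (.instr (.clear (5 + N)))

lemma bound_clearUp (N : ℕ) : (clearUp N).bound = 5 + N := by
  induction N with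
  | zero => rfl
  | succ N ih => simp only [clearUp, Prog.bound, ih, Instr.bound]; omega

lemma exec_clearUp (W N : ℕ) (σ : Mem) :
    ∃ σ' t, t ≤ 2 * N + 1 ∧ (∀ K, ∃ s, Exec W K (clearUp N) σ σ' t s) ∧
    (∀ a, 4 ≤ a → a < 5 + N → σ'.arr a = []) ∧ (∀ a < 4, σ'.arr a = σ.arr a) ∧
    σ'.reg = σ.reg ∧ σ'.out = σ.out := by
  induction N with
  | zero =>
    refine ⟨_, 1, le_rfl, fun _ => ⟨_, .instr _ _⟩, fun a h1 h2 => ?_, fun a ha => ?_, rfl, rfl⟩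
    · obtain rfl : a = 4 := by omega
      simp [run]
    · simp only [run]; rw [update_of_ne (by omega)]
  | succ N ih =>
    obtain ⟨σ1, t, ht, e1, z1, a1, r1, o1⟩ := ih
    refine ⟨run W (.clear (5 + N)) σ1, t + 1, by omega, fun K => ?_, fun a h1 h2 => ?_,
      fun a ha => ?_, r1, o1⟩
    · obtain ⟨_, e1⟩ := e1 K; exact ⟨_, .comp e1 (.instr _ _)⟩
    · simp only [run, update_apply]; split_ifs with h
      · rfl
      · exact z1 a h1 (by omega)
    · simp only [run]; rw [update_of_ne (by omega), a1 a ha]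

def mainP (progs : ℕ → NodeProg) (g a : ℕ) : Prog :=
  .comp (coreP progs g a) (clearUp (coreP progs g a).bound)

lemma bound_mainP (progs : ℕ → NodeProg) (g a : ℕ) :
    (mainP progs g a).bound = (coreP progs g a).bound + 5 := by
  simp only [mainP, Prog.bound, bound_clearUp]; omega

lemma exists_seq {α : Type} (P : ℕ → α → Prop) (Rel : α → α → Prop) {a : α} (h0 : P 0 a)
    (step : ∀ r a, P r a → ∃ b, Rel a b ∧ P (r + 1) b) :
    ∃ f : ℕ → α, f 0 = a ∧ ∀ r, P r (f r) ∧ Rel (f r) (f (r + 1)) := by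
  choose! b hb hP using step; have key : ∀ r, P r (Nat.rec a (fun r x => b r x) r) := fun r => by
    induction r with
    | zero => exact h0
    | succ r ih => exact hP r _ ih
  exact ⟨fun r => Nat.rec a (fun r x => b r x) r, rfl, fun r => ⟨key r, hb r _ (key r)⟩⟩

namespace Setup
variable {S : Setup}

lemma Inv.congr {s : Stage} {j : ℕ} {st st' : St} (hI : S.Inv s j st)
    (hr : ∀ r < vis, st'.reg r = st.reg r) (ha : ∀ a < 4, st'.arr a = st.arr a) :
    S.Inv s j st' := by
  obtain ⟨h0, h1, h2, hs⟩ := hI; refine ⟨by rw [hr 0 (by decide), h0], by rw [hr 1 (by decide), h1],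
    by rw [hr 2 (by decide), h2], ?_⟩
  rw [hr 3 (by decide), hr 4 (by decide), hr 5 (by decide), hr 6 (by decide), hr 7 (by decide),
    hr 8 (by decide), hr 15 (by decide), ha 0 (by decide), ha 1 (by decide), ha 2 (by decide),
    ha 3 (by decide)]; exact hs

abbrev prog (S : Setup) : Prog := mainP S.progs S.g S.a

structure MemInv (S : Setup) (s : Stage) (j : ℕ) (σ : Mem) : Prop where
  inv : S.Inv s j ⟨σ.reg, σ.arr, σ.out⟩
  out : σ.out = []
  free : ∀ a, 4 ≤ a → a < S.prog.bound → σ.arr a = []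

variable (h : S.Ok)
include h

lemma MemInv.size_le {s : Stage} {j : ℕ} (hj : j < S.m) {σ : Mem} (hI : S.MemInv s j σ) :
    σ.size S.prog.bound ≤ (S.prog.bound + 5 * S.c0 + 2) * S.Z := by
  have hK : 4 ≤ S.prog.bound := by rw [bound_mainP]; omega
  obtain ⟨⟨-, -, -, hst⟩, ho, hf⟩ := hI; generalize S.prog.bound = K at *
  have e : ∑ a ∈ range K, (σ.arr a).length = ∑ a ∈ range 4, (σ.arr a).length := by
    refine (Finset.sum_subset (by simpa using hK) fun a h1 h2 => ?_).symm
    simp only [mem_range] at h1 h2; rw [hf a (by omega) h1]; rfl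
  have hz : 1 ≤ S.Z := h.Z_pos; have hin : (encIn (S.V j)).length ≤ S.c0 * S.Z := by
    refine le_trans ?_ (h.z2 j hj); refine le_trans ?_ (le_mul_succ S.lam _); omega
  have hl : S.lam ≤ S.c0 * S.Z := by have := h.z1; nlinarith
  have hp : ∀ M : List (ℕ × ℕ), (pairs M).length = 2 * M.length := length_pairs
  have key : (σ.arr 0).length + (σ.arr 1).length + (σ.arr 2).length + (σ.arr 3).length ≤
      (5 * S.c0 + 2) * S.Z := by
    have e2 : (5 * S.c0 + 2) * S.Z = 5 * (S.c0 * S.Z) + 2 * S.Z := by ring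
    rw [e2]
    cases s with
    | copy =>
      obtain ⟨-, -, -, a0, a1, a2, a3⟩ := hst; simp only at *
      rw [a0, a1, a2, a3]; simp only [length_nil]; omega
    | lg i =>
      obtain ⟨-, -, -, -, -, a0, a1, a2, a3⟩ := hst; simp only at *
      rw [a0, a1, a2, a3]; simp only [length_nil]; omega
    | pad t =>
      obtain ⟨-, -, -, -, a0, a1, a2, -, a3⟩ := hst; simp only at *
      rw [a0, a1, a2]; simp only [length_nil]; omega
    | init =>
      obtain ⟨-, -, a0, a1, a2, -, a3⟩ := hst; simp only at *
      rw [a0, a1, a2]; simp only [length_nil]; omega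
    | net u =>
      obtain ⟨hu, -, -, -, -, -, -, a0, a1, a2, -, a3⟩ := hst; have := h.inbox_len hu.le hj
      simp only at *; rw [a0, a1, a2, hp]; simp only [length_nil]; omega
    | output =>
      obtain ⟨-, -, -, a0, a1, a2, -, a3⟩ := hst; have := h.inbox_len le_rfl hj; simp only at *
      rw [a0, a1, a2, hp]; simp only [length_nil]; omega
    | idle =>
      obtain ⟨-, a0, a1, a2, a3⟩ := hst; have := (h.gok _ le_rfl).len (j * S.q) 21; simp only at *
      rw [a0, a1, a2]; simp only [length_nil]; omega
  have e2 : (K + 5 * S.c0 + 2) * S.Z = K * S.Z + (5 * S.c0 + 2) * S.Z := by ring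
  have e3 : K ≤ K * S.Z := Nat.le_mul_of_pos_right _ hz
  simp only [Mem.size, e, ho, sum_range_succ, Finset.sum_range_zero, length_nil]; omega

def timeF (progs : ℕ → NodeProg) (c0 g a : ℕ) : ℕ := timeC progs c0 g a + 2

abbrev time (S : Setup) : ℕ := timeF S.progs S.c0 S.g S.a

omit h in
lemma size_ge (K : ℕ) (hK : 4 ≤ K) (σ : Mem) :
    K + (σ.arr 0).length + (σ.arr 3).length ≤ σ.size K := by
  have : ∑ a ∈ ({0, 3} : Finset ℕ), (σ.arr a).length ≤ ∑ a ∈ range K, (σ.arr a).length := by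
    refine Finset.sum_le_sum_of_subset ?_; intro a ha
    simp only [Finset.mem_insert, Finset.mem_singleton] at ha; simp only [mem_range]; omega
  rw [Finset.sum_pair (by decide)] at this; simp only [Mem.size]; omega

lemma MemInv.exec {s : Stage} {j : ℕ} (hj : j < S.m) {σ : Mem} (hI : S.MemInv s j σ) :
    ∃ σ' t, t ≤ S.time * σ.size S.prog.bound ∧ (∀ K, ∃ s', Exec S.W K S.prog σ σ' t s') ∧
      σ'.out = enc2 (S.out s j) ∧
      S.Inv (S.next s) j ⟨σ'.reg, update σ'.arr 0 (pairs (inbox S.m (S.out s) j)), []⟩ ∧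
      ∀ a, 4 ≤ a → a < S.prog.bound → σ'.arr a = [] := by
  obtain ⟨hinv, ho, hf⟩ := hI; have hb : S.prog.bound = _ := bound_mainP S.progs S.g S.a
  obtain ⟨σ1, t1, st1, ht1, e1, ⟨sr, sa, so⟩, hp1, hp2⟩ :=
    h.step hj s hinv ho (hf 4 le_rfl (by omega)) σ ⟨fun _ _ => rfl, rfl, rfl⟩
  obtain ⟨σ2, t2, ht2, e2, z2, a2, r2, o2⟩ := exec_clearUp S.W (coreP S.progs S.g S.a).bound σ1
  refine ⟨σ2, t1 + t2, ?_, fun K => ?_, by rw [o2, so, hp1], ?_, fun a h1 h2 => z2 a h1 (by omega)⟩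
  · have := size_ge S.prog.bound (by omega) σ
    simp only at ht1; generalize σ.size S.prog.bound = z at *
    have h2 := Nat.mul_le_mul_left (timeC S.progs S.c0 S.g S.a)
      (show 1 + (σ.arr 0).length + (σ.arr 3).length ≤ z by omega)
    have h3 : S.time * z = timeC S.progs S.c0 S.g S.a * z + 2 * z := by unfold time timeF; ring
    rw [h3]; omega
  · obtain ⟨_, e1⟩ := e1 K; obtain ⟨_, e2⟩ := e2 K; exact ⟨_, .comp e1 e2⟩
  · refine hp2.congr (fun r hr => ?_) fun a ha => ?_
    · simp only [r2]; exact sr r hr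
    · simp only [update_apply]; split_ifs with h0
      · rfl
      · rw [a2 a ha, sa]

lemma round {s : Stage} {c : Fin S.m → Mem} (hc : ∀ j : Fin S.m, S.MemInv s j (c j)) :
    ∃ c', (∃ t sp, IsRound S.W S.prog c c' t sp ∧ ∀ j, t j ≤ S.time * (c j).size S.prog.bound ∧
        sp j ≤ (1 + 2 * S.time) * ((S.prog.bound + 5 * S.c0 + 2) * S.Z)) ∧
      ∀ j : Fin S.m, S.MemInv (S.next s) j (c' j) := by
  choose mid t ht ex o inv free using fun j : Fin S.m => MemInv.exec h j.2 (hc j)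
  choose s' hs' using fun j => ex j S.prog.bound
  have harr : ∀ j : Fin S.m, (deliver mid j).arr = update (mid j).arr 0
      (pairs (inbox S.m (S.out s) j)) := fun j => by
    rw [← deliver_arr_zero mid (S.out s) o j]; rfl
  have hinv : ∀ j : Fin S.m, S.MemInv (S.next s) j (deliver mid j) := fun j => by
    refine ⟨?_, rfl, fun a h1 h2 => ?_⟩
    · rw [harr]; exact inv j
    · rw [harr, update_of_ne (by omega)]; exact free j a h1 h2
  refine ⟨deliver mid, ⟨t, _, ⟨mid, s', hs', rfl, fun j => rfl⟩, fun j => ⟨ht j, ?_⟩⟩, hinv⟩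
  have h1 := (hs' j).size_le.1; have h2 := MemInv.size_le h j.2 (hc j)
  have h3 := MemInv.size_le h j.2 (hinv j); have h4 := ht j
  generalize (S.prog.bound + 5 * S.c0 + 2) * S.Z = z at *
  generalize (c j).size S.prog.bound = y at *; have h5 := Nat.mul_le_mul_left (S.time) h2
  have h6 : (1 + 2 * S.time) * z = z + 2 * (S.time * z) := by ring
  rw [h6]; refine max_le ?_ (by omega); omega

lemma iterate_next {r : ℕ} (hr : (S.g + 28) * S.L ≤ r) : S.next^[r] .copy = .idle := by
  have hL := h.L_pos; have e1 : ∀ i, i < S.L → S.next^[i] (.lg 0) = .lg i := fun i => by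
    induction i with
    | zero => exact fun _ => rfl
    | succ i ih => exact fun hi => by rw [iterate_succ_apply', ih (by omega)]; exact if_pos hi
  have e2 : ∀ i, i < S.g * S.L → S.next^[i] (.pad 0) = .pad i := fun i => by
    induction i with
    | zero => exact fun _ => rfl
    | succ i ih => exact fun hi => by rw [iterate_succ_apply', ih (by omega)]; exact if_pos hi
  have e3 : ∀ i, i < 9 * S.L + 15 → S.next^[i] (.net 0) = .net i := fun i => by
    induction i with
    | zero => exact fun _ => rfl
    | succ i ih => exact fun hi => by rw [iterate_succ_apply', ih (by omega)]; exact if_pos hi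
  have f1 : S.next^[S.L] (.lg 0) = .pad 0 := by
    obtain ⟨l, hl⟩ : ∃ l, S.L = l + 1 := ⟨S.L - 1, by omega⟩
    rw [hl, iterate_succ_apply', e1 l (by omega)]; exact if_neg (by omega)
  have f2 : S.next^[S.g * S.L] (.pad 0) = .init := by
    have := Nat.mul_pos h.g_pos hL
    obtain ⟨l, hl⟩ : ∃ l, S.g * S.L = l + 1 := ⟨S.g * S.L - 1, by omega⟩
    rw [hl, iterate_succ_apply', e2 l (by omega)]; exact if_neg (by omega)
  have f3 : S.next^[9 * S.L + 15] (.net 0) = .output := by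
    rw [iterate_succ_apply', e3 _ (by omega)]; exact if_neg (by omega)
  have f4 : ∀ i, S.next^[i] .idle = .idle := fun i => by
    induction i with
    | zero => rfl
    | succ i ih => rw [iterate_succ_apply', ih]; rfl
  obtain ⟨d, rfl⟩ : ∃ d, r = d + (1 + ((9 * S.L + 15) + (1 + (S.g * S.L + (S.L + 1))))) :=
    ⟨r - (1 + ((9 * S.L + 15) + (1 + (S.g * S.L + (S.L + 1))))), by
      have : (S.g + 28) * S.L = S.g * S.L + 28 * S.L := by ring
      omega⟩
  clear hr e3; generalize 9 * S.L + 15 = N at f3 ⊢; simp only [Function.iterate_add_apply S.next]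
  rw [show S.next^[1] .copy = .lg 0 from rfl, f1, f2, show S.next^[1] .init = .net 0 from rfl, f3,
    show S.next^[1] .output = .idle from rfl, f4]

lemma exists_trace {c : Fin S.m → Mem} (hc : ∀ j : Fin S.m, S.MemInv .copy j (c j)) :
    ∃ τ : Trace S.m, τ.mem 0 = c ∧
      (∀ r, IsRound S.W S.prog (τ.mem r) (τ.mem (r + 1)) (τ.time r) (τ.space r)) ∧
      (∀ r j, (S.g + 28) * S.L ≤ r → (τ.mem r j).arr 1 = S.Γ (9 * S.L + 15) (j * S.q) 21) ∧
      ∀ r j, τ.time r j ≤ S.time * (τ.mem r j).size S.prog.bound ∧ τ.space r j ≤ (1 + 2 * S.time) *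
          ((S.prog.bound + 5 * S.c0 + 2) * S.Z) := by
  obtain ⟨f, f0, hf⟩ := exists_seq
    (fun r (c : Fin S.m → Mem) => ∀ j : Fin S.m, S.MemInv (S.next^[r] .copy) j (c j))
    (fun c c' => ∃ t sp, IsRound S.W S.prog c c' t sp ∧
      ∀ j, t j ≤ S.time * (c j).size S.prog.bound ∧ sp j ≤ (1 + 2 * S.time) *
          ((S.prog.bound + 5 * S.c0 + 2) * S.Z)) hc
    fun r c hr => by rw [iterate_succ_apply' S.next]; exact round h hr
  choose t sp hround hb using fun r => (hf r).2
  refine ⟨⟨f, t, sp⟩, f0, hround, fun r j hr => ?_, hb⟩; have := ((hf r).1 j).inv.stage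
  rw [iterate_next h hr] at this; exact this.2.2.1

end Setup

/-! ## The programs of the nodes -/

namespace NodeProg

def noCall : Call := ⟨[.c 0], skip, []⟩

def keep (f : ℕ) : Rule := ⟨[], .x, f, [.a f]⟩

def isZero (e : NE) : NE := .op .eq e (.c 0)

def keepUnless (e : NE) (f : ℕ) : Rule := ⟨[isZero e], .x, f, [.a f]⟩

def bitE : NE := .op .mod (.op .div (.get 2 0) .pw) (.c 2)

def sortA : NodeProg := ⟨noCall, [keep 1, keep 2], .op .lt (.op .mul bitE (.c 2)) (.len 2)⟩

def sortB : NodeProg := ⟨noCall, [keep 1, ⟨[.len 2, isZero bitE], .pre, 2, [.a 2]⟩,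
  ⟨[.len 2, bitE], .op .add .tot (.op .sub .x .pre), 2, [.a 2]⟩], .c 0⟩

def link1 : NodeProg := ⟨noCall, [keep 1, keep 2, ⟨[.len 2, .x], .op .sub .x (.c 1), 4, [.a 2]⟩,
  ⟨[.len 2, .op .lt (.op .add .x (.c 1)) .n], .op .add .x (.c 1), 3, [.a 2]⟩], .c 0⟩

def link2 : NodeProg := ⟨noCall, [keep 1,
  ⟨[.len 2, isZero (.op .eq (.get 3 0) (.get 2 0))], .op .sub (.get 2 0) (.c 1), 5,
    [.e (.get 2 1)]⟩,
  ⟨[.len 2, .op .eq (.get 4 0) (.get 2 0)], .get 2 1, 6, [.e (.get 4 1)]⟩,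
  ⟨[.len 2, isZero (.op .eq (.get 4 0) (.get 2 0))], .get 2 1, 6,
    [.e (.op .add .n (.get 2 0))]⟩], .c 0⟩

def leafE : NE := .op .add (.op .add .n (.c 1)) .x

def leftE : NE := .op .add (.get 5 0) (.op .mul (isZero (.len 5)) leafE)

def isReal : NE := .op .lt .x .n

def hasLeaf : NE := .op .lt .x (.op .add .n (.c 1))

def link3 : NodeProg := ⟨noCall, [
  ⟨[isReal], .x, 1, [.e (.c 2), .e (.c 0), .e (.c 2), .e (.c 1), .e (.len 1), .a 1, .e (.c 1),
    .e (.c 0), .e (.c 0), .e (.c 1), .e (.c 0)]⟩,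
  ⟨[hasLeaf], leafE, 1, [.e (.c 2), .e (.c 0), .e (.c 0), .e (.c 0)]⟩,
  ⟨[isReal], .x, 7, [.e leftE, .e (.get 6 0)]⟩,
  ⟨[isReal], leftE, 8, [.e (.c 1), .e .x, .e (.c 0)]⟩,
  ⟨[isReal], .get 6 0, 8, [.e (.c 1), .e .x, .e (.c 1)]⟩,
  ⟨[.op .eq .x .n], .get 5 0, 8, [.e (.c 0)]⟩,
  ⟨[isReal], .x, 9, [.e leftE]⟩,
  ⟨[isReal], leftE, 10, [.e .x]⟩,
  ⟨[isReal], leafE, 9, [.e (.get 6 0)]⟩,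
  ⟨[isReal], .get 6 0, 10, [.e leafE]⟩,
  ⟨[hasLeaf], leafE, 11, [.e (.c 2)]⟩], .c 0⟩

def rankE : NE := .op .add (.get 11 0) (.get 12 0)

def rank : NodeProg := ⟨noCall, [keep 1, keep 7, keep 8, ⟨[.len 8], .x, 11, [.e rankE]⟩,
  ⟨[.len 10], .get 10 0, 12, [.e rankE]⟩, ⟨[.len 10], .get 10 0, 9, [.a 9]⟩,
  ⟨[.len 9], .get 9 0, 10, [.a 10]⟩], .c 0⟩

def build (pC : Prog) : NodeProg := ⟨⟨[.len 8], pC, [[.a 1]]⟩, [keep 7, keep 8,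
  ⟨[.len 8], .x, 14, [.a 22]⟩, ⟨[.len 8, isZero (.len 7)], .x, 13, [.e rankE]⟩], .c 0⟩

def numE (h : ℕ) : NE := .op .div (.get 13 0) (.c h)

def dyE (h : ℕ) (s : Bool) : NE :=
  .op .mul (.op .mul (.op .mod (numE h) (.c 2)) (.op .eq (.len 8) (.c 3)))
    (.op .eq (.get 8 2) (.c s.toNat))

def drop (h : ℕ) (s : Bool) : NodeProg := ⟨noCall, [⟨[dyE h s], .get 8 1, 15, [.e (.c 1)]⟩,
  ⟨[dyE h s], .get 8 1, 16, [.a 14]⟩, keepUnless (dyE h s) 7, keepUnless (dyE h s) 8,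
  keepUnless (dyE h s) 14, ⟨[isZero (dyE h s), .len 13], .x, 13, [.e (numE h)]⟩], .c 0⟩

def sibE (s : Bool) : NE := .get 7 (!s).toNat

def merge (pM : Prog) (s : Bool) : NodeProg :=
  ⟨⟨[.len 15], pM, [[.e (.c 1), .e (.c s.toNat)], [.a 14], [.a 16]]⟩, [
  ⟨[.len 15], sibE s, 17, [.a 8]⟩, ⟨[.len 15], sibE s, 18, [.a 22]⟩,
  ⟨[.len 15, .op .eq (.len 8) (.c 3), isZero (.get 8 2)], .get 8 1, 19, [.e (sibE s)]⟩,
  ⟨[.len 15, .op .eq (.len 8) (.c 3), .get 8 2], .get 8 1, 20, [.e (sibE s)]⟩,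
  keepUnless (.len 15) 7, keepUnless (.len 15) 8, keepUnless (.len 15) 13,
  keepUnless (.len 15) 14], .c 0⟩

def newChild (f j : ℕ) : NE := .op .add (.get f 0) (.op .mul (isZero (.len f)) (.get 7 j))

def absorb (pM : Prog) : NodeProg := ⟨⟨[.len 17], pM, [[.e (.c 1), .e (.c 0)], [.a 18], [.a 14]]⟩, [
  ⟨[.len 17], .x, 8, [.a 17]⟩, keepUnless (.len 17) 8, ⟨[.len 17], .x, 14, [.a 22]⟩,
  keepUnless (.len 17) 14, keep 13, ⟨[.len 7], .x, 7, [.e (newChild 19 0), .e (newChild 20 1)]⟩],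
  .c 0⟩

def finish (pM : Prog) : NodeProg := ⟨⟨[.op .eq (.len 8) (.c 1)], pM, [[.e (.c 0)], [.a 14]]⟩,
  [⟨[.op .eq (.len 8) (.c 1)], .c 0, 21, [.a 22]⟩], .c 0⟩

def all (pC pM : Prog) : ℕ → NodeProg
  | 0 => sortA
  | 1 => sortB
  | 2 => link1
  | 3 => link2
  | 4 => link3
  | 5 => rank
  | 6 => build pC
  | 7 => drop 2 false
  | 8 => merge pM false
  | 9 => absorb pM
  | 10 => drop 1 true
  | 11 => merge pM true
  | 12 => absorb pM
  | _ => finish pM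

lemma all_good (pC pM : Prog) : ∀ k ≤ 13, (all pC pM k).good = true := by
  intro k hk; interval_cases k <;> rfl

lemma all_seq {pC pM : Prog} (hC : pC.IsSequential) (hM : pM.IsSequential) :
    ∀ k ≤ 13, (all pC pM k).call.prog.IsSequential := by
  intro k hk; interval_cases k <;> first | exact hC | exact hM | exact trivial

end NodeProg

lemma noCall_result {W t : ℕ} {E : Env} : NodeProg.noCall.Result W t E [] :=
  ⟨fun h => by simp [NodeProg.noCall, NE.eval] at h, fun _ => rfl⟩

lemma eval_len (f : ℕ) (E : Env) : (NE.len f).eval E ≠ 0 ↔ E.fld f ≠ [] := by simp [NE.eval]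

lemma eval_len_zero (f : ℕ) (E : Env) : (NE.len f).eval E = 0 ↔ E.fld f = [] := by simp [NE.eval]

lemma eval_eq (a b : NE) (E : Env) : (NE.op .eq a b).eval E ≠ 0 ↔ a.eval E = b.eval E := by
  simp only [NE.eval, Op.eval, ne_eq, ite_eq_right_iff, one_ne_zero, imp_false, not_not]

lemma eval_isZero (e : NE) (E : Env) : (NodeProg.isZero e).eval E ≠ 0 ↔ e.eval E = 0 :=
  eval_eq e (.c 0) E

def NE.orInj : NE → Prop → Prop
  | .x, _ => True
  | _, p => p

lemma rule_simps : (∀ (P : Rule → Prop) a l, (∀ r ∈ a :: l, P r) ↔ P a ∧ ∀ r ∈ l, P r) ∧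
    (∀ P : Rule → Prop, (∀ r ∈ [], P r) ↔ True) ∧
    (∀ (P : Rule → Prop) a l, (∃ r ∈ a :: l, P r) ↔ P a ∨ ∃ r ∈ l, P r) ∧
    (∀ P : Rule → Prop, (∃ r ∈ [], P r) ↔ False) ∧ (∀ p, p ∨ False ↔ p) ∧ (∀ p, p ∧ True ↔ p) ∧
    (∀ p, True ∧ p ↔ p) ∧ (∀ E g l, fires E (g :: l) ↔ g.eval E ≠ 0 ∧ fires E l) ∧
    (∀ E, fires E [] ↔ True) ∧ (∀ e E, (NodeProg.isZero e).eval E ≠ 0 ↔ e.eval E = 0) ∧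
    (∀ f E, (NE.len f).eval E ≠ 0 ↔ E.fld f ≠ []) ∧
    (∀ f, NodeProg.keep f = ⟨[], .x, f, [.a f]⟩) ∧
    (∀ e f, NodeProg.keepUnless e f = ⟨[NodeProg.isZero e], .x, f, [.a f]⟩) ∧
    (∀ p, NE.orInj .x p ↔ True) ∧ (∀ p, NE.orInj .pre p ↔ p) ∧ (∀ k p, NE.orInj (.c k) p ↔ p) ∧
    (∀ f j p, NE.orInj (.get f j) p ↔ p) ∧ ∀ o a b p, NE.orInj (.op o a b) p ↔ p := by
  simp [eval_isZero, eval_len, NodeProg.keep, NodeProg.keepUnless, NE.orInj]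

lemma inr2 {a b c : Prop} (h : c) : a ∨ b ∨ c := .inr (.inr h)

lemma inr3 {a b c d : Prop} (h : d) : a ∨ b ∨ c ∨ d := .inr (inr2 h)

lemma inr5 {a b c d e f : Prop} (h : f) : a ∨ b ∨ c ∨ d ∨ e ∨ f := inr2 (inr3 h)

lemma VStep.of {W lam n pw N : ℕ} {p : NodeProg} {Γ Γ' : Fields} {R : ℕ → List ℕ}
    (hr : ∀ r ∈ p.rules, ∀ x < N, fires (envOf n pw N Γ R x) r.guards →
      r.target.eval (envOf n pw N Γ R x) < N ∧
      Γ' (r.target.eval (envOf n pw N Γ R x)) r.field = segs (envOf n pw N Γ R x) r.payload)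
    (hinj : ∀ r ∈ p.rules, r.target.orInj <| ∀ x < N, ∀ y < N, fires (envOf n pw N Γ R x) r.guards →
      fires (envOf n pw N Γ R y) r.guards →
      r.target.eval (envOf n pw N Γ R x) = r.target.eval (envOf n pw N Γ R y) → x = y)
    (hc : ∀ y < N, ∀ f, f ≠ 0 → Γ' y f ≠ [] → ∃ r ∈ p.rules, r.field = f ∧
      ∃ x < N, fires (envOf n pw N Γ R x) r.guards ∧ r.target.eval (envOf n pw N Γ R x) = y)
    (hcall : ∀ x < N, p.call.Result W lam (nodeEnv n pw N Γ x) (R x) := by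
      exact fun _ _ => noCall_result)
    (hR : ∀ x < N, (R x).length < lam := by exact fun _ _ => by assumption)
    (hcv : ∀ x < N, Γ' x 0 = [p.cv.eval (envOf n pw N Γ R x)] := by exact fun _ _ => rfl) :
    VStep W lam n pw N p Γ Γ' R where
  call := hcall
  res_len := hR
  inj r hr := by
    have := hinj r hr; unfold NE.orInj at this; split at this
    · rename_i h; rw [h]; exact fun x _ y _ _ _ he => he
    · exact this
  sound := by
    intro x hx e he; simp only [emits, mem_append, mem_flatMap, mem_singleton] at he
    rcases he with ⟨r, hr', he⟩ | rfl
    · unfold Rule.emit at he; split_ifs at he with hg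
      · simp only [mem_singleton] at he; subst he; exact hr r hr' x hx hg
      · simp at he
    · exact ⟨hx, hcv x hx⟩
  complete := by
    intro y hy f hf hne; by_cases h0 : f = 0
    · subst h0; refine ⟨y, hy, ?_⟩; rw [hcv y hy]
      simp only [emits, mem_append, mem_singleton]; exact Or.inr rfl
    · obtain ⟨r, hr', rfl, x, hx, hg, rfl⟩ := hc y hy f h0 hne; refine ⟨x, hx, ?_⟩
      rw [(hr r hr' x hx hg).2]; simp only [emits, mem_append, mem_flatMap]
      exact Or.inl ⟨r, hr', by rw [Rule.emit, if_pos hg]; simp⟩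

open NodeProg (emits absorb sortA sortB build isZero dyE finish keepUnless keep newChild rank bitE
  link1 link2 link3 merge drop all)

section
variable (n pw N : ℕ) (Γ : Fields) (x : ℕ) (R : List ℕ)

@[simp] lemma withR_fld (f : ℕ) :
    ((nodeEnv n pw N Γ x).withR R).fld f = if f = 22 then R else Γ x f := rfl
@[simp] lemma withR_x : ((nodeEnv n pw N Γ x).withR R).x = x := rfl
@[simp] lemma withR_n : ((nodeEnv n pw N Γ x).withR R).n = n := rfl
@[simp] lemma withR_pw : ((nodeEnv n pw N Γ x).withR R).pw = pw := rfl
@[simp] lemma withR_pre : ((nodeEnv n pw N Γ x).withR R).pre =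
    ∑ y ∈ range x, hd (Γ y 0) := rfl
@[simp] lemma withR_tot : ((nodeEnv n pw N Γ x).withR R).tot =
    ∑ y ∈ range N, hd (Γ y 0) := rfl
@[simp] lemma nodeEnv_fld : (nodeEnv n pw N Γ x).fld = Γ x := rfl

end

/-! ## Contraction of a binary tree that is given by pointers -/

structure PtrOk (N : ℕ) (Γ : Fields) : Prop where
  child : ∀ y < N, Γ y 7 ≠ [] → ∀ s : Bool,
    (Γ y 7).getD s.toNat 0 < N ∧ Γ ((Γ y 7).getD s.toNat 0) 8 = [1, y, s.toNat]
  parent : ∀ c < N, Γ c 8 = [] ∨ Γ c 8 = [0] ∨ ∃ y < N, ∃ s : Bool, Γ c 8 = [1, y, s.toNat] ∧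
    Γ y 7 ≠ [] ∧ (Γ y 7).getD s.toNat 0 = c
  num : ∀ y, Γ y 7 ≠ [] → Γ y 13 = []

def Dies (h : ℕ) (s : Bool) (Γ : Fields) (c : ℕ) : Prop :=
  hd (Γ c 13) / h % 2 = 1 ∧ (Γ c 8).length = 3 ∧ (Γ c 8).getD 2 0 = s.toNat

instance (h : ℕ) (s : Bool) (Γ : Fields) (c : ℕ) : Decidable (Dies h s Γ c) :=
  inferInstanceAs (Decidable (_ ∧ _))

def kid (Γ : Fields) (y : ℕ) (s : Bool) : ℕ := (Γ y 7).getD s.toNat 0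

def Loses (h : ℕ) (s : Bool) (Γ : Fields) (y : ℕ) : Prop := Γ y 7 ≠ [] ∧ Dies h s Γ (kid Γ y s)

instance (h : ℕ) (s : Bool) (Γ : Fields) (c : ℕ) : Decidable (Loses h s Γ c) :=
  inferInstanceAs (Decidable (_ ∧ _))

def Gains (s : Bool) (Γ : Fields) (y : ℕ) : Prop :=
  (Γ y 8).length = 3 ∧ (Γ y 8).getD 2 0 = (!s).toNat ∧ Γ ((Γ y 8).getD 1 0) 15 ≠ []

instance (s : Bool) (Γ : Fields) (c : ℕ) : Decidable (Gains s Γ c) :=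
  inferInstanceAs (Decidable (_ ∧ _))

def dropΓ (h : ℕ) (s : Bool) (Γ : Fields) (y f : ℕ) : List ℕ :=
  match f with
  | 0 => [0]
  | 7 => if Dies h s Γ y then [] else Γ y 7
  | 8 => if Dies h s Γ y then [] else Γ y 8
  | 14 => if Dies h s Γ y then [] else Γ y 14
  | 13 => if Dies h s Γ y ∨ Γ y 13 = [] then [] else [hd (Γ y 13) / h]
  | 15 => if Loses h s Γ y then [1] else []
  | 16 => if Loses h s Γ y then Γ (kid Γ y s) 14 else []
  | _ => []

def mergeΓ (s : Bool) (Γ : Fields) (R : ℕ → List ℕ) (y f : ℕ) : List ℕ :=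
  match f with
  | 0 => [0]
  | 7 => if Γ y 15 = [] then Γ y 7 else []
  | 8 => if Γ y 15 = [] then Γ y 8 else []
  | 13 => if Γ y 15 = [] then Γ y 13 else []
  | 14 => if Γ y 15 = [] then Γ y 14 else []
  | 17 => if Gains s Γ y then Γ ((Γ y 8).getD 1 0) 8 else []
  | 18 => if Gains s Γ y then R ((Γ y 8).getD 1 0) else []
  | 19 => if Γ y 7 = [] ∨ Γ (kid Γ y false) 15 = [] then [] else [kid Γ (kid Γ y false) (!s)]
  | 20 => if Γ y 7 = [] ∨ Γ (kid Γ y true) 15 = [] then [] else [kid Γ (kid Γ y true) (!s)]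
  | _ => []

def absorbΓ (Γ : Fields) (R : ℕ → List ℕ) (y f : ℕ) : List ℕ :=
  match f with
  | 0 => [0]
  | 7 => if Γ y 7 = [] then [] else [if Γ y 19 = [] then kid Γ y false else hd (Γ y 19),
       if Γ y 20 = [] then kid Γ y true else hd (Γ y 20)]
  | 8 => if Γ y 17 = [] then Γ y 8 else Γ y 17
  | 13 => Γ y 13
  | 14 => if Γ y 17 = [] then Γ y 14 else R y
  | _ => []

section
variable {W lam n pw N h : ℕ} {s : Bool} {Γ : Fields}

lemma toNat_inj {a b : Bool} : a.toNat = b.toNat ↔ a = b := by cases a <;> cases b <;> simp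

lemma PtrOk.dies (hP : PtrOk N Γ) {c : ℕ} (hc : c < N) (hd : Dies h s Γ c) :
    ∃ y < N, Γ c 8 = [1, y, s.toNat] ∧ Γ y 7 ≠ [] ∧ kid Γ y s = c := by
  obtain ⟨-, h1, h2⟩ := hd; rcases hP.parent c hc with h' | h' | ⟨y, hy, s', h', h3, h4⟩
  · simp [h'] at h1
  · simp [h'] at h1
  · rw [h'] at h2; obtain rfl : s' = s := toNat_inj.mp (by simpa using h2)
    exact ⟨y, hy, h', h3, h4⟩

lemma eval_lt (a b : NE) (E : Env) : (NE.op .lt a b).eval E ≠ 0 ↔ a.eval E < b.eval E := by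
  simp only [NE.eval, Op.eval, ne_eq, ite_eq_right_iff, one_ne_zero, imp_false, not_not]

lemma eval_mul (a b : NE) (E : Env) :
    (NE.op .mul a b).eval E ≠ 0 ↔ a.eval E ≠ 0 ∧ b.eval E ≠ 0 := mul_ne_zero_iff

lemma dyE_ne (E : Env) : (dyE h s).eval E ≠ 0 ↔
    hd (E.fld 13) / h % 2 = 1 ∧ (E.fld 8).length = 3 ∧ (E.fld 8).getD 2 0 = s.toNat := by
  have := Nat.mod_two_eq_zero_or_one (hd (E.fld 13) / h)
  rw [dyE, eval_mul, eval_mul, eval_eq, eval_eq, and_assoc]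
  have e : ((NodeProg.numE h).op .mod (.c 2)).eval E = hd (E.fld 13) / h % 2 := rfl; rw [e]
  constructor
  · rintro ⟨h1, h2⟩; exact ⟨by omega, h2⟩
  · rintro ⟨h1, h2⟩; exact ⟨by omega, h2⟩

lemma vstep_drop (hlam : 0 < lam) (hP : PtrOk N Γ) :
    VStep W lam n pw N (drop h s) Γ (dropΓ h s Γ) (fun _ => []) := by
  have hdy : ∀ x, (dyE h s).eval ((nodeEnv n pw N Γ x).withR []) ≠ 0 ↔ Dies h s Γ x :=
    fun x => by rw [dyE_ne]; rfl
  have hdy0 : ∀ x, (dyE h s).eval ((nodeEnv n pw N Γ x).withR []) = 0 ↔ ¬ Dies h s Γ x :=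
    fun x => by rw [← hdy]; simp
  have hloses : ∀ x < N, Dies h s Γ x → ∃ y < N, Γ x 8 = [1, y, s.toNat] ∧ Loses h s Γ y ∧
      kid Γ y s = x := fun x hx hd => by
    obtain ⟨y, hy, h1, h2, h3⟩ := hP.dies hx hd; exact ⟨y, hy, h1, ⟨h2, h3 ▸ hd⟩, h3⟩
  have hne15 : ∀ y, dropΓ h s Γ y 15 = if Loses h s Γ y then [1] else [] := fun y => rfl
  have hne16 : ∀ y, dropΓ h s Γ y 16 = if Loses h s Γ y then Γ (kid Γ y s) 14 else [] :=
    fun y => rfl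
  have hne7 : ∀ y, dropΓ h s Γ y 7 = if Dies h s Γ y then [] else Γ y 7 := fun y => rfl
  have hne8 : ∀ y, dropΓ h s Γ y 8 = if Dies h s Γ y then [] else Γ y 8 := fun y => rfl
  have hne14 : ∀ y, dropΓ h s Γ y 14 = if Dies h s Γ y then [] else Γ y 14 := fun y => rfl
  have hne13 : ∀ y, dropΓ h s Γ y 13 = if Dies h s Γ y ∨ Γ y 13 = [] then [] else
    [hd (Γ y 13) / h] := fun y => rfl
  refine VStep.of ?_ ?_ ?_
  · simp only [drop, rule_simps, hdy, hdy0]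
    refine ⟨fun x hx hd => ?_, fun x hx hd => ?_, fun x hx hd => ?_, fun x hx hd => ?_,
      fun x hx hd => ?_, fun x hx hd => ?_⟩
    · obtain ⟨y, hy, h1, h2, h3⟩ := hloses x hx hd; simp [NE.eval, h1, hy, hne15, h2, segs, Seg.val]
    · obtain ⟨y, hy, h1, h2, h3⟩ := hloses x hx hd
      simp [NE.eval, h1, hy, hne16, h2, h3, segs, Seg.val]
    · simp [NE.eval, hx, hne7, segs, Seg.val, hd]
    · simp [NE.eval, hx, hne8, segs, Seg.val, hd]
    · simp [NE.eval, hx, hne14, segs, Seg.val, hd]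
    · have h2 : Γ x 13 ≠ [] := hd.2
      simp [NE.eval, hx, hne13, segs, Seg.val, hd.1, h2, NodeProg.numE, Op.eval, MPC.hd]
  · simp only [drop, rule_simps, hdy, hdy0]
    have key : ∀ x < N, ∀ y < N, Dies h s Γ x → Dies h s Γ y →
        (NE.get 8 1).eval ((nodeEnv n pw N Γ x).withR []) =
          (NE.get 8 1).eval ((nodeEnv n pw N Γ y).withR []) → x = y := by
      intro x hx y hy dx dy he; obtain ⟨x', -, h1, -, h3⟩ := hloses x hx dx
      obtain ⟨y', -, h1', -, h3'⟩ := hloses y hy dy; simp [NE.eval, h1, h1'] at he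
      rw [← h3, ← h3', he]
    exact ⟨key, key⟩
  · intro y hy f h0 hne
    have hk : Loses h s Γ y → kid Γ y s < N ∧ (NE.get 8 1).eval ((nodeEnv n pw N Γ (kid Γ y s)).withR []) = y :=
      fun hl => by
        have := hP.child y hy hl.1 s; refine ⟨this.1, ?_⟩
        simp only [NE.eval, kid, withR_fld, this.2, if_neg (show (8 : ℕ) ≠ 22 by decide)]; rfl
    simp only [drop, rule_simps, hdy, hdy0]; unfold dropΓ at hne
    split at hne <;> (try split_ifs at hne with hh) <;> (try exact absurd rfl hne)
    all_goals first | exact absurd rfl h0 | skip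
    · exact inr2 (.inl ⟨rfl, y, hy, hh, rfl⟩)
    · exact inr3 (.inl ⟨rfl, y, hy, hh, rfl⟩)
    · exact inr2 (inr2 (.inl ⟨rfl, y, hy, hh, rfl⟩))
    · exact inr2 (inr2 (.inr ⟨rfl, y, hy, ⟨fun h => hh (.inl h), fun h => hh (.inr h)⟩, rfl⟩))
    · exact .inl ⟨rfl, _, (hk hh).1, hh.2, (hk hh).2⟩
    · exact .inr (.inl ⟨rfl, _, (hk hh).1, hh.2, (hk hh).2⟩)

structure MergeOk (N : ℕ) (s : Bool) (Γ : Fields) : Prop where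
  sib : ∀ y < N, Γ y 15 ≠ [] → kid Γ y (!s) < N ∧ Γ (kid Γ y (!s)) 8 = [1, y, (!s).toNat]
  parent : ∀ c < N, Γ c 8 = [] ∨ Γ c 8 = [0] ∨ ∃ y < N, ∃ t : Bool, Γ c 8 = [1, y, t.toNat] ∧
    Γ y 7 ≠ [] ∧ kid Γ y t = c
  child : ∀ y < N, Γ y 7 ≠ [] → ∀ t, Γ (kid Γ y t) 15 ≠ [] →
    kid Γ y t < N ∧ Γ (kid Γ y t) 8 = [1, y, t.toNat]

lemma PtrOk.not_dies (hP : PtrOk N Γ) {y : ℕ} (hy : Γ y 7 ≠ []) : ¬ Dies h s Γ y := by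
  intro hd; have := hd.1; rw [hP.num y hy] at this; simp [MPC.hd] at this

lemma dropΓ_of_not_dies {y : ℕ} (hy : ¬ Dies h s Γ y) :
    dropΓ h s Γ y 7 = Γ y 7 ∧ dropΓ h s Γ y 8 = Γ y 8 ∧ dropΓ h s Γ y 14 = Γ y 14 :=
  ⟨if_neg hy, if_neg hy, if_neg hy⟩

lemma dropΓ_15 {y : ℕ} : dropΓ h s Γ y 15 ≠ [] ↔ Loses h s Γ y := by
  show (if Loses h s Γ y then [1] else []) ≠ [] ↔ _; split_ifs with hl <;> simp [hl]

lemma kid_dropΓ {y : ℕ} (hP : PtrOk N Γ) (hy : Γ y 7 ≠ []) (t : Bool) :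
    kid (dropΓ h s Γ) y t = kid Γ y t := by
  unfold kid; rw [(dropΓ_of_not_dies (hP.not_dies hy)).1]

lemma PtrOk.mergeOk (hP : PtrOk N Γ) : MergeOk N s (dropΓ h s Γ) where
  sib := by
    intro y hy hl; rw [dropΓ_15] at hl; rw [kid_dropΓ hP hl.1]
    obtain ⟨h1, h2⟩ := hP.child y hy hl.1 (!s); refine ⟨h1, ?_⟩; rw [(dropΓ_of_not_dies _).2.1]
    · exact h2
    · intro hd; have h3 := hd.2.2; unfold kid at h3; rw [h2] at h3
      cases s <;> simp at h3
  parent := by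
    intro c hc; by_cases hd : Dies h s Γ c
    · exact .inl (if_pos hd)
    · rw [(dropΓ_of_not_dies hd).2.1]; rcases hP.parent c hc with h' | h' | ⟨y, hy, t, h1, h2, h3⟩
      · exact .inl h'
      · exact .inr (.inl h')
      · refine .inr (.inr ⟨y, hy, t, h1, ?_, ?_⟩)
        · rwa [(dropΓ_of_not_dies (hP.not_dies h2)).1]
        · rwa [kid_dropΓ hP h2]
  child := by
    intro y hy h7 t h15
    have hy7 : Γ y 7 ≠ [] := fun h' => h7 (by show (if _ then _ else _) = _; rw [h']; simp)
    rw [kid_dropΓ hP hy7] at *; obtain ⟨h1, h2⟩ := hP.child y hy hy7 t; refine ⟨h1, ?_⟩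
    rw [dropΓ_15] at h15; rwa [(dropΓ_of_not_dies (hP.not_dies h15.1)).2.1]

lemma vstep_merge {pM : Prog} {R : ℕ → List ℕ} (hM : MergeOk N s Γ) (hcall : ∀ x < N, Γ x 15 ≠ [] →
      pM.Computes W [[1, s.toNat], Γ x 14, Γ x 16] (R x) lam)
    (hR0 : ∀ x < N, Γ x 15 = [] → R x = []) (hR : ∀ x < N, (R x).length < lam) :
    VStep W lam n pw N (merge pM s) Γ (mergeΓ s Γ R) R := by
  have hs : ∀ x, (NodeProg.sibE s).eval (envOf n pw N Γ R x) = kid Γ x (!s) := fun x => rfl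
  have h17 : ∀ y, mergeΓ s Γ R y 17 = if Gains s Γ y then Γ ((Γ y 8).getD 1 0) 8 else [] :=
    fun y => rfl
  have h18 : ∀ y, mergeΓ s Γ R y 18 = if Gains s Γ y then R ((Γ y 8).getD 1 0) else [] :=
    fun y => rfl
  have h19 : ∀ y, mergeΓ s Γ R y 19 = if Γ y 7 = [] ∨ Γ (kid Γ y false) 15 = [] then [] else
    [kid Γ (kid Γ y false) (!s)] := fun y => rfl
  have h20 : ∀ y, mergeΓ s Γ R y 20 = if Γ y 7 = [] ∨ Γ (kid Γ y true) 15 = [] then [] else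
    [kid Γ (kid Γ y true) (!s)] := fun y => rfl
  have hsib : ∀ x < N, Γ x 15 ≠ [] → kid Γ x (!s) < N ∧ Gains s Γ (kid Γ x (!s)) ∧
      (Γ (kid Γ x (!s)) 8).getD 1 0 = x := fun x hx hl => by
    obtain ⟨h1, h2⟩ := hM.sib x hx hl
    exact ⟨h1, by unfold Gains; rw [h2]; exact ⟨rfl, rfl, hl⟩, by rw [h2]; rfl⟩
  have hpar : ∀ x < N, (Γ x 8).length = 3 → ∃ y < N, ∃ t : Bool, Γ x 8 = [1, y, t.toNat] ∧
      Γ y 7 ≠ [] ∧ kid Γ y t = x := fun x hx h3 => by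
    rcases hM.parent x hx with h' | h' | h'
    · simp [h'] at h3
    · simp [h'] at h3
    · exact h'
  have hgain : ∀ y < N, Gains s Γ y → ∃ x < N, Γ x 15 ≠ [] ∧ kid Γ x (!s) = y := by
    rintro y hy ⟨h1, h2, h3⟩; obtain ⟨p, hp, t, h4, h5, h6⟩ := hpar y hy h1; rw [h4] at h2 h3
    obtain rfl : t = !s := toNat_inj.mp h2; exact ⟨p, hp, h3, h6⟩
  have hside : ∀ x < N, (Γ x 8).length = 3 → ∀ t : Bool, (Γ x 8).getD 2 0 = t.toNat →
      (Γ x 8).getD 1 0 < N ∧ Γ ((Γ x 8).getD 1 0) 7 ≠ [] ∧ kid Γ ((Γ x 8).getD 1 0) t = x := by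
    intro x hx h3 t ht; obtain ⟨p, hp, t', h4, h5, h6⟩ := hpar x hx h3; rw [h4] at ht ⊢
    obtain rfl : t' = t := toNat_inj.mp ht; exact ⟨hp, h5, h6⟩
  have hone : ∀ x < N, (Γ x 8).length = 3 → (Γ x 8).getD 2 0 ≠ 0 →
      (Γ x 8).getD 2 0 = true.toNat := by
    intro x hx h3 hne; obtain ⟨p, hp, t', h4, h5, h6⟩ := hpar x hx h3; rw [h4] at hne ⊢
    cases t' <;> simp at hne ⊢
  have e8 : ∀ x j, (NE.get 8 j).eval (envOf n pw N Γ R x) = (Γ x 8).getD j 0 := fun _ _ => rfl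
  have l8 : ∀ x, (NE.len 8).eval (envOf n pw N Γ R x) = (Γ x 8).length := fun _ => rfl
  have l15 : ∀ x, (envOf n pw N Γ R x).fld 15 = Γ x 15 := fun _ => rfl
  have c3 : ∀ x, (NE.c 3).eval (envOf n pw N Γ R x) = 3 := fun _ => rfl
  refine VStep.of ?_ ?_ ?_ (fun x hx => ⟨fun hf => ?_, fun hf => hR0 x hx ?_⟩) hR
  · simp only [merge, rule_simps, eval_len_zero, eval_eq, e8, l8, c3, l15, hs]
    refine ⟨fun x hx hd => ?_, fun x hx hd => ?_, fun x hx hd => ?_, fun x hx hd => ?_,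
      fun x hx hd => ?_, fun x hx hd => ?_, fun x hx hd => ?_, fun x hx hd => ?_⟩
    · obtain ⟨h1, h2, h3⟩ := hsib x hx hd; refine ⟨h1, ?_⟩; rw [h17, if_pos h2, h3]
      simp [segs, Seg.val]
    · obtain ⟨h1, h2, h3⟩ := hsib x hx hd; refine ⟨h1, ?_⟩; rw [h18, if_pos h2, h3]
      simp [segs, Seg.val]
    · obtain ⟨h1, h2, h3⟩ := hside x hx hd.2.1 false hd.2.2; refine ⟨h1, ?_⟩
      rw [h19, h3, if_neg (by rintro (h' | h'); exacts [h2 h', hd.1 h'])]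
      simp only [segs, Seg.val, hs, flatMap_cons, flatMap_nil, append_nil]
    · obtain ⟨h1, h2, h3⟩ := hside x hx hd.2.1 true (hone x hx hd.2.1 (by rw [← e8]; exact hd.2.2))
      refine ⟨h1, ?_⟩; rw [h20, h3, if_neg (by rintro (h' | h'); exacts [h2 h', hd.1 h'])]
      simp only [segs, Seg.val, hs, flatMap_cons, flatMap_nil, append_nil]
    all_goals
      refine ⟨hx, ?_⟩
      simp only [segs, Seg.val, flatMap_cons, flatMap_nil, append_nil]; exact if_pos hd
  · simp only [merge, rule_simps, eval_len_zero, eval_eq, e8, l8, c3, l15, hs]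
    have key : ∀ x < N, ∀ y < N, Γ x 15 ≠ [] → Γ y 15 ≠ [] → kid Γ x (!s) = kid Γ y (!s) →
        x = y := by grind
    have key' : ∀ t : Bool, ∀ x < N, ∀ y < N, (Γ x 8).length = 3 → (Γ y 8).length = 3 →
        (Γ x 8).getD 2 0 = t.toNat → (Γ y 8).getD 2 0 = t.toNat →
        (Γ x 8).getD 1 0 = (Γ y 8).getD 1 0 → x = y := by grind
    exact ⟨key, key, fun x hx y hy dx dy he => key' false x hx y hy dx.2.1 dy.2.1 dx.2.2 dy.2.2 he,
      fun x hx y hy dx dy he => key' true x hx y hy dx.2.1 dy.2.1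
        (hone x hx dx.2.1 (by rw [← e8]; exact dx.2.2))
        (hone y hy dy.2.1 (by rw [← e8]; exact dy.2.2)) he⟩
  · intro y hy f h0 hne; simp only [merge, rule_simps, eval_len_zero, eval_eq, e8, l8, c3, l15, hs]
    unfold mergeΓ at hne
    split at hne <;> (try split_ifs at hne with hh) <;> (try exact absurd rfl hne)
    all_goals first | exact absurd rfl h0 | skip
    · exact inr2 (inr2 (.inl ⟨rfl, y, hy, hh, rfl⟩))
    · exact inr5 (.inl ⟨rfl, y, hy, hh, rfl⟩)
    · exact inr5 (.inr (.inl ⟨rfl, y, hy, hh, rfl⟩))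
    · exact inr5 (.inr (.inr ⟨rfl, y, hy, hh, rfl⟩))
    · obtain ⟨x, hx, h1, h2⟩ := hgain y hy hh; exact .inl ⟨rfl, x, hx, h1, h2⟩
    · obtain ⟨x, hx, h1, h2⟩ := hgain y hy hh; exact .inr (.inl ⟨rfl, x, hx, h1, h2⟩)
    · have h1 : Γ (kid Γ y false) 15 ≠ [] := fun h => hh (.inr h)
      obtain ⟨h2, h3⟩ := hM.child y hy (fun h => hh (.inl h)) false h1
      exact inr2 (.inl ⟨rfl, _, h2, ⟨h1, by rw [h3]; rfl, by rw [h3]; rfl⟩, by rw [h3]; rfl⟩)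
    · have h1 : Γ (kid Γ y true) 15 ≠ [] := fun h => hh (.inr h)
      obtain ⟨h2, h3⟩ := hM.child y hy (fun h => hh (.inl h)) true h1
      exact inr3 (.inl ⟨rfl, _, h2, ⟨h1, by rw [h3]; rfl, by
        rw [h3]; exact one_ne_zero⟩, by rw [h3]; rfl⟩)
  · simp only [merge, rule_simps] at hf
    simpa [segs, Seg.val, NE.eval, merge, absorb] using hcall x hx hf
  · simp only [merge, rule_simps] at hf; simpa using hf

lemma vstep_absorb {pM : Prog} {R : ℕ → List ℕ}
    (hcall : ∀ x < N, Γ x 17 ≠ [] → pM.Computes W [[1, 0], Γ x 18, Γ x 14] (R x) lam)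
    (hR0 : ∀ x < N, Γ x 17 = [] → R x = []) (hR : ∀ x < N, (R x).length < lam) :
    VStep W lam n pw N (absorb pM) Γ (absorbΓ Γ R) R := by
  have l17 : ∀ x, (envOf n pw N Γ R x).fld 17 = Γ x 17 := fun _ => rfl
  have l7 : ∀ x, (envOf n pw N Γ R x).fld 7 = Γ x 7 := fun _ => rfl
  have hnew : ∀ x f j, f ≠ 22 → (newChild f j).eval (envOf n pw N Γ R x) =
      if Γ x f = [] then (Γ x 7).getD j 0 else hd (Γ x f) := fun x f j hf => by
    simp only [newChild, isZero, NE.eval, Op.eval, withR_fld, if_neg hf, hd,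
      List.length_eq_zero_iff, if_neg (show (7 : ℕ) ≠ 22 by decide)]; by_cases h1 : Γ x f = []
    · simp [h1]
    · simp [h1]
  refine VStep.of ?_ ?_ ?_ (fun x hx => ⟨fun hf => ?_, fun hf => hR0 x hx ?_⟩) hR
  · simp only [absorb, rule_simps, eval_len_zero, l17, l7]
    refine ⟨fun x hx hd => ⟨hx, ?_⟩, fun x hx hd => ⟨hx, ?_⟩, fun x hx hd => ⟨hx, ?_⟩,
      fun x hx hd => ⟨hx, ?_⟩, fun x hx _ => ⟨hx, ?_⟩, fun x hx hd => ⟨hx, ?_⟩⟩ <;>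
      simp only [segs, Seg.val, flatMap_cons, flatMap_nil, append_nil]
    · exact if_neg hd
    · exact if_pos hd
    · exact if_neg hd
    · exact if_pos hd
    · rfl
    · rw [hnew _ _ _ (by decide), hnew _ _ _ (by decide)]; exact if_neg hd
  · simp only [absorb, rule_simps]
  · intro y hy f h0 hne; simp only [absorb, rule_simps, eval_len_zero, l17, l7]
    unfold absorbΓ at hne
    split at hne <;> (try split_ifs at hne with hh) <;> (try exact absurd rfl hne)
    all_goals first | exact absurd rfl h0 | skip
    · exact inr2 (inr2 (.inr ⟨rfl, y, hy, by assumption, rfl⟩))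
    · exact inr2 (inr2 (.inr ⟨rfl, y, hy, by assumption, rfl⟩))
    · exact inr2 (inr2 (.inr ⟨rfl, y, hy, by assumption, rfl⟩))
    · exact inr2 (inr2 (.inr ⟨rfl, y, hy, by assumption, rfl⟩))
    · exact .inr (.inl ⟨rfl, y, hy, hh, rfl⟩)
    · exact .inl ⟨rfl, y, hy, hh, rfl⟩
    · exact inr2 (inr2 (.inl ⟨rfl, y, hy, rfl⟩))
    · exact inr3 (.inl ⟨rfl, y, hy, hh, rfl⟩)
    · exact inr2 (.inl ⟨rfl, y, hy, hh, rfl⟩)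
  · simp only [absorb, rule_simps] at hf
    simpa [segs, Seg.val, NE.eval, merge, absorb] using hcall x hx hf
  · simp only [absorb, rule_simps] at hf; simpa using hf

end

/-! ## Parts with holes -/

namespace Part

lemma Fills.holes_eq {X : Part} {hs : List BTree} {S : BTree} (h : X.Fills hs S) :
    X.holes = hs.length := by
  induction h with
  | nil => rfl
  | hole => rfl
  | node d _ _ ih1 ih2 => simp [holes, ih1, ih2]

lemma Fills.plug {X Y : Part} {hs ks : List BTree} {S U : BTree} {i : ℕ} (h : X.Fills hs S)
    (hi : hs[i]? = some U) (hY : Y.Fills ks U) :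
    (X.plug i Y).Fills (hs.take i ++ ks ++ hs.drop (i + 1)) S := by
  induction h generalizing i with
  | nil => simp at hi
  | hole d l r =>
    obtain ⟨rfl, rfl⟩ : i = 0 ∧ BTree.node d l r = U := by
      rcases i with _ | i
      · exact ⟨rfl, by simpa using hi⟩
      · simp at hi
    simpa [Part.plug] using hY
  | @node d A B hs1 hs2 l r h1 h2 ih1 ih2 =>
    simp only [Part.plug, h1.holes_eq]; split_ifs with hlt
    · rw [List.getElem?_append_left hlt] at hi; have := Fills.node d (ih1 hi) h2
      rw [List.take_append_of_le_length hlt.le, List.drop_append_of_le_length (by omega)]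
      simpa [append_assoc] using this
    · rw [List.getElem?_append_right (by omega)] at hi; have := Fills.node d h1 (ih2 hi)
      rw [List.take_append, take_of_length_le (by omega), List.drop_append,
        List.drop_eq_nil_of_le (by omega), Nat.sub_add_comm (by omega)]
      simpa [append_assoc] using this

lemma IsNode.plug {X : Part} (h : X.IsNode) (i : ℕ) (Y : Part) : (X.plug i Y).IsNode := by
  cases X with
  | nil => exact h.elim
  | hole d => exact h.elim
  | node d l r => simp only [Part.plug]; split_ifs <;> trivial

end Part

structure CallOk (W lam : ℕ) (B : BTree) (Cf : Part → List ℕ) (val : BTree → List ℕ) (pM : Prog) :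
    Prop where
  len : ∀ (S : BTree) (X : Part) (hs : List BTree), S.IsSubtree B → X.IsNode → X.holes ≤ 2 →
    X.Fills hs S → (Cf X).length < lam
  val_len : (val B).length < lam
  eval : ∀ X : Part, X.IsNode → X.Fills [] B → pM.Computes W [[0], Cf X] (val B) lam
  join : ∀ (S U : BTree) (X Y : Part) (hs ks : List BTree) (i : ℕ), S.IsSubtree B → X.IsNode →
    X.Fills hs S → hs[i]? = some U → Y.IsNode → Y.Fills ks U → X.holes ≤ 2 → Y.holes ≤ 2 →
    (X.plug i Y).holes ≤ 2 → pM.Computes W [[1, i], Cf X, Cf Y] (Cf (X.plug i Y)) lam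

/-! ## The shape of the tree -/

inductive CT : Type
  | leaf (i : ℕ)
  | node (i : ℕ) (ch : Bool → CT)

namespace CT

def id : CT → ℕ
  | leaf i => i
  | node i _ => i

def ids : CT → List ℕ
  | leaf i => [i]
  | node i ch => i :: ((ch false).ids ++ (ch true).ids)

def leaves : CT → List ℕ
  | leaf i => [i]
  | node _ ch => (ch false).leaves ++ (ch true).leaves

lemma id_leaf (i : ℕ) : (leaf i).id = i := rfl

lemma id_node (i : ℕ) (ch : Bool → CT) : (node i ch).id = i := rfl

lemma id_mem (t : CT) : t.id ∈ t.ids := by cases t <;> simp [id, ids]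

lemma leaves_ne_nil (t : CT) : t.leaves ≠ [] := by
  induction t with
  | leaf i => simp [leaves]
  | node i ch ih => simp [leaves, ih]

lemma mem_ids_node {i y : ℕ} {ch : Bool → CT} :
    y ∈ (node i ch).ids ↔ y = i ∨ ∃ b, y ∈ (ch b).ids := by
  simp [ids]

lemma leaves_subset {t : CT} {y : ℕ} (h : y ∈ t.leaves) : y ∈ t.ids := by
  induction t with
  | leaf i => exact h
  | node i ch ih =>
    simp only [leaves, mem_append] at h; rw [mem_ids_node]; rcases h with h | h
    · exact .inr ⟨_, ih _ h⟩
    · exact .inr ⟨_, ih _ h⟩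

/-- The pointers in `Γ` describe the tree, whose root has the given parent entry; the partial
data of the node `i` is `C i`. -/
def Shape (Γ : Fields) (C : ℕ → List ℕ) : List ℕ → CT → Prop
  | par, leaf i => Γ i 8 = par ∧ Γ i 14 = C i ∧ Γ i 7 = []
  | par, node i ch => Γ i 8 = par ∧ Γ i 14 = C i ∧ Γ i 7 = [(ch false).id, (ch true).id] ∧
      Γ i 13 = [] ∧ ∀ b, Shape Γ C [1, i, Bool.toNat b] (ch b)

/-- The parts `X i` fit together to the tree `S`. -/
def Good (B : BTree) (X : ℕ → Part) : BTree → CT → Prop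
  | S, leaf i => S.IsSubtree B ∧ (X i).IsNode ∧ (X i).Fills [] S
  | S, node i ch => S.IsSubtree B ∧ (X i).IsNode ∧ ∃ U : Bool → BTree,
      (X i).Fills [U false, U true] S ∧ ∀ b, Good B X (U b) (ch b)

section
variable {Γ : Fields} {C : ℕ → List ℕ} {B : BTree} {X : ℕ → Part}

lemma Shape.par {par : List ℕ} {t : CT} (h : t.Shape Γ C par) : Γ t.id 8 = par := by
  cases t <;> exact h.1

lemma Shape.part {par : List ℕ} {t : CT} (h : t.Shape Γ C par) : Γ t.id 14 = C t.id := by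
  cases t <;> exact h.2.1

lemma Good.isNode {S : BTree} {t : CT} (h : t.Good B X S) : (X t.id).IsNode := by
  cases t <;> exact h.2.1

lemma Good.fills {S : BTree} {t : CT} (h : t.Good B X S) :
    ∃ hs, hs.length ≤ 2 ∧ (X t.id).Fills hs S := by
  cases t with
  | leaf i => exact ⟨[], by simp, h.2.2⟩
  | node i ch => obtain ⟨-, -, U, h1, -⟩ := h; exact ⟨_, by simp, h1⟩

lemma kid_eq {i : ℕ} {ch : Bool → CT}
    (h : Γ i 7 = [(ch false).id, (ch true).id]) (b : Bool) : kid Γ i b = (ch b).id := by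
  unfold kid; rw [h]
  cases b <;> rfl

lemma Shape.child {par : List ℕ} {t : CT} (h : t.Shape Γ C par) {y : ℕ}
    (hy : y ∈ t.ids) : Γ y 7 = [] ∨ ((Γ y 7).length = 2 ∧ Γ y 13 = [] ∧
      ∀ b, kid Γ y b ∈ t.ids ∧ Γ (kid Γ y b) 8 = [1, y, b.toNat]) := by
  induction t generalizing par with
  | leaf i => simp only [ids, mem_singleton] at hy; subst hy; exact .inl h.2.2
  | node i ch ih =>
    obtain ⟨h1, -, h2, h3, h4⟩ := h; rcases mem_ids_node.mp hy with rfl | ⟨b, hb⟩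
    · refine .inr ⟨by rw [h2]; rfl, h3, fun b => ?_⟩
      rw [kid_eq h2]; exact ⟨mem_ids_node.mpr (.inr ⟨b, id_mem _⟩), (h4 b).par⟩
    · rcases ih b (h4 b) hb with h' | ⟨h5, h6, h7⟩
      · exact .inl h'
      · exact .inr ⟨h5, h6, fun b' => ⟨mem_ids_node.mpr (.inr ⟨b, (h7 b').1⟩), (h7 b').2⟩⟩

lemma Shape.parent {par : List ℕ} {t : CT} (h : t.Shape Γ C par) {y : ℕ}
    (hy : y ∈ t.ids) : (y = t.id ∧ Γ y 8 = par) ∨ ∃ p ∈ t.ids, ∃ b : Bool,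
      Γ y 8 = [1, p, b.toNat] ∧ Γ p 7 ≠ [] ∧ kid Γ p b = y := by
  induction t generalizing par with
  | leaf i => simp only [ids, mem_singleton] at hy; subst hy; exact .inl ⟨rfl, h.1⟩
  | node i ch ih =>
    obtain ⟨h1, -, h2, h3, h4⟩ := h; rcases mem_ids_node.mp hy with rfl | ⟨b, hb⟩
    · exact .inl ⟨rfl, h1⟩
    · rcases ih b (h4 b) hb with ⟨h', h''⟩ | ⟨p, hp, b', h5, h6, h7⟩
      · exact .inr ⟨i, mem_ids_node.mpr (.inl rfl), b, h'', by rw [h2]; simp, by rw [kid_eq h2, h']⟩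
      · exact .inr ⟨p, mem_ids_node.mpr (.inr ⟨b, hp⟩), b', h5, h6, h7⟩

end

/-! ### Raking leaves -/

def fst : CT → ℕ
  | leaf i => i
  | node _ ch => (ch false).fst

def last : CT → ℕ
  | leaf i => i
  | node _ ch => (ch true).last

section
variable (o : ℕ → Bool)

def isOddLeaf : CT → Bool
  | leaf i => o i
  | node _ _ => false

def rake (s : Bool) : CT → CT
  | leaf i => leaf i
  | node i ch => if (ch s).isOddLeaf o then rake s (ch (!s)) else node i fun b => rake s (ch b)

def Alt : CT → Prop
  | leaf _ => True
  | node _ ch => (∀ b, (ch b).Alt) ∧ ¬ (o (ch false).last = true ∧ o (ch true).fst = true)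

def OddOn (b : Bool) : CT → Prop
  | leaf _ => True
  | node _ ch => ∀ b', (ch b').OddOn b ∧ ((ch b').isOddLeaf o → b' = b)

variable {o}

lemma rake_ids {s : Bool} {t : CT} {y : ℕ} (h : y ∈ (t.rake o s).ids) : y ∈ t.ids := by
  induction t with
  | leaf i => exact h
  | node i ch ih =>
    rw [rake] at h; split_ifs at h
    · exact mem_ids_node.mpr (.inr ⟨_, ih _ h⟩)
    · rcases mem_ids_node.mp h with rfl | ⟨b, hb⟩
      · exact mem_ids_node.mpr (.inl rfl)
      · exact mem_ids_node.mpr (.inr ⟨b, ih _ hb⟩)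

lemma isOddLeaf_ends {t : CT} (h : t.isOddLeaf o = true) : o t.fst = true ∧ o t.last = true := by
  cases t with
  | leaf i => exact ⟨h, h⟩
  | node i ch => exact absurd h (by simp [isOddLeaf])

lemma Alt.rake {s : Bool} {t : CT} (h : t.Alt o) : (t.rake o s).Alt o ∧
    (o (t.rake o s).fst = true → o t.fst = true) ∧
    (o (t.rake o s).last = true → o t.last = true) := by
  induction t with
  | leaf i => exact ⟨h, fun h => h, fun h => h⟩
  | node i ch ih =>
    rw [CT.rake]; split_ifs with hs
    · have e := isOddLeaf_ends hs; have := ih (!s) (h.1 _)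
      cases s
      · exact ⟨this.1, fun _ => e.1, this.2.2⟩
      · exact ⟨this.1, this.2.1, fun _ => e.2⟩
    · have h0 := ih false (h.1 _); have h1 := ih true (h.1 _)
      refine ⟨⟨fun b => (ih b (h.1 _)).1, fun ⟨a1, a2⟩ => h.2 ⟨h0.2.2 a1, h1.2.1 a2⟩⟩, h0.2.1,
        h1.2.2⟩

lemma Alt.not_twice {i c : ℕ} {s : Bool} {ch ch' : Bool → CT} (h : (node i ch).Alt o)
    (h1 : (ch s).isOddLeaf o = true) (hc : ch (!s) = node c ch') :
    ¬ (ch' s).isOddLeaf o = true := by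
  intro h2; have e1 := isOddLeaf_ends h1; have e2 := isOddLeaf_ends h2
  cases s
  · exact h.2 ⟨e1.2, by rw [show ch true = _ from hc]; exact e2.1⟩
  · exact h.2 ⟨by rw [show ch false = _ from hc]; exact e2.2, e1.1⟩

lemma rake_id {s : Bool} {i : ℕ} {ch : Bool → CT} (h : ¬ (ch s).isOddLeaf o = true) :
    ((node i ch).rake o s).id = i := by
  rw [rake, if_neg h]; rfl

lemma rake_false_leaf {t : CT} {a : ℕ} (h : t.Alt o) (hr : t.rake o false = leaf a)
    (ha : o a = true) : t = leaf a := by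
  induction t with
  | leaf i => exact hr
  | node i ch ih =>
    rw [rake] at hr; split_ifs at hr with hs
    have h1 := ih true (h.1 true) hr; refine absurd ⟨(isOddLeaf_ends hs).2, ?_⟩ h.2; rw [h1]
    exact ha

lemma Alt.oddOn {t : CT} (h : t.Alt o) : (t.rake o false).OddOn o true := by
  induction t with
  | leaf i => trivial
  | node i ch ih =>
    rw [CT.rake]; split_ifs with hs
    · exact ih true (h.1 _)
    · refine fun b => ⟨ih b (h.1 _), fun hb => ?_⟩; by_contra hne
      obtain rfl : b = false := by simpa using hne
      cases hr : (ch false).rake o false with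
      | node j ch' => simp [hr, isOddLeaf] at hb
      | leaf a =>
        simp only [hr, isOddLeaf] at hb; have := rake_false_leaf (h.1 _) hr hb
        simp [this, isOddLeaf, hb] at hs

lemma Shape.subtree {Γ : Fields} {C : ℕ → List ℕ} {B : BTree} {X : ℕ → Part}
    {par : List ℕ} {S : BTree} {t : CT} (h : t.Shape Γ C par)
    (hg : t.Good B X S) (ha : t.Alt o) {y : ℕ} (hy : y ∈ t.ids) :
    ∃ u : CT, ∃ par' S', u.id = y ∧ u.Shape Γ C par' ∧ u.Good B X S' ∧ u.Alt o := by
  induction t generalizing par S with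
  | leaf i => simp only [ids, mem_singleton] at hy; subst hy; exact ⟨_, _, _, rfl, h, hg, ha⟩
  | node i ch ih =>
    rcases mem_ids_node.mp hy with rfl | ⟨b, hb⟩
    · exact ⟨_, _, _, rfl, h, hg, ha⟩
    · obtain ⟨-, -, U, -, hU⟩ := hg; exact ih b (h.2.2.2.2 b) (hU b) (ha.1 b) hb

lemma rake_filter {s : Bool} {t : CT} :
    (t.rake o s).leaves.filter (fun a => !o a) = t.leaves.filter (fun a => !o a) := by
  induction t with
  | leaf i => rfl
  | node i ch ih =>
    rw [rake]; split_ifs with hs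
    · rw [ih]; have : (ch s).leaves.filter (fun a => !o a) = [] := by
        cases hc : ch s with
        | leaf a => simp only [hc, isOddLeaf] at hs; simp [leaves, hs]
        | node => simp [hc, isOddLeaf] at hs
      cases s <;> simp only [leaves, List.filter_append, this, List.nil_append, append_nil] <;> rfl
    · simp [leaves, ih]

lemma OddOn.leaves_rake {t : CT} (h : t.OddOn o true) (ht : ¬ t.isOddLeaf o = true) :
    (t.rake o true).leaves = t.leaves.filter (fun a => !o a) := by
  induction t with
  | leaf i => simp only [isOddLeaf, Bool.not_eq_true] at ht; simp [rake, leaves, ht]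
  | node i ch ih =>
    rw [rake]; have h0 := ih false (h false).1 (fun h' => by simpa using (h false).2 h')
    split_ifs with hs
    · rw [show (!true) = false from rfl, h0]
      cases hc : ch true with
      | leaf a => simp only [hc, isOddLeaf] at hs; simp [leaves, hs, hc]
      | node => simp [hc, isOddLeaf] at hs
    · simp [leaves, h0, ih true (h true).1 hs]

lemma fst_mem (t : CT) : ∃ l, t.leaves = t.fst :: l := by
  induction t with
  | leaf i => exact ⟨[], rfl⟩
  | node i ch ih =>
    obtain ⟨l, hl⟩ := ih false; exact ⟨l ++ (ch true).leaves, by simp [leaves, hl, fst]⟩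

lemma last_mem (t : CT) : ∃ l, t.leaves = l ++ [t.last] := by
  induction t with
  | leaf i => exact ⟨[], rfl⟩
  | node i ch ih =>
    obtain ⟨l, hl⟩ := ih true; exact ⟨(ch false).leaves ++ l, by simp [leaves, hl, last]⟩

lemma alt_of_isChain {t : CT} (h : t.leaves.IsChain fun a b => ¬ (o a = true ∧ o b = true)) :
    t.Alt o := by
  induction t with
  | leaf i => trivial
  | node i ch ih =>
    rw [leaves, List.isChain_append] at h
    refine ⟨fun b => by cases b; exacts [ih _ h.1, ih _ h.2.1], ?_⟩
    obtain ⟨l, hl⟩ := last_mem (ch false); obtain ⟨l', hl'⟩ := fst_mem (ch true)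
    exact h.2.2 _ (by simp [hl]) _ (by simp [hl'])

end

end CT

/-! ## One step of the contraction -/

def isOdd (h : ℕ) (Γ : Fields) (y : ℕ) : Bool := decide (hd (Γ y 13) / h % 2 = 1)

/-- The tree `t` of parts `X` describes `B` and is stored in `Γ`. -/
structure CInv (N : ℕ) (B : BTree) (Cf : Part → List ℕ) (Γ : Fields) (X : ℕ → Part)
    (t : CT) : Prop where
  shape : t.Shape Γ (fun i => Cf (X i)) [0]
  good : t.Good B X B
  lt : ∀ y ∈ t.ids, y < N
  supp : ∀ y, y ∉ t.ids → Γ y 7 = [] ∧ Γ y 8 = []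

section
variable {W lam n pw N h : ℕ} {s : Bool} {Γ : Fields} {B : BTree} {Cf : Part → List ℕ}
  {val : BTree → List ℕ} {pM : Prog} {X : ℕ → Part} {t : CT}

lemma CInv.ptrOk (hI : CInv N B Cf Γ X t) : PtrOk N Γ where
  child := by
    intro y _ h7 s; have hy : y ∈ t.ids := by_contra fun hy => h7 (hI.supp y hy).1
    rcases hI.shape.child hy with h' | h'
    · exact absurd h' h7
    · exact ⟨hI.lt _ (h'.2.2 s).1, (h'.2.2 s).2⟩
  parent := by
    intro c _; by_cases hc : c ∈ t.ids
    · rcases hI.shape.parent hc with h' | ⟨p, hp, b, h'⟩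
      · exact .inr (.inl h'.2)
      · exact .inr (.inr ⟨p, hI.lt p hp, b, h'⟩)
    · exact .inl (hI.supp c hc).2
  num := by
    intro y h7; have hy : y ∈ t.ids := by_contra fun hy => h7 (hI.supp y hy).1
    rcases hI.shape.child hy with h' | h'
    · exact absurd h' h7
    · exact h'.2.1

lemma loses_iff {C : ℕ → List ℕ} {par : List ℕ} {i : ℕ} {ch : Bool → CT}
    (hS : (CT.node i ch).Shape Γ C par) :
    Loses h s Γ i ↔ (ch s).isOddLeaf (isOdd h Γ) = true := by
  obtain ⟨-, -, h7, -, hc⟩ := hS; unfold Loses Dies; rw [CT.kid_eq h7, (hc s).par, h7]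
  cases hcs : ch s with
  | leaf a => simp [CT.id, CT.isOddLeaf, isOdd]
  | node a ch' => have := hc s; rw [hcs] at this; simp [CT.id, CT.isOddLeaf, this.2.2.2.1, hd]

lemma CInv.loses (hI : CInv N B Cf Γ X t) (ha : t.Alt (isOdd h Γ)) {p : ℕ} (hl : Loses h s Γ p) :
    ∃ (S : BTree) (U : Bool → BTree), S.IsSubtree B ∧ p < N ∧ Γ p 8 ≠ [] ∧
      Γ p 14 = Cf (X p) ∧ (X p).IsNode ∧
      (X p).Fills [U false, U true] S ∧ Γ (kid Γ p s) 14 = Cf (X (kid Γ p s)) ∧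
      (X (kid Γ p s)).IsNode ∧ (X (kid Γ p s)).Fills [] (U s) ∧
      ¬ Loses h s Γ (kid Γ p (!s)) ∧ Γ (kid Γ p (!s)) 14 = Cf (X (kid Γ p (!s))) ∧
      (X (kid Γ p (!s))).IsNode ∧
      ∃ ks, ks.length ≤ 2 ∧ (X (kid Γ p (!s))).Fills ks (U (!s)) := by
  have hp : p ∈ t.ids := by_contra fun hy => hl.1 (hI.supp p hy).1; have h8 : Γ p 8 ≠ [] := by
    rcases hI.shape.parent hp with h' | ⟨_, _, _, h', _⟩
    · rw [h'.2]; simp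
    · rw [h']; simp
  obtain ⟨u, par', S, rfl, hu, hg, hal⟩ := hI.shape.subtree hI.good ha hp
  cases u with
  | leaf i => exact absurd hu.2.2 hl.1
  | node i ch =>
    have hl' := (loses_iff hu).mp hl; obtain ⟨-, h14, h7, h13, hc⟩ := id hu
    obtain ⟨hB, hX, U, hU, hgU⟩ := hg; simp only [CT.id] at *; rw [CT.kid_eq h7, CT.kid_eq h7]
    refine ⟨S, U, hB, hI.lt _ hp, h8, h14, hX, hU, (hc s).part, (hgU s).isNode, ?_, ?_,
      (hc _).part, (hgU _).isNode, (hgU _).fills⟩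
    · have hgs := hgU s
      cases hcs : ch s with
      | leaf a => rw [hcs] at hgs; exact hgs.2.2
      | node a ch' => rw [hcs] at hl'; exact absurd hl' (by simp [CT.isOddLeaf])
    · intro h2
      cases hcs : ch (!s) with
      | leaf a => have := hc (!s); rw [hcs] at h2 this; exact h2.1 this.2.2
      | node a ch' =>
        have h3 := hc (!s); rw [hcs] at h2 h3; exact hal.not_twice hl' hcs ((loses_iff h3).mp h2)

lemma gains_dropΓ (hP : PtrOk N Γ) {y : ℕ} (hy : y < N) : Gains s (dropΓ h s Γ) y ↔
    ∃ p, Loses h s Γ p ∧ Γ y 8 = [1, p, (!s).toNat] ∧ kid Γ p (!s) = y := by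
  unfold Gains; rw [dropΓ_15]; constructor
  · rintro ⟨h1, h2, h3⟩; by_cases hd : Dies h s Γ y
    · rw [show dropΓ h s Γ y 8 = [] from if_pos hd] at h1; simp at h1
    · rw [(dropΓ_of_not_dies hd).2.1] at *
      rcases hP.parent y hy with h' | h' | ⟨p, hp, b, h', h4, h5⟩
      · simp [h'] at h1
      · simp [h'] at h1
      · rw [h'] at h2 h3; obtain rfl : b = !s := toNat_inj.mp h2; exact ⟨p, h3, h', h5⟩
  · rintro ⟨p, h1, h2, h3⟩; have hd : ¬ Dies h s Γ y := by
      intro hd; have := hd.2.2; rw [h2] at this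
      cases s <;> simp at this
    rw [(dropΓ_of_not_dies hd).2.1, h2]; exact ⟨rfl, rfl, h1⟩

def stepX (h : ℕ) (s : Bool) (Γ : Fields) (X : ℕ → Part) (y : ℕ) : Part :=
  if Gains s (dropΓ h s Γ) y then
    ((X ((Γ y 8).getD 1 0)).plug s.toNat (X (kid Γ ((Γ y 8).getD 1 0) s))).plug 0 (X y)
  else X y

def mergeR (h : ℕ) (s : Bool) (Cf : Part → List ℕ) (Γ : Fields) (X : ℕ → Part) (y : ℕ) : List ℕ :=
  if Loses h s Γ y then Cf ((X y).plug s.toNat (X (kid Γ y s))) else []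

def absorbR (Cf : Part → List ℕ) (X' : ℕ → Part) (Γ₂ : Fields) (y : ℕ) : List ℕ :=
  if Γ₂ y 17 = [] then [] else Cf (X' y)

lemma fills_lose {X Y : Part} {S : BTree} {U : Bool → BTree} (hX : X.Fills [U false, U true] S)
    (hY : Y.Fills [] (U s)) : [U false, U true][s.toNat]? = some (U s) ∧
      (X.plug s.toNat Y).Fills [U (!s)] S := by
  have hi : [U false, U true][s.toNat]? = some (U s) := by cases s <;> rfl
  refine ⟨hi, ?_⟩; have := hX.plug hi hY
  cases s <;> exact this

lemma mergeΓ_dropΓ {y : ℕ} (hd : ¬ Dies h s Γ y) (hl : ¬ Loses h s Γ y) (R : ℕ → List ℕ) :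
    mergeΓ s (dropΓ h s Γ) R y 7 = Γ y 7 ∧ mergeΓ s (dropΓ h s Γ) R y 8 = Γ y 8 ∧
    mergeΓ s (dropΓ h s Γ) R y 14 = Γ y 14 ∧
    mergeΓ s (dropΓ h s Γ) R y 13 = if Γ y 13 = [] then [] else [MPC.hd (Γ y 13) / h] := by
  have h15 : dropΓ h s Γ y 15 = [] := if_neg hl
  refine ⟨(if_pos h15).trans (if_neg hd), (if_pos h15).trans (if_neg hd),
    (if_pos h15).trans (if_neg hd), (if_pos h15).trans ?_⟩; show (if _ then _ else _) = _; simp [hd]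

lemma CInv.calls (hC : CallOk W lam B Cf val pM) (hI : CInv N B Cf Γ X t)
    (ha : t.Alt (isOdd h Γ)) {p : ℕ} (hl : Loses h s Γ p) :
    pM.Computes W [[1, s.toNat], Cf (X p), Cf (X (kid Γ p s))]
      (Cf ((X p).plug s.toNat (X (kid Γ p s)))) lam ∧
    (Cf ((X p).plug s.toNat (X (kid Γ p s)))).length < lam ∧
    pM.Computes W [[1, 0], Cf ((X p).plug s.toNat (X (kid Γ p s))), Cf (X (kid Γ p (!s)))]
      (Cf (((X p).plug s.toNat (X (kid Γ p s))).plug 0 (X (kid Γ p (!s))))) lam ∧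
    (Cf (((X p).plug s.toNat (X (kid Γ p s))).plug 0 (X (kid Γ p (!s))))).length < lam := by
  obtain ⟨S, U, hS, -, -, -, hX, hU, -, hY, hYf, -, -, hZ, ks, hk, hZf⟩ := hI.loses ha hl
  obtain ⟨hi, h1⟩ := fills_lose hU hYf; have h2 := h1.plug (i := 0) rfl hZf; have e0 := hU.holes_eq
  have e1 := h1.holes_eq; have e2 := h2.holes_eq; have e3 := hYf.holes_eq; have e4 := hZf.holes_eq
  simp at e0 e1 e2 e3 e4; have n1 := hX.plug s.toNat (X (kid Γ p s))
  exact ⟨hC.join S _ _ _ _ _ _ hS hX hU hi hY hYf (by omega) (by omega) (by omega),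
    hC.len S _ _ hS n1 (by omega) h1,
    hC.join S _ _ _ _ _ _ hS n1 h1 rfl hZ hZf (by omega) (by omega) (by omega),
    hC.len S _ _ hS (n1.plug _ _) (by omega) h2⟩

lemma rake_id_kid {C : ℕ → List ℕ} {par : List ℕ} (hS : t.Shape Γ C par) (ha : t.Alt (isOdd h Γ)) :
    (t.rake (isOdd h Γ) s).id = if Loses h s Γ t.id then kid Γ t.id (!s) else t.id := by
  cases t with
  | leaf i => rw [if_neg fun hl => hl.1 hS.2.2]; rfl
  | node i ch =>
    have := loses_iff (s := s) (h := h) hS; rw [CT.rake]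
    change _ = if Loses h s Γ i then kid Γ i (!s) else i
    by_cases hl : Loses h s Γ i
    · rw [if_pos hl, if_pos (this.mp hl), CT.kid_eq hS.2.2.1]
      cases hc : ch (!s) with
      | leaf a => rfl
      | node a ch' => exact CT.rake_id (ha.not_twice (this.mp hl) hc)
    · rw [if_neg hl, if_neg fun h' => hl (this.mpr h')]; rfl

local notation "midΓ" => mergeΓ s (dropΓ h s Γ) (mergeR h s Cf Γ X)

section
variable (h s Γ X Cf)

def stepΓ : Fields := absorbΓ midΓ (absorbR Cf (stepX h s Γ X) midΓ)

end

lemma mergeΓ_17 (R : ℕ → List ℕ) (y : ℕ) : mergeΓ s Γ R y 17 =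
    if Gains s Γ y then Γ ((Γ y 8).getD 1 0) 8 else [] := rfl

lemma CInv.stepΓ_eq (hI : CInv N B Cf Γ X t) (ha : t.Alt (isOdd h Γ)) {y : ℕ} (hy : y < N)
    (hd : ¬ Dies h s Γ y) (hl : ¬ Loses h s Γ y) :
    stepΓ h s Γ Cf X y 8 = (if Gains s (dropΓ h s Γ) y then Γ ((Γ y 8).getD 1 0) 8 else Γ y 8) ∧
    stepΓ h s Γ Cf X y 14 = (if Gains s (dropΓ h s Γ) y then Cf (stepX h s Γ X y) else Γ y 14) ∧
    stepΓ h s Γ Cf X y 13 = (if Γ y 13 = [] then [] else [MPC.hd (Γ y 13) / h]) ∧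
    stepΓ h s Γ Cf X y 7 = (if Γ y 7 = [] then [] else
      [if Loses h s Γ (kid Γ y false) then kid Γ (kid Γ y false) (!s) else kid Γ y false,
       if Loses h s Γ (kid Γ y true) then kid Γ (kid Γ y true) (!s) else kid Γ y true]) := by
  have hP := hI.ptrOk; obtain ⟨e7, e8, e14, e13⟩ := mergeΓ_dropΓ hd hl (mergeR h s Cf Γ X)
  have e17 := mergeΓ_17 (s := s) (Γ := dropΓ h s Γ) (mergeR h s Cf Γ X) y
  have hk : ∀ b, kid midΓ y b = kid Γ y b := fun b => by unfold kid; rw [e7]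
  have h17 : midΓ y 17 = [] ↔ ¬ Gains s (dropΓ h s Γ) y := by
    rw [e17]; split_ifs with hg
    · obtain ⟨p, h1, h2, h3⟩ := (gains_dropΓ hP hy).mp hg
      obtain ⟨_, _, _, _, h8, _⟩ := hI.loses ha h1; rw [(dropΓ_of_not_dies hd).2.1, h2]
      simp only [getD_cons_succ, List.getD_cons_zero,
        (dropΓ_of_not_dies (hP.not_dies h1.1)).2.1, h8, hg, not_true]
    · simp [hg]
  refine ⟨?_, ?_, e13, ?_⟩
  · show (if _ then _ else _) = _; rw [e8]; by_cases hg : Gains s (dropΓ h s Γ) y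
    · rw [if_neg fun h' => h17.mp h' hg, if_pos hg, e17, if_pos hg]
      obtain ⟨p, h1, h2, h3⟩ := (gains_dropΓ hP hy).mp hg; rw [(dropΓ_of_not_dies hd).2.1, h2]
      exact (dropΓ_of_not_dies (hP.not_dies h1.1)).2.1
    · rw [if_pos (h17.mpr hg), if_neg hg]
  · show (if _ then _ else _) = _; rw [e14]; by_cases hg : Gains s (dropΓ h s Γ) y
    · rw [if_neg fun h' => h17.mp h' hg, if_pos hg]; exact if_neg fun h' => h17.mp h' hg
    · rw [if_pos (h17.mpr hg), if_neg hg]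
  · show (if _ then _ else _) = _; rw [e7, hk, hk]; by_cases h7 : Γ y 7 = []
    · rw [if_pos h7, if_pos h7]
    · rw [if_neg h7, if_neg h7]; have key : ∀ f b, (midΓ y f =
          if dropΓ h s Γ y 7 = [] ∨ dropΓ h s Γ (kid (dropΓ h s Γ) y b) 15 = [] then []
          else [kid (dropΓ h s Γ) (kid (dropΓ h s Γ) y b) (!s)]) →
          (if midΓ y f = [] then kid Γ y b else MPC.hd (midΓ y f)) =
          if Loses h s Γ (kid Γ y b) then kid Γ (kid Γ y b) (!s) else kid Γ y b := by
        intro f b hf; rw [hf, (dropΓ_of_not_dies hd).1, kid_dropΓ hP h7]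
        by_cases hlb : Loses h s Γ (kid Γ y b)
        · have : ¬ (Γ y 7 = [] ∨ dropΓ h s Γ (kid Γ y b) 15 = []) := by
            rintro (h' | h'); exacts [h7 h', dropΓ_15.mpr hlb h']
          rw [if_neg this, if_pos hlb, kid_dropΓ hP hlb.1]; simp [MPC.hd]
        · have : Γ y 7 = [] ∨ dropΓ h s Γ (kid Γ y b) 15 = [] := .inr (if_neg hlb)
          rw [if_pos this, if_neg hlb]; simp
      rw [key 19 false rfl, key 20 true rfl]

lemma CInv.stepΓ_supp (hI : CInv N B Cf Γ X t) (ha : t.Alt (isOdd h Γ)) {y : ℕ}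
    (hy : Dies h s Γ y ∨ Loses h s Γ y ∨ (Γ y 7 = [] ∧ Γ y 8 = [])) :
    stepΓ h s Γ Cf X y 7 = [] ∧ stepΓ h s Γ Cf X y 8 = [] := by
  have hP := hI.ptrOk; have key : midΓ y 7 = [] ∧ midΓ y 8 = [] ∧ ¬ Gains s (dropΓ h s Γ) y := by
    rcases hy with hd | hl | ⟨h7, h8⟩
    · have h7 : dropΓ h s Γ y 7 = [] := if_pos hd; have h8 : dropΓ h s Γ y 8 = [] := if_pos hd
      refine ⟨?_, ?_, ?_⟩
      · show (if _ then _ else _) = _; rw [h7]; simp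
      · show (if _ then _ else _) = _; rw [h8]; simp
      · unfold Gains; rw [h8]; simp
    · have h15 := dropΓ_15.mpr hl; refine ⟨if_neg h15, if_neg h15, fun hg => ?_⟩
      have hd := hP.not_dies (h := h) (s := s) hl.1; unfold Gains at hg
      rw [(dropΓ_of_not_dies hd).2.1, dropΓ_15] at hg
      have hyt : y ∈ t.ids := by_contra fun hy => hl.1 (hI.supp y hy).1
      have := (gains_dropΓ hP (hI.lt y hyt)).mp (by
        unfold Gains; rw [(dropΓ_of_not_dies hd).2.1, dropΓ_15]; exact hg)
      obtain ⟨p, h1, h2, h3⟩ := this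
      obtain ⟨_, _, _, _, _, _, _, _, _, _, _, h4, _⟩ := hI.loses ha h1; rw [h3] at h4; exact h4 hl
    · have hd : ¬ Dies h s Γ y := fun hd => by have := hd.2.1; simp [h8] at this
      have hl : ¬ Loses h s Γ y := fun hl => hl.1 h7
      obtain ⟨e7, e8, -⟩ := mergeΓ_dropΓ hd hl (mergeR h s Cf Γ X)
      refine ⟨e7.trans h7, e8.trans h8, ?_⟩; unfold Gains; rw [(dropΓ_of_not_dies hd).2.1, h8]; simp
  obtain ⟨k7, k8, kg⟩ := key; have h17 : midΓ y 17 = [] := by rw [mergeΓ_17, if_neg kg]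
  exact ⟨(if_pos k7), (if_pos h17).trans k8⟩

lemma CInv.step_aux {t₀ : CT} (hI : CInv N B Cf Γ X t₀) (ha₀ : t₀.Alt (isOdd h Γ))
    {par par' : List ℕ} {S S' : BTree} (hS : t.Shape Γ (fun i => Cf (X i)) par)
    (hlt : ∀ y ∈ t.ids, y < N)
    (hg : t.Good B X S) (hal : t.Alt (isOdd h Γ)) (hd : ¬ Dies h s Γ t.id)
    (hgl : Gains s (dropΓ h s Γ) t.id → ¬ Loses h s Γ t.id)
    (hS' : Gains s (dropΓ h s Γ) t.id → par' = Γ ((Γ t.id 8).getD 1 0) 8 ∧ S'.IsSubtree B ∧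
      ∃ Z : Part, Z.IsNode ∧ Z.Fills [S] S' ∧ stepX h s Γ X t.id = Z.plug 0 (X t.id))
    (hS₀ : ¬ Gains s (dropΓ h s Γ) t.id → par' = par ∧ S' = S) :
    (t.rake (isOdd h Γ) s).Shape (stepΓ h s Γ Cf X) (fun i => Cf (stepX h s Γ X i)) par' ∧
    (t.rake (isOdd h Γ) s).Good B (stepX h s Γ X) S' ∧
    ∀ y ∈ (t.rake (isOdd h Γ) s).ids, ¬ Dies h s Γ y ∧ ¬ Loses h s Γ y := by
  have hP := hI.ptrOk
  induction t generalizing par par' S S' with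
  | leaf i =>
    obtain ⟨h8, h14, h7⟩ := hS; obtain ⟨g1, g2, g3⟩ := hg
    have hl : ¬ Loses h s Γ i := fun hl => hl.1 h7
    obtain ⟨e8, e14, e13, e7⟩ := hI.stepΓ_eq ha₀ (hlt i (CT.id_mem (.leaf i))) hd hl
    refine ⟨⟨?_, ?_, by rw [e7, if_pos h7]⟩, ?_, ?_⟩
    · rw [e8]; split_ifs with hgn
      exacts [(hS' hgn).1.symm, h8.trans (hS₀ hgn).1.symm]
    · rw [e14]; split_ifs with hgn
      · rfl
      · show _ = Cf (stepX h s Γ X i); rw [h14, stepX, if_neg hgn]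
    · by_cases hgn : Gains s (dropΓ h s Γ) i
      · obtain ⟨-, s1, Z, s2, s3, s4⟩ := hS' hgn; rw [CT.id_leaf] at s4; refine ⟨s1, ?_, ?_⟩
        · rw [s4]; exact s2.plug _ _
        · rw [s4]; exact s3.plug rfl g3
      · obtain ⟨-, rfl⟩ := hS₀ hgn; have e : stepX h s Γ X i = X i := if_neg hgn
        exact ⟨g1, by rwa [e], by rwa [e]⟩
    · intro y hy; obtain rfl : y = i := by simpa [CT.rake, CT.ids] using hy
      exact ⟨hd, hl⟩
  | node i ch ih =>
    have hli := loses_iff (s := s) (h := h) hS; obtain ⟨h8, h14, h7, h13, hc⟩ := id hS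
    obtain ⟨g1, g2, U, g3, g4⟩ := hg; dsimp only [CT.id_node] at *
    have hlt' : ∀ b, ∀ y ∈ (ch b).ids, y < N := fun b y hy =>
      hlt y (CT.mem_ids_node.mpr (.inr ⟨b, hy⟩)); rw [CT.rake]; by_cases hl : Loses h s Γ i
    · have hgn : ¬ Gains s (dropΓ h s Γ) i := fun hgn => hgl hgn hl; obtain ⟨rfl, rfl⟩ := hS₀ hgn
      rw [if_pos (hli.mp hl)]; have hk := CT.kid_eq h7 (!s); have hks := CT.kid_eq h7 s
      have hg' : Gains s (dropΓ h s Γ) (ch (!s)).id :=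
        (gains_dropΓ hP (hlt' _ _ (CT.id_mem _))).mpr ⟨i, hl, (hc _).par, hk⟩
      obtain ⟨_, _, _, _, _, _, _, _, _, hY, _, h4, _⟩ := hI.loses ha₀ hl
      have hYf : (X (ch s).id).Fills [] (U s) := by
        have := hli.mp hl; have hgs := g4 s
        cases hcs : ch s with
        | leaf a => rw [hcs] at hgs; exact hgs.2.2
        | node a ch' => rw [hcs] at this; exact absurd this (by simp [CT.isOddLeaf])
      refine ih (!s) (hc (!s)) (hlt' _) (g4 _) (hal.1 _) ?_ (fun _ => ?_) (fun _ => ?_) (absurd hg')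
      · intro hd'; have := hd'.2.2; rw [(hc _).par] at this
        cases s <;> simp at this
      · rw [← hk]; exact h4
      · rw [(hc _).par]
        refine ⟨h8.symm, g1, _, g2.plug s.toNat (X (ch s).id), (fills_lose g3 hYf).2, ?_⟩
        rw [stepX, if_pos hg', (hc _).par]; simp only [getD_cons_succ, List.getD_cons_zero, hks]
    · rw [if_neg fun h' => hl (hli.mpr h')]
      obtain ⟨e8, e14, e13, e7⟩ := hI.stepΓ_eq ha₀ (hlt i (CT.id_mem (.node i ch))) hd hl
      have hgc : ∀ b, ¬ Gains s (dropΓ h s Γ) (ch b).id := fun b hgn => by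
        obtain ⟨p, h1, h2, -⟩ := (gains_dropΓ hP (hlt' b _ (CT.id_mem _))).mp hgn
        rw [(hc b).par] at h2
        obtain rfl : i = p := by simpa using (List.cons_eq_cons.mp (List.cons_eq_cons.mp h2).2).1
        exact hl h1
      have hdc : ∀ b, ¬ Dies h s Γ (ch b).id := fun b hd' => by
        have h2 := hd'.2.2; rw [(hc b).par] at h2; obtain rfl : b = s := toNat_inj.mp h2
        exact hl ⟨by rw [h7]; simp, by rw [CT.kid_eq h7]; exact hd'⟩
      have IH := fun b => ih b (S' := U b) (hc b) (hlt' b) (g4 b) (hal.1 b) (hdc b)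
        (fun hgn => absurd hgn (hgc b)) (fun hgn => absurd hgn (hgc b)) (fun _ => ⟨rfl, rfl⟩)
      refine ⟨⟨?_, ?_, ?_, by rw [e13, if_pos h13], fun b => (IH b).1⟩, ?_, ?_⟩
      · rw [e8]; split_ifs with hgn
        exacts [(hS' hgn).1.symm, h8.trans (hS₀ hgn).1.symm]
      · rw [e14]; by_cases hgn : Gains s (dropΓ h s Γ) i
        · rw [if_pos hgn]
        · show _ = Cf (stepX h s Γ X i); rw [if_neg hgn, h14, stepX, if_neg hgn]
      · rw [e7, if_neg (by rw [h7]; simp), CT.kid_eq h7, CT.kid_eq h7, rake_id_kid (hc false) (hal.1 _),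
          rake_id_kid (hc true) (hal.1 _)]
      · by_cases hgn : Gains s (dropΓ h s Γ) i
        · obtain ⟨-, s1, Z, s2, s3, s4⟩ := hS' hgn; refine ⟨s1, ?_, U, ?_, fun b => (IH b).2.1⟩
          · rw [s4]; exact s2.plug _ _
          · rw [s4]; simpa using s3.plug (i := 0) rfl g3
        · obtain ⟨-, rfl⟩ := hS₀ hgn; have e : stepX h s Γ X i = X i := if_neg hgn
          exact ⟨g1, by rwa [e], U, by rwa [e], fun b => (IH b).2.1⟩
      · intro y hy; rcases CT.mem_ids_node.mp hy with rfl | ⟨b, hb⟩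
        · exact ⟨hd, hl⟩
        · exact (IH b).2.2 y hb

lemma mem_rake {C : ℕ → List ℕ} {par : List ℕ} (hS : t.Shape Γ C par) {y : ℕ} (hy : y ∈ t.ids) :
    y ∈ (t.rake (isOdd h Γ) s).ids ∨ Dies h s Γ y ∨ Loses h s Γ y := by
  induction t generalizing par with
  | leaf i => exact .inl hy
  | node i ch ih =>
    have hli := loses_iff (s := s) (h := h) hS; have hc := hS.2.2.2.2; have h7 := hS.2.2.1
    rw [CT.rake]; by_cases hl : Loses h s Γ i
    · rw [if_pos (hli.mp hl)]; rcases CT.mem_ids_node.mp hy with rfl | ⟨b, hb⟩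
      · exact .inr (.inr hl)
      · rcases eq_or_ne b s with rfl | hbs
        · have hl' := hl.2; rw [CT.kid_eq h7] at hl'; have h1 := hli.mp hl
          cases hcb : ch b with
          | leaf a =>
            rw [hcb] at hb hl'; obtain rfl : y = a := by simpa [CT.ids] using hb
            exact .inr (.inl hl')
          | node a ch' => rw [hcb] at h1; exact absurd h1 (by simp [CT.isOddLeaf])
        · obtain rfl : b = !s := by cases b <;> cases s <;> simp_all
          exact ih _ (hc _) hb
    · rw [if_neg fun h' => hl (hli.mpr h')]; rcases CT.mem_ids_node.mp hy with rfl | ⟨b, hb⟩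
      · exact .inl (CT.id_mem (.node _ _))
      · rcases ih _ (hc b) hb with h' | h'
        · exact .inl (CT.mem_ids_node.mpr (.inr ⟨b, h'⟩))
        · exact .inr h'

lemma CInv.step (hC : CallOk W lam B Cf val pM) (hlam : 0 < lam) (hI : CInv N B Cf Γ X t)
    (ha : t.Alt (isOdd h Γ)) :
    VStep W lam n pw N (drop h s) Γ (dropΓ h s Γ) (fun _ => []) ∧
    VStep W lam n pw N (merge pM s) (dropΓ h s Γ) midΓ (mergeR h s Cf Γ X) ∧
    VStep W lam n pw N (absorb pM) midΓ (stepΓ h s Γ Cf X) (absorbR Cf (stepX h s Γ X) midΓ) ∧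
    CInv N B Cf (stepΓ h s Γ Cf X) (stepX h s Γ X) (t.rake (isOdd h Γ) s) ∧
    ∀ y ∈ (t.rake (isOdd h Γ) s).ids, hd (stepΓ h s Γ Cf X y 13) = hd (Γ y 13) / h := by
  have hP := hI.ptrOk; have h0 : ¬ Dies h s Γ t.id := fun hd => by
    have := hd.2.1; rw [hI.shape.par] at this; simp at this
  have h1 : ¬ Gains s (dropΓ h s Γ) t.id := fun hg => by
    have := hg.1; rw [(dropΓ_of_not_dies h0).2.1, hI.shape.par] at this; simp at this
  obtain ⟨m1, m2, m3⟩ := hI.step_aux (S' := B) (par' := [0]) ha hI.shape hI.lt hI.good ha h0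
    (fun hg => absurd hg h1) (fun hg => absurd hg h1) fun _ => ⟨rfl, rfl⟩
  have hlt : ∀ y ∈ (t.rake (isOdd h Γ) s).ids, y < N := fun y hy => hI.lt y (CT.rake_ids hy)
  have hgain : ∀ x < N, midΓ x 17 ≠ [] →
      ∃ p, Loses h s Γ p ∧ Γ x 8 = [1, p, (!s).toNat] ∧ kid Γ p (!s) = x ∧
        ¬ Dies h s Γ x ∧ stepX h s Γ X x =
          ((X p).plug s.toNat (X (kid Γ p s))).plug 0 (X (kid Γ p (!s))) ∧
        midΓ x 18 = Cf ((X p).plug s.toNat (X (kid Γ p s))) := by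
    intro x hx h17; have hg : Gains s (dropΓ h s Γ) x := by by_contra hg; exact h17 (if_neg hg)
    obtain ⟨p, h1, h2, h3⟩ := (gains_dropΓ hP hx).mp hg; have hd : ¬ Dies h s Γ x := by
      intro hd; have := hd.2.2; rw [h2] at this
      cases s <;> simp at this
    refine ⟨p, h1, h2, h3, hd, ?_, ?_⟩
    · rw [stepX, if_pos hg, h2, h3]; simp only [getD_cons_succ, List.getD_cons_zero]
    · show (if _ then _ else _) = _; rw [if_pos hg, (dropΓ_of_not_dies hd).2.1, h2]
      simp only [getD_cons_succ, List.getD_cons_zero]; exact if_pos h1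
  refine ⟨vstep_drop hlam hP, vstep_merge hP.mergeOk ?_ ?_ ?_, vstep_absorb ?_ ?_ ?_,
    ⟨m1, m2, hlt, ?_⟩, ?_⟩
  · intro x hx h15; have hl := dropΓ_15.mp h15
    obtain ⟨_, _, _, _, _, h14, _, _, h14', _⟩ := hI.loses ha hl
    rw [(dropΓ_of_not_dies (hP.not_dies hl.1)).2.2, h14,
      show dropΓ h s Γ x 16 = Γ (kid Γ x s) 14 from if_pos hl, h14', mergeR, if_pos hl]
    exact (hI.calls hC ha hl).1
  · intro x _ h15; exact if_neg fun hl => dropΓ_15.mpr hl h15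
  · intro x _; unfold mergeR; split_ifs with hl
    · exact (hI.calls hC ha hl).2.1
    · exact hlam
  · intro x hx h17; obtain ⟨p, h1, h2, h3, h4, h5, h6⟩ := hgain x hx h17
    obtain ⟨_, _, _, _, _, _, _, _, _, _, _, hnl, h14, _⟩ := hI.loses ha h1; rw [h3] at hnl h14
    rw [absorbR, if_neg h17, h6, h5, (mergeΓ_dropΓ h4 hnl _).2.2.1, h14]
    have := (hI.calls hC ha h1).2.2.1; rw [h3] at this ⊢; exact this
  · intro x _ h17; exact if_pos h17
  · intro x hx; unfold absorbR; split_ifs with h17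
    · exact hlam
    · obtain ⟨p, h1, h2, h3, h4, h5, h6⟩ := hgain x hx h17; rw [h5]; exact (hI.calls hC ha h1).2.2.2
  · intro y hy; apply hI.stepΓ_supp ha; by_cases hyt : y ∈ t.ids
    · rcases mem_rake (s := s) (h := h) hI.shape hyt with h' | h' | h'
      · exact absurd h' hy
      · exact .inl h'
      · exact .inr (.inl h')
    · exact inr2 (hI.supp y hyt)
  · intro y hy; obtain ⟨h2, h3⟩ := m3 y hy; rw [(hI.stepΓ_eq ha (hlt y hy) h2 h3).2.2.1]
    split_ifs with h13
    · simp [h13, hd]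
    · rfl

end

/-! ### Sizes -/

section
variable {b lam h : ℕ} {s : Bool} {Γ : Fields} {R : ℕ → List ℕ}

lemma GOK.of (hlen : ∀ x f, (Γ x f).length < lam)
    (hptr : ∀ x f, isPtr f = true → ∀ w ∈ Γ x f, w ≤ b) (h0 : ∀ x, Γ x 0 = [0]) :
    GOK b lam Γ :=
  ⟨hlen, hptr, fun x => by rw [h0]; simp [MPC.hd]⟩

lemma GOK.getD_le (hG : GOK b lam Γ) {f : ℕ} (hf : isPtr f = true) (x i : ℕ) :
    (Γ x f).getD i 0 ≤ b := by
  rw [getD_eq_getElem?_getD]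
  cases h : (Γ x f)[i]? with
  | none => simp
  | some w => exact hG.ptr x f hf w (mem_of_getElem? h)

lemma GOK.drop (hG : GOK b lam Γ) (hlam : 2 < lam) (hb : 1 ≤ b) : GOK b lam (dropΓ h s Γ) := by
  refine .of (fun x f => ?_) (fun x f hf w hw => ?_) fun x => rfl
  · unfold dropΓ; split <;> (try split_ifs) <;> first | exact hG.len _ _ | (simp; omega)
  · unfold dropΓ at hw; split at hw <;> (try split_ifs at hw) <;> first
      | exact hG.ptr _ _ hf w hw
      | (simp at hw; done)
      | (simp at hw; omega)
      | (simp [isPtr] at hf; done)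
      | skip
    obtain rfl := by simpa using hw
    exact (Nat.div_le_self _ _).trans (hG.getD_le hf _ _)

lemma GOK.merge (hG : GOK b lam Γ) (hR : ∀ x, (R x).length < lam) (hlam : 2 < lam) :
    GOK b lam (mergeΓ s Γ R) := by
  refine .of (fun x f => ?_) (fun x f hf w hw => ?_) fun x => rfl
  · unfold mergeΓ
    split <;> (try split_ifs) <;> first | exact hG.len _ _ | exact hR _ | (simp; omega)
  · unfold mergeΓ at hw; split at hw <;> (try split_ifs at hw) <;> first
      | exact hG.ptr _ _ hf w hw
      | exact hG.ptr _ 8 rfl w hw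
      | (simp at hw; done)
      | (simp at hw; omega)
      | (simp [isPtr] at hf; done)
      | (simp only [mem_singleton] at hw; rw [hw]; exact hG.getD_le rfl _ _)

lemma GOK.absorb (hG : GOK b lam Γ) (hR : ∀ x, (R x).length < lam) (hlam : 2 < lam) :
    GOK b lam (absorbΓ Γ R) := by
  refine .of (fun x f => ?_) (fun x f hf w hw => ?_) fun x => rfl
  · unfold absorbΓ
    split <;> (try split_ifs) <;> first | exact hG.len _ _ | exact hR _ | (simp; omega)
  · unfold absorbΓ at hw; split at hw
    · simp at hw; omega
    · split_ifs at hw <;> simp only [mem_cons, not_mem_nil, or_false] at hw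
      all_goals rcases hw with rfl | rfl <;> exact hG.getD_le rfl _ _
    · split_ifs at hw <;> exact hG.ptr _ _ rfl w hw
    · exact hG.ptr _ _ hf w hw
    · simp [isPtr] at hf
    · simp at hw

end

/-! ## Sequences of steps -/

structure Net where
  W : ℕ
  lam : ℕ
  n : ℕ
  N : ℕ
  b : ℕ
  L : ℕ
  pC : Prog
  pM : Prog

inductive Net.Steps (P : Net) (u : ℕ) (Γ : Fields) : ℕ → (Fields) → Prop
  | refl : P.Steps u Γ u Γ
  | tail {v : ℕ} {Γ' Γ'' : Fields} {R : ℕ → List ℕ} : P.Steps u Γ v Γ' →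
      VStep P.W P.lam P.n (pwAt P.L v) P.N (all P.pC P.pM (ncode P.L v)) Γ' Γ'' R →
      GOK P.b P.lam Γ'' → P.Steps u Γ (v + 1) Γ''

namespace Net

variable {P : Net}

lemma Steps.trans {u v w : ℕ} {Γ Γ' Γ'' : Fields} (h : P.Steps u Γ v Γ')
    (h' : P.Steps v Γ' w Γ'') : P.Steps u Γ w Γ'' := by
  induction h' with
  | refl => exact h
  | tail _ hv hg ih => exact ih.tail hv hg

lemma Steps.single {u : ℕ} {Γ Γ' : Fields} {R : ℕ → List ℕ} {p : NodeProg}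
    (hp : all P.pC P.pM (ncode P.L u) = p)
    (h : VStep P.W P.lam P.n (pwAt P.L u) P.N p Γ Γ' R) (hg : GOK P.b P.lam Γ') :
    P.Steps u Γ (u + 1) Γ' := by
  subst hp; exact Steps.refl.tail h hg

lemma Steps.exists_seq {u : ℕ} {Γ₀ Γ' : Fields} (h : P.Steps 0 Γ₀ u Γ')
    (hg : GOK P.b P.lam Γ₀) : ∃ (Γ : ℕ → Fields) (R : Fields), Γ 0 = Γ₀ ∧ Γ u = Γ' ∧
      (∀ k < u, VStep P.W P.lam P.n (pwAt P.L k) P.N (all P.pC P.pM (ncode P.L k))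
        (Γ k) (Γ (k + 1)) (R k)) ∧ ∀ k ≤ u, GOK P.b P.lam (Γ k) := by
  induction h with
  | refl =>
    refine ⟨fun _ => Γ₀, fun _ _ => [], rfl, rfl, fun k hk => absurd hk (by omega), fun _ _ => hg⟩
  | @tail v Γ' Γ'' R h1 h2 h3 ih =>
    obtain ⟨G, Rs, e0, e1, e2, e3⟩ := ih
    refine ⟨fun k => if k ≤ v then G k else Γ'', fun k => if k < v then Rs k else R,
      (if_pos (Nat.zero_le v)).trans e0, if_neg (by omega), fun k hk => ?_, fun k hk => ?_⟩
    · rcases Nat.lt_succ_iff_lt_or_eq.mp hk with h' | rfl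
      · simp only [if_pos h'.le, if_pos (show k + 1 ≤ v from h'), if_pos h']; exact e2 k h'
      · simp only [if_pos le_rfl, if_neg (show ¬ k + 1 ≤ k by omega), if_neg (lt_irrefl k), e1]
        exact h2
    · dsimp only; split_ifs with h'
      · exact e3 k h'
      · exact h3

end Net

/-! ## The contraction -/

namespace CT

variable {o o' : ℕ → Bool} {t : CT}

lemma isOddLeaf_congr (h : ∀ y ∈ t.ids, o y = o' y) : t.isOddLeaf o = t.isOddLeaf o' := by
  cases t with
  | leaf i => exact h i (id_mem (leaf i))
  | node => rfl

lemma ids_child {i : ℕ} {ch : Bool → CT} {q : ℕ → Prop} (h : ∀ y ∈ (node i ch).ids, q y)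
    (b : Bool) : ∀ y ∈ (ch b).ids, q y :=
  fun y hy => h y (mem_ids_node.mpr (.inr ⟨b, hy⟩))

lemma rake_congr {s : Bool} (h : ∀ y ∈ t.ids, o y = o' y) : t.rake o s = t.rake o' s := by
  induction t with
  | leaf i => rfl
  | node i ch ih =>
    rw [rake, rake, isOddLeaf_congr (ids_child h s), ih _ (ids_child h (!s))]
    simp only [fun b => ih b (ids_child h b)]

lemma fst_mem_ids (t : CT) : t.fst ∈ t.ids := by
  obtain ⟨l, hl⟩ := fst_mem t; exact leaves_subset (by rw [hl]; simp)

lemma last_mem_ids (t : CT) : t.last ∈ t.ids := by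
  obtain ⟨l, hl⟩ := last_mem t; exact leaves_subset (by rw [hl]; simp)

lemma Alt.congr (h : ∀ y ∈ t.ids, o y = o' y) (ha : t.Alt o) : t.Alt o' := by
  induction t with
  | leaf i => trivial
  | node i ch ih =>
    refine ⟨fun b => ih b (ids_child h b) (ha.1 b), ?_⟩
    rw [← ids_child h _ _ (last_mem_ids (ch false)), ← ids_child h _ _ (fst_mem_ids (ch true))]
    exact ha.2

lemma two_le_leaves {i : ℕ} {ch : Bool → CT} : 2 ≤ (node i ch).leaves.length := by
  have h1 := List.length_pos_iff.mpr (leaves_ne_nil (ch false))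
  have h2 := List.length_pos_iff.mpr (leaves_ne_nil (ch true))
  simp only [leaves, length_append]; omega

lemma rake_leaf_of {s : Bool} (h : ∃ i, t = leaf i) : t.rake o s = t := by obtain ⟨i, rfl⟩ := h; rfl

end CT

def desc : ℕ → List ℕ
  | 0 => []
  | r + 1 => (r + 1) :: desc r

lemma desc_length (r : ℕ) : (desc r).length = r := by
  induction r with
  | zero => rfl
  | succ r ih => simp [desc, ih]

lemma desc_isChain (r : ℕ) : (desc r).IsChain fun a b => ¬ (a % 2 = 1 ∧ b % 2 = 1) := by
  induction r with
  | zero => exact .nil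
  | succ r ih =>
    cases r with
    | zero => exact .singleton _
    | succ r => exact .cons_cons (by omega) ih

lemma desc_filter (r : ℕ) :
    (desc r).filter (fun x => !decide (x % 2 = 1)) = (desc (r / 2)).map (2 * ·) := by
  induction r with
  | zero => rfl
  | succ r ih =>
    rw [desc, List.filter_cons, ih]; rcases Nat.even_or_odd' r with ⟨c, rfl | rfl⟩
    · rw [if_neg (by simp), show (2 * c + 1) / 2 = 2 * c / 2 by omega]
    · rw [if_pos (by simp; omega), show (2 * c + 1 + 1) / 2 = c + 1 by omega,
        show (2 * c + 1) / 2 = c by omega]; rfl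

/-- The leaves are numbered by `r, …, 1`, and the numbers are stored with a factor `2`. -/
def Numbered (Γ : Fields) (t : CT) (r : ℕ) : Prop :=
  (∃ i, t = .leaf i) ∨ t.leaves.map (fun y => hd (Γ y 13)) = (desc r).map (2 * ·)

lemma Net.ncode_phase {L k i : ℕ} (hk : k ≤ L) (hi : i < 6) :
    ncode L (3 * L + 8 + 6 * k + i) = 7 + i := by
  unfold ncode; rw [if_neg (by omega), if_neg (by omega), if_neg (by omega), if_neg (by omega),
    if_neg (by omega), if_neg (by omega), if_pos (by omega)]; omega

section
variable {P : Net} {Γ : Fields} {B : BTree} {Cf : Part → List ℕ}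
  {val : BTree → List ℕ} {X : ℕ → Part} {t : CT}

lemma Net.rake_steps {u h : ℕ} {s : Bool} (hC : CallOk P.W P.lam B Cf val P.pM)
    (hlam : 2 < P.lam) (hb : 1 ≤ P.b) (hG : GOK P.b P.lam Γ) (hI : CInv P.N B Cf Γ X t)
    (ha : t.Alt (isOdd h Γ))
    (h1 : all P.pC P.pM (ncode P.L u) = drop h s)
    (h2 : all P.pC P.pM (ncode P.L (u + 1)) = merge P.pM s)
    (h3 : all P.pC P.pM (ncode P.L (u + 2)) = absorb P.pM) :
    ∃ Γ' X', P.Steps u Γ (u + 3) Γ' ∧ GOK P.b P.lam Γ' ∧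
      CInv P.N B Cf Γ' X' (t.rake (isOdd h Γ) s) ∧
      ∀ y ∈ (t.rake (isOdd h Γ) s).ids, hd (Γ' y 13) = hd (Γ y 13) / h := by
  have hl0 : 0 < P.lam := by omega
  obtain ⟨v1, v2, v3, v4, v5⟩ := hI.step (s := s) (n := P.n) (pw := pwAt P.L u) hC hl0 ha
  obtain ⟨-, v2, -⟩ := hI.step (s := s) (n := P.n) (pw := pwAt P.L (u + 1)) hC hl0 ha
  obtain ⟨-, -, v3, -⟩ := hI.step (s := s) (n := P.n) (pw := pwAt P.L (u + 2)) hC hl0 ha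
  have g1 : GOK P.b P.lam (dropΓ h s Γ) := hG.drop hlam hb
  have g2 := g1.merge (s := s) (R := mergeR h s Cf Γ X) (fun x => ?_) hlam
  · have g3 := g2.absorb (R := absorbR Cf (stepX h s Γ X)
      (mergeΓ s (dropΓ h s Γ) (mergeR h s Cf Γ X))) (fun x => ?_) hlam
    · exact ⟨_, _, ((Steps.single h1 v1 g1).trans (Steps.single h2 v2 g2)).trans
        (Steps.single h3 v3 g3), g3, v4, v5⟩
    · by_cases hx : x < P.N
      · exact v3.res_len x hx
      · rw [absorbR, if_pos, length_nil]
        · exact hl0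
        · rw [mergeΓ_17, if_neg]; intro hg; have h8 := hg.1
          have : ¬ x ∈ t.ids := fun hy => hx (hI.lt x hy)
          rw [show dropΓ h s Γ x 8 = [] from ?_] at h8
          · simp at h8
          · show (if _ then _ else _) = _; rw [(hI.supp x this).2, ite_self]
  · by_cases hx : x < P.N
    · exact v2.res_len x hx
    · have : ¬ x ∈ t.ids := fun hy => hx (hI.lt x hy)
      rw [mergeR, if_neg fun hl => hl.1 (hI.supp x this).1, length_nil]; exact hl0

lemma Net.phase {k r : ℕ} (hC : CallOk P.W P.lam B Cf val P.pM)
    (hlam : 2 < P.lam) (hb : 1 ≤ P.b) (hG : GOK P.b P.lam Γ) (hI : CInv P.N B Cf Γ X t)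
    (hn : Numbered Γ t r) (hk : k ≤ P.L) :
    ∃ Γ' X' t', P.Steps (3 * P.L + 8 + 6 * k) Γ (3 * P.L + 8 + 6 * (k + 1)) Γ' ∧
      GOK P.b P.lam Γ' ∧ CInv P.N B Cf Γ' X' t' ∧ Numbered Γ' t' (r / 2) := by
  have hc : ∀ i < 6, ncode P.L (3 * P.L + 8 + 6 * k + i) = 7 + i := fun i hi => ncode_phase hk hi
  have ha : t.Alt (isOdd 2 Γ) := by
    rcases hn with ⟨i, rfl⟩ | hn
    · trivial
    · apply CT.alt_of_isChain; have h1 : t.leaves.map (fun y => MPC.hd (Γ y 13) / 2) = desc r := by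
        have := congrArg (List.map (· / 2)) hn; simpa [Function.comp_def] using this
      have h2 := desc_isChain r; rw [← h1, List.isChain_map] at h2; simpa [isOdd] using h2
  obtain ⟨Γ₁, X₁, s1, g1, c1, n1⟩ := rake_steps (s := false) hC hlam hb hG hI ha
    (by rw [hc 0 (by omega)]; rfl) (by rw [add_assoc, hc 1 (by omega)]; rfl)
    (by rw [add_assoc, hc 2 (by omega)]; rfl)
  have ho : ∀ y ∈ (t.rake (isOdd 2 Γ) false).ids, isOdd 2 Γ y = isOdd 1 Γ₁ y := fun y hy => by
    simp [isOdd, n1 y hy]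
  obtain ⟨Γ₂, X₂, s2, g2, c2, n2⟩ := rake_steps (u := 3 * P.L + 8 + 6 * k + 3) (s := true) hC
    hlam hb g1 c1 (ha.rake.1.congr ho)
    (by rw [hc 3 (by omega)]; rfl) (by rw [add_assoc, hc 4 (by omega)]; rfl)
    (by rw [add_assoc, hc 5 (by omega)]; rfl)
  rw [← CT.rake_congr ho] at c2 n2; refine ⟨Γ₂, X₂, _, s1.trans s2, g2, c2, ?_⟩
  rcases hn with ht | hn
  · refine .inl ?_; rw [CT.rake_leaf_of ht, CT.rake_leaf_of ht]; exact ht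
  · cases h1 : t.rake (isOdd 2 Γ) false with
    | leaf i => exact .inl ⟨i, rfl⟩
    | node i ch =>
      refine .inr ?_; rw [← h1]
      have e : ((t.rake (isOdd 2 Γ) false).rake (isOdd 2 Γ) true).leaves =
          t.leaves.filter fun a => !isOdd 2 Γ a := by
        rw [← CT.rake_filter (s := false)]
        exact ha.oddOn.leaves_rake (by rw [h1]; simp [CT.isOddLeaf])
      have e2 : ((t.rake (isOdd 2 Γ) false).rake (isOdd 2 Γ) true).leaves.map
          (fun y => MPC.hd (Γ₂ y 13)) =
          ((t.rake (isOdd 2 Γ) false).rake (isOdd 2 Γ) true).leaves.map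
          (fun y => MPC.hd (Γ y 13) / 2) := by
        refine List.map_congr_left fun y hy => ?_; have hy := CT.leaves_subset hy
        rw [n2 y hy, n1 y (CT.rake_ids hy), Nat.div_one]
      have h1 : t.leaves.map (fun y => MPC.hd (Γ y 13) / 2) = desc r := by
        have := congrArg (List.map (· / 2)) hn; simpa [Function.comp_def] using this
      rw [e2, e, ← desc_filter, ← h1, List.filter_map]; rfl

lemma Net.phases {r : ℕ} (hC : CallOk P.W P.lam B Cf val P.pM)
    (hlam : 2 < P.lam) (hb : 1 ≤ P.b) (hG : GOK P.b P.lam Γ) (hI : CInv P.N B Cf Γ X t)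
    (hn : Numbered Γ t r) {k : ℕ} (hk : k ≤ P.L + 1) :
    ∃ Γ' X' t', P.Steps (3 * P.L + 8) Γ (3 * P.L + 8 + 6 * k) Γ' ∧
      GOK P.b P.lam Γ' ∧ CInv P.N B Cf Γ' X' t' ∧ Numbered Γ' t' (r / 2 ^ k) := by
  induction k with
  | zero => exact ⟨Γ, X, t, .refl, hG, hI, by simpa using hn⟩
  | succ k ih =>
    obtain ⟨Γ₁, X₁, t₁, h1, h2, h3, h4⟩ := ih (by omega)
    obtain ⟨Γ₂, X₂, t₂, h5, h6, h7, h8⟩ := phase hC hlam hb h2 h3 h4 (by omega : k ≤ P.L)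
    exact ⟨Γ₂, X₂, t₂, h1.trans h5, h6, h7, by rwa [pow_succ, ← Nat.div_div_eq_div_mul]⟩

lemma Numbered.leaf {r : ℕ} (hn : Numbered Γ t r) (hr : r ≤ 1) : ∃ i, t = .leaf i := by
  rcases hn with h | h
  · exact h
  · cases t with
    | leaf i => exact ⟨i, rfl⟩
    | node i ch =>
      have h1 := congrArg List.length h; have := CT.two_le_leaves (i := i) (ch := ch)
      rw [length_map, length_map, desc_length] at h1; omega

def finΓ (v : List ℕ) (y f : ℕ) : List ℕ := if f = 0 then [0] else if f = 21 ∧ y = 0 then v else []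

lemma Net.finish (hC : CallOk P.W P.lam B Cf val P.pM) (hlam : 2 < P.lam) {i : ℕ}
    (hI : CInv P.N B Cf Γ X (.leaf i)) :
    P.Steps (9 * P.L + 14) Γ (9 * P.L + 15) (finΓ (val B)) := by
  have hi : i < P.N := hI.lt i (CT.id_mem (.leaf i)); have hN : 0 < P.N := by omega
  have h8 : Γ i 8 = [0] := hI.shape.1; have h14 : Γ i 14 = Cf (X i) := hI.shape.2.1
  have hne : ∀ x, x ≠ i → Γ x 8 = [] := fun x hx => (hI.supp x (by simpa [CT.ids] using hx)).2
  have hv := hC.val_len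
  have hfire : ∀ x R, fires ((nodeEnv P.n (pwAt P.L (9 * P.L + 14)) P.N Γ x).withR R)
      [.op .eq (.len 8) (.c 1)] ↔ x = i := by
    intro x R; simp only [fires_cons, fires_nil, and_true, eval_eq]; show (Γ x 8).length = 1 ↔ _
    by_cases hx : x = i
    · rw [hx, h8]; simp
    · simp [hne x hx, hx]
  have hfire' : ∀ x, fires (nodeEnv P.n (pwAt P.L (9 * P.L + 14)) P.N Γ x)
      [.op .eq (.len 8) (.c 1)] ↔ x = i := fun x => by
    simp only [fires_cons, fires_nil, and_true, eval_eq]; show (Γ x 8).length = 1 ↔ _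
    by_cases hx : x = i
    · rw [hx, h8]; simp
    · simp [hne x hx, hx]
  refine Steps.single (p := NodeProg.finish P.pM) (R := fun x => if x = i then val B else []) ?_
    (VStep.of ?_ ?_ ?_ ?_ ?_)
    (GOK.of (fun x f => ?_) (fun x f hf w hw => ?_) fun x => rfl)
  · have : ncode P.L (9 * P.L + 14) = 13 := by
      unfold ncode; rw [if_neg (by omega), if_neg (by omega), if_neg (by omega), if_neg (by omega),
        if_neg (by omega), if_neg (by omega), if_neg (by omega)]
    rw [this]; rfl
  · simp only [NodeProg.finish, mem_singleton, forall_eq, hfire]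
    rintro x hx rfl; refine ⟨hN, ?_⟩; simp [finΓ, NE.eval, segs, Seg.val]
  · simp only [NodeProg.finish, mem_singleton, forall_eq, hfire]; rintro x hx y hy rfl rfl _; rfl
  · intro y hy f hf0 hf; unfold finΓ at hf; rw [if_neg hf0] at hf; split_ifs at hf with h
    · obtain ⟨rfl, rfl⟩ := h
      refine ⟨_, mem_singleton.mpr rfl, rfl, i, hi, (hfire i _).mpr rfl, rfl⟩
    · exact absurd rfl hf
  · intro x hx; refine ⟨fun hf => ?_, fun hf => if_neg fun hx => hf ((hfire' x).mpr hx)⟩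
    obtain rfl := (hfire' x).mp hf
    rw [if_pos rfl]; have := hC.eval (X x) hI.good.2.1 hI.good.2.2; rw [← h14] at this
    simpa [segs, Seg.val, NE.eval, NodeProg.finish] using this
  · intro x _; split_ifs
    · exact hv
    · simp; omega
  · unfold finΓ; split_ifs
    · rw [List.length_singleton]; omega
    · exact hv
    · rw [length_nil]; omega
  · unfold finΓ at hw; split_ifs at hw with h1 h2
    · simp at hw; omega
    · rw [h2.1] at hf; simp [isPtr] at hf
    · simp at hw

lemma Net.contract {r : ℕ} (hC : CallOk P.W P.lam B Cf val P.pM)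
    (hlam : 2 < P.lam) (hb : 1 ≤ P.b) (hG : GOK P.b P.lam Γ) (hI : CInv P.N B Cf Γ X t)
    (hn : Numbered Γ t r) (hr : r < 2 ^ (P.L + 1)) :
    P.Steps (3 * P.L + 8) Γ (9 * P.L + 15) (finΓ (val B)) := by
  obtain ⟨Γ₁, X₁, t₁, h1, h2, h3, h4⟩ := phases hC hlam hb hG hI hn (k := P.L + 1) le_rfl
  obtain ⟨i, rfl⟩ := h4.leaf (by rw [Nat.div_eq_of_lt hr]; omega)
  rw [show 3 * P.L + 8 + 6 * (P.L + 1) = 9 * P.L + 14 by ring] at h1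
  exact h1.trans (finish hC hlam h3)

end

/-! ## Sorting -/

def sortΓ (z dat itm : ℕ → List ℕ) (y f : ℕ) : List ℕ :=
  match f with
  | 0 => z y
  | 1 => dat y
  | 2 => itm y
  | _ => []

def items (n : ℕ) (key ℓ : ℕ → ℕ) (y : ℕ) : List ℕ := if y < n then [key (ℓ y), ℓ y] else []

def zeroBit (n pw : ℕ) (key ℓ : ℕ → ℕ) (y : ℕ) : ℕ :=
  if y < n ∧ key (ℓ y) / pw % 2 = 0 then 1 else 0

def newPos (n pw : ℕ) (key ℓ : ℕ → ℕ) (c : ℕ → ℕ) (t y : ℕ) : ℕ :=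
  if key (ℓ y) / pw % 2 = 0 then c y else t + (y - c y)

section
variable {W lam n pw N b : ℕ} {key ℓ : ℕ → ℕ} {z dat : ℕ → List ℕ}

lemma gok_sortΓ (hlam : 2 < lam) (hdat : ∀ y, (dat y).length < lam) (hz : ∀ y, ∃ v ≤ 1, z y = [v])
    (hb : 1 ≤ b) (hkey : ∀ y < n, key (ℓ y) ≤ b ∧ ℓ y ≤ b) :
    GOK b lam (sortΓ z dat (items n key ℓ)) where
  len x f := by
    unfold sortΓ items; obtain ⟨v, -, hv⟩ := hz x
    split <;> (try split_ifs) <;> first | exact hdat _ | (simp [*]; done) | (simp [*]; omega)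
  ptr x f hf w hw := by
    unfold sortΓ items at hw; obtain ⟨v, hv1, hv⟩ := hz x
    split at hw <;> (try split_ifs at hw with hx)
    · simp [hv] at hw; omega
    · simp [isPtr] at hf
    · have := hkey x hx; simp at hw; rcases hw with rfl | rfl <;> omega
    · simp at hw
    · simp at hw
  hd x := by obtain ⟨v, hv1, hv⟩ := hz x; show MPC.hd (z x) ≤ 1; rw [hv]; exact hv1

lemma vstep_sortA (hlam : 0 < lam) : VStep W lam n pw N sortA (sortΓ z dat (items n key ℓ))
    (sortΓ (fun y => [zeroBit n pw key ℓ y]) dat (items n key ℓ)) (fun _ => []) := by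
  refine VStep.of ?_ ?_ ?_ (hcv := fun x hx => ?_)
  · simp only [sortA, rule_simps]
    exact ⟨fun x hx _ => ⟨hx, by simp [segs, Seg.val, sortΓ, NE.eval]⟩,
      fun x hx _ => ⟨hx, by simp [segs, Seg.val, sortΓ, NE.eval]⟩⟩
  · simp only [sortA, rule_simps]
  · intro y hy f h0 hf; simp only [sortA, rule_simps]; unfold sortΓ at hf; split at hf
    · exact absurd rfl h0
    · exact .inl ⟨rfl, y, hy, rfl⟩
    · exact .inr ⟨rfl, y, hy, rfl⟩
    · exact absurd rfl hf
  · simp only [sortΓ, zeroBit, sortA, bitE, NE.eval, Op.eval, withR_fld,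
      withR_pw, items, if_neg (show (2 : ℕ) ≠ 22 by decide)]
    have := Nat.mod_two_eq_zero_or_one (key (ℓ x) / pw); by_cases h : x < n
    · rcases this with h1 | h1 <;> simp [h, h1]
    · simp [h]

local notation:max "envS" x:max => Env.withR (nodeEnv n pw N (sortΓ (fun y => [zeroBit n pw key ℓ y]) dat (items n key ℓ)) x) []

lemma vstep_sortB {ℓ' : ℕ → ℕ} (hlam : 0 < lam) (hn : n ≤ N) {pos : ℕ → ℕ}
    (hpos : pos = newPos n pw key ℓ (fun y => ∑ x ∈ range y, zeroBit n pw key ℓ x)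
      (∑ x ∈ range N, zeroBit n pw key ℓ x))
    (hlt : ∀ y < n, pos y < n ∧ ℓ' (pos y) = ℓ y)
    (hinj : ∀ x < n, ∀ y < n, pos x = pos y → x = y) (hsurj : ∀ p < n, ∃ y < n, pos y = p) :
    VStep W lam n pw N sortB
    (sortΓ (fun y => [zeroBit n pw key ℓ y]) dat (items n key ℓ))
    (sortΓ (fun _ => [0]) dat (items n key ℓ')) (fun _ => []) := by
  have hlen : ∀ x, items n key ℓ x ≠ [] ↔ x < n := fun x => by
    unfold items; split_ifs with h <;> simp [h]
  have e2 : ∀ x, (envS x).fld 2 = items n key ℓ x := fun _ => rfl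
  have eb : ∀ x < n, NodeProg.bitE.eval (envS x) = key (ℓ x) / pw % 2 := fun x hx => by
    simp [bitE, NE.eval, Op.eval, sortΓ, items, hx]
  have p0 : ∀ x < n, key (ℓ x) / pw % 2 = 0 → NE.pre.eval (envS x) = pos x := by
    intro x hx h; rw [hpos, newPos, if_pos h]; rfl
  have p1 : ∀ x < n, key (ℓ x) / pw % 2 ≠ 0 → (NE.op .add .tot (.op .sub .x .pre)).eval (envS x)
      = pos x := by
    intro x hx h; rw [hpos, newPos, if_neg h]; rfl
  have hpay : ∀ x < n, sortΓ (fun _ => [0]) dat (items n key ℓ') (pos x) 2 = segs (envS x) [.a 2] := by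
    intro x hx; obtain ⟨h1, h2⟩ := hlt x hx; simp [sortΓ, items, h1, h2, segs, Seg.val, hx]
  refine VStep.of ?_ ?_ ?_
  · simp only [sortB, rule_simps, e2, hlen]
    refine ⟨fun x hx _ => ⟨hx, by simp [segs, Seg.val, sortΓ, NE.eval]⟩,
      fun x _ ⟨hx, h0⟩ => ?_, fun x _ ⟨hx, h0⟩ => ?_⟩
    · rw [eb x hx] at h0; rw [p0 x hx h0]; exact ⟨(hlt x hx).1.trans_le hn, hpay x hx⟩
    · rw [eb x hx] at h0; rw [p1 x hx h0]; exact ⟨(hlt x hx).1.trans_le hn, hpay x hx⟩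
  · simp only [sortB, rule_simps, e2, hlen]
    refine ⟨fun x _ y _ ⟨hx, h0⟩ ⟨hy, h1⟩ he => ?_, fun x _ y _ ⟨hx, h0⟩ ⟨hy, h1⟩ he => ?_⟩
    · rw [eb x hx] at h0; rw [eb y hy] at h1; rw [p0 x hx h0, p0 y hy h1] at he
      exact hinj x hx y hy he
    · rw [eb x hx] at h0; rw [eb y hy] at h1; rw [p1 x hx h0, p1 y hy h1] at he
      exact hinj x hx y hy he
  · intro y hy f h0 hf; simp only [sortB, rule_simps, e2, hlen]; unfold sortΓ at hf; split at hf
    · exact absurd rfl h0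
    · exact .inl ⟨rfl, y, hy, rfl⟩
    · have hyn : y < n := by by_contra h; simp [items, h] at hf
      obtain ⟨x, hx, rfl⟩ := hsurj y hyn; by_cases h0 : key (ℓ x) / pw % 2 = 0
      · exact .inr (.inl ⟨rfl, x, by omega, ⟨hx, by rwa [eb x hx]⟩, p0 x hx h0⟩)
      · exact .inr (.inr ⟨rfl, x, by omega, ⟨hx, by rwa [eb x hx]⟩, p1 x hx h0⟩)
    · exact absurd rfl hf

lemma exists_partition {k : ℕ} (hN : n ≤ N) (hℓ : ∀ y < n, ℓ y < n)
    (hi : ∀ x < n, ∀ y < n, ℓ x = ℓ y → x = y)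
    (hs : ∀ x y, x < y → y < n → key (ℓ x) % 2 ^ k ≤ key (ℓ y) % 2 ^ k) :
    ∃ pos ℓ' : ℕ → ℕ, pos = newPos n (2 ^ k) key ℓ
        (fun y => ∑ x ∈ range y, zeroBit n (2 ^ k) key ℓ x)
        (∑ x ∈ range N, zeroBit n (2 ^ k) key ℓ x) ∧
      (∀ y < n, pos y < n ∧ ℓ' (pos y) = ℓ y) ∧
      (∀ x < n, ∀ y < n, pos x = pos y → x = y) ∧ (∀ p < n, ∃ y < n, pos y = p) ∧
      (∀ y < n, ℓ' y < n) ∧ (∀ x < n, ∀ y < n, ℓ' x = ℓ' y → x = y) ∧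
      ∀ x y, x < y → y < n → key (ℓ' x) % 2 ^ (k + 1) ≤ key (ℓ' y) % 2 ^ (k + 1) := by
  set c : ℕ → ℕ := fun y => ∑ x ∈ range y, zeroBit n (2 ^ k) key ℓ x with hc
  set pos := newPos n (2 ^ k) key ℓ c (c N) with hpos
  have cs : ∀ y, c (y + 1) = c y + zeroBit n (2 ^ k) key ℓ y := fun y => sum_range_succ _ y
  have z1 : ∀ y, zeroBit n (2 ^ k) key ℓ y ≤ 1 := fun y => by unfold zeroBit; split_ifs <;> omega
  have cmono : ∀ d y, c y ≤ c (y + d) ∧ c (y + d) ≤ c y + d := by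
    intro d y
    induction d with
    | zero => simp
    | succ d ih => rw [← add_assoc, cs]; have := z1 (y + d); omega
  have cN : c N = c n := by
    refine (Finset.sum_subset (Finset.range_mono hN) fun x _ hx => ?_).symm
    rw [mem_range] at hx; exact if_neg fun h => hx h.1
  have c0 : ∀ y, c y ≤ y := fun y => by simpa [hc] using (cmono y 0).2
  have cle : ∀ x y, x ≤ y → c x ≤ c y ∧ c y ≤ c x + (y - x) := fun x y h => by
    have := cmono (y - x) x; rwa [Nat.add_sub_cancel' h] at this
  have bz : ∀ y < n, key (ℓ y) / 2 ^ k % 2 = 0 → c (y + 1) = c y + 1 := fun y hy h => by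
    rw [cs, zeroBit, if_pos ⟨hy, h⟩]
  have bo : ∀ y, key (ℓ y) / 2 ^ k % 2 ≠ 0 → c (y + 1) = c y := fun y h => by
    rw [cs, zeroBit, if_neg fun h' => h h'.2]; rfl
  have plt : ∀ y < n, pos y < n := by
    intro y hy; have h2 := cle (y + 1) n hy; have h3 := c0 y; rw [hpos, newPos, cN]
    split_ifs with h
    · have := bz y hy h; have := c0 n; omega
    · have := bo y h; omega
  have plt' : ∀ x < n, ∀ y < n, (key (ℓ x) / 2 ^ k % 2 < key (ℓ y) / 2 ^ k % 2 ∨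
      (key (ℓ x) / 2 ^ k % 2 = key (ℓ y) / 2 ^ k % 2 ∧ x < y)) → pos x < pos y := by
    intro x hx y hy h; have hb := Nat.mod_lt (key (ℓ x) / 2 ^ k) (show 0 < 2 by decide)
    have hb' := Nat.mod_lt (key (ℓ y) / 2 ^ k) (show 0 < 2 by decide)
    have h3 := c0 y; have h3' := c0 x; rw [hpos, newPos, newPos, cN]; rcases h with h | ⟨h, hxy⟩
    · rw [if_pos (by omega), if_neg (by omega)]; have := bz x hx (by omega)
      have := cle (x + 1) n hx; omega
    · have h2 := cle (x + 1) y hxy; rw [← h]; split_ifs with h0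
      · have := bz x hx h0; omega
      · have := bo x h0; omega
  have hinj : ∀ x < n, ∀ y < n, pos x = pos y → x = y := by
    intro x hx y hy h; by_contra hne; have h1 := plt' x hx y hy; have h2 := plt' y hy x hx; omega
  have hsurj : ∀ p < n, ∃ y < n, pos y = p := by
    have := Finset.surjOn_of_injOn_of_card_le (s := range n) (t := range n) pos
      (fun y hy => by simpa using plt y (by simpa using hy))
      (fun x hx y hy h => hinj x (by simpa using hx) y (by simpa using hy) h) le_rfl
    intro p hp; obtain ⟨y, hy, h⟩ := this (by simpa using hp); exact ⟨y, by simpa using hy, h⟩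
  choose! inv hinv using hsurj; have e : ∀ y < n, inv (pos y) = y := fun y hy =>
    hinj _ (hinv _ (plt y hy)).1 y hy (hinv _ (plt y hy)).2
  refine ⟨pos, fun p => ℓ (inv p), rfl, fun y hy => ⟨plt y hy, congrArg ℓ (e y hy)⟩, hinj,
    fun p hp => ⟨_, hinv p hp⟩, fun y hy => hℓ _ (hinv y hy).1, fun x hx y hy h => ?_,
    fun x y hxy hy => ?_⟩
  · have := hi _ (hinv x hx).1 _ (hinv y hy).1 h; rw [← (hinv x hx).2, this, (hinv y hy).2]
  · have hx := hxy.trans hy; obtain ⟨a1, a2⟩ := hinv x hx; obtain ⟨b1, b2⟩ := hinv y hy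
    have h1 := plt' _ b1 _ a1; have h2 : inv x ≠ inv y := fun h => by rw [h, b2] at a2; omega
    rw [a2, b2] at h1; simp only [Nat.mod_pow_succ]
    rcases lt_trichotomy (key (ℓ (inv x)) / 2 ^ k % 2) (key (ℓ (inv y)) / 2 ^ k % 2) with h | h | h
    · have := Nat.mod_lt (key (ℓ (inv x))) (show 0 < 2 ^ k by positivity)
      have := Nat.mul_le_mul_left (2 ^ k) h; rw [Nat.mul_succ] at this; omega
    · have := hs (inv x) (inv y) (by omega) b1; rw [h]; omega
    · omega

end

lemma Net.sort {P : Net} {key : ℕ → ℕ} {z dat : ℕ → List ℕ} (hlam : 2 < P.lam) (hb : 1 ≤ P.b)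
    (hdat : ∀ y, (dat y).length < P.lam) (hn : P.n ≤ P.N) (hnb : P.n ≤ P.b)
    (hkey : ∀ y < P.n, key y ≤ P.b) {k : ℕ} (hk : k ≤ P.L + 1) :
    ∃ z' ℓ, P.Steps 0 (sortΓ z dat (items P.n key fun y => y)) (2 * k)
        (sortΓ z' dat (items P.n key ℓ)) ∧
      (∀ y < P.n, ℓ y < P.n) ∧ (∀ x < P.n, ∀ y < P.n, ℓ x = ℓ y → x = y) ∧
      ∀ x y, x < y → y < P.n → key (ℓ x) % 2 ^ k ≤ key (ℓ y) % 2 ^ k := by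
  induction k with
  | zero => exact ⟨z, fun y => y, .refl, fun y h => h, fun x _ y _ h => h, by simp [Nat.mod_one]⟩
  | succ k ih =>
    obtain ⟨z', ℓ, h1, h2, h3, h4⟩ := ih (by omega)
    obtain ⟨pos, ℓ', q0, q1, q2, q3, q4, q5, q6⟩ := exists_partition hn h2 h3 h4
    have e0 : pwAt P.L (2 * k) = 2 ^ k := by unfold pwAt; congr 1; omega
    have e1 : pwAt P.L (2 * k + 1) = 2 ^ k := by unfold pwAt; congr 1; omega
    have n0 : all P.pC P.pM (ncode P.L (2 * k)) = sortA := by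
      rw [ncode, if_pos (by omega), Nat.mul_mod_right]; rfl
    have n1 : all P.pC P.pM (ncode P.L (2 * k + 1)) = sortB := by
      rw [ncode, if_pos (by omega), show (2 * k + 1) % 2 = 1 by omega]; rfl
    have s1 := Steps.single n0 (vstep_sortA (z := z') (dat := dat) (key := key) (ℓ := ℓ) (by omega))
      (gok_sortΓ hlam hdat (fun y => ⟨_, ?_, rfl⟩) hb fun y hy =>
        ⟨hkey _ (h2 y hy), (h2 y hy).le.trans hnb⟩)
    · rw [e0] at s1
      have s2 := Steps.single n1 (by rw [e1]; exact vstep_sortB (dat := dat) (by omega) hn q0 q1 q2 q3)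
        (gok_sortΓ hlam hdat (fun y => ⟨0, by omega, rfl⟩) hb fun y hy =>
          ⟨hkey _ (q4 y hy), (q4 y hy).le.trans hnb⟩)
      exact ⟨_, ℓ', (h1.trans s1).trans s2, q4, q5, q6⟩
    · unfold zeroBit; split_ifs <;> omega

/-! ## Links -/

/-- The first child `lf p` of a vertex (if there is one), and the pointer `rg v` to the next
sibling, or to the node `n + 1 + up v`. -/
structure Links (n : ℕ) (up : ℕ → ℕ) (lf : ℕ → List ℕ) (rg : ℕ → ℕ) : Prop where
  lf_eq : ∀ p, lf p = [] ∨ ∃ v < n, lf p = [v] ∧ up v = p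
  lf_ne : ∀ v < n, lf (up v) ≠ []
  rg_eq : ∀ v < n, (rg v < n ∧ up (rg v) = up v) ∨ rg v = n + 1 + up v
  rg_inj : ∀ v < n, ∀ w < n, rg v = rg w → v = w
  lf_rg : ∀ v < n, ∀ p, lf p ≠ [rg v]
  reach : ∀ (S : ℕ → Prop) (p : ℕ), (∀ v, lf p = [v] → S v) →
    (∀ v < n, up v = p → S v → rg v < n → S (rg v)) → ∀ v < n, up v = p → S v
  rank : ∃ e : ℕ → ℕ, ∀ v < n, e v < n ∧ (rg v < n → e v < e (rg v))

def FirstItem (n : ℕ) (key ℓ : ℕ → ℕ) (y : ℕ) : Prop :=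
  y < n ∧ (0 < y → key (ℓ (y - 1)) ≠ key (ℓ y))

def link1Γ (n : ℕ) (key ℓ : ℕ → ℕ) (dat : ℕ → List ℕ) (y f : ℕ) : List ℕ :=
  match f with
  | 0 => [0]
  | 1 => dat y
  | 2 => items n key ℓ y
  | 3 => if 0 < y ∧ y < n then items n key ℓ (y - 1) else []
  | 4 => items n key ℓ (y + 1)
  | _ => []

def link2Γ (n : ℕ) (lf : ℕ → List ℕ) (rg : ℕ → ℕ) (dat : ℕ → List ℕ) (y f : ℕ) : List ℕ :=
  match f with
  | 0 => [0]
  | 1 => dat y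
  | 5 => lf y
  | 6 => if y < n then [rg y] else []
  | _ => []

section
variable {W lam n pw N b : ℕ} {key ℓ : ℕ → ℕ} {z dat : ℕ → List ℕ}

lemma items_ne {x : ℕ} : items n key ℓ x ≠ [] ↔ x < n := by
  unfold items; split_ifs with h <;> simp [h]

local notation:max "envI" x:max => Env.withR (nodeEnv n pw N (sortΓ z dat (items n key ℓ)) x) []

lemma vstep_link1 (hlam : 0 < lam) (hn : n ≤ N) :
    VStep W lam n pw N link1 (sortΓ z dat (items n key ℓ)) (link1Γ n key ℓ dat) (fun _ => []) := by
  have e2 : ∀ x, (envI x).fld 2 = items n key ℓ x := fun _ => rfl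
  have ex : ∀ x, NE.x.eval (envI x) = x := fun _ => rfl
  have ex1 : ∀ x, (NE.op .add .x (.c 1)).eval (envI x) = x + 1 := fun _ => rfl
  have ex2 : ∀ x, (NE.op .sub .x (.c 1)).eval (envI x) = x - 1 := fun _ => rfl
  have en : ∀ x, NE.n.eval (envI x) = n := fun _ => rfl; refine VStep.of ?_ ?_ ?_ <;>
    simp only [link1, rule_simps, eval_lt, e2, items_ne, ex, ex1, ex2, en]
  · refine ⟨fun x hx _ => ⟨hx, by simp [segs, Seg.val, sortΓ, link1Γ]⟩,
      fun x hx _ => ⟨hx, by simp [segs, Seg.val, sortΓ, link1Γ]⟩,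
      fun x hx ⟨h1, h2⟩ => ⟨by omega, ?_⟩, fun x hx ⟨h1, h2⟩ => ⟨by omega, ?_⟩⟩
    · show items n key ℓ (x - 1 + 1) = _; rw [Nat.sub_add_cancel (by omega)]
      simp [segs, Seg.val, sortΓ]
    · simp [segs, Seg.val, sortΓ, link1Γ, h2]
  · exact ⟨fun x _ y _ h h' he => by omega, fun x _ y _ _ _ he => by omega⟩
  · intro y hy f h0 hf; unfold link1Γ at hf; split at hf
    · exact absurd rfl h0
    · exact .inl ⟨rfl, y, hy, rfl⟩
    · exact .inr (.inl ⟨rfl, y, hy, rfl⟩)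
    · split_ifs at hf with h
      · exact inr2 (.inr ⟨rfl, y - 1, by omega, ⟨by omega, by omega⟩, by omega⟩)
      · exact absurd rfl hf
    · rw [items_ne] at hf; exact inr2 (.inl ⟨rfl, y + 1, by omega, ⟨by omega, by omega⟩, by omega⟩)
    · exact absurd rfl hf

local notation:max "envL" x:max => Env.withR (nodeEnv n pw N (link1Γ n key ℓ dat) x) []

lemma exists_links {up : ℕ → ℕ} (hkey : ∀ v, key v = up v + 1) (hup : ∀ v < n, up v ≤ n)
    (hlam : 0 < lam) (hN : 2 * n + 2 ≤ N) (hℓ : ∀ y < n, ℓ y < n)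
    (hi : ∀ x < n, ∀ y < n, ℓ x = ℓ y → x = y)
    (hs : ∀ x y, x < y → y < n → key (ℓ x) ≤ key (ℓ y)) :
    ∃ lf rg, Links n up lf rg ∧ VStep W lam n pw N link2 (link1Γ n key ℓ dat)
      (link2Γ n lf rg dat) (fun _ => []) := by
  classical
  have hsurj : ∀ p < n, ∃ y < n, ℓ y = p := by
    have := Finset.surjOn_of_injOn_of_card_le (s := range n) (t := range n) ℓ
      (fun y hy => by simpa using hℓ y (by simpa using hy))
      (fun x hx y hy h => hi x (by simpa using hx) y (by simpa using hy) h) le_rfl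
    intro p hp; obtain ⟨y, hy, h⟩ := this (by simpa using hp); exact ⟨y, by simpa using hy, h⟩
  choose! e he using hsurj
  have eℓ : ∀ y < n, e (ℓ y) = y := fun y hy => hi _ (he _ (hℓ y hy)).1 y hy (he _ (hℓ y hy)).2
  have funiq : ∀ x y, FirstItem n key ℓ x → FirstItem n key ℓ y → key (ℓ x) = key (ℓ y) → ¬ x < y := by
    intro x y hx hy h hxy; refine hy.2 (by omega) (le_antisymm (hs _ _ (by omega) hy.1) ?_)
    rcases eq_or_ne x (y - 1) with rfl | hne
    · exact h.ge
    · rw [← h]; exact hs _ _ (by omega) (by have := hy.1; omega)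
  set lf : ℕ → List ℕ := fun p => if h : ∃ y, FirstItem n key ℓ y ∧ key (ℓ y) = p + 1 then
    [ℓ h.choose] else [] with hlf
  set rg : ℕ → ℕ := fun v => if e v + 1 < n ∧ key (ℓ (e v + 1)) = key v then ℓ (e v + 1)
    else n + key v with hrg
  have lf1 : ∀ p, lf p = [] ∨ ∃ y, FirstItem n key ℓ y ∧ key (ℓ y) = p + 1 ∧ lf p = [ℓ y] := by
    intro p; by_cases h : ∃ y, FirstItem n key ℓ y ∧ key (ℓ y) = p + 1
    · exact .inr ⟨h.choose, h.choose_spec.1, h.choose_spec.2, dif_pos h⟩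
    · exact .inl (dif_neg h)
  have lf2 : ∀ y, FirstItem n key ℓ y → lf (up (ℓ y)) = [ℓ y] := by
    intro y hy; have h : ∃ y', FirstItem n key ℓ y' ∧ key (ℓ y') = up (ℓ y) + 1 := ⟨y, hy, hkey _⟩
    have h' := h.choose_spec; rw [hlf]; simp only [dif_pos h, List.cons.injEq, and_true]
    congr 1; have h3 := h'.2.trans (hkey _).symm; have h1 := funiq _ _ h'.1 hy h3
    have h2 := funiq _ _ hy h'.1 h3.symm; omega
  have rg1 : ∀ y, y + 1 < n → key (ℓ (y + 1)) = key (ℓ y) → rg (ℓ y) = ℓ (y + 1) := by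
    intro y hy h; simp only [hrg, eℓ y (by omega)]; rw [if_pos ⟨hy, h⟩]
  have rg2 : ∀ y < n, ¬ (y + 1 < n ∧ key (ℓ (y + 1)) = key (ℓ y)) → rg (ℓ y) = n + key (ℓ y) := by
    intro y hy h; simp only [hrg, eℓ y hy]; rw [if_neg h]
  have first : ∀ p, (∃ v < n, up v = p) → lf p ≠ [] := by
    rintro _ ⟨v, hv, rfl⟩
    have hex : ∃ y, y < n ∧ key (ℓ y) = key v := ⟨e v, (he v hv).1, by rw [(he v hv).2]⟩
    obtain ⟨h1, h2⟩ := Nat.find_spec hex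
    have hf : FirstItem n key ℓ (Nat.find hex) := ⟨h1, fun h0 h =>
      Nat.find_min hex (show Nat.find hex - 1 < _ by omega) ⟨by omega, h.trans h2⟩⟩
    have := lf2 _ hf; have h3 := (hkey _).symm.trans (h2.trans (hkey _))
    rw [show up v = up (ℓ (Nat.find hex)) by omega, this]; simp
  have hL : Links n up lf rg := by
    refine ⟨fun p => ?_, fun v hv => first _ ⟨v, hv, rfl⟩, fun v hv => ?_, fun v hv w hw h => ?_,
      fun v hv p h => ?_, fun S p h0 h1 v hv hvp => ?_, e, fun v hv => ⟨(he v hv).1, fun h => ?_⟩⟩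
    · rcases lf1 p with h | ⟨y, h1, h2, h3⟩
      · exact .inl h
      · exact .inr ⟨_, hℓ y h1.1, h3, by rw [hkey] at h2; omega⟩
    · obtain ⟨y, hy, rfl⟩ : ∃ y < n, ℓ y = v := ⟨e v, he v hv⟩
      by_cases h : y + 1 < n ∧ key (ℓ (y + 1)) = key (ℓ y)
      · rw [rg1 y h.1 h.2]; have := h.2; rw [hkey, hkey] at this; exact .inl ⟨hℓ _ h.1, by omega⟩
      · rw [rg2 y hy h, hkey]; exact .inr (by omega)
    · obtain ⟨x, hx, rfl⟩ : ∃ y < n, ℓ y = v := ⟨e v, he v hv⟩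
      obtain ⟨y, hy, rfl⟩ : ∃ y < n, ℓ y = w := ⟨e w, he w hw⟩; have hkx := hkey (ℓ x)
      have hky := hkey (ℓ y); by_cases h1 : x + 1 < n ∧ key (ℓ (x + 1)) = key (ℓ x) <;>
        by_cases h2 : y + 1 < n ∧ key (ℓ (y + 1)) = key (ℓ y)
      · rw [rg1 x h1.1 h1.2, rg1 y h2.1 h2.2] at h; have := hi _ h1.1 _ h2.1 h
        rw [show x = y by omega]
      · rw [rg1 x h1.1 h1.2, rg2 y hy h2] at h; have := hℓ _ h1.1; omega
      · rw [rg2 x hx h1, rg1 y h2.1 h2.2] at h; have := hℓ _ h2.1; omega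
      · rw [rg2 x hx h1, rg2 y hy h2] at h
        have key' : ∀ a c, a < c → c < n → key (ℓ a) = key (ℓ c) →
            a + 1 < n ∧ key (ℓ (a + 1)) = key (ℓ a) := by
          intro a c hac hc hk; refine ⟨by omega, le_antisymm ?_ (hs _ _ (by omega) (by omega))⟩
          rcases eq_or_ne (a + 1) c with rfl | hne
          · exact hk.ge
          · rw [hk]; exact hs _ _ (by omega) hc
        rcases lt_trichotomy x y with hxy | rfl | hxy
        · exact absurd (key' x y hxy hy (by omega)) h1
        · rfl
        · exact absurd (key' y x hxy hx (by omega)) h2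
    · obtain ⟨x, hx, rfl⟩ : ∃ y < n, ℓ y = v := ⟨e v, he v hv⟩
      rcases lf1 p with h' | ⟨y, h1, h2, h3⟩
      · rw [h'] at h; simp at h
      · rw [h3] at h; simp only [List.cons.injEq, and_true] at h
        by_cases h4 : x + 1 < n ∧ key (ℓ (x + 1)) = key (ℓ x)
        · rw [rg1 x h4.1 h4.2] at h; obtain rfl := hi _ h1.1 _ h4.1 h
          exact h1.2 (by omega) h4.2.symm
        · rw [rg2 x hx h4] at h; have := hℓ _ h1.1; have := hkey (ℓ x); omega
    · obtain ⟨y, hy, rfl⟩ : ∃ y < n, ℓ y = v := ⟨e v, he v hv⟩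
      induction y with
      | zero => refine h0 _ ?_; rw [← hvp]; exact lf2 0 ⟨hy, fun h => absurd h (by omega)⟩
      | succ y ih =>
        by_cases hk : key (ℓ y) = key (ℓ (y + 1))
        · have hr := rg1 y hy hk.symm; have hu : up (ℓ y) = p := by rw [hkey, hkey] at hk; omega
          have := h1 (ℓ y) (hℓ _ (by omega)) hu (ih (by omega) (hℓ _ (by omega)) hu)
          rw [hr] at this; exact this hv
        · refine h0 _ ?_; rw [← hvp]; exact lf2 _ ⟨hy, fun _ => hk⟩
    · obtain ⟨y, hy, rfl⟩ : ∃ y < n, ℓ y = v := ⟨e v, he v hv⟩; have := hkey (ℓ y)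
      by_cases h1 : y + 1 < n ∧ key (ℓ (y + 1)) = key (ℓ y)
      · rw [rg1 y h1.1 h1.2, eℓ _ h1.1, eℓ y hy]; omega
      · rw [rg2 y hy h1] at h; omega
  refine ⟨lf, rg, hL, ?_⟩; have e2 : ∀ x, (envL x).fld 2 = items n key ℓ x := fun _ => rfl
  have g20 : ∀ x < n, (NE.get 2 0).eval (envL x) =
      key (ℓ x) := fun x hx => by simp [NE.eval, link1Γ, items, hx]
  have g21 : ∀ x < n, (NE.get 2 1).eval (envL x) =
      ℓ x := fun x hx => by simp [NE.eval, link1Γ, items, hx]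
  have gk : ∀ x < n, (NE.op .sub (.get 2 0) (.c 1)).eval (envL x) = up (ℓ x) := fun x hx => by
    simp [NE.eval, Op.eval, link1Γ, items, hx, hkey]
  have f3 : ∀ x < n, (NE.op .eq (.get 3 0) (.get 2 0)).eval
      (envL x) = 0 ↔ FirstItem n key ℓ x := fun x hx => by
    rw [← not_iff_not, ← ne_eq, eval_eq, g20 x hx]
    have : (NE.get 3 0).eval (envL x) = if 0 < x then key (ℓ (x - 1)) else 0 := by
      by_cases h0 : 0 < x
      · simp [NE.eval, link1Γ, h0, hx, items, show x - 1 < n by omega]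
      · simp [NE.eval, link1Γ, h0]
    rw [this, FirstItem, hkey (ℓ x)]; split_ifs with h0
    · simp [hx, h0]
    · simp [hx, h0]
  have f4 : ∀ x < n, (NE.get 4 0).eval (envL x) = (NE.get 2 0).eval (envL x) ↔
      (x + 1 < n ∧ key (ℓ (x + 1)) = key (ℓ x)) := fun x hx => by
    rw [g20 x hx]; by_cases h : x + 1 < n
    · simp [NE.eval, link1Γ, h, items]
    · simp [NE.eval, link1Γ, h, items, hkey (ℓ x)]
  have f4' : ∀ x < n, (NE.op .eq (.get 4 0) (.get 2 0)).eval (envL x) = 0 ↔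
      ¬ (x + 1 < n ∧ key (ℓ (x + 1)) = key (ℓ x)) := fun x hx => by
    rw [← f4 x hx, ← eval_eq]; simp
  refine VStep.of ?_ ?_ ?_ <;> simp only [link2, rule_simps, eval_eq, e2, items_ne]
  · refine ⟨fun x hx _ => ⟨hx, by simp [segs, Seg.val, link1Γ, link2Γ, NE.eval]⟩, fun x _ ⟨hx, h⟩ => ?_,
      fun x _ ⟨hx, h⟩ => ?_, fun x _ ⟨hx, h⟩ => ?_⟩
    · rw [f3 x hx] at h; rw [gk x hx]; refine ⟨by have := hup _ (hℓ x hx); omega, ?_⟩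
      show lf _ = _; rw [lf2 x h]; simp [segs, Seg.val, g21 x hx]
    · rw [f4 x hx] at h; rw [g21 x hx]; refine ⟨by have := hℓ x hx; omega, ?_⟩
      show (if _ then _ else _) = _
      rw [if_pos (hℓ x hx), rg1 x h.1 h.2]; simp [segs, Seg.val, NE.eval, link1Γ, items, h.1]
    · rw [f4' x hx] at h; rw [g21 x hx]; refine ⟨by have := hℓ x hx; omega, ?_⟩
      show (if _ then _ else _) = _
      rw [if_pos (hℓ x hx), rg2 x hx h]; simp [segs, Seg.val, NE.eval, Op.eval, link1Γ, items, hx]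
  · refine ⟨fun x _ y _ ⟨hx, h⟩ ⟨hy, h'⟩ he => ?_,
      fun x _ y _ ⟨hx, h⟩ ⟨hy, h'⟩ he => ?_, fun x _ y _ ⟨hx, h⟩ ⟨hy, h'⟩ he => ?_⟩
    · rw [f3 x hx] at h; rw [f3 y hy] at h'; rw [gk x hx, gk y hy] at he; have h1 := lf2 x h
      rw [he, lf2 y h'] at h1; exact hi _ hx _ hy (by simpa using h1.symm)
    · rw [g21 x hx, g21 y hy] at he; exact hi _ hx _ hy he
    · rw [g21 x hx, g21 y hy] at he; exact hi _ hx _ hy he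
  · intro y hy f h0 hf; unfold link2Γ at hf; split at hf
    · exact absurd rfl h0
    · exact .inl ⟨rfl, y, hy, rfl⟩
    · rcases lf1 y with h | ⟨x, h1, h2, h3⟩
      · exact absurd h hf
      · refine .inr (.inl ⟨rfl, x, by have := h1.1; omega, ⟨h1.1, (f3 x h1.1).mpr h1⟩, ?_⟩)
        rw [gk x h1.1]; rw [hkey] at h2; omega
    · split_ifs at hf with hy
      · by_cases h : e y + 1 < n ∧ key (ℓ (e y + 1)) = key (ℓ (e y))
        · exact inr2 (.inl ⟨rfl, e y, by have := (he y hy).1; omega,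
            ⟨(he y hy).1, (f4 _ (he y hy).1).mpr h⟩, (g21 _ (he y hy).1).trans (he y hy).2⟩)
        · exact inr2 (.inr ⟨rfl, e y, by have := (he y hy).1; omega,
            ⟨(he y hy).1, (f4' _ (he y hy).1).mpr h⟩, (g21 _ (he y hy).1).trans (he y hy).2⟩)
      · exact absurd rfl hf
    · exact absurd rfl hf

end

/-! ## The binary tree of nodes -/

def leftOf (n : ℕ) (lf : ℕ → List ℕ) (x : ℕ) : ℕ := if lf x = [] then n + 1 + x else hd (lf x)

def nextOf (n : ℕ) (lf : ℕ → List ℕ) (rg : ℕ → ℕ) (x : ℕ) : ℕ :=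
  if x < n then leftOf n lf x else rg (x - (n + 1))

def HasNext (n x : ℕ) : Prop := x < n ∨ (n < x ∧ x < 2 * n + 1)

open Classical in
def parentOf (n : ℕ) (lf : ℕ → List ℕ) (rg : ℕ → ℕ) (y : ℕ) : List ℕ :=
  if h : ∃ x, x < n ∧ leftOf n lf x = y then [1, h.choose, 0]
  else if h : ∃ x, x < n ∧ rg x = y then [1, h.choose, 1]
  else if leftOf n lf n = y then [0] else []

open Classical in
def prevOf (n : ℕ) (lf : ℕ → List ℕ) (rg : ℕ → ℕ) (y : ℕ) : List ℕ :=
  if h : ∃ x, HasNext n x ∧ nextOf n lf rg x = y then [h.choose] else []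

def initPart (n : ℕ) (dat : ℕ → List ℕ) (y : ℕ) : Part :=
  if y < n then .node none (.node (some (dat y)) (.hole none) .nil) (.hole none)
  else .node none .nil .nil

open Classical in
def link3Γ (n : ℕ) (lf : ℕ → List ℕ) (rg : ℕ → ℕ) (dat : ℕ → List ℕ) (y f : ℕ) : List ℕ :=
  match f with
  | 0 => [0]
  | 1 => if y < n ∨ (n < y ∧ y < 2 * n + 2) then (initPart n dat y).encode else []
  | 7 => if y < n then [leftOf n lf y, rg y] else []
  | 8 => parentOf n lf rg y
  | 9 => if HasNext n y then [nextOf n lf rg y] else []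
  | 10 => prevOf n lf rg y
  | 11 => if n < y ∧ y < 2 * n + 2 then [2] else []
  | _ => []

section
variable {W lam n pw N b : ℕ} {up : ℕ → ℕ} {lf : ℕ → List ℕ} {rg : ℕ → ℕ} {dat : ℕ → List ℕ}

lemma Links.left_lt (hL : Links n up lf rg) {x : ℕ} (hx : x ≤ n) : leftOf n lf x < 2 * n + 2 := by
  unfold leftOf; rcases hL.lf_eq x with h | ⟨v, hv, h, -⟩
  · rw [if_pos h]; omega
  · rw [h, if_neg (by simp)]; simp [hd]; omega

lemma Links.rg_lt (hL : Links n up lf rg) (hup : ∀ v < n, up v ≤ n) {x : ℕ} (hx : x < n) :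
    rg x < 2 * n + 2 := by
  rcases hL.rg_eq x hx with h | h
  · omega
  · have := hup x hx; omega

lemma Links.left_inj (hL : Links n up lf rg) {x y : ℕ} (h : leftOf n lf x = leftOf n lf y) :
    x = y := by
  unfold leftOf at h
  rcases hL.lf_eq x with hx | ⟨v, hv, hx, rfl⟩ <;> rcases hL.lf_eq y with hy | ⟨w, hw, hy, rfl⟩ <;>
    simp [hx, hy, hd] at h
  · exact h
  · omega
  · omega
  · rw [h]

lemma Links.left_ne (hL : Links n up lf rg) {x v : ℕ} (hv : v < n) : leftOf n lf x ≠ rg v := by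
  intro h; unfold leftOf at h; rcases hL.lf_eq x with hx | ⟨w, hw, hx, -⟩
  · rw [if_pos hx] at h; rcases hL.rg_eq v hv with h' | h'
    · omega
    · exact hL.lf_ne v hv (by rwa [show up v = x by omega])
  · rw [hx, if_neg (by simp)] at h; refine hL.lf_rg v hv x ?_; rw [hx, ← h]; rfl

lemma Links.next_inj (hL : Links n up lf rg) {x y : ℕ} (hx : HasNext n x) (hy : HasNext n y)
    (h : nextOf n lf rg x = nextOf n lf rg y) : x = y := by
  unfold nextOf at h; unfold HasNext at hx hy; split_ifs at h with h1 h2 h2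
  · exact hL.left_inj h
  · exact absurd h (hL.left_ne (by omega))
  · exact absurd h.symm (hL.left_ne (by omega))
  · have := hL.rg_inj _ (by omega) _ (by omega) h; omega

lemma Links.next_ne (hL : Links n up lf rg) {x : ℕ} (hx : HasNext n x) :
    nextOf n lf rg x ≠ leftOf n lf n := by
  intro h; unfold nextOf at h; unfold HasNext at hx; split_ifs at h with h1
  · have := hL.left_inj h; omega
  · exact hL.left_ne (by omega) h.symm

lemma Links.next_lt (hL : Links n up lf rg) (hup : ∀ v < n, up v ≤ n) {x : ℕ}
    (hx : HasNext n x) : nextOf n lf rg x < 2 * n + 2 := by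
  unfold nextOf; unfold HasNext at hx; split_ifs with h
  · exact hL.left_lt h.le
  · exact hL.rg_lt hup (by omega)

lemma Links.parent_left (hL : Links n up lf rg) {x : ℕ} (hx : x < n) :
    parentOf n lf rg (leftOf n lf x) = [1, x, 0] := by
  have h : ∃ y, y < n ∧ leftOf n lf y = leftOf n lf x := ⟨x, hx, rfl⟩
  rw [parentOf, dif_pos h, hL.left_inj h.choose_spec.2]

lemma Links.parent_rg (hL : Links n up lf rg) {x : ℕ} (hx : x < n) :
    parentOf n lf rg (rg x) = [1, x, 1] := by
  have h : ∃ y, y < n ∧ rg y = rg x := ⟨x, hx, rfl⟩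
  rw [parentOf, dif_neg fun ⟨y, hy, h'⟩ => hL.left_ne hx h', dif_pos h,
    hL.rg_inj _ h.choose_spec.1 _ hx h.choose_spec.2]

lemma Links.parent_root (hL : Links n up lf rg) : parentOf n lf rg (leftOf n lf n) = [0] := by
  rw [parentOf, dif_neg fun ⟨y, hy, h'⟩ => by have := hL.left_inj h'; omega,
    dif_neg fun ⟨y, hy, h'⟩ => hL.left_ne hy h'.symm, if_pos rfl]

lemma Links.parent_eq {y : ℕ} : (∃ x < n, leftOf n lf x = y ∧ parentOf n lf rg y = [1, x, 0]) ∨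
    (∃ x < n, rg x = y ∧ parentOf n lf rg y = [1, x, 1]) ∨
    (leftOf n lf n = y ∧ parentOf n lf rg y = [0]) ∨ parentOf n lf rg y = [] := by
  unfold parentOf; split_ifs with h1 h2 h3
  · exact .inl ⟨_, h1.choose_spec.1, h1.choose_spec.2, rfl⟩
  · exact .inr (.inl ⟨_, h2.choose_spec.1, h2.choose_spec.2, rfl⟩)
  · exact inr2 (.inl ⟨h3, rfl⟩)
  · exact inr2 (.inr rfl)

lemma Links.prev_next (hL : Links n up lf rg) {x : ℕ} (hx : HasNext n x) :
    prevOf n lf rg (nextOf n lf rg x) = [x] := by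
  have h : ∃ y, HasNext n y ∧ nextOf n lf rg y = nextOf n lf rg x := ⟨x, hx, rfl⟩
  rw [prevOf, dif_pos h, hL.next_inj h.choose_spec.1 hx h.choose_spec.2]

lemma prevOf_eq {y : ℕ} : prevOf n lf rg y = [] ∨
    ∃ x, HasNext n x ∧ nextOf n lf rg x = y ∧ prevOf n lf rg y = [x] := by
  unfold prevOf; split_ifs with h
  · exact .inr ⟨_, h.choose_spec.1, h.choose_spec.2, rfl⟩
  · exact .inl rfl

local notation:max "envT" x:max => Env.withR (nodeEnv n pw N (link2Γ n lf rg dat) x) []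

lemma vstep_link3 (hL : Links n up lf rg) (hup : ∀ v < n, up v ≤ n) (hroot : lf n ≠ [])
    (hlam : 0 < lam) (hN : 2 * n + 2 ≤ N) :
    VStep W lam n pw N link3 (link2Γ n lf rg dat) (link3Γ n lf rg dat) (fun _ => []) := by
  have ereal : ∀ x, NodeProg.isReal.eval (envT x) ≠ 0 ↔ x < n := fun x => eval_lt _ _ _
  have eleaf : ∀ x, NodeProg.hasLeaf.eval (envT x) ≠ 0 ↔ x < n + 1 := fun x => eval_lt _ _ _
  have eL : ∀ x, NodeProg.leafE.eval (envT x) = n + 1 + x := fun x => rfl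
  have el : ∀ x, NodeProg.leftE.eval (envT x) = leftOf n lf x := fun x => by
    have h1 : NodeProg.leftE.eval (envT x) =
      (lf x).getD 0 0 + (if (lf x).length = 0 then 1 else 0) * (n + 1 + x) := rfl; rw [h1, leftOf]
    by_cases h : lf x = []
    · simp [h]
    · simp [h, hd]
  have e6 : ∀ x < n, (NE.get 6 0).eval (envT x) = rg x := fun x hx => by simp [NE.eval, link2Γ, hx]
  have e5 : (NE.get 5 0).eval (envT n) = leftOf n lf n := (if_neg hroot).symm
  have en : ∀ x, NE.n.eval (envT x) = n := fun _ => rfl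
  have ex : ∀ x, NE.x.eval (envT x) = x := fun _ => rfl
  have nx1 : ∀ x < n, nextOf n lf rg x = leftOf n lf x := fun x hx => if_pos hx
  have nx2 : ∀ x < n, nextOf n lf rg (n + 1 + x) = rg x := fun x hx => by
    rw [nextOf, if_neg (by omega), Nat.add_sub_cancel_left]
  refine VStep.of ?_ ?_ ?_ <;> simp only [link3, rule_simps, ereal, eleaf, eval_eq, en, ex, el, eL]
  · refine ⟨fun x hN hx => ⟨hN, ?_⟩, fun x _ hx => ⟨by omega, ?_⟩, fun x hN hx => ⟨hN, ?_⟩,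
      fun x _ hx => ⟨by have := hL.left_lt hx.le; omega, ?_⟩,
      fun x _ hx => ⟨by rw [e6 x hx]; have := hL.rg_lt hup hx; omega, ?_⟩,
      fun x _ hx => ⟨by rw [hx, e5]; have := hL.left_lt (le_refl n); omega, ?_⟩,
      fun x hN hx => ⟨hN, ?_⟩,
      fun x _ hx => ⟨by have := hL.left_lt hx.le; omega, ?_⟩, fun x _ hx => ⟨by omega, ?_⟩,
      fun x _ hx => ⟨by rw [e6 x hx]; have := hL.rg_lt hup hx; omega, ?_⟩,
      fun x _ hx => ⟨by omega, ?_⟩⟩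
    · simp [link3Γ, hx, initPart, Part.encode, Part.encodeData, segs, Seg.val, NE.eval, link2Γ]
    · show (if _ then _ else _) = _
      rw [if_pos (.inr ⟨by omega, by omega⟩), initPart, if_neg (by omega)]; rfl
    · simp [link3Γ, hx, segs, Seg.val, el, e6]
    · simp only [link3Γ, hL.parent_left hx]; rfl
    · simp only [link3Γ, e6 x hx, hL.parent_rg hx]; rfl
    · subst hx; simp only [link3Γ, e5, hL.parent_root]; rfl
    · simp only [link3Γ, if_pos (show HasNext n x from .inl hx), nx1 x hx]; simp [segs, Seg.val, el]
    · simp only [link3Γ, ← nx1 x hx, hL.prev_next (.inl hx)]; rfl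
    · simp only [link3Γ, if_pos (show HasNext n (n + 1 + x) from .inr ⟨by omega, by omega⟩), nx2 x hx]
      simp [segs, Seg.val, e6 x hx]
    · simp only [link3Γ, e6 x hx]; rw [← nx2 x hx, hL.prev_next (.inr ⟨by omega, by omega⟩)]; rfl
    · show (if _ then _ else _) = _; rw [if_pos ⟨by omega, by omega⟩]; rfl
  · refine ⟨fun x _ y _ _ _ h => by omega,
      fun x _ y _ _ _ h => hL.left_inj h, fun x _ y _ hx hy h => ?_,
      fun x _ y _ hx hy _ => by omega,
      fun x _ y _ _ _ h => hL.left_inj h, fun x _ y _ _ _ h => by omega,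
      fun x _ y _ hx hy h => ?_, fun x _ y _ _ _ h => by omega⟩
    · rw [e6 x hx, e6 y hy] at h; exact hL.rg_inj _ hx _ hy h
    · rw [e6 x hx, e6 y hy] at h; exact hL.rg_inj _ hx _ hy h
  · intro y hy f h0 hf; unfold link3Γ at hf; split at hf
    · exact absurd rfl h0
    · split_ifs at hf with h
      · rcases h with h | h
        · exact .inl ⟨rfl, y, hy, h, rfl⟩
        · exact .inr (.inl ⟨rfl, y - (n + 1), by omega, by omega, by omega⟩)
      · exact absurd rfl hf
    · split_ifs at hf with h
      · exact inr2 (.inl ⟨rfl, y, hy, h, rfl⟩)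
      · exact absurd rfl hf
    · rcases Links.parent_eq (n := n) (lf := lf) (rg := rg) (y := y) with
        ⟨x, hx, h, -⟩ | ⟨x, hx, h, -⟩ | ⟨h, -⟩ | h
      · exact inr3 (.inl ⟨rfl, x, by omega, hx, h⟩)
      · exact inr2 (inr2 (.inl ⟨rfl, x, by omega, hx, by rw [e6 x hx, h]⟩))
      · exact inr5 (.inl ⟨rfl, n, by omega, rfl, by rw [e5, h]⟩)
      · exact absurd h hf
    · split_ifs at hf with h
      · rcases h with h | h
        · exact inr5 (.inr (.inl ⟨rfl, y, hy, h, rfl⟩))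
        · exact inr5 (inr3 (.inl ⟨rfl, y - (n + 1), by omega, by omega, by omega⟩))
      · exact absurd rfl hf
    · rcases prevOf_eq (n := n) (lf := lf) (rg := rg) (y := y) with h | ⟨x, hx, h, -⟩
      · exact absurd h hf
      · rcases hx with hx | hx
        · rw [nx1 x hx] at h; exact inr5 (inr2 (.inl ⟨rfl, x, by omega, hx, h⟩))
        · obtain ⟨z, rfl⟩ := Nat.exists_eq_add_of_le (show n + 1 ≤ x by omega)
          rw [nx2 z (by omega)] at h
          exact inr5 (inr2 (inr2 (.inl ⟨rfl, z, by omega, by omega, by rw [e6 z (by omega), h]⟩)))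
    · split_ifs at hf with h
      · exact inr5 (inr2 (inr2 (.inr ⟨rfl, y - (n + 1), by omega, by omega, by omega⟩)))
      · exact absurd rfl hf
    · exact absurd rfl hf

end

/-! ### The tree -/

/-- `t` is a list of siblings with their descendants; `p` is the parent. -/
inductive LC (n : ℕ) (up : ℕ → ℕ) (lf : ℕ → List ℕ) (rg : ℕ → ℕ) : ℕ → CT → Prop
  | leaf (p : ℕ) : LC n up lf rg p (.leaf (n + 1 + p))
  | node {v : ℕ} {ch : Bool → CT} : v < n → LC n up lf rg v (ch false) →
      (ch false).id = leftOf n lf v → LC n up lf rg (up v) (ch true) → (ch true).id = rg v →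
      LC n up lf rg (up v) (.node v ch)

section
variable {n : ℕ} {up : ℕ → ℕ} {lf : ℕ → List ℕ} {rg : ℕ → ℕ} {p : ℕ} {t : CT}

lemma Links.exists_tree (hL : Links n up lf rg) {dep : ℕ → ℕ} {M : ℕ}
    (hdep : ∀ v < n, dep v = dep (up v) + 1) (hM : ∀ v < n, dep v ≤ M) (p : ℕ) :
    ∃ t, LC n up lf rg p t ∧ t.id = leftOf n lf p := by
  obtain ⟨e, he⟩ := hL.rank; generalize hk : M - dep p = k
  induction k using Nat.strong_induction_on generalizing p with
  | _ k ih =>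
    have sib : ∀ i v, v < n → up v = p → n - e v = i → ∃ t, LC n up lf rg p t ∧ t.id = v := by
      intro i
      induction i using Nat.strong_induction_on with
      | _ i ihi =>
        rintro v hv rfl hi; have h1 := hdep v hv; have h2 := hM v hv
        obtain ⟨a, ha, hai⟩ := ih (M - dep v) (by omega) v rfl
        have hb : ∃ b, LC n up lf rg (up v) b ∧ b.id = rg v := by
          rcases hL.rg_eq v hv with ⟨h, h'⟩ | h
          · have := he v hv; have := he _ h; exact ihi (n - e (rg v)) (by omega) _ h h' rfl
          · exact ⟨_, .leaf _, h.symm⟩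
        obtain ⟨b, hb, hbi⟩ := hb; exact ⟨.node v fun s => cond s b a, .node hv ha hai hb hbi, rfl⟩
    rcases hL.lf_eq p with h | ⟨v, hv, h, h'⟩
    · exact ⟨_, .leaf p, (if_pos h).symm⟩
    · rw [leftOf, h, if_neg (by simp)]; exact sib _ v hv h' rfl

lemma LC.lt (h : LC n up lf rg p t) (hup : ∀ v < n, up v ≤ n) (hp : p ≤ n) :
    ∀ y ∈ t.ids, y < n ∨ (n < y ∧ y < 2 * n + 2) := by
  induction h with
  | leaf p =>
    intro y hy; obtain rfl : y = n + 1 + p := by simpa [CT.ids] using hy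
    omega
  | @node v ch hv _ _ _ _ ih1 ih2 =>
    intro y hy; rcases CT.mem_ids_node.mp hy with rfl | ⟨b, hb⟩
    · exact .inl hv
    · cases b
      · exact ih1 hv.le y hb
      · exact ih2 (hup v hv) y hb

lemma LC.last_mem (h : LC n up lf rg p t) : n + 1 + p ∈ t.ids := by
  induction h with
  | leaf p => exact CT.id_mem (.leaf _)
  | node _ _ _ _ _ _ ih => exact CT.mem_ids_node.mpr (.inr ⟨true, ih⟩)

lemma LC.children (h : LC n up lf rg p t) : ∀ v ∈ t.ids, v < n →
    leftOf n lf v ∈ t.ids ∧ rg v ∈ t.ids ∧ n + 1 + v ∈ t.ids := by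
  induction h with
  | leaf p =>
    intro v hv hn; obtain rfl : v = n + 1 + p := by simpa [CT.ids] using hv
    omega
  | @node v ch hv h1 e1 h2 e2 ih1 ih2 =>
    intro w hw hn; have mem : ∀ b y, y ∈ (ch b).ids → y ∈ (CT.node v ch).ids := fun b y hy =>
      CT.mem_ids_node.mpr (.inr ⟨b, hy⟩); rcases CT.mem_ids_node.mp hw with rfl | ⟨b, hb⟩
    · exact ⟨mem false _ (e1 ▸ CT.id_mem _), mem true _ (e2 ▸ CT.id_mem _), mem false _ h1.last_mem⟩
    · cases b
      · obtain ⟨a, b, c⟩ := ih1 w hb hn; exact ⟨mem _ _ a, mem _ _ b, mem _ _ c⟩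
      · obtain ⟨a, b, c⟩ := ih2 w hb hn; exact ⟨mem _ _ a, mem _ _ b, mem _ _ c⟩

lemma LC.isChain (h : LC n up lf rg p t) (hup : ∀ v < n, up v ≤ n) (hp : p ≤ n) :
    t.ids.IsChain (fun a b => HasNext n a ∧ nextOf n lf rg a = b) ∧
    t.ids.head? = some t.id ∧ t.ids.getLast? = some (n + 1 + p) := by
  induction h with
  | leaf p => exact ⟨.singleton _, rfl, rfl⟩
  | @node v ch hv h1 e1 h2 e2 ih1 ih2 =>
    obtain ⟨a1, a2, a3⟩ := ih1 hv.le; obtain ⟨b1, b2, b3⟩ := ih2 (hup v hv); refine ⟨?_, rfl, ?_⟩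
    · rw [CT.ids, List.isChain_cons, List.isChain_append]
      refine ⟨fun y hy => ?_, a1, b1, fun x hx y hy => ?_⟩
      · rw [List.head?_append, a2] at hy; obtain rfl : (ch false).id = y := by simpa using hy
        exact ⟨.inl hv, by rw [nextOf, if_pos hv, e1]⟩
      · rw [a3] at hx; rw [b2] at hy; obtain rfl : n + 1 + v = x := by simpa using hx
        obtain rfl : (ch true).id = y := by simpa using hy
        exact ⟨.inr ⟨by omega, by omega⟩, by
          rw [nextOf, if_neg (by omega), Nat.add_sub_cancel_left, e2]⟩
    · rw [CT.ids, List.getLast?_cons, List.getLast?_append, b3]; rfl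

lemma nodup_of_isChain {q : ℕ → Prop} {g : ℕ → ℕ} (hg : ∀ x y, q x → q y → g x = g y → x = y)
    {l : List ℕ} {a : ℕ} (h : l.IsChain fun x y => q x ∧ g x = y) (ha : l.head? = some a)
    (hne : ∀ x, q x → g x ≠ a) : l.Nodup := by
  rw [List.isChain_iff_getElem] at h; have h0 : ∀ h' : 0 < l.length, l[0] = a := fun h' => by
    rw [List.head?_eq_getElem?, List.getElem?_eq_getElem h'] at ha; simpa using ha
  have key : ∀ i j (hij : i < j) (hj : j < l.length), l[i] ≠ l[j] := by
    intro i
    induction i with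
    | zero =>
      intro j hij hj he; obtain ⟨j, rfl⟩ := Nat.exists_eq_succ_of_ne_zero hij.ne'
      obtain ⟨h1, h2⟩ := h j hj; exact hne _ h1 (h2.trans (he.symm.trans (h0 (by omega))))
    | succ i ih =>
      intro j hij hj he; obtain ⟨j, rfl⟩ := Nat.exists_eq_succ_of_ne_zero (show j ≠ 0 by omega)
      obtain ⟨h1, h2⟩ := h j hj; obtain ⟨h3, h4⟩ := h i (by omega)
      exact ih j (by omega) (by omega) (hg _ _ h3 h1 (h4.trans (he.trans h2.symm)))
  rw [List.nodup_iff_injective_getElem]; intro i j hij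
  rcases lt_trichotomy i.1 j.1 with h' | h' | h'
  · exact absurd hij (key _ _ h' j.2)
  · exact Fin.ext h'
  · exact absurd hij.symm (key _ _ h' i.2)

lemma Links.mem_ids (hL : Links n up lf rg) {dep : ℕ → ℕ} (hdep : ∀ v < n, dep v = dep (up v) + 1)
    (hup : ∀ v < n, up v ≤ n) (h : LC n up lf rg n t) (hi : t.id = leftOf n lf n) :
    ∀ v < n, v ∈ t.ids := by
  have hleft : ∀ p v, lf p = [v] → leftOf n lf p = v := fun p v h => by
    rw [leftOf, h, if_neg (by simp)]; rfl
  intro v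
  induction hd : dep v using Nat.strong_induction_on generalizing v with
  | _ d ih =>
    intro hv
    refine hL.reach (· ∈ t.ids) (up v) (fun w hw => ?_) (fun w hw _ hm _ => (h.children w hm hw).2.1)
      v hv rfl; rw [← hleft _ _ hw]; rcases (hup v hv).lt_or_eq with hlt | heq
    · have := hdep v hv; exact (h.children _ (ih _ (by omega) _ rfl hlt) hlt).1
    · rw [heq, ← hi]; exact CT.id_mem t

end

/-! ## Ranks -/

def rankVal (Γ : Fields) (y : ℕ) : ℕ := hd (Γ y 11) + hd (Γ y 12)

def rankΓ (Γ : Fields) (y f : ℕ) : List ℕ :=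
  match f with
  | 0 => [0]
  | 1 => Γ y 1
  | 7 => Γ y 7
  | 8 => Γ y 8
  | 9 => if Γ y 9 = [] then [] else Γ (hd (Γ y 9)) 9
  | 10 => if Γ y 10 = [] then [] else Γ (hd (Γ y 10)) 10
  | 11 => if Γ y 8 = [] then [] else [rankVal Γ y]
  | 12 => if Γ y 9 = [] then [] else [rankVal Γ (hd (Γ y 9))]
  | _ => []

def buildΓ (R : ℕ → List ℕ) (Γ : Fields) (y f : ℕ) : List ℕ :=
  match f with
  | 0 => [0]
  | 7 => Γ y 7
  | 8 => Γ y 8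
  | 13 => if Γ y 8 ≠ [] ∧ Γ y 7 = [] then [rankVal Γ y] else []
  | 14 => R y
  | _ => []

/-- In the list `w`, every node knows the nodes at distance `2 ^ k`, and twice the number of the
elements that satisfy `q` among the next `2 ^ k` ones. -/
structure RankInv (q : ℕ → Bool) (w : List ℕ) (k : ℕ) (Γ : Fields) : Prop where
  next : ∀ i y, w[i]? = some y → Γ y 9 = (w[i + 2 ^ k]?).toList
  prev : ∀ i y, w[i]? = some y → Γ y 10 = if 2 ^ k ≤ i then (w[i - 2 ^ k]?).toList else []
  val : ∀ i y, w[i]? = some y → rankVal Γ y = 2 * ((w.drop i).take (2 ^ k)).countP q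
  out : ∀ y, y ∉ w → Γ y 9 = [] ∧ Γ y 10 = []
  mem : ∀ y, Γ y 8 ≠ [] ↔ y ∈ w

section
variable {W lam n pw N b k : ℕ} {q : ℕ → Bool} {w : List ℕ} {Γ : Fields}

lemma RankInv.next_eq (h : RankInv q w k Γ) (y : ℕ) : Γ y 9 = [] ∨
    ∃ i z, w[i]? = some y ∧ w[i + 2 ^ k]? = some z ∧ Γ y 9 = [z] ∧ Γ z 10 = [y] := by
  by_cases hy : y ∈ w
  · obtain ⟨i, hi⟩ := List.mem_iff_getElem?.mp hy; have h1 := h.next i y hi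
    cases hz : w[i + 2 ^ k]? with
    | none => left; rw [h1, hz]; rfl
    | some z =>
      refine .inr ⟨i, z, hi, hz, by rw [h1, hz]; rfl, ?_⟩
      rw [h.prev _ _ hz, if_pos (by omega), Nat.add_sub_cancel, hi]; rfl
  · exact .inl (h.out y hy).1

lemma RankInv.prev_eq (h : RankInv q w k Γ) (y : ℕ) : Γ y 10 = [] ∨
    ∃ i z, w[i + 2 ^ k]? = some y ∧ w[i]? = some z ∧ Γ y 10 = [z] ∧ Γ z 9 = [y] := by
  by_cases hy : y ∈ w
  · obtain ⟨i, hi⟩ := List.mem_iff_getElem?.mp hy; have h1 := h.prev i y hi; split_ifs at h1 with hk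
    · obtain ⟨j, rfl⟩ := Nat.exists_eq_add_of_le' hk; rw [Nat.add_sub_cancel] at h1
      cases hz : w[j]? with
      | none => left; rw [h1, hz]; rfl
      | some z => refine .inr ⟨j, z, hi, hz, by rw [h1, hz]; rfl, ?_⟩; rw [h.next _ _ hz, hi]; rfl
    · exact .inl h1
  · exact .inl (h.out y hy).2

lemma RankInv.rankVal_le (h : RankInv q w k Γ) {y : ℕ} (hy : y ∈ w) :
    rankVal Γ y ≤ 2 * w.length := by
  obtain ⟨i, hi⟩ := List.mem_iff_getElem?.mp hy; rw [h.val i y hi]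
  refine Nat.mul_le_mul_left _ (List.countP_le_length.trans ?_); simp

lemma vstep_rank (hlam : 0 < lam) (hw : ∀ y ∈ w, y < N) (h : RankInv q w k Γ) :
    VStep W lam n pw N rank Γ (rankΓ Γ) (fun _ => []) := by
  have ef : ∀ x f, f ≠ 22 → ((nodeEnv n pw N Γ x).withR []).fld f = Γ x f := fun x f hf => if_neg hf
  have hS : ∀ x, Γ x 9 ≠ [] → x < N ∧ hd (Γ x 9) < N ∧ Γ (hd (Γ x 9)) 10 = [x] := fun x hx => by
    rcases h.next_eq x with h' | ⟨i, z, h1, h2, h3, h4⟩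
    · exact absurd h' hx
    · rw [h3]; exact ⟨hw _ (mem_of_getElem? h1), hw _ (mem_of_getElem? h2), h4⟩
  have hP : ∀ x, Γ x 10 ≠ [] → x < N ∧ hd (Γ x 10) < N ∧ Γ (hd (Γ x 10)) 9 = [x] := fun x hx => by
    rcases h.prev_eq x with h' | ⟨i, z, h1, h2, h3, h4⟩
    · exact absurd h' hx
    · rw [h3]; exact ⟨hw _ (mem_of_getElem? h1), hw _ (mem_of_getElem? h2), h4⟩
  have er : ∀ x, NodeProg.rankE.eval ((nodeEnv n pw N Γ x).withR []) = rankVal Γ x := fun x => rfl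
  have g9 : ∀ x, (NE.get 9 0).eval ((nodeEnv n pw N Γ x).withR []) = hd (Γ x 9) := fun x => rfl
  have g10 : ∀ x, (NE.get 10 0).eval ((nodeEnv n pw N Γ x).withR []) = hd (Γ x 10) := fun x => rfl
  have ex : ∀ x, NE.x.eval ((nodeEnv n pw N Γ x).withR []) = x := fun _ => rfl
  have hone : ∀ x : ℕ, hd [x] = x := fun _ => rfl; refine VStep.of ?_ ?_ ?_ <;>
    simp only [rank, rule_simps, g9, g10, ex, ef _ 8 (by decide), ef _ 9 (by decide),
        ef _ 10 (by decide)]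
  · refine ⟨fun x hx _ => ⟨hx, ?_⟩, fun x hx _ => ⟨hx, ?_⟩, fun x hx _ => ⟨hx, ?_⟩,
      fun x hx h8 => ⟨hx, ?_⟩, fun x hx h10 => ⟨(hP x h10).2.1, ?_⟩,
      fun x hx h10 => ⟨(hP x h10).2.1, ?_⟩, fun x hx h9 => ⟨(hS x h9).2.1, ?_⟩⟩
    · simp [segs, Seg.val, rankΓ]
    · simp [segs, Seg.val, rankΓ]
    · simp [segs, Seg.val, rankΓ]
    · simp [segs, Seg.val, rankΓ, h8, er]
    · show (if _ then _ else _) = _; rw [(hP x h10).2.2, if_neg (by simp), hone]; rfl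
    · show (if _ then _ else _) = _; rw [(hP x h10).2.2, if_neg (by simp), hone]
      simp [segs, Seg.val]
    · show (if _ then _ else _) = _; rw [(hS x h9).2.2, if_neg (by simp), hone]
      simp [segs, Seg.val]
  · have kP : ∀ x < N, ∀ y < N, Γ x 10 ≠ [] → Γ y 10 ≠ [] → hd (Γ x 10) = hd (Γ y 10) → x = y := by
      intro x _ y _ hx hy he; have h1 := (hP x hx).2.2; rw [he, (hP y hy).2.2] at h1
      simpa using h1.symm
    refine ⟨kP, kP, fun x _ y _ hx hy he => ?_⟩
    have h1 := (hS x hx).2.2; rw [he, (hS y hy).2.2] at h1; simpa using h1.symm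
  · intro y hy f h0 hf; unfold rankΓ at hf
    split at hf <;> (try split_ifs at hf with hh) <;> (try exact absurd rfl hf)
    all_goals first | exact absurd rfl h0 | skip
    · exact .inl ⟨rfl, y, hy, rfl⟩
    · exact .inr (.inl ⟨rfl, y, hy, rfl⟩)
    · exact inr2 (.inl ⟨rfl, y, hy, rfl⟩)
    · obtain ⟨h1, h2, h3⟩ := hS y hh
      exact inr5 (.inl ⟨rfl, _, h2, by rw [h3]; simp, by rw [h3]; rfl⟩)
    · obtain ⟨h1, h2, h3⟩ := hP y hh
      exact inr5 (.inr ⟨rfl, _, h2, by rw [h3]; simp, by rw [h3]; rfl⟩)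
    · exact inr3 (.inl ⟨rfl, y, hy, hh, rfl⟩)
    · obtain ⟨h1, h2, h3⟩ := hS y hh
      exact inr2 (inr2 (.inl ⟨rfl, _, h2, by rw [h3]; simp, by rw [h3]; rfl⟩))

lemma RankInv.rank (h : RankInv q w k Γ) : RankInv q w (k + 1) (rankΓ Γ) where
  next i y hi := by
    have h2k := Nat.two_pow_pos k; show (if _ then _ else _) = _
    rw [h.next i y hi, pow_succ, mul_two, ← add_assoc]
    cases hz : w[i + 2 ^ k]? with
    | none =>
      rw [List.getElem?_eq_none (by have := List.getElem?_eq_none_iff.mp hz; omega)]; rfl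
    | some z => rw [if_neg (by simp)]; exact h.next _ _ hz
  prev i y hi := by
    show (if _ then _ else _) = _; rw [h.prev i y hi, pow_succ, mul_two]; by_cases hk : 2 ^ k ≤ i
    · obtain ⟨j, rfl⟩ := Nat.exists_eq_add_of_le' hk; have hj : ∃ z, w[j]? = some z := by
        have h2k := Nat.two_pow_pos k; have := (List.getElem?_eq_some_iff.mp hi).1
        exact ⟨_, List.getElem?_eq_getElem (by omega)⟩
      obtain ⟨z, hz⟩ := hj; rw [if_pos hk, Nat.add_sub_cancel, hz, if_neg (by simp)]
      refine (h.prev j z hz).trans ?_; rw [Nat.add_sub_add_right]; split_ifs <;> first | rfl | omega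
    · rw [if_neg hk, if_pos rfl, if_neg (by omega)]
  val i y hi := by
    have h8 : Γ y 8 ≠ [] := (h.mem y).mpr (mem_of_getElem? hi)
    have h11 : rankΓ Γ y 11 = [rankVal Γ y] := if_neg h8
    have h12 : rankΓ Γ y 12 = if Γ y 9 = [] then [] else [rankVal Γ (hd (Γ y 9))] := rfl
    have e : hd (rankΓ Γ y 12) = 2 * ((w.drop (i + 2 ^ k)).take (2 ^ k)).countP q := by
      rw [h12, h.next i y hi]
      cases hz : w[i + 2 ^ k]? with
      | none => rw [List.drop_eq_nil_of_le (List.getElem?_eq_none_iff.mp hz)]; simp [hd]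
      | some z => rw [if_neg (by simp)]; exact h.val _ _ hz
    rw [rankVal, h11, e, show hd [rankVal Γ y] = rankVal Γ y from rfl, h.val i y hi, pow_succ, mul_two,
      List.take_add, countP_append, List.drop_drop]; ring
  out y hy := by obtain ⟨h1, h2⟩ := h.out y hy; exact ⟨if_pos h1, if_pos h2⟩
  mem := h.mem

lemma GOK.rank (hG : GOK b lam Γ) (h : RankInv q w k Γ) (hlam : 2 < lam)
    (hb : 2 * w.length ≤ b) : GOK b lam (rankΓ Γ) := by
  refine .of (fun x f => ?_) (fun x f hf v hv => ?_) fun x => rfl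
  · unfold rankΓ; split <;> (try split_ifs) <;> first | exact hG.len _ _ | (simp; omega)
  · unfold rankΓ at hv; split at hv <;> (try split_ifs at hv with hh) <;> first
      | exact hG.ptr _ _ hf v hv
      | exact hG.ptr _ _ rfl v hv
      | (simp at hv; done)
      | (simp at hv; omega)
      | skip
    · rw [mem_singleton] at hv; rw [hv]; exact (h.rankVal_le ((h.mem x).mp hh)).trans hb
    · rw [mem_singleton] at hv; rcases h.next_eq x with h' | ⟨i, z, h1, h2, h3, h4⟩
      · exact absurd h' hh
      · rw [hv, h3]; exact (h.rankVal_le (mem_of_getElem? h2)).trans hb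

lemma vstep_build {pC : Prog} {R : ℕ → List ℕ}
    (hcall : ∀ x < N, Γ x 8 ≠ [] → pC.Computes W [Γ x 1] (R x) lam)
    (hR0 : ∀ x, Γ x 8 = [] → R x = []) (hR : ∀ x, (R x).length < lam) :
    VStep W lam n pw N (build pC) Γ (buildΓ R Γ) R := by
  have ef : ∀ x f, f ≠ 22 → ((nodeEnv n pw N Γ x).withR (R x)).fld f = Γ x f :=
    fun x f hf => if_neg hf
  have ex : ∀ x, NE.x.eval ((nodeEnv n pw N Γ x).withR (R x)) = x := fun _ => rfl
  refine VStep.of ?_ ?_ ?_ (fun x hx => ⟨fun hf => ?_, fun hf => hR0 x ?_⟩) fun x _ => hR x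
  rotate_left 3
  · simp only [build, rule_simps] at hf; simpa [segs, Seg.val, build] using hcall x hx hf
  · simp only [build, rule_simps] at hf; simpa using hf
  all_goals simp only [build, rule_simps, eval_len_zero, ex, ef _ 8 (by decide), ef _ 7 (by decide)]
  · refine ⟨fun x hx _ => ⟨hx, ?_⟩, fun x hx _ => ⟨hx, ?_⟩, fun x hx _ => ⟨hx, ?_⟩,
      fun x hx h8 => ⟨hx, ?_⟩⟩
    · simp [segs, Seg.val, buildΓ]
    · simp [segs, Seg.val, buildΓ]
    · simp [segs, Seg.val, buildΓ]
    · show (if _ then _ else _) = _; rw [if_pos h8]; rfl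
  · intro y hy f h0 hf; unfold buildΓ at hf; split at hf
    · exact absurd rfl h0
    · exact .inl ⟨rfl, y, hy, rfl⟩
    · exact .inr (.inl ⟨rfl, y, hy, rfl⟩)
    · split_ifs at hf with hh
      · exact inr2 (.inr ⟨rfl, y, hy, hh, rfl⟩)
      · exact absurd rfl hf
    · exact inr2 (.inl ⟨rfl, y, hy, fun h => hf (hR0 y h), rfl⟩)
    · exact absurd rfl hf

lemma GOK.build {R : ℕ → List ℕ} (hG : GOK b lam Γ) (h : RankInv q w k Γ) (hlam : 2 < lam)
    (hb : 2 * w.length ≤ b) (hR : ∀ x, (R x).length < lam) : GOK b lam (buildΓ R Γ) := by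
  refine .of (fun x f => ?_) (fun x f hf v hv => ?_) fun x => rfl
  · unfold buildΓ
    split <;> (try split_ifs) <;> first | exact hG.len _ _ | exact hR _ | (simp; omega)
  · unfold buildΓ at hv; split at hv <;> (try split_ifs at hv with hh) <;> first
      | exact hG.ptr _ _ hf v hv
      | (simp at hv; done)
      | (simp at hv; omega)
      | (simp [isPtr] at hf; done)
      | skip
    rw [mem_singleton] at hv; rw [hv]; exact (h.rankVal_le ((h.mem x).mp hh.1)).trans hb

lemma map_filter_suffix {val : ℕ → ℕ} (hw : w.Nodup)
    (h : ∀ i y, w[i]? = some y → val y = 2 * (w.drop i).countP q) :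
    (w.filter q).map val = (desc (w.countP q)).map (2 * ·) := by
  induction w with
  | nil => rfl
  | cons x l ih =>
    have hx := h 0 x rfl; have hl := ih hw.of_cons fun i y hi => h (i + 1) y hi
    rw [List.drop_zero] at hx; rw [List.filter_cons, List.countP_cons] at *
    split_ifs at hx ⊢ with hq
    · rw [map_cons, hl, hx]; rfl
    · exact hl

end

/-! ## The binary extension -/

lemma BTree.IsSubtree.trans {s t u : BTree} (h : s.IsSubtree t) (h' : t.IsSubtree u) :
    s.IsSubtree u := by
  induction h' with
  | refl => exact h
  | left d r _ ih => exact .left d r ih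
  | right d l _ ih => exact .right d l ih

lemma BTree.IsSubtree.size_le {s t : BTree} (h : s.IsSubtree t) : s.size ≤ t.size := by
  induction h with
  | refl => exact le_rfl
  | left d r _ ih => rw [BTree.size]; omega
  | right d l _ ih => rw [BTree.size]; omega

lemma Part.Fills.size_le {X : Part} {hs : List BTree} {S : BTree} (h : X.Fills hs S) :
    X.size ≤ S.size := by
  induction h with
  | nil => exact le_rfl
  | hole => simp [Part.size, BTree.size]
  | node _ _ _ ih1 ih2 => simp only [Part.size, BTree.size]; omega

namespace CT

def toB (dat : ℕ → List ℕ) : CT → BTree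
  | leaf _ => .node none .nil .nil
  | node v ch => .node none (.node (some (dat v)) ((ch false).toB dat) .nil) ((ch true).toB dat)

def addr : CT → ℕ → List Bool
  | leaf _, _ => []
  | node v ch, y => if y = v then [false] else
      if y ∈ (ch false).ids then false :: false :: (ch false).addr y else true :: (ch true).addr y

lemma size_toB {dat : ℕ → List ℕ} (t : CT) : (t.toB dat).size ≤ 2 * t.ids.length := by
  induction t with
  | leaf i => simp [toB, BTree.size, ids]
  | node i ch ih =>
    have h0 := ih false; have h1 := ih true
    simp only [toB, BTree.size, ids, length_cons, length_append]; omega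

lemma nodup_node {v : ℕ} {ch : Bool → CT} (h : (node v ch).ids.Nodup) :
    (∀ b, v ∉ (ch b).ids ∧ (ch b).ids.Nodup) ∧ ∀ y ∈ (ch false).ids, y ∉ (ch true).ids := by
  rw [ids, List.nodup_cons, List.nodup_append, mem_append] at h; obtain ⟨h1, h2, h3, h4⟩ := h
  refine ⟨fun b => ?_, fun y hy hy' => h4 y hy y hy' rfl⟩
  cases b
  · exact ⟨fun h => h1 (.inl h), h2⟩
  · exact ⟨fun h => h1 (.inr h), h3⟩

lemma addr_false {v : ℕ} {ch : Bool → CT} (h : (node v ch).ids.Nodup) {y : ℕ}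
    (hy : y ∈ (ch false).ids) : (node v ch).addr y = false :: false :: (ch false).addr y := by
  have h' : y ≠ v := fun e => ((nodup_node h).1 false).1 (e ▸ hy); rw [addr, if_neg h', if_pos hy]

lemma addr_true {v : ℕ} {ch : Bool → CT} (h : (node v ch).ids.Nodup) {y : ℕ}
    (hy : y ∈ (ch true).ids) : (node v ch).addr y = true :: (ch true).addr y := by
  have h' : y ≠ v := fun e => ((nodup_node h).1 true).1 (e ▸ hy)
  rw [addr, if_neg h', if_neg fun h' => (nodup_node h).2 y h' hy]

end CT

def Anc (up : ℕ → ℕ) (u v : ℕ) : Prop := ∃ k, up^[k] v = u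

section
variable {n : ℕ} {up dep : ℕ → ℕ} {lf : ℕ → List ℕ} {rg : ℕ → ℕ} {dat : ℕ → List ℕ} {p : ℕ} {t : CT}
  {u v w : ℕ}

lemma Anc.parent (h : Anc up u v) : Anc up (up u) v := by
  obtain ⟨k, rfl⟩ := h; exact ⟨k + 1, iterate_succ_apply' ..⟩

lemma Anc.trans (h : Anc up u v) (h' : Anc up v w) : Anc up u w := by
  obtain ⟨k, rfl⟩ := h; obtain ⟨l, rfl⟩ := h'; exact ⟨k + l, Function.iterate_add_apply ..⟩

lemma dep_iterate (hd : ∀ x, dep (up x) = dep x - 1) (k x : ℕ) : dep (up^[k] x) = dep x - k := by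
  induction k with
  | zero => rfl
  | succ k ih => rw [iterate_succ_apply', hd, ih]; omega

lemma Anc.dep_le (hd : ∀ x, dep (up x) = dep x - 1) (h : Anc up u v) : dep u ≤ dep v := by
  obtain ⟨k, rfl⟩ := h; rw [dep_iterate hd]; omega

lemma Anc.unique (hd : ∀ x, dep (up x) = dep x - 1) (h : Anc up u w) (h' : Anc up v w)
    (hu : 0 < dep u) (huv : dep u = dep v) : u = v := by
  obtain ⟨k, rfl⟩ := h; obtain ⟨l, rfl⟩ := h'; rw [dep_iterate hd] at hu huv
  rw [dep_iterate hd] at huv; rw [show k = l by omega]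

lemma LC.exists_anc (h : LC n up lf rg p t) :
    ∀ w ∈ t.ids, w < n → ∃ u ∈ t.ids, u < n ∧ up u = p ∧ Anc up u w := by
  induction h with
  | leaf p =>
    intro w hw hn; obtain rfl : w = n + 1 + p := by simpa [CT.ids] using hw
    omega
  | @node v ch hv _ _ _ _ ih1 ih2 =>
    intro w hw hn; rcases CT.mem_ids_node.mp hw with rfl | ⟨b, hb⟩
    · exact ⟨w, hw, hv, rfl, 0, rfl⟩
    · cases b
      · obtain ⟨u, -, -, h2, h3⟩ := ih1 w hb hn
        exact ⟨v, CT.mem_ids_node.mpr (.inl rfl), hv, rfl, h2 ▸ h3.parent⟩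
      · obtain ⟨u, h1, h2⟩ := ih2 w hb hn; exact ⟨u, CT.mem_ids_node.mpr (.inr ⟨true, h1⟩), h2⟩

lemma LC.prefix_iff (h : LC n up lf rg p t) (hn : t.ids.Nodup)
    (hd : ∀ x, dep (up x) = dep x - 1) (hp : ∀ x < n, 0 < dep x) :
    ∀ y ∈ t.ids, y < n → ∀ z ∈ t.ids, z < n → (t.addr y <+: t.addr z ↔ Anc up y z) := by
  induction h with
  | leaf p =>
    intro w hw hn; obtain rfl : w = n + 1 + p := by simpa [CT.ids] using hw
    omega
  | @node v ch hv h1 _ h2 _ ih1 ih2 =>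
    obtain ⟨n1, n2⟩ := CT.nodup_node hn
    have ha : ∀ z ∈ (ch false).ids, z < n → Anc up v z ∧ dep v < dep z := fun z hz hzn => by
      obtain ⟨u, -, h3, h4, h5⟩ := h1.exists_anc z hz hzn; have := h5.dep_le hd; have e := hd u
      have := hp u h3; rw [h4] at e; exact ⟨h4 ▸ h5.parent, by omega⟩
    have hs : ∀ u < n, up u = up v → dep u = dep v := fun u hu h => by
      have e := hd u; rw [h, hd] at e; have := hp u hu; have := hp v hv; omega
    have hb : ∀ z ∈ (ch true).ids, z < n → ¬ Anc up v z ∧ ¬ Anc up z v := fun z hz hzn => by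
      obtain ⟨u, h3, h4, h5, h6⟩ := h2.exists_anc z hz hzn; have e := hs u h4 h5
      have hne : u ≠ v := fun h => (n1 true).1 (h ▸ h3)
      exact ⟨fun h => hne (h6.unique hd h (hp u h4) e),
        fun h => hne ((h6.trans h).unique hd ⟨0, rfl⟩ (hp u h4) e)⟩
    have hc : ∀ y ∈ (ch true).ids, y < n → ∀ z ∈ (ch false).ids, z < n → ¬ Anc up y z := by
      intro y hy hyn z hz hzn h; obtain ⟨u, h3, h4, h5, h6⟩ := h2.exists_anc y hy hyn
      refine (hb u h3 h4).1 ?_; have e := hs u h4 h5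
      rw [(h6.trans h).unique hd (ha z hz hzn).1 (hp u h4) e]; exact ⟨0, rfl⟩
    have e0 : (CT.node v ch).addr v = [false] := if_pos rfl; have e1 := @CT.addr_false v ch hn
    have e2 := @CT.addr_true v ch hn; intro y hy hyn z hz hzn
    rcases CT.mem_ids_node.mp hy with rfl | ⟨_ | _, hy'⟩ <;>
      rcases CT.mem_ids_node.mp hz with rfl | ⟨_ | _, hz'⟩ <;>
      simp only [*, List.cons_prefix_cons, true_and, List.prefix_rfl, List.nil_prefix,
        List.prefix_nil, reduceCtorEq, false_and, and_false, false_iff, true_iff]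
    · exact ⟨0, rfl⟩
    · intro h; have := h.dep_le hd; have := (ha y hy' hyn).2; omega
    · exact fun h => (hb z hz' hzn).1 ((ha y hy' hyn).1.trans h)

lemma LC.label_addr (h : LC n up lf rg p t) :
    ∀ y ∈ t.ids, y < n → (t.toB dat).label (t.addr y) = some (some (dat y)) := by
  induction h with
  | leaf p =>
    intro w hw hn; obtain rfl : w = n + 1 + p := by simpa [CT.ids] using hw
    omega
  | @node v ch hv _ _ _ _ ih1 ih2 =>
    intro y hy hyn; rw [CT.addr]; split_ifs with h1 h2
    · rw [h1]; rfl
    · exact ih1 y h2 hyn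
    · rcases CT.mem_ids_node.mp hy with h | ⟨_ | _, h⟩
      · exact absurd h h1
      · exact absurd h h2
      · exact ih2 y h hyn

lemma LC.exists_addr (h : LC n up lf rg p t) (hn : t.ids.Nodup) : ∀ (q : List Bool) (d : List ℕ),
    (t.toB dat).label q = some (some d) → ∃ y ∈ t.ids, y < n ∧ t.addr y = q := by
  induction h with
  | leaf p => rintro (_ | ⟨_ | _, q⟩) d h <;> simp [CT.toB, BTree.label] at h
  | @node v ch hv _ _ _ _ ih1 ih2 =>
    obtain ⟨n1, n2⟩ := CT.nodup_node hn; rintro (_ | ⟨_ | _, q⟩) d h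
    · simp [CT.toB, BTree.label] at h
    · rcases q with _ | ⟨_ | _, q⟩
      · exact ⟨v, CT.mem_ids_node.mpr (.inl rfl), hv, if_pos rfl⟩
      · obtain ⟨y, h1, h2, h3⟩ := ih1 (n1 _).2 q d h
        refine ⟨y, CT.mem_ids_node.mpr (.inr ⟨_, h1⟩), h2, ?_⟩; rw [CT.addr_false hn h1, h3]
      · simp [CT.toB, BTree.label] at h
    · obtain ⟨y, h1, h2, h3⟩ := ih2 (n1 _).2 q d h
      refine ⟨y, CT.mem_ids_node.mpr (.inr ⟨_, h1⟩), h2, ?_⟩; rw [CT.addr_true hn h1, h3]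

end

section
variable {n : ℕ} (T : DataTree n)

def upOf (v : ℕ) : ℕ := if h : v < n then upper n v (T.parent ⟨v, h⟩) else n

def datOf (v : ℕ) : List ℕ := if h : v < n then T.data ⟨v, h⟩ else []

open Classical in
def depOf (v : ℕ) : ℕ := if h : v < n then Nat.find (T.reaches_root ⟨v, h⟩) + 1 else 0

variable {T}

lemma upOf_fin (v : Fin n) : upOf T v = if T.parent v = v then n else (T.parent v : ℕ) := by
  rw [upOf, dif_pos v.2, upper]; simp only [Fin.ext_iff]

lemma upOf_le (v : ℕ) : upOf T v ≤ n := by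
  unfold upOf upper; split_ifs
  · exact le_rfl
  · exact (Fin.is_lt _).le
  · exact le_rfl

lemma depOf_up (v : ℕ) : depOf T (upOf T v) = depOf T v - 1 := by
  classical
  by_cases h : v < n
  · lift v to Fin n using h; rw [upOf_fin, depOf, depOf, dif_pos v.2, Nat.add_sub_cancel]
    split_ifs with h1 h2 h2
    · omega
    · rw [eq_comm, Nat.find_eq_zero]; obtain ⟨k, hk⟩ := T.reaches_root v
      rwa [Function.iterate_fixed h1] at hk
    · have h0 : v ≠ T.root := fun h => h1 (h ▸ T.parent_root)
      exact (Nat.find_comp_succ (T.reaches_root v) (T.reaches_root (T.parent v)) h0).symm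
    · exact absurd (Fin.is_lt _) h2
  · simp [upOf, depOf, h]

lemma depOf_pos {v : ℕ} (h : v < n) : 0 < depOf T v := by rw [depOf, dif_pos h]; omega

lemma anc_iff (u v : Fin n) : Anc (upOf T) u v ↔ T.IsAncestor u v := by
  constructor
  · rintro ⟨k, hk⟩
    induction k generalizing v with
    | zero => exact ⟨0, Fin.ext hk⟩
    | succ k ih =>
      rw [Function.iterate_succ_apply, upOf_fin] at hk; split_ifs at hk with h
      · rw [Function.iterate_fixed (by simp [upOf])] at hk; omega
      · obtain ⟨l, hl⟩ := ih _ hk; exact ⟨l + 1, hl⟩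
  · rintro ⟨k, hk⟩
    induction k generalizing v with
    | zero => exact ⟨0, congrArg Fin.val hk⟩
    | succ k ih =>
      obtain ⟨l, hl⟩ := ih _ hk; by_cases h : T.parent v = v
      · exact ⟨l, by rwa [h] at hl⟩
      · exact ⟨l + 1, by rw [Function.iterate_succ_apply, upOf_fin, if_neg h, hl]⟩

variable {lf : ℕ → List ℕ} {rg : ℕ → ℕ} {t : CT}

lemma LC.isBinaryExtension {p : ℕ} (h : LC n (upOf T) lf rg p t) (hn : t.ids.Nodup)
    (hm : ∀ v < n, v ∈ t.ids) : IsBinaryExtension T (t.toB (datOf T)) := by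
  have key : ∀ u v : Fin n, t.addr u <+: t.addr v ↔ T.IsAncestor u v := fun u v =>
    (h.prefix_iff hn depOf_up (fun x => depOf_pos) u (hm _ u.2) u.2 v (hm _ v.2) v.2).trans
      (anc_iff u v); refine ⟨fun v => t.addr v, fun u v he => ?_, fun v => ?_, fun q hq => ?_, key⟩
  · have h1 := (anc_iff u v).mpr ((key u v).mp (by simp only [he, List.prefix_rfl]))
    have h2 := (anc_iff v u).mpr ((key v u).mp (by simp only [he, List.prefix_rfl]))
    exact Fin.ext (h1.unique depOf_up ⟨0, rfl⟩ (depOf_pos u.2)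
      (le_antisymm (h1.dep_le depOf_up) (h2.dep_le depOf_up)))
  · rw [h.label_addr _ (hm _ v.2) v.2, datOf, dif_pos v.2]
  · cases hl : (t.toB (datOf T)).label q with
    | none => exact .inl rfl
    | some d =>
      cases d with
      | none => exact .inr rfl
      | some d => obtain ⟨y, -, h2, h3⟩ := h.exists_addr hn q d hl; exact absurd ⟨⟨y, h2⟩, h3⟩ hq

end

/-! ## From the sorted items to the solution -/

section
variable {n b lam : ℕ} {up : ℕ → ℕ} {lf : ℕ → List ℕ} {rg : ℕ → ℕ} {dat : ℕ → List ℕ}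
  {Γ : Fields} {C : ℕ → List ℕ} {B : BTree} {p : ℕ} {t : CT}

lemma LC.nodup (hL : Links n up lf rg) (h : LC n up lf rg n t) (hi : t.id = leftOf n lf n)
    (hup : ∀ v < n, up v ≤ n) : t.ids.Nodup := by
  obtain ⟨h1, h2, -⟩ := h.isChain hup le_rfl
  exact nodup_of_isChain (fun x y => hL.next_inj) h1 h2 fun x hx => hi ▸ hL.next_ne hx

lemma LC.length_le (h : LC n up lf rg n t) (hn : t.ids.Nodup) (hup : ∀ v < n, up v ≤ n) :
    t.ids.length ≤ 2 * n + 1 := by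
  rw [← List.toFinset_card_of_nodup hn]
  have : t.ids.toFinset ⊆ (range (2 * n + 2)).erase n := fun y hy => by
    have := h.lt hup le_rfl y (List.mem_toFinset.mp hy); rw [Finset.mem_erase, mem_range]; omega
  refine (Finset.card_le_card this).trans ?_
  rw [Finset.card_erase_of_mem (mem_range.mpr (by omega)), Finset.card_range]; omega

lemma LC.leaves_eq (h : LC n up lf rg p t) : t.leaves = t.ids.filter fun y => decide (n < y) := by
  induction h with
  | leaf p => simp [CT.leaves, CT.ids, show n < n + 1 + p by omega]
  | node hv _ _ _ _ ih1 ih2 => simp [CT.leaves, CT.ids, ih1, ih2, Nat.not_lt.mpr hv.le]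

lemma LC.shape (hL : Links n up lf rg) (h : LC n up lf rg p t) {par : List ℕ}
    (h7 : ∀ y, Γ y 7 = if y < n then [leftOf n lf y, rg y] else [])
    (h8 : ∀ y, Γ y 8 = parentOf n lf rg y) (h13 : ∀ y < n, Γ y 13 = [])
    (h14 : ∀ y ∈ t.ids, Γ y 14 = C y) (hp : parentOf n lf rg t.id = par) : t.Shape Γ C par := by
  induction h generalizing par with
  | leaf p => exact ⟨(h8 _).trans hp, h14 _ (CT.id_mem (.leaf _)), by rw [h7, if_neg (by omega)]⟩
  | @node v ch hv _ e1 _ e2 ih1 ih2 =>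
    refine ⟨(h8 _).trans hp, h14 _ (CT.id_mem (.node v ch)), by rw [h7, if_pos hv, e1, e2],
      h13 v hv, fun s => ?_⟩; have hm := CT.ids_child h14 s
    cases s
    · exact ih1 hm (by rw [e1, hL.parent_left hv]; rfl)
    · exact ih2 hm (by rw [e2, hL.parent_rg hv]; rfl)

lemma LC.good (h : LC n up lf rg p t) (hB : (t.toB dat).IsSubtree B) :
    t.Good B (initPart n dat) (t.toB dat) := by
  have root : ∀ t : CT, ∃ l r, t.toB dat = .node none l r := fun t => by
    cases t <;> exact ⟨_, _, rfl⟩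
  induction h with
  | leaf p => rw [CT.Good, initPart, if_neg (by omega)]; exact ⟨hB, trivial, .node none .nil .nil⟩
  | @node v ch hv _ _ _ _ ih1 ih2 =>
    obtain ⟨l, r, h0⟩ := root (ch false); obtain ⟨l', r', h1⟩ := root (ch true)
    rw [CT.Good, initPart, if_pos hv]
    refine ⟨hB, trivial, fun s => (ch s).toB dat, ?_, fun s => ?_⟩
    · show Part.Fills _ [(ch false).toB dat, (ch true).toB dat] _; rw [CT.toB, h0, h1]
      exact .node none (.node _ (.hole none l r) .nil) (.hole none l' r')
    · cases s
      · exact ih1 ((BTree.IsSubtree.left _ _ (.left _ _ (.refl _))).trans hB)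
      · exact ih2 ((BTree.IsSubtree.right _ _ (.refl _)).trans hB)

lemma initPart_holes (y : ℕ) : (initPart n dat y).holes ≤ 2 ∧ (initPart n dat y).size ≤ 4 := by
  unfold initPart; split_ifs <;> simp [Part.holes, Part.size]

lemma CT.Good.exists_fills {X : ℕ → Part} {S : BTree} (h : t.Good B X S) :
    ∀ y ∈ t.ids, (X y).IsNode ∧ ∃ S hs, S.IsSubtree B ∧ (X y).Fills hs S := by
  induction t generalizing S with
  | leaf i =>
    intro y hy; obtain rfl : y = i := by simpa [CT.ids] using hy
    exact ⟨h.2.1, _, _, h.1, h.2.2⟩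
  | node i ch ih =>
    obtain ⟨h1, h2, U, h3, h4⟩ := h; intro y hy; rcases CT.mem_ids_node.mp hy with rfl | ⟨s, hs⟩
    · exact ⟨h2, _, _, h1, h3⟩
    · exact ih s (h4 s) y hs

lemma LC.mem_of_parent (h : LC n up lf rg n t) (hi : t.id = leftOf n lf n)
    (hm : ∀ v < n, v ∈ t.ids) {y : ℕ} (hy : parentOf n lf rg y ≠ []) : y ∈ t.ids := by
  rcases Links.parent_eq (n := n) (lf := lf) (rg := rg) (y := y) with
    ⟨x, hx, rfl, -⟩ | ⟨x, hx, rfl, -⟩ | ⟨rfl, -⟩ | h'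
  · exact (h.children x (hm x hx) hx).1
  · exact (h.children x (hm x hx) hx).2.1
  · exact hi ▸ CT.id_mem t
  · exact absurd h' hy

lemma LC.rankInv (hL : Links n up lf rg) (h : LC n up lf rg n t) (hi : t.id = leftOf n lf n)
    (hup : ∀ v < n, up v ≤ n) (hm : ∀ v < n, v ∈ t.ids) :
    RankInv (fun y => decide (n < y)) t.ids 0 (link3Γ n lf rg dat) := by
  obtain ⟨h1, h2, h3⟩ := h.isChain hup le_rfl; rw [List.isChain_iff_getElem] at h1
  have hlt := h.lt hup le_rfl
  have hleaf : ∀ y, HasNext n y → y ∈ t.ids ∧ nextOf n lf rg y ∈ t.ids := fun y hy => by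
    unfold nextOf; rcases hy with hy | ⟨h4, h5⟩
    · rw [if_pos hy]; exact ⟨hm y hy, (h.children y (hm y hy) hy).1⟩
    · obtain ⟨v, rfl⟩ := Nat.exists_eq_add_of_le (show n + 1 ≤ y by omega)
      have := h.children v (hm v (by omega)) (by omega)
      rw [if_neg (by omega), Nat.add_sub_cancel_left]; exact ⟨this.2.2, this.2.1⟩
  constructor
  · intro i y hy; obtain ⟨h4, rfl⟩ := List.getElem?_eq_some_iff.mp hy; rw [pow_zero]
    by_cases h5 : i + 1 < t.ids.length
    · rw [show link3Γ n lf rg dat _ 9 = _ from if_pos (h1 i h5).1, (h1 i h5).2, List.getElem?_eq_getElem h5]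
      rfl
    · rw [List.getLast?_eq_getElem?, show t.ids.length - 1 = i by omega, hy] at h3
      simp only [Option.some.injEq] at h3
      rw [h3, show link3Γ n lf rg dat _ 9 = _ from if_neg (by unfold HasNext; omega), List.getElem?_eq_none (by omega)]
      rfl
  · intro i y hy; obtain ⟨h4, rfl⟩ := List.getElem?_eq_some_iff.mp hy; show prevOf n lf rg _ = _
    cases i with
    | zero =>
      rw [List.head?_eq_getElem?, hy] at h2; simp only [Option.some.injEq] at h2
      rw [h2, if_neg (by simp)]
      rcases prevOf_eq (n := n) (lf := lf) (rg := rg) (y := t.id) with h' | ⟨x, h5, h6, -⟩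
      · exact h'
      · exact absurd (h6.trans hi) (hL.next_ne h5)
    | succ i =>
      rw [if_pos (by simp), ← (h1 i h4).2, hL.prev_next (h1 i h4).1, pow_zero, Nat.add_sub_cancel,
        List.getElem?_eq_getElem (by omega)]; rfl
  · intro i y hy; obtain ⟨h4, rfl⟩ := List.getElem?_eq_some_iff.mp hy
    have h5 := hlt _ (List.getElem_mem h4); rw [pow_zero, List.drop_eq_getElem_cons h4]
    generalize t.ids[i] = y at *; show hd (if _ then _ else _) + 0 = 2 * List.countP _ [y]
    by_cases h6 : n < y
    · rw [if_pos ⟨h6, by omega⟩]; simp [hd, h6]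
    · rw [if_neg (by omega)]; simp [hd, h6]
  · intro y hy; refine ⟨if_neg fun h => hy (hleaf y h).1, ?_⟩
    rcases prevOf_eq (n := n) (lf := lf) (rg := rg) (y := y) with h' | ⟨x, h5, rfl, -⟩
    · exact h'
    · exact absurd (hleaf x h5).2 hy
  · refine fun y => ⟨h.mem_of_parent hi hm, fun hy => ?_⟩
    have hs : t.Shape (link3Γ n lf rg dat) (fun _ => []) [0] :=
      h.shape hL (fun _ => rfl) (fun _ => rfl) (fun _ _ => rfl) (fun _ _ => rfl)
        (by rw [hi, hL.parent_root])
    rcases hs.parent hy with ⟨-, h'⟩ | ⟨_, -, _, h', -⟩ <;> rw [h'] <;> simp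

lemma gok_link (hlam : 11 < lam) (hdat : ∀ y, (dat y).length + 11 < lam) (hb : 2 * n + 2 ≤ b)
    (hup : ∀ v < n, up v ≤ n) {key ℓ : ℕ → ℕ} (hk : ∀ y < n, key (ℓ y) ≤ b ∧ ℓ y < n) :
    GOK b lam (link1Γ n key ℓ dat) ∧ (Links n up lf rg → GOK b lam (link2Γ n lf rg dat) ∧
      GOK b lam (link3Γ n lf rg dat)) := by
  have hit : ∀ y, (items n key ℓ y).length < lam ∧ ∀ w ∈ items n key ℓ y, w ≤ b := fun y => by
    unfold items; split_ifs with h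
    · have := hk y h; simp; omega
    · simp; omega
  have hda : ∀ y, (dat y).length < lam := fun y => by have := hdat y; omega
  refine ⟨.of (fun x f => ?_) (fun x f hf v hv => ?_) fun x => rfl, fun hL => ⟨.of (fun x f => ?_)
    (fun x f hf v hv => ?_) fun x => rfl, .of (fun x f => ?_) (fun x f hf v hv => ?_) fun x => rfl⟩⟩
  · unfold link1Γ
    split <;> (try split_ifs) <;> first | exact (hit _).1 | exact hda _ | (simp; omega)
  · unfold link1Γ at hv; split at hv <;> (try split_ifs at hv) <;>
      first | exact (hit _).2 v hv | (simp [isPtr] at hf; done) | (simp at hv; done) | (simp at hv; omega)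
  · have hlf : (lf x).length < lam := by
      rcases hL.lf_eq x with h | ⟨w, -, h, -⟩ <;> rw [h] <;> simp <;> omega
    unfold link2Γ; split <;> (try split_ifs) <;> first | exact hlf | exact hda _ | (simp; omega)
  · unfold link2Γ at hv; split at hv <;> (try split_ifs at hv) <;>
      first | (simp [isPtr] at hf; done) | (simp at hv; done) | (simp at hv; omega) | skip
    · rcases hL.lf_eq x with h | ⟨w, hw, h, -⟩ <;> rw [h] at hv
      · simp at hv
      · simp at hv; omega
    · have := hL.rg_lt hup ‹x < n›; simp at hv; omega
  · have h8 : (parentOf n lf rg x).length ≤ 3 := by unfold parentOf; split_ifs <;> simp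
    have h10 : (prevOf n lf rg x).length ≤ 1 := by unfold prevOf; split_ifs <;> simp
    have h1 : (initPart n dat x).encode.length < lam := by
      have := hdat x; unfold initPart; split_ifs <;> simp [Part.encode, Part.encodeData] <;> omega
    unfold link3Γ; split <;> (try split_ifs) <;> first | exact h1 | (simp; omega)
  · unfold link3Γ at hv; split at hv <;> (try split_ifs at hv) <;>
      first | (simp [isPtr] at hf; done) | (simp at hv; done) | (simp at hv; omega) | skip
    · have h1 := hL.left_lt (show x ≤ n by omega)
      have h2 := hL.rg_lt hup ‹x < n›; simp at hv; omega
    · rcases Links.parent_eq (n := n) (lf := lf) (rg := rg) (y := x) with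
        ⟨y, hy, -, h⟩ | ⟨y, hy, -, h⟩ | ⟨-, h⟩ | h <;> rw [h] at hv <;> simp at hv <;> omega
    · have h1 := hL.next_lt hup ‹HasNext n x›; simp at hv; omega
    · rcases prevOf_eq (n := n) (lf := lf) (rg := rg) (y := x) with h | ⟨y, hy, -, h⟩ <;>
        rw [h] at hv
      · simp at hv
      · unfold HasNext at hy; simp at hv; omega

lemma iterate_rankΓ (k : ℕ) {f : ℕ} (hf : f = 1 ∨ f = 7 ∨ f = 8) (y : ℕ) :
    rankΓ^[k] Γ y f = Γ y f := by
  induction k with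
  | zero => rfl
  | succ k ih => rw [iterate_succ_apply', ← ih]; rcases hf with rfl | rfl | rfl <;> rfl

end

lemma Net.solve {P : Net} (T : DataTree P.n) {Cf : Part → List ℕ} {val : BTree → List ℕ}
    (hlam : 11 < P.lam) (hdat : ∀ y, (datOf T y).length + 11 < P.lam) (hb : 4 * P.n + 2 ≤ P.b)
    (hN : 2 * P.n + 2 ≤ P.N) (hL : P.n < 2 ^ P.L)
    (hC : ∀ B, IsBinaryExtension T B → B.size ≤ 4 * P.n + 2 → CallOk P.W P.lam B Cf val P.pM ∧
      ∀ S X hs, S.IsSubtree B → X.IsNode → X.holes ≤ 2 → X.size ≤ 4 → X.Fills hs S →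
        P.pC.Computes P.W [X.encode] (Cf X) P.lam) :
    ∃ B, IsBinaryExtension T B ∧ P.Steps 0
      (sortΓ (fun _ => []) (datOf T) (items P.n (fun v => upOf T v + 1) fun y => y)) (9 * P.L + 15)
      (finΓ (val B)) := by
  have hup : ∀ v < P.n, upOf T v ≤ P.n := fun v _ => upOf_le v
  have hpow : 2 ^ (P.L + 1) = 2 * 2 ^ P.L := pow_succ' ..
  obtain ⟨z', ℓ, s1, hℓ, hinj, hsort⟩ := Net.sort (P := P) (key := fun v => upOf T v + 1)
    (z := fun _ => []) (dat := datOf T) (by omega) (by omega) (fun y => by have := hdat y; omega)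
    (by omega) (by omega) (fun y hy => by have := hup y hy; omega) (k := P.L + 1) le_rfl
  have hs : ∀ x y, x < y → y < P.n → upOf T (ℓ x) + 1 ≤ upOf T (ℓ y) + 1 := fun x y hxy hy => by
    have h1 := hsort x y hxy hy; have h2 := hup _ (hℓ x (by omega))
    have h3 := hup _ (hℓ y hy); rwa [Nat.mod_eq_of_lt (by omega), Nat.mod_eq_of_lt (by omega)] at h1
  obtain ⟨lf, rg, hLk, v2⟩ := exists_links (W := P.W) (lam := P.lam) (pw := pwAt P.L (2 * P.L + 3))
    (N := P.N) (dat := datOf T) (key := fun v => upOf T v + 1) (fun _ => rfl) hup (by omega) hN hℓ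
    hinj hs; obtain ⟨g1, g23⟩ := gok_link (lf := lf) (rg := rg) (up := upOf T) (b := P.b) (ℓ := ℓ)
    (key := fun v => upOf T v + 1) hlam hdat (by omega) hup fun y hy =>
      ⟨by have := hup _ (hℓ y hy); omega, hℓ y hy⟩; obtain ⟨g2, g3⟩ := g23 hLk
  have hroot : lf P.n ≠ [] := by
    have h : upOf T T.root = P.n := by rw [upOf_fin, if_pos T.parent_root]
    exact h ▸ hLk.lf_ne _ T.root.2
  have hdep : ∀ v < P.n, depOf T v = depOf T (upOf T v) + 1 := fun v hv => by
    have := depOf_pos (T := T) hv; rw [depOf_up]; omega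
  obtain ⟨t, hlc, hi⟩ := hLk.exists_tree hdep (M := ∑ v ∈ range P.n, depOf T v)
    (fun v hv => Finset.single_le_sum (f := depOf T) (fun _ _ => Nat.zero_le _)
      (mem_range.mpr hv)) P.n
  have hm := hLk.mem_ids hdep hup hlc hi; have hnd := hlc.nodup hLk hi hup
  have hlen := hlc.length_le hnd hup; have hlt := hlc.lt hup le_rfl
  have hB := hlc.isBinaryExtension hnd hm; have hsz := t.size_toB (dat := datOf T)
  obtain ⟨hCall, hpC⟩ := hC _ hB (by omega)
  have hgood := hlc.good (dat := datOf T) (.refl _); refine ⟨_, hB, ?_⟩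
  have nc : ∀ u k, ncode P.L u = k →
      all P.pC P.pM (ncode P.L u) = all P.pC P.pM k := fun _ _ h => by rw [h]
  have s2 := s1.trans (.single (p := link1) (nc _ 2 (by unfold ncode; split_ifs <;> omega))
    (vstep_link1 (by omega) (by omega)) g1)
  have s3 := s2.trans (.single (p := link2) (nc _ 3 (by unfold ncode; split_ifs <;> omega)) v2 g2)
  have s4 := s3.trans (.single (p := link3) (nc _ 4 (by unfold ncode; split_ifs <;> omega))
    (vstep_link3 hLk hup hroot (by omega) hN) g3)
  have hr : ∀ k ≤ P.L + 2, RankInv (fun y => decide (P.n < y)) t.ids k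
        (rankΓ^[k] (link3Γ P.n lf rg (datOf T))) ∧
      GOK P.b P.lam (rankΓ^[k] (link3Γ P.n lf rg (datOf T))) ∧
      P.Steps (2 * P.L + 5) (link3Γ P.n lf rg (datOf T)) (2 * P.L + 5 + k)
        (rankΓ^[k] (link3Γ P.n lf rg (datOf T))) := by
    intro k
    induction k with
    | zero => exact fun _ => ⟨hlc.rankInv hLk hi hup hm, g3, .refl⟩
    | succ k ih =>
      intro hk; obtain ⟨i1, i2, i3⟩ := ih (by omega); have i4 := i2.rank i1 (by omega) (by omega)
      rw [iterate_succ_apply']; exact ⟨i1.rank, i4, i3.trans (.single (p := rank)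
        (nc _ 5 (by unfold ncode; split_ifs <;> omega))
        (vstep_rank (by omega) (fun y hy => by have := hlt y hy; omega) i1) i4)⟩
  obtain ⟨r1, r2, r3⟩ := hr _ le_rfl; rw [show 2 * P.L + 5 + (P.L + 2) = 3 * P.L + 7 by ring] at r3
  have k7 := @iterate_rankΓ (link3Γ P.n lf rg (datOf T)) (P.L + 2) 7 (by simp)
  have k8 := @iterate_rankΓ (link3Γ P.n lf rg (datOf T)) (P.L + 2) 8 (by simp)
  have k1 := @iterate_rankΓ (link3Γ P.n lf rg (datOf T)) (P.L + 2) 1 (by simp)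
  generalize rankΓ^[P.L + 2] (link3Γ P.n lf rg (datOf T)) = Γ at *
  let R : ℕ → List ℕ := fun y => if y ∈ t.ids then Cf (initPart P.n (datOf T) y) else []
  have hR : ∀ y, (R y).length < P.lam := fun y => by
    dsimp only [R]; split_ifs with hy
    · obtain ⟨h1, S, hs, h2, h3⟩ := hgood.exists_fills y hy
      exact hCall.len S _ hs h2 h1 (initPart_holes y).1 h3
    · simp; omega
  have hbuild : VStep P.W P.lam P.n (pwAt P.L (3 * P.L + 7)) P.N (build P.pC) Γ (buildΓ R Γ) R := by
    refine vstep_build (fun x _ hx => ?_) (fun x hx => if_neg fun h => (r1.mem x).mpr h hx) hR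
    have hy := (r1.mem x).mp hx; obtain ⟨h1, S, hs, h2, h3⟩ := hgood.exists_fills x hy
    rw [k1, show link3Γ P.n lf rg (datOf T) x 1 = _ from if_pos (hlt x hy),
      show R x = _ from if_pos hy]
    exact hpC S _ hs h2 h1 (initPart_holes x).1 (initPart_holes x).2 h3
  have g6 := r2.build r1 (by omega) (by omega) hR
  have s6 := (s4.trans r3).trans (Steps.single (nc _ 6 (by unfold ncode; split_ifs <;> omega))
    hbuild g6)
  have h7 : ∀ y, buildΓ R Γ y 7 = if y < P.n then [leftOf P.n lf y, rg y] else [] := k7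
  have hI : CInv P.N (t.toB (datOf T)) Cf (buildΓ R Γ) (initPart P.n (datOf T)) t :=
    { shape := hlc.shape hLk h7 k8 (fun y hy => if_neg fun h => by
          have := h7 y; rw [if_pos hy] at this; exact absurd (this.symm.trans h.2) (by simp))
        (fun y hy => if_pos hy) (by rw [hi, hLk.parent_root])
      good := hgood
      lt := fun y hy => by have := hlt y hy; omega
      supp := fun y hy => ⟨(h7 y).trans (if_neg fun h => hy (hm y h)),
        by_contra fun h => hy ((r1.mem y).mp h)⟩ }
  have hnum : Numbered (buildΓ R Γ) t (t.ids.countP fun y => decide (P.n < y)) := by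
    refine .inr ?_; rw [← map_filter_suffix hnd (val := rankVal Γ) fun i y hy => ?_, hlc.leaves_eq]
    · refine List.map_congr_left fun y hy => ?_; rw [List.mem_filter, decide_eq_true_eq] at hy
      have : buildΓ R Γ y 13 = [rankVal Γ y] :=
        if_pos ⟨(r1.mem y).mpr hy.1, (h7 y).trans (if_neg (by omega))⟩; rw [this]; rfl
    · rw [r1.val i y hy, take_of_length_le]; rw [List.length_drop, pow_succ]; omega
  have hcnt := List.countP_le_length (p := fun y => decide (P.n < y)) (l := t.ids)
  have s7 := Net.contract hCall (by omega) (by omega) g6 hI hnum (by omega); exact s6.trans s7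

/-! ## The input -/

section
variable {n m q lam : ℕ} (T : DataTree n) (loc : Fin n → Fin m)

def inputOf (j : ℕ) : List (ℕ × ℕ × List ℕ) :=
  ((List.finRange n).filter fun v => (loc v : ℕ) = j).map fun v : Fin n =>
    ((v : ℕ), (T.parent v : ℕ), T.data v)

def startΓ : Fields := sortΓ (fun _ => []) (datOf T) (items n (fun v => upOf T v + 1) fun y => y)

variable {T loc}

lemma encIn_inputOf (j : Fin m) : encIn (inputOf T loc j) = localInput T loc j := by
  simp only [encIn, inputOf, localInput, List.flatMap_map, Fin.ext_iff]

lemma inputMsgs_inputOf (j : ℕ) : inputMsgs n q lam (inputOf T loc j) =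
    ((List.finRange n).filter fun v => (loc v : ℕ) = j).flatMap fun v : Fin n =>
      emitMsgs q lam (v, 1, startΓ T v 1) ++ emitMsgs q lam (v, 2, startΓ T v 2) := by
  have h1 : ∀ v : Fin n, startΓ T v 1 = T.data v := fun v => dif_pos v.2
  have h2 : ∀ v : Fin n, startΓ T v 2 = [upper n v (T.parent v) + 1, (v : ℕ)] := fun v => by
    simp [startΓ, sortΓ, items, upOf]
  simp only [inputMsgs, inputOf, List.flatMap_map, h1, h2]

lemma describes_start (hq : 0 < q) (hn : n ≤ m * q) (hlam : 2 < lam)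
    (hdat : ∀ y, (datOf T y).length < lam) {j : ℕ} (hj : j < m) :
    Describes (q * nf * lam + m) (memOf q lam (startΓ T) j)
      (inbox m (fun i => inputMsgs n q lam (inputOf T loc i)) j) := by
  have hc : ∀ i, cnt q (startΓ T) i = 0 := fun i => Finset.sum_eq_zero fun _ _ => rfl
  have hlt : ∀ y f, (startΓ T y f).length < lam := fun y f => by
    unfold startΓ sortΓ items; split <;> (try split_ifs) <;> first | exact hdat _ | (simp; omega)
  refine describes_inbox hq _ (fun i _ x hx => .inl ?_) (fun y _ f hf hne => ?_)
    (fun i _ h => absurd (hc i) h) hj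
  · rw [inputMsgs_inputOf] at hx; obtain ⟨v, -, hx⟩ := mem_flatMap.mp hx
    rcases mem_append.mp hx with hx | hx
    exacts [⟨_, v.2.trans_le hn, (by decide : 1 < nf), hlt v 1, rfl, hx⟩,
      ⟨_, v.2.trans_le hn, (by decide : 2 < nf), hlt v 2, rfl, hx⟩]
  · have hy : y < n ∧ (f = 1 ∨ f = 2) := by
      unfold startΓ sortΓ items at hne; split at hne
      · exact absurd rfl hne
      · exact ⟨by_contra fun h => hne (dif_neg h), .inl rfl⟩
      · split_ifs at hne with h; exacts [⟨h, .inr rfl⟩, absurd rfl hne]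
      · exact absurd rfl hne
    refine ⟨loc ⟨y, hy.1⟩, Fin.is_lt _, fun x hx => ?_⟩; rw [inputMsgs_inputOf]
    refine mem_flatMap.mpr ⟨⟨y, hy.1⟩, by simp, mem_append.mpr ?_⟩; rcases hy.2 with rfl | rfl
    exacts [.inl hx, .inr hx]

lemma length_start_le (hq : 0 < q) (hlam : 2 < lam) (hdat : ∀ y, (datOf T y).length < lam) (j : ℕ) :
    (inbox m (fun i => inputMsgs n q lam (inputOf T loc i)) j).length ≤ 2 * (q * lam) := by
  let F : ℕ → ℕ → ℕ := fun f y =>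
    (([(y, f, startΓ T y f)] : List (ℕ × ℕ × List ℕ)).flatMap (emitMsgs q lam)).countP
      fun x => x.1 = j
  have hF : ∀ f, ∑ y ∈ range n, F f y ≤ q * lam := fun f =>
    sum_countP_le hq _ (fun _ _ => le_rfl) (fun x _ y _ e he e' he' h => by
        rw [mem_singleton] at he he'; rwa [he, he'] at h)
      fun x _ e he => by
        rw [mem_singleton.mp he]; unfold startΓ sortΓ items; dsimp only
        split <;> (try split_ifs) <;> first | exact hdat _ | (simp; omega)
  have h1 : ∀ i, (((inputMsgs n q lam (inputOf T loc i)).filter fun x => x.1 = j).map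
      Prod.snd).length = ∑ v : Fin n with (loc v : ℕ) = i, (F 1 v + F 2 v) := fun i => by
    rw [length_map, ← List.countP_eq_length_filter, inputMsgs_inputOf, List.countP_flatMap,
      ← List.sum_toFinset _ ((List.nodup_finRange n).filter _), List.toFinset_filter,
      List.toFinset_finRange]; simp [F, countP_append]
  rw [inbox, length_flatMap_range]; simp only [h1]
  rw [Finset.sum_fiberwise_of_maps_to (fun v _ => mem_range.mpr (loc v).2),
    Fin.sum_univ_eq_sum_range (fun y => F 1 y + F 2 y), Finset.sum_add_distrib]
  have := hF 1; have := hF 2; omega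

lemma length_encIn_le (hdat : ∀ y, (datOf T y).length + 3 ≤ lam) (j : Fin m) :
    (encIn (inputOf T loc j)).length ≤ {v : Fin n | loc v = j}.ncard * lam := by
  have h : {v : Fin n | loc v = j}.ncard = ((List.finRange n).filter fun v => loc v = j).length := by
    rw [← List.toFinset_card_of_nodup ((List.nodup_finRange n).filter _), ← Set.ncard_coe_finset]
    congr; ext v; simp
  rw [encIn_inputOf, localInput, h, List.length_flatMap, ← smul_eq_mul, ← length_map]
  refine List.sum_le_card_nsmul _ _ fun x hx => ?_; obtain ⟨v, -, rfl⟩ := mem_map.mp hx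
  have := hdat v; rw [datOf, dif_pos v.2] at this; simp only [length_cons]; omega

end

/-! ## The main theorem -/

lemma lg_mono {x y : ℕ} (h : x ≤ y) : lg x ≤ lg y := Nat.add_le_add_right (Nat.log_mono_right h) 1

lemma Prog.Computes.mono {p : Prog} {W : ℕ} {xs : List (List ℕ)} {y : List ℕ} {t t' : ℕ}
    (h : p.Computes W xs y t) (ht : t ≤ t') : p.Computes W xs y t' := by
  obtain ⟨σ, s, s', h1, h2, h3⟩ := h; exact ⟨σ, s, s', h1, h2, h3.trans ht⟩

lemma two_mul_cube_le (L : ℕ) (hL : 0 < L) : 2 * L ^ 3 ≤ 4 ^ L := by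
  induction L, hL using Nat.le_induction with
  | base => decide
  | succ L h ih =>
    rcases Nat.lt_or_ge L 2 with h' | h'
    · obtain rfl : L = 1 := by omega
      decide
    · rw [pow_succ 4]; nlinarith [Nat.mul_le_mul h' h', Nat.mul_le_mul_right (L * L) h']

lemma numbers {n m K L : ℕ} (hm : 0 < m) (hL : 0 < L)
    (h : m * m ≤ K * n * L ^ K) : (2 * n + 2) / m + 2 ≤ 4 * (n / m + 1) ∧
    (∀ c, c * m ≤ K * n * L ^ K → c ≤ K * ((n / m + 1) * L ^ K)) ∧
    (n / m + 1) * m ≤ (K + 1) * (n * L ^ K) := by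
  have h1 := Nat.lt_mul_div_succ n hm; refine ⟨?_, fun c hc => ?_, ?_⟩
  · have : (2 * n + 2) / m ≤ 2 * (n / m + 1) := Nat.div_le_of_le_mul (by
      rw [← mul_assoc, mul_comm m 2, mul_assoc]; omega); generalize n / m = e at *; omega
  · refine Nat.le_of_mul_le_mul_right (hc.trans ?_) hm
    calc K * n * L ^ K ≤ K * (m * (n / m + 1)) * L ^ K := by gcongr
      _ = _ := by ring
  · have h2 := Nat.div_mul_le_self n m; have h3 : m ≤ m * m := Nat.le_mul_of_pos_left _ hm
    have h4 : n ≤ n * L ^ K := Nat.le_mul_of_pos_right _ (by positivity)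
    calc (n / m + 1) * m = n / m * m + m := by ring
      _ ≤ n * L ^ K + K * n * L ^ K := by omega
      _ = _ := by ring

lemma exists_run (P : TreeProblem) (hP : IsPolylogExpressible P) (K : ℕ) :
    ∃ (p : Prog) (κ ρ b : ℕ), ∀ (n m : ℕ) (T : DataTree n) (loc : Fin n → Fin m) (hm : 0 < m),
      P.IsInput T → m * m ≤ K * n * lg n ^ K →
      (∀ j : Fin m, {v : Fin n | loc v = j}.ncard * m ≤ K * n * lg n ^ K) →
      ∀ ω : Coins m (2 ^ (κ * lg n)), ∃ τ : Trace m, τ.IsRun p T loc ω (ρ * lg n) ∧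
        P.IsSolution T ((τ.mem (ρ * lg n) ⟨0, hm⟩).arr 1) ∧ ∀ r < ρ * lg n, ∀ j : Fin m,
          τ.space r j * m ≤ b * n * lg n ^ b ∧ τ.time r j ≤ b * (τ.mem r j).size p.bound := by
  obtain ⟨a0, D, Cf, pC, pM, A, k, hk, hpC, hpM, hD, hexp⟩ := hP; obtain ⟨A1, hA1⟩ := P.data_bound
  obtain ⟨a, ha⟩ : ∃ a, a = 12 + A1 + A * 4 ^ (a0 + A) + A * (4 * 4 ^ (a0 + 1)) ^ A + (a0 + A) +
    (a0 + 1) * A := ⟨_, rfl⟩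
  obtain ⟨l, hl⟩ : ∃ l, l = ∑ k ∈ range 14, (all pC pM k).rules.length + 22 := ⟨_, rfl⟩
  obtain ⟨g, hg⟩ : ∃ g, g = K + 2 * a + 3 := ⟨_, rfl⟩
  obtain ⟨c0, hc0⟩ : ∃ c0, c0 = 8 * a + K + (K * a + 1) * (2 * a) + l * (4 * a) + g + 24 := ⟨_, rfl⟩
  obtain ⟨κ0, hκ0⟩ : ∃ κ0, κ0 = c0 + g + 1 + 6 := ⟨_, rfl⟩
  obtain ⟨s, hs⟩ : ∃ s, s = (1 + 2 * Setup.timeF (all pC pM) c0 g a) *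
    ((mainP (all pC pM) g a).bound + 5 * c0 + 2) := ⟨_, rfl⟩
  obtain ⟨κ, hκ⟩ : ∃ κ, κ = 24 * κ0 + 4 * A + 1 := ⟨_, rfl⟩
  refine ⟨mainP (all pC pM) g a, κ, g + 28,
    s * (K + 1) + (K + g) + Setup.timeF (all pC pM) c0 g a, fun n m T loc hm hin hmm hcnt => ?_⟩
  have hn : 0 < n := T.root.pos; obtain ⟨L, hL⟩ : ∃ L, L = lg n := ⟨_, rfl⟩
  have hL0 : 0 < L := hL ▸ Nat.succ_pos _
  have hnL : n < 2 ^ L := hL ▸ Nat.lt_pow_succ_log_self (by decide) n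
  rw [← hL] at hmm hcnt ⊢; intro ω; obtain ⟨E, hE⟩ : ∃ E, E = n / m + 1 := ⟨_, rfl⟩
  obtain ⟨q, hq⟩ : ∃ q, q = (2 * n + 2) / m + 1 := ⟨_, rfl⟩
  obtain ⟨lam, hlam⟩ : ∃ lam, lam = a * L ^ a := ⟨_, rfl⟩
  obtain ⟨Z, hZ⟩ : ∃ Z, Z = E * L ^ g := ⟨_, rfl⟩; obtain ⟨n1, n2, n3⟩ := numbers hm hL0 hmm
  rw [← hE] at n1 n2 n3
  -- strings are short
  have hpoly : ∀ c e, c + 12 ≤ a → e ≤ a → c * L ^ e + 12 ≤ lam := fun c e hc he => by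
    calc c * L ^ e + 12 ≤ c * L ^ a + 12 * L ^ a :=
          Nat.add_le_add (Nat.mul_le_mul_left _ (Nat.pow_le_pow_right hL0 he))
            (Nat.le_mul_of_pos_right _ (by positivity))
      _ = (c + 12) * L ^ a := by ring
      _ ≤ lam := hlam ▸ Nat.mul_le_mul_right _ hc
  have hdat : ∀ y, (datOf T y).length + 12 ≤ lam := fun y => by
    have h0 := hpoly A1 A1 (by omega) (by omega); unfold datOf; split_ifs with h
    · have h1 := (hA1 n T hin ⟨y, h⟩).1; rw [← hL] at h1; omega
    · simp; omega
  have hlam12 : 12 ≤ lam := (Nat.le_add_left _ _).trans (hdat 0)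
  -- calls are correct
  have hC : ∀ B, IsBinaryExtension T B → B.size ≤ 4 * n + 2 →
      CallOk (2 ^ (κ * L)) lam B Cf D.value pM ∧ ∀ S X hs, S.IsSubtree B → X.IsNode → X.holes ≤ 2 →
        X.size ≤ 4 → X.Fills hs S → pC.Computes (2 ^ (κ * L)) [X.encode] (Cf X) lam := by
    intro B hB hsz; obtain ⟨e1, e2, e3⟩ := hexp n T B hin hB; have hlg : lg B.size ≤ 4 * L := by
      refine (lg_mono (show B.size ≤ 2 ^ (L + 2) by rw [pow_add]; omega)).trans ?_
      rw [lg, Nat.log_pow (by decide)]; omega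
    have hw : A * lg B.size ≤ κ * L := by
      refine (Nat.mul_le_mul_left A hlg).trans ?_; rw [← mul_assoc, hκ]
      exact Nat.mul_le_mul_right _ (by omega)
    have hlen : ∀ s ≤ B.size, A * lg s ^ a0 * lg B.size ^ A < lam := fun s h => by
      have h1 := hpoly (A * 4 ^ (a0 + A)) (a0 + A) (by omega) (by omega)
      calc A * lg s ^ a0 * lg B.size ^ A ≤ A * (4 * L) ^ a0 * (4 * L) ^ A := by
            gcongr; exact (lg_mono h).trans hlg
        _ = A * 4 ^ (a0 + A) * L ^ (a0 + A) := by rw [mul_assoc, ← pow_add, mul_pow]; ring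
        _ < lam := by omega
    have htime : ∀ x ≤ 4, ∀ s ≤ B.size, A * (x * lg s ^ a0 * lg B.size) ^ A ≤ lam := fun x hx s h => by
      have h1 := hpoly (A * (4 * 4 ^ (a0 + 1)) ^ A) ((a0 + 1) * A) (by omega) (by omega)
      calc A * (x * lg s ^ a0 * lg B.size) ^ A ≤ A * (4 * (4 * L) ^ a0 * (4 * L)) ^ A := by
            gcongr; exact (lg_mono h).trans hlg
        _ = A * (4 * 4 ^ (a0 + 1)) ^ A * L ^ ((a0 + 1) * A) := by
            rw [mul_assoc 4, ← pow_succ, mul_pow 4 L, ← mul_assoc, mul_pow _ (L ^ _), ← pow_mul]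
            ring
        _ ≤ lam := by omega
    have hle : ∀ (S : BTree) (X : Part) (hs : List BTree), S.IsSubtree B → X.Fills hs S →
      X.size ≤ B.size := fun S X hs h1 h2 => h2.size_le.trans h1.size_le
    have htime' : ∀ s ≤ B.size, A * (lg s ^ a0 * lg B.size) ^ A ≤ lam := fun s h => by
      simpa using htime 1 (by decide) s h
    have hne : B ≠ .nil := by
      rintro rfl; obtain ⟨φ, -, h, -⟩ := hB; exact absurd (h T.root) (by simp [BTree.label])
    refine ⟨⟨fun S X hs h1 h2 h3 h4 => ?_, ?_, fun X h1 h2 => ?_,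
      fun S U X Y hs ks i h1 h2 h3 h4 h5 h6 h7 h8 h9 => ?_⟩, fun S X hs h1 h2 h3 h4 h5 => ?_⟩
    · exact (e2 S X hs h1 h2 (h3.trans hk) h4).1.1.trans_lt (hlen _ (hle S X hs h1 h4))
    · exact (e1 B (.refl _) hne).1.trans_lt (hlen _ le_rfl)
    · exact ((e2 B X [] (.refl _) h1 (by rw [h2.holes_eq]; simp) h2).2 _ hw).2.mono
        (htime' _ (hle B X [] (.refl _) h2))
    · exact (e3 S U X Y hs ks i h1 h2 h3 h4 h5 h6 (h7.trans hk) (h8.trans hk) (h9.trans hk) _ hw).mono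
        (htime' _ (hle S _ _ h1 (h3.plug h4 h6)))
    · exact ((e2 S X hs h1 h2 (h3.trans hk) h5).2 _ hw).1.mono (htime _ h4 _ (hle S X hs h1 h5))
  -- the numbers fit
  have hZe : ∀ c e, e ≤ g → c * (E * L ^ e) ≤ c * Z := fun c e he =>
    hZ ▸ Nat.mul_le_mul_left _ (Nat.mul_le_mul_left _ (Nat.pow_le_pow_right hL0 he))
  have hmZ : m ≤ K * Z := (n2 m hmm).trans (hZe _ _ (by omega))
  have hql : (q + 1) * lam ≤ 4 * a * Z := by
    calc (q + 1) * lam ≤ 4 * E * (a * L ^ a) := by rw [hlam]; gcongr; omega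
      _ = 4 * a * (E * L ^ a) := by ring
      _ ≤ _ := hZe _ _ (by omega)
  have hql' : q * lam ≤ 4 * a * Z := (Nat.mul_le_mul_right _ (Nat.le_succ q)).trans hql
  have hload : ∀ x ≤ l, m + x * (q * lam) ≤ c0 * Z := fun x hx => by
    calc m + x * (q * lam) ≤ K * Z + l * (4 * a * Z) := by gcongr
      _ = (K + l * (4 * a)) * Z := by ring
      _ ≤ _ := Nat.mul_le_mul_right _ (by omega)
  have hz1 : (q + 1) * (lam + 1) + m ≤ c0 * Z := by
    calc (q + 1) * (lam + 1) + m ≤ (q + 1) * (lam + lam) + K * Z := by gcongr; omega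
      _ = 2 * ((q + 1) * lam) + K * Z := by ring
      _ ≤ 2 * (4 * a * Z) + K * Z := by gcongr
      _ = (8 * a + K) * Z := by ring
      _ ≤ _ := Nat.mul_le_mul_right _ (by omega)
  have hz2 : ∀ j < m, ((encIn (inputOf T loc j)).length + 1) * (lam + 1) ≤ c0 * Z := fun j hj => by
    have h1 := length_encIn_le (T := T) (lam := lam) (loc := loc) (fun y => by have := hdat y; omega) ⟨j, hj⟩
    have h2 := n2 _ (hcnt ⟨j, hj⟩); have hE1 : 0 < E * L ^ (K + a) := by rw [hE]; positivity
    calc _ ≤ (K * (E * L ^ K) * lam + E * L ^ (K + a)) * (lam + lam) := by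
          gcongr
          · exact h1.trans (Nat.mul_le_mul_right _ h2)
          · omega
          · omega
      _ = (K * a + 1) * (2 * a) * (E * L ^ (K + a + a)) := by rw [hlam]; ring
      _ ≤ (K * a + 1) * (2 * a) * Z := hZe _ _ (by omega)
      _ ≤ _ := Nat.mul_le_mul_right _ (by omega)
  have hLZ : L ≤ Z := by
    rw [hZ]; exact (Nat.le_self_pow (by omega) L).trans (Nat.le_mul_of_pos_left _ (by omega))
  have hcZ : ∀ c ≤ c0, c * Z ≤ c0 * Z := fun c h => Nat.mul_le_mul_right _ h
  have hgL : g * L ≤ c0 * Z := Nat.mul_le_mul (by omega) hLZ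
  have hL24 : 24 * L ≤ c0 * Z := Nat.mul_le_mul (by omega) hLZ
  have haZ : a * 1 ≤ c0 * Z := Nat.mul_le_mul (by omega) (hL0.trans_le hLZ)
  have hEn : E ≤ 2 ^ L := by have := Nat.div_le_self n m; omega
  obtain ⟨Y, hY⟩ : ∃ Y, Y = (2 ^ L) ^ (c0 + g + 1) := ⟨_, rfl⟩
  have ht : 2 ≤ 2 ^ L := Nat.le_self_pow hL0.ne' 2
  have htY : 2 ^ L ≤ Y := hY ▸ Nat.le_self_pow (by omega) _; have hXY : c0 * Z ≤ Y := by
    rw [hY, hZ, pow_add, pow_add, pow_one, mul_assoc, mul_comm E]; gcongr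
    · exact Nat.lt_two_pow_self.le.trans (Nat.pow_le_pow_left ht _)
    · exact Nat.lt_two_pow_self.le
  obtain ⟨B, hB⟩ : ∃ B, B = 2 ^ (κ0 * L) := ⟨_, rfl⟩; have hYB : Y * 64 ≤ B := by
    rw [hB, hκ0, mul_comm _ L, pow_mul, pow_add _ _ 6, ← hY]
    exact Nat.mul_le_mul_left _ (Nat.pow_le_pow_left ht 6)
  have hBW : B ^ 24 < 2 ^ (κ * L) := by
    rw [hB, ← pow_mul]; refine Nat.pow_lt_pow_right (by decide) ?_
    rw [mul_right_comm]; exact Nat.mul_lt_mul_of_pos_right (by omega) hL0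
  have hBW' : B < 2 ^ (κ * L) := (Nat.le_self_pow (by decide) B).trans_lt hBW
  have hmq : m * q ≤ 2 * n + 2 + m := by
    have := Nat.mul_div_le (2 * n + 2) m; rw [hq, mul_add]; omega
  have hmq' : 2 * n + 2 ≤ m * q := by rw [hq]; exact (Nat.lt_mul_div_succ _ hm).le
  have hq0 : 0 < q := hq ▸ Nat.succ_pos _; have hql0 := hload 1 (by omega)
  have hql22 := hload 22 (by omega)
  have hqlam : q ≤ q * lam := Nat.le_mul_of_pos_right _ (by omega)
  have hlamq : lam ≤ q * lam := Nat.le_mul_of_pos_left _ hq0; have hnf' : nf = 22 := rfl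
  have hnf : q * nf * lam = 22 * (q * lam) := by unfold nf; ring
  have hpow : 2 ^ (L + 1) = 2 * 2 ^ L := pow_succ' ..; have hZp : Z ≤ 2 ^ (g * L - 1) := by
    obtain ⟨h, rfl⟩ : ∃ h, g = h + 3 := ⟨K + 2 * a, hg⟩; have h1 := two_mul_cube_le L hL0
    have h2 : 1 ≤ (h + 3) * L := Nat.mul_pos (by omega) hL0
    refine Nat.le_of_mul_le_mul_left ?_ (show 0 < 2 by decide)
    rw [← pow_succ', Nat.sub_add_cancel h2]
    calc 2 * Z = E * (L ^ h * (2 * L ^ 3)) := by rw [hZ]; ring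
      _ ≤ 2 ^ L * ((2 ^ L) ^ h * 4 ^ L) := by gcongr; exact Nat.lt_two_pow_self.le
      _ = 2 ^ ((h + 3) * L) := by
        rw [show 4 = 2 ^ 2 by rfl, ← pow_mul, ← pow_mul, ← pow_add, ← pow_add]; ring_nf
  -- the computation
  let N : Net := ⟨2 ^ (κ * L), lam, n, m * q, B, L, pC, pM⟩
  obtain ⟨Bt, hBt, hst⟩ := Net.solve (P := N) T (Cf := Cf) (val := D.value) (by simp only [N]; omega)
    (fun y => by have := hdat y; simp only [N]; omega) (by simp only [N]; omega) hmq' hnL hC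
  have hg0 : GOK B lam (startΓ T) := by
    refine ⟨fun x f => ?_, fun x f hf v hv => ?_, fun x => Nat.zero_le _⟩
    · unfold startΓ sortΓ items
      split <;> (try split_ifs) <;> first | (simp; omega) | (have := hdat x; omega)
    · unfold startΓ sortΓ items at hv; have := upOf_le (T := T) x
      split at hv <;> (try split_ifs at hv) <;>
        first | (simp [isPtr] at hf; done) | (simp at hv; done) | (simp at hv; omega)
  obtain ⟨Γ, R, f0, f1, f2, f3⟩ := hst.exists_seq hg0
  let S : Setup := ⟨n, m, q, lam, L, Z, g, a, c0, 2 ^ (κ * L), B, inputOf T loc, all pC pM, Γ, R⟩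
  have hdl : ∀ y, (datOf T y).length < lam := fun y => by have := hdat y; omega
  have hok : S.Ok :=
    { sizes := ⟨⟨hq0, by dsimp only [S]; omega, by dsimp only [S]; omega⟩, ⟨by dsimp only [S]; omega, by dsimp only [S]; omega, hBW⟩, by dsimp only [S]; omega,
        hm, by dsimp only [S]; omega⟩
      two_lt := by dsimp only [S]; omega
      n_pos := hn
      L_eq := hL
      q_eq := hq
      lam_eq := hlam
      Z_eq := by rw [← hE]; exact hZ
      g_pos := by dsimp only [S]; omega
      Z_pow := hZp
      Z_le := by have := hcZ 2 (by omega); dsimp only [S]; omega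
      n_le := by dsimp only [S]; omega
      a_le := by dsimp only [S]; omega
      gL_le := by dsimp only [S]; omega
      L_le := by dsimp only [S]; omega
      in_le := fun j hj => by
        have h1 := hz2 j hj
        have h2 := Nat.le_mul_of_pos_right ((encIn (inputOf T loc j)).length + 1) (show 0 < lam + 1 by omega)
        dsimp only [S]; omega
      pw_le := by dsimp only [S]; omega
      c0_le := by dsimp only [S]; omega
      good := NodeProg.all_good pC pM
      seq := NodeProg.all_seq hpC hpM
      vstep := f2
      gok := f3
      input := fun j _ v hv => by
        obtain ⟨w, -, rfl⟩ := mem_map.mp hv; have := hdl w; rw [datOf, dif_pos w.2] at this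
        exact ⟨w.2, Fin.is_lt _, this⟩
      start := fun j hj => by
        show Describes _ (memOf q lam (Γ 0) j) _; rw [f0]
        exact describes_start hq0 (show n ≤ m * q by omega) (by omega) hdl hj
      start_len := fun j _ => (length_start_le hq0 (by omega) hdl j).trans (by
        have := hload 2 (by omega); dsimp only [S]; omega)
      load := fun k hk => hload _ (by
        rw [hl]; have := Finset.single_le_sum (f := fun k => (all pC pM k).rules.length)
          (fun _ _ => Nat.zero_le _) (mem_range.mpr (show k < 14 by omega)); dsimp only [S] at *
        omega)
      z1 := hz1
      z2 := hz2 }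
  obtain ⟨τ, t0, t1, t2, t3⟩ := Setup.exists_trace hok (c := initial T loc ω) fun j =>
    ⟨⟨rfl, rfl, rfl, rfl, rfl, rfl, (encIn_inputOf j).symm, rfl, rfl, rfl⟩, rfl, fun a ha _ => if_neg (by omega)⟩
  refine ⟨τ, ⟨t0, fun r _ => t1 r⟩, ?_, fun r _ j => ⟨?_, ?_⟩⟩
  · rw [t2 _ ⟨0, hm⟩ le_rfl]; show P.IsSolution T (Γ (9 * L + 15) (0 * q) 21)
    rw [zero_mul, show Γ (9 * L + 15) = _ from f1]; exact hD n T Bt hin hBt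
  · have h1 : L ^ K * L ^ g ≤ L ^ (s * (K + 1) + (K + g) + Setup.timeF (all pC pM) c0 g a) := by
      rw [← pow_add]; exact Nat.pow_le_pow_right hL0 (by omega)
    calc τ.space r j * m ≤ s * Z * m := by
          refine Nat.mul_le_mul_right _ ((t3 r j).2.trans (le_of_eq ?_)); rw [hs, mul_assoc]
      _ = s * (E * m) * L ^ g := by rw [hZ]; ring
      _ ≤ s * ((K + 1) * (n * L ^ K)) * L ^ g := by gcongr
      _ = s * (K + 1) * n * (L ^ K * L ^ g) := by ring
      _ ≤ _ := by
        refine Nat.mul_le_mul (Nat.mul_le_mul_right _ ?_) h1; rw [add_assoc]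
        exact Nat.le_add_right _ _
  · exact (t3 r j).1.trans (Nat.mul_le_mul_right _ (Nat.le_add_left _ _))

end MPC

end

theorem theorem1 (P : MPC.TreeProblem) (hP : MPC.IsPolylogExpressible P) (K c : ℕ) :
    ∃ (p : MPC.Prog) (κ ρ b : ℕ),
      ∀ (n m : ℕ) (T : MPC.DataTree n) (loc : Fin n → Fin m) (hm : 0 < m),
        P.IsInput T →
        m * m ≤ K * n * MPC.lg n ^ K →
        (∀ j : Fin m, {v : Fin n | loc v = j}.ncard * m ≤ K * n * MPC.lg n ^ K) →
        (∀ ω : MPC.Coins m (2 ^ (κ * MPC.lg n)),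
          ∃ τ : MPC.Trace m, τ.IsRun p T loc ω (ρ * MPC.lg n) ∧
            P.IsSolution T ((τ.mem (ρ * MPC.lg n) ⟨0, hm⟩).arr 1)) ∧
        MPC.coinMeasure m (2 ^ (κ * MPC.lg n))
          {ω | ∃ τ : MPC.Trace m, τ.IsRun p T loc ω (ρ * MPC.lg n) ∧
            ∀ r < ρ * MPC.lg n, ∀ j : Fin m,
              τ.space r j * m ≤ b * n * MPC.lg n ^ b ∧
              τ.time r j ≤ b * (τ.mem r j).size p.bound}ᶜ ≤ ((n : ENNReal) ^ c)⁻¹ := by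
  obtain ⟨p, κ, ρ, b, h⟩ := MPC.exists_run P hP K
  refine ⟨p, κ, ρ, b, fun n m T loc hm hin h1 h2 => ⟨fun ω => ?_, ?_⟩⟩
  · obtain ⟨τ, h3, h4, -⟩ := h n m T loc hm hin h1 h2 ω
    exact ⟨τ, h3, h4⟩
  · rw [Set.compl_empty_iff.mpr (Set.eq_univ_of_forall fun ω => ?_), measure_empty]
    · exact zero_le
    · obtain ⟨τ, h3, -, h4⟩ := h n m T loc hm hin h1 h2 ω
      exact ⟨τ, h3, h4⟩
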